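/- **Setting.** Let $(\varepsilon_t)_{t\in\mathbb Z}$ be i.i.d. square integrable real random variables, $\Theta\subset\mathbb R^d$ a Borel set, $\theta_0\in\Theta$, and $H,G:\Theta\times\mathbb R^{\mathbb N}\to\mathbb R$ measurable. Let $(X_t)_{t\in\mathbb Z}$ be a stationary process with $X_t=H(\theta_0;X_{t-1},X_{t-2},\dots)+\varepsilon_tG(\theta_0;X_{t-1},X_{t-2},\dots)$ and $X_t=E(\varepsilon_t,\varepsilon_{t-1},\dots)$ almost surely, for a measurable $E:\mathbb R^{\mathbb N}\to\mathbb R$. Put $m_t(\theta)=H(\theta;X_{t-1},X_{t-2},\dots)$, $\sigma_t(\theta)=G(\theta;X_{t-1},X_{t-2},\dots)$, and let $\overline m_t(\theta)$, $\overline\sigma_t(\theta)$ ($t\ge1$) be measurable functions of $(\theta;X_{t-1},\dots,X_1)$ (the truncated conditional mean and volatility). For $\ell\ge 1$ let $m_{i\ell}(\theta),\sigma_{i\ell}(\theta)$ be obtained from $m_i(\theta),\sigma_i(\theta)$, seen as functions of $(\varepsilon_i,\varepsilon_{i-1},\dots)$, by replacing the $\varepsilon_j$, $j\le i-\ell$,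 by those of an independent copy of $(\varepsilon_t)$. Put $$L_{v,i}(\theta)=\frac{v-m_i(\theta)}{\sigma_i(\theta)},\qquad \varepsilon_j(\theta)=\frac{X_j-m_j(\theta)}{\sigma_j(\theta)},$$ and let $\overline L_{v,i}(\theta),\overline\varepsilon_j(\theta)$ be the same expressions with $\overline m,\overline\sigma$ in place of $m,\sigma$. Let $K\ge0$ be a continuously differentiable probability density supported in $[-1,1]$, let $b=b_n>0$, $K_b(x)=K(x/b)/b$, and for random elements $\hat\theta=\hat\theta_n$ of $\Theta$ let $$\check f_X(v)=\frac1{n^2}\sum_{i,j=1}^n\frac1{\sigma_i(\theta_0)}K_b\big[L_{v,i}(\theta_0)-\varepsilon_j\big],\qquad \hat f_X(v)=\frac1{n^2}\sum_{i,j=1}^n\frac1{\overline\sigma_i(\hat\theta)}K_b\big[\overline L_{v,i}(\hat\theta)-\overline\varepsilon_j(\hat\theta)\big].$$ For $\epsilon>0$ let $\Theta_{0,\epsilon}=\{\theta\in\Theta:\|\theta-\theta_0\|<\epsilon\}$, $|A,B|_{\epsilon}=\sup_{\theta,\theta'\in\Theta_{0,\epsilon}}\|A(\theta)/B(\theta')\|$,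 and let $\dot g,\ddot g$ be the first two derivatives over $\Theta$ of $g:\Theta\to\mathbb R$. **Assumptions.** There is $\epsilon>0$ such that the following hold. * **A1.** $\Theta$ is compact, and $\Theta_{0,\epsilon}$ is convex with nonempty interior (for instance, $\theta_0$ is an interior point of $\Theta$ and $\epsilon$ is small). * **A2.** There are $\gamma,\kappa>0$ and $s,a\in(0,1)$ such that, almost surely, $\inf_{\theta\in\Theta}\sigma_i(\theta)\ge\gamma$ for all $i\in\mathbb Z$ and $\inf_{\theta\in\Theta}\overline\sigma_i(\theta)\ge\gamma$ for all $i\ge1$; and, all suprema being over $\Theta_{0,\epsilon}$, $\mathbb E[\sup|m_t|^s+\sup|\sigma_t|^s]<\infty$ for all $t$, $\mathbb E[\sup|m_i-m_{i\ell}|^s+\sup|\sigma_i^2-\sigma_{i\ell}^2|^s]\le\kappa a^\ell$ for all $i\in\mathbb Z$, $\ell\ge1$, and $\mathbb E[\sup|m_i-\overline m_i|^s+\sup|\sigma_i^2-\overline\sigma_i^2|^s]\le\kappa a^i$ for all $i\ge1$. * **A3.** Almost surely, $m_i$ and $\sigma_i$ are twice differentiable over $\Theta$ at the points of $\Theta_{0,\epsilon}$,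 and the following random variables are integrable: $|m_i,\sigma_i|_\epsilon^2$, $|\dot m_i,\sigma_i|_\epsilon^3$, $|\dot{\sigma_i^2},\sigma_i^2|_\epsilon^3$, $|\dot m_i,\sigma_i|_\epsilon^2\,|\dot{\sigma_i^2},\sigma_i^2|_\epsilon^2$, $|\sigma_i,\sigma_i|_\epsilon\,|\ddot m_i,\sigma_i|_\epsilon$, $|m_i,\sigma_i|_\epsilon\,|\ddot{\sigma_i^2},\sigma_i^2|_\epsilon$, $|\ddot{\sigma_i^2},\sigma_i^2|_\epsilon^{6/5}$. * **A4.** $\hat\theta-\theta_0=O_{\mathbb P}(1/\sqrt n)$. * **A5.** $\varepsilon_0$ has a twice differentiable density $f_\varepsilon$, and $f_\varepsilon,f_\varepsilon',f_\varepsilon''$ are bounded. * **A6.** $I$ is a compact interval; for every $v\in I$ the ratio $L_{v,t}(\theta_0)$ has a density $h_v$, and with $g_v(x)=\mathbb E\big[\tfrac1{\sigma_t(\theta_0)}\,\big|\,L_{v,t}(\theta_0)=x\big]h_v(x)$ the map $(x,v)\mapsto g_v(x)$ is jointly measurable and, for some $s_0>0$, $\int g_v(x)^2\sup_{|s|\le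 s_0}f_\varepsilon(x+s)\,dx<\infty$ for all $v\in I$. **Theorem.** Suppose that, moreover, $nb^{3+\delta}\to\infty$ for some $\delta\in(0,1)$ and $nb^4\to0$. Then for every $\theta\in\Theta_{0,\epsilon}$ the residual $\varepsilon_i(\theta)$ has a continuous density $f_\theta$. Put $$h_\theta(v)=\mathbb E\Big[\frac1{\sigma_i(\theta)}f_\theta\Big(\frac{v-m_i(\theta)}{\sigma_i(\theta)}\Big)\Big].$$ For every $v\in I$ the map $\theta\mapsto h_\theta(v)$ is differentiable over $\Theta$ at $\theta_0$, with derivative denoted $\dot h_{\theta_0}(v)$, and $$\sqrt n\,\sup_{v\in I}\Big|\hat f_X(v)-\check f_X(v)-\dot h_{\theta_0}(v)^T(\hat\theta-\theta_0)\Big|=o_{\mathbb P}(1).$$ -/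

import Mathlib

open MeasureTheory ProbabilityTheory Filter Topology
open scoped ENNReal

noncomputable section

/-- The parameter space `ℝ^d` with its Euclidean norm. -/
abbrev Par (d : ℕ) : Type := EuclideanSpace ℝ (Fin d)

/-- `(x_t, x_{t-1}, x_{t-2}, …)` for a two-sided sequence `x`. -/
def pastOf (x : ℤ → ℝ) (t : ℤ) : ℕ → ℝ := fun k => x (t - (k : ℤ))

/-- The sequence equal to `u` at the times `j > i - ℓ` and to `u'` at the times `j ≤ i - ℓ`, so that
its past at time `i` is `(u_i, …, u_{i-ℓ+1}, u'_{i-ℓ}, u'_{i-ℓ-1}, …)`. -/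
def coupled (u u' : ℤ → ℝ) (i : ℤ) (ℓ : ℕ) : ℤ → ℝ :=
  fun j => if i - (ℓ : ℤ) < j then u j else u' j

/-- The data of a location-scale time series model (no property is imposed here). -/
structure SeriesModel (d : ℕ) (Ω : Type*) where
  /-- the noise `ε_t` -/
  noise : ℤ → Ω → ℝ
  /-- the observed process `X_t` -/
  X : ℤ → Ω → ℝ
  /-- the function giving `X_t` from `(ε_t, ε_{t-1}, …)` -/
  causal : (ℕ → ℝ) → ℝ
  /-- the parameter set -/
  Θ : Set (Par d)
  /-- the true parameter -/
  θ₀ : Par d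
  /-- the conditional mean, as a function of the parameter and of `(X_{t-1}, X_{t-2}, …)` -/
  H : Par d → (ℕ → ℝ) → ℝ
  /-- the volatility, as a function of the parameter and of `(X_{t-1}, X_{t-2}, …)` -/
  G : Par d → (ℕ → ℝ) → ℝ
  /-- the truncated conditional mean at time `k + 1`, a function of `(X_k, …, X_1)` -/
  Htr : (k : ℕ) → Par d → (Fin k → ℝ) → ℝ
  /-- the truncated volatility at time `k + 1`, a function of `(X_k, …, X_1)` -/
  Gtr : (k : ℕ) → Par d → (Fin k → ℝ) → ℝ

namespace SeriesModel

variable {d : ℕ} {Ω : Type*} (M : SeriesModel d Ω)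

/-- `m_t(θ) = H(θ; X_{t-1}, X_{t-2}, …)`. -/
def m (t : ℤ) (θ : Par d) (ω : Ω) : ℝ := M.H θ (pastOf (fun j => M.X j ω) (t - 1))

/-- `σ_t(θ) = G(θ; X_{t-1}, X_{t-2}, …)`. -/
def σ (t : ℤ) (θ : Par d) (ω : Ω) : ℝ := M.G θ (pastOf (fun j => M.X j ω) (t - 1))

/-- The truncated conditional mean `m̄_t(θ)`, a function of `(X_{t-1}, …, X_1)`, for `t ≥ 1`. -/
def mTr (t : ℕ) (θ : Par d) (ω : Ω) : ℝ :=
  M.Htr (t - 1) θ (fun k => M.X ((t : ℤ) - 1 - ((k : ℕ) : ℤ)) ω)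

/-- The truncated volatility `σ̄_t(θ)`, a function of `(X_{t-1}, …, X_1)`, for `t ≥ 1`. -/
def σTr (t : ℕ) (θ : Par d) (ω : Ω) : ℝ :=
  M.Gtr (t - 1) θ (fun k => M.X ((t : ℤ) - 1 - ((k : ℕ) : ℤ)) ω)

/-- The process computed from the noise sequence `u`. -/
def path (u : ℤ → ℝ) : ℤ → ℝ := fun t => M.causal (pastOf u t)

/-- The coupled version `m_{iℓ}(θ)`: the noise is read off `p.1` at the times `> i - ℓ` and off
`p.2` at the times `≤ i - ℓ`. Under `P.prod P`, the noise read off `p.2` is an independent copy of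
the noise read off `p.1`. -/
def mCoupled (i : ℤ) (ℓ : ℕ) (θ : Par d) (p : Ω × Ω) : ℝ :=
  M.H θ (pastOf
    (M.path (coupled (fun j => M.noise j p.1) (fun j => M.noise j p.2) i ℓ)) (i - 1))

/-- The coupled version `σ_{iℓ}(θ)`. -/
def σCoupled (i : ℤ) (ℓ : ℕ) (θ : Par d) (p : Ω × Ω) : ℝ :=
  M.G θ (pastOf
    (M.path (coupled (fun j => M.noise j p.1) (fun j => M.noise j p.2) i ℓ)) (i - 1))

/-- `L_{v,i}(θ) = (v - m_i(θ)) / σ_i(θ)`. -/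
def L (v : ℝ) (i : ℤ) (θ : Par d) (ω : Ω) : ℝ := (v - M.m i θ ω) / M.σ i θ ω

/-- The residual process `ε_j(θ) = (X_j - m_j(θ)) / σ_j(θ)`. -/
def resid (j : ℤ) (θ : Par d) (ω : Ω) : ℝ := (M.X j ω - M.m j θ ω) / M.σ j θ ω

/-- The truncated version of `L_{v,i}(θ)`. -/
def LTr (v : ℝ) (i : ℕ) (θ : Par d) (ω : Ω) : ℝ := (v - M.mTr i θ ω) / M.σTr i θ ω

/-- The truncated version of `ε_j(θ)`. -/
def residTr (j : ℕ) (θ : Par d) (ω : Ω) : ℝ := (M.X j ω - M.mTr j θ ω) / M.σTr j θ ω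

/-- The neighbourhood `{θ ∈ Θ : ‖θ - θ₀‖ < r}` of `θ₀` in `Θ`. -/
def nhd (r : ℝ) : Set (Par d) := M.Θ ∩ Metric.ball M.θ₀ r

end SeriesModel

/-- `K_b(x) = K(x / b) / b`. -/
def scaledKernel (K : ℝ → ℝ) (b x : ℝ) : ℝ := 1 / b * K (x / b)

/-- A continuously differentiable probability density supported in `[-1, 1]`. -/
structure IsKernel (K : ℝ → ℝ) : Prop where
  contDiff : ContDiff ℝ 1 K
  nonneg : ∀ x, 0 ≤ K x
  support : ∀ x, 1 < |x| → K x = 0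
  integral_eq_one : ∫ x, K x = 1

namespace SeriesModel

variable {d : ℕ} {Ω : Type*} (M : SeriesModel d Ω)

/-- The unfeasible estimator of the marginal density at `v`, for the bandwidth `b`. -/
def fCheck (K : ℝ → ℝ) (b : ℝ) (n : ℕ) (v : ℝ) (ω : Ω) : ℝ :=
  1 / (n : ℝ) ^ 2 * ∑ i ∈ Finset.Icc 1 n, ∑ j ∈ Finset.Icc 1 n,
    1 / M.σ i M.θ₀ ω * scaledKernel K b (M.L v i M.θ₀ ω - M.noise j ω)

/-- The feasible estimator of the marginal density at `v`, for the bandwidth `b` and the value `θ`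
of the estimator of the parameter. -/
def fHat (K : ℝ → ℝ) (b : ℝ) (n : ℕ) (θ : Par d) (v : ℝ) (ω : Ω) : ℝ :=
  1 / (n : ℝ) ^ 2 * ∑ i ∈ Finset.Icc 1 n, ∑ j ∈ Finset.Icc 1 n,
    1 / M.σTr i θ ω * scaledKernel K b (M.LTr v i θ ω - M.residTr j θ ω)

end SeriesModel

/-- `f` is a continuous density of `μ` with respect to the Lebesgue measure. -/
def IsContDensity (μ : Measure ℝ) (f : ℝ → ℝ) : Prop :=
  Continuous f ∧ (∀ x, 0 ≤ f x) ∧ μ = volume.withDensity (fun x => ENNReal.ofReal (f x))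

open Classical in
/-- The (unique) continuous density of `μ`, or `0` if `μ` has none. -/
def contDensity (μ : Measure ℝ) : ℝ → ℝ :=
  if h : ∃ f, IsContDensity μ f then h.choose else 0

/-- The nonnegative function `f` is a random variable with expectation at most `c`. -/
def ExpLE {Ω : Type*} [MeasurableSpace Ω] (P : Measure Ω) (f : Ω → ℝ≥0∞) (c : ℝ≥0∞) : Prop :=
  AEMeasurable f P ∧ ∫⁻ ω, f ω ∂P ≤ c

/-- The nonnegative function `f` is a random variable with finite expectation. -/
def ExpFinite {Ω : Type*} [MeasurableSpace Ω] (P : Measure Ω) (f : Ω → ℝ≥0∞) : Prop :=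
  AEMeasurable f P ∧ ∫⁻ ω, f ω ∂P < ∞

/-- `sup_{θ ∈ S} |g(θ)|^s`. -/
def supPow {d : ℕ} (S : Set (Par d)) (s : ℝ) (g : Par d → ℝ) : ℝ≥0∞ :=
  ⨆ θ ∈ S, ENNReal.ofReal (|g θ| ^ s)

/-- `sup_{θ, θ' ∈ S} ‖A(θ) / B(θ')‖`. -/
def supRatio {d : ℕ} {F : Type*} [NormedAddCommGroup F] (S : Set (Par d)) (A : Par d → F)
    (B : Par d → ℝ) : ℝ≥0∞ :=
  ⨆ θ ∈ S, ⨆ θ' ∈ S, ENNReal.ofReal (‖A θ‖ / |B θ'|)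

/-- First derivative over `Θ`. -/
def D1 {d : ℕ} (Θ : Set (Par d)) (g : Par d → ℝ) : Par d → (Par d →L[ℝ] ℝ) :=
  fderivWithin ℝ g Θ

/-- Second derivative over `Θ`. -/
def D2 {d : ℕ} (Θ : Set (Par d)) (g : Par d → ℝ) : Par d → (Par d →L[ℝ] Par d →L[ℝ] ℝ) :=
  fderivWithin ℝ (fderivWithin ℝ g Θ) Θ

/-- `g` is two times differentiable, as a function on `Θ`, at every point of `S ⊆ Θ`. -/
def TwiceDiff {d : ℕ} (Θ S : Set (Par d)) (g : Par d → ℝ) : Prop :=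
  ∀ θ ∈ S, DifferentiableWithinAt ℝ g Θ θ ∧ DifferentiableWithinAt ℝ (fderivWithin ℝ g Θ) Θ θ

namespace SeriesModel

variable {d : ℕ} {Ω : Type*} [MeasurableSpace Ω] (M : SeriesModel d Ω) (P : Measure Ω)

/-- The standing assumptions: i.i.d. square integrable noise, measurable `H`, `G` and truncations,
and a causal process solving `X_t = H(θ₀; X_{t-1}, …) + ε_t G(θ₀; X_{t-1}, …)`. The stationarity
of `X` follows from `X_causal` and from the noise being i.i.d. -/
structure IsLocationScale : Prop where
  θ₀_mem : M.θ₀ ∈ M.Θ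
  measurableSet_Θ : MeasurableSet M.Θ
  noise_meas : ∀ t, Measurable (M.noise t)
  noise_indep : iIndepFun M.noise P
  noise_ident : ∀ t, IdentDistrib (M.noise t) (M.noise 0) P P
  noise_sq : MemLp (M.noise 0) 2 P
  H_meas : Measurable (fun p : M.Θ × (ℕ → ℝ) => M.H p.1 p.2)
  G_meas : Measurable (fun p : M.Θ × (ℕ → ℝ) => M.G p.1 p.2)
  Htr_meas : ∀ k, Measurable (fun p : M.Θ × (Fin k → ℝ) => M.Htr k p.1 p.2)
  Gtr_meas : ∀ k, Measurable (fun p : M.Θ × (Fin k → ℝ) => M.Gtr k p.1 p.2)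
  X_meas : ∀ t, Measurable (M.X t)
  causal_meas : Measurable M.causal
  X_causal : ∀ t, ∀ᵐ ω ∂P, M.X t ω = M.causal (pastOf (fun j => M.noise j ω) t)
  X_eq : ∀ t, ∀ᵐ ω ∂P, M.X t ω = M.m t M.θ₀ ω + M.noise t ω * M.σ t M.θ₀ ω

/-- Compactness of `Θ`; moreover, near `θ₀`, the set `Θ` is convex with nonempty interior, so that
derivatives over `Θ` are unique there. -/
structure A1 (r : ℝ) : Prop where
  compact : IsCompact M.Θ
  convex : Convex ℝ (M.nhd r)
  nonempty_interior : (interior (M.nhd r)).Nonempty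

/-- Lower bound on the volatility, small moments, and short memory. -/
def A2 (r : ℝ) : Prop :=
  ∃ γ s a κ : ℝ, 0 < γ ∧ s ∈ Set.Ioo (0 : ℝ) 1 ∧ a ∈ Set.Ioo (0 : ℝ) 1 ∧ 0 < κ ∧
    (∀ i : ℤ, ∀ᵐ ω ∂P, ∀ θ ∈ M.Θ, γ ≤ M.σ i θ ω) ∧
    (∀ i : ℕ, 1 ≤ i → ∀ᵐ ω ∂P, ∀ θ ∈ M.Θ, γ ≤ M.σTr i θ ω) ∧
    (∀ t : ℤ, ExpFinite P (fun ω =>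
      supPow (M.nhd r) s (fun θ => M.m t θ ω) + supPow (M.nhd r) s (fun θ => M.σ t θ ω))) ∧
    (∀ (i : ℤ) (ℓ : ℕ), 1 ≤ ℓ → ExpLE (P.prod P) (fun p =>
      supPow (M.nhd r) s (fun θ => M.m i θ p.1 - M.mCoupled i ℓ θ p) +
      supPow (M.nhd r) s (fun θ => M.σ i θ p.1 ^ 2 - M.σCoupled i ℓ θ p ^ 2))
      (ENNReal.ofReal (κ * a ^ ℓ))) ∧
    (∀ i : ℕ, 1 ≤ i → ExpLE P (fun ω =>
      supPow (M.nhd r) s (fun θ => M.m i θ ω - M.mTr i θ ω) +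
      supPow (M.nhd r) s (fun θ => M.σ i θ ω ^ 2 - M.σTr i θ ω ^ 2))
      (ENNReal.ofReal (κ * a ^ i)))

/-- Smoothness in the parameter, and moments of the derivatives. -/
structure A3 (r : ℝ) : Prop where
  diff_m : ∀ i, ∀ᵐ ω ∂P, TwiceDiff M.Θ (M.nhd r) (fun θ => M.m i θ ω)
  diff_σ : ∀ i, ∀ᵐ ω ∂P, TwiceDiff M.Θ (M.nhd r) (fun θ => M.σ i θ ω)
  mom_m : ∀ i, ExpFinite P (fun ω =>
    supRatio (M.nhd r) (fun θ => M.m i θ ω) (fun θ => M.σ i θ ω) ^ 2)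
  mom_dm : ∀ i, ExpFinite P (fun ω =>
    supRatio (M.nhd r) (D1 M.Θ (fun θ => M.m i θ ω)) (fun θ => M.σ i θ ω) ^ 3)
  mom_dσ : ∀ i, ExpFinite P (fun ω =>
    supRatio (M.nhd r) (D1 M.Θ (fun θ => M.σ i θ ω ^ 2)) (fun θ => M.σ i θ ω ^ 2) ^ 3)
  mom_dm_dσ : ∀ i, ExpFinite P (fun ω =>
    supRatio (M.nhd r) (D1 M.Θ (fun θ => M.m i θ ω)) (fun θ => M.σ i θ ω) ^ 2 *
    supRatio (M.nhd r) (D1 M.Θ (fun θ => M.σ i θ ω ^ 2)) (fun θ => M.σ i θ ω ^ 2) ^ 2)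
  mom_σ_ddm : ∀ i, ExpFinite P (fun ω =>
    supRatio (M.nhd r) (fun θ => M.σ i θ ω) (fun θ => M.σ i θ ω) *
    supRatio (M.nhd r) (D2 M.Θ (fun θ => M.m i θ ω)) (fun θ => M.σ i θ ω))
  mom_m_ddσ : ∀ i, ExpFinite P (fun ω =>
    supRatio (M.nhd r) (fun θ => M.m i θ ω) (fun θ => M.σ i θ ω) *
    supRatio (M.nhd r) (D2 M.Θ (fun θ => M.σ i θ ω ^ 2)) (fun θ => M.σ i θ ω ^ 2))
  mom_ddσ : ∀ i, ExpFinite P (fun ω =>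
    supRatio (M.nhd r) (D2 M.Θ (fun θ => M.σ i θ ω ^ 2)) (fun θ => M.σ i θ ω ^ 2) ^ (6 / 5 : ℝ))

/-- `θhat n` is a random element of `Θ` and `θhat n - θ₀ = O_P(1 / √n)`. -/
structure A4 (θhat : ℕ → Ω → Par d) : Prop where
  meas : ∀ n, Measurable (θhat n)
  mem : ∀ n ω, θhat n ω ∈ M.Θ
  rate : ∀ η : ℝ, 0 < η → ∃ C : ℝ, ∀ᶠ n : ℕ in atTop,
    P {ω | C < √(n : ℝ) * ‖θhat n ω - M.θ₀‖} ≤ ENNReal.ofReal η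

/-- `fε` is a density of the noise; it is twice differentiable, and it is bounded together with its
first two derivatives. -/
structure A5 (fε : ℝ → ℝ) : Prop where
  nonneg : ∀ x, 0 ≤ fε x
  law : P.map (M.noise 0) = volume.withDensity (fun x => ENNReal.ofReal (fε x))
  diff : Differentiable ℝ fε
  diff_deriv : Differentiable ℝ (deriv fε)
  bdd : ∃ C : ℝ, ∀ x, |fε x| ≤ C
  bdd_deriv : ∃ C : ℝ, ∀ x, |deriv fε x| ≤ C
  bdd_deriv2 : ∃ C : ℝ, ∀ x, |deriv (deriv fε) x| ≤ C

/-- For `v ∈ [α, β]`, the ratio `L_{v,0}(θ₀)` has a density `dens v`, and with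
`g_v(x) = E[1 / σ_0(θ₀) | L_{v,0}(θ₀) = x] * dens v x` (`reg v` being a version of the regression
function), `g` is jointly measurable and `∫ g_v(x)^2 sup_{|s| ≤ s₀} fε(x + s) dx < ∞`. -/
def A6 (fε : ℝ → ℝ) (α β : ℝ) : Prop :=
  ∃ (dens reg : ℝ → ℝ → ℝ) (s₀ : ℝ), 0 < s₀ ∧
    (∀ v ∈ Set.Icc α β, Measurable (dens v) ∧ (∀ x, 0 ≤ dens v x) ∧
      P.map (M.L v 0 M.θ₀) = volume.withDensity (fun x => ENNReal.ofReal (dens v x))) ∧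
    (∀ v ∈ Set.Icc α β, Measurable (reg v) ∧
      P[fun ω => 1 / M.σ 0 M.θ₀ ω | MeasurableSpace.comap (M.L v 0 M.θ₀) inferInstance]
        =ᵐ[P] fun ω => reg v (M.L v 0 M.θ₀ ω)) ∧
    Measurable (fun p : ℝ × Set.Icc α β => reg p.2 p.1 * dens p.2 p.1) ∧
    (∀ v ∈ Set.Icc α β,
      ∫⁻ x, ENNReal.ofReal ((reg v x * dens v x) ^ 2) *
        (⨆ s ∈ Set.Icc (-s₀) s₀, ENNReal.ofReal (fε (x + s))) < ∞)

/-- The density `f_θ` of the residual `ε_0(θ)` (the law of `ε_i(θ)` does not depend on `i`). -/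
def residDensity (θ : Par d) : ℝ → ℝ := contDensity (P.map (M.resid 0 θ))

/-- `h_θ(v) = E[f_θ((v - m_0(θ)) / σ_0(θ)) / σ_0(θ)]`. -/
def h (θ : Par d) (v : ℝ) : ℝ :=
  ∫ ω, 1 / M.σ 0 θ ω * M.residDensity P θ (M.L v 0 θ ω) ∂P

end SeriesModel

end

/-! Put `w = 1/σ`, `q = m/σ`, `s = σ(θ)/σ(θ₀)` and `e = (m(θ) - m(θ₀))/σ(θ₀)`, all functions of `θ`
and of the past. The model equation gives `ε_j(θ) = (ε_j - e_j)/s_j` (`resid_ae_eq`), and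
`L_{v,i}(θ) = v w_i - q_i`. Up to truncation, the feasible estimator is therefore a double average
of `w_i K_b(v w_i - q_i - (ε_j - e_j)/s_j)`, in which `ε_j` is independent of the past that
determines `s_j` and `e_j`.

Derivative of `h`. Given the past, the residual has density `s f(s x + e)`. Hence its law has a
mixture density, and `h_θ(v)` is the integral of `w s f(s L + e)` over two independent copies of the
past, one carrying `w, L` and the other `s, e` (`h_eq_integral_pairF`). A first-order expansion of
the integrand (`SmoothBdd.expansion`, `Expands.pair`) has a linear term that is a sum of products of
a function of the first past and a function of the second. Its integral is the derivative. For the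
remainder, differentiability at `θ₀` and an integrable Lipschitz envelope suffice: divided by `‖θ -
θ₀‖`, it tends to zero in mean by dominated convergence (`exists_remainder`).

Estimators. The difference between the average at `θ` and the unfeasible estimator splits into a
compensator, where each term is replaced by its mean over `ε_j` given the past at `j`, and a centred
part (`kernelAvg_sub_fCheck`). The kernel only shifts the argument of the density by at most `b`, so
the expansion applies to the compensator as well; its linear term is an empirical version of the
derivative, and converges to it uniformly in `v` by the law of large numbers (`likely_compensator`).

The centred part must be `o(1/√n)`. For frozen values of `θ, w, L`, it is an average of martingale
differences in `j`, and an exponential supermartingale gives a Bernstein bound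
(`measure_incr_gt_le`). The true values of `w_i, L_i` depend on the noises in the sum, so the bound
is made uniform over all values, through a net of polynomial size (`likely_incrAvg`). The third
moments of the envelopes keep their maximum over the sample below a multiple of `n^(1/3)`, and the
exponent is then of order `(b n^(1/3))²`. Since `n b^(3+δ) → ∞`, this exceeds a positive power of
`n` and beats the net.

Truncation. The truncation errors decay geometrically in time. Beyond a burn-in of `n^(1/12)` times
they are smaller than any fixed power of `n`; the earlier times contribute at most `n^(1/12)/(n b)`
up to a constant, which is `o(1/√n)` (`likely_fHat_sub_kernelAvg`).

All the bounds are uniform over `√n ‖θ - θ₀‖ ≤ C` (`likely_fHat`), which allows the random `θhat` to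
be inserted. Events are measured by outer measure, so suprema over `θ` and `v` need not be
measurable. -/

set_option linter.unusedSectionVars false

/-! ### Events of asymptotic probability at least `1 - κ` -/

/-- For large `n`, the event `p n` fails with (outer) probability at most `κ`. -/
def WHP {Ω : Type*} [MeasurableSpace Ω] (P : Measure Ω) (κ : ℝ≥0∞) (p : ℕ → Ω → Prop) : Prop :=
  ∀ᶠ n in atTop, P {ω | ¬ p n ω} ≤ κ

namespace WHP

variable {Ω : Type*} [MeasurableSpace Ω] {P : Measure Ω} {κ κ' : ℝ≥0∞} {p q : ℕ → Ω → Prop}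

lemma and (hp : WHP P κ p) (hq : WHP P κ' q) : WHP P (κ + κ') (fun n ω => p n ω ∧ q n ω) := by
  filter_upwards [hp, hq] with n h1 h2
  refine (measure_mono ?_).trans ((measure_union_le _ _).trans (add_le_add h1 h2))
  intro ω hω
  by_contra hcon
  simp only [Set.mem_union, Set.mem_ofPred_eq, not_or, not_not] at hcon hω
  exact hω hcon

lemma mono (hp : WHP P κ p) (h : ∀ᶠ n in atTop, ∀ᵐ ω ∂P, p n ω → q n ω) : WHP P κ q := by
  filter_upwards [hp, h] with n h1 h2
  refine (measure_mono_ae ?_).trans h1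
  filter_upwards [h2] with ω hω hq hp
  exact hq (hω hp)

lemma mono_of_forall (hp : WHP P κ p) (h : ∀ n ω, p n ω → q n ω) : WHP P κ q :=
  hp.mono (Eventually.of_forall fun n => Eventually.of_forall (h n))

lemma of_ae (h : ∀ᶠ n in atTop, ∀ᵐ ω ∂P, p n ω) : WHP P κ p := by
  filter_upwards [h] with n h1
  have : P {ω | ¬ p n ω} = 0 := h1
  rw [this]; simp

lemma of_le {u : ℕ → ℝ≥0∞} (hκ : κ ≠ 0) (h : ∀ᶠ n in atTop, P {ω | ¬ p n ω} ≤ u n)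
    (hu : Tendsto u atTop (𝓝 0)) : WHP P κ p := by
  filter_upwards [h, hu.eventually_le_const (pos_iff_ne_zero.2 hκ)] with n h1 h2
  exact h1.trans h2

lemma forall_finset {ι : Type*} {p : ι → ℕ → Ω → Prop} (s : Finset ι)
    (hκ : κ ≠ 0) (h : ∀ i ∈ s, ∀ κ : ℝ≥0∞, κ ≠ 0 → WHP P κ (p i)) :
    WHP P κ (fun n ω => ∀ i ∈ s, p i n ω) := by
  classical
  induction s using Finset.induction_on generalizing κ with
  | empty => exact of_ae (Eventually.of_forall fun n => Eventually.of_forall fun ω => by simp)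
  | insert a s ha ih =>
    have h2 : κ / 2 ≠ 0 := by simp [hκ]
    have := (h a (Finset.mem_insert_self a s) (κ / 2) h2).and
      (ih h2 fun i hi => h i (Finset.mem_insert_of_mem hi))
    rw [ENNReal.add_halves] at this
    refine this.mono_of_forall fun n ω h => ?_
    simpa using h

end WHP

/-! ### Causal functions of an i.i.d. sequence -/


section Causal

variable {Ω : Type*} [MeasurableSpace Ω] {P : Measure Ω} [IsProbabilityMeasure P]
  {ε : ℤ → Ω → ℝ}

lemma measurable_pastOf_noise (hm : ∀ t, Measurable (ε t)) (t : ℤ) :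
    Measurable (fun ω => pastOf (fun j => ε j ω) t) :=
  measurable_pi_lambda _ fun _ => hm _

/-- The law found here does not involve `t`: this is how stationarity enters the proof. -/
lemma map_pastOf_noise (hm : ∀ t, Measurable (ε t)) (hi : iIndepFun ε P)
    (hd : ∀ t, IdentDistrib (ε t) (ε 0) P P) (t : ℤ) :
    P.map (fun ω => pastOf (fun j => ε j ω) t) = Measure.infinitePi (fun _ => P.map (ε 0)) := by
  have hinj : Function.Injective (fun k : ℕ => t - (k : ℤ)) := fun a b h => by simpa using h
  have := (hi.precomp hinj).map_fun_eq_infinitePi_map (fun k => hm _)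
  have h2 : (fun k : ℕ => P.map (ε (t - (k : ℤ)))) = fun _ => P.map (ε 0) := by
    funext k; exact (hd _).map_eq
  rw [h2] at this
  exact this

/-- The two sides use the noises at the disjoint sets of times `j < t` and `{t}`. -/
lemma indepFun_pastOf_noise (hm : ∀ t, Measurable (ε t)) (hi : iIndepFun ε P) (t : ℤ) :
    IndepFun (fun ω => pastOf (fun j => ε j ω) (t - 1)) (ε t) P := by
  have hdis : Disjoint (Set.Iio t) ({t} : Set ℤ) := by simp
  have := indep_iSup_of_disjoint (fun i => (hm i).comap_le) hi hdis
  rw [IndepFun_iff_Indep]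
  refine indep_of_indep_of_le_left (indep_of_indep_of_le_right this ?_) ?_
  · exact le_iSup₂_of_le t rfl le_rfl
  · rw [MeasurableSpace.pi, MeasurableSpace.comap_iSup]
    refine iSup_le fun k => ?_
    rw [MeasurableSpace.comap_comp]
    refine le_iSup₂_of_le (t - 1 - (k : ℤ)) ?_ le_rfl
    simp only [Set.mem_Iio]; omega

/-- A product of functions `g_l` of the past and of the present noise, with conditional
expectations at most `1`, has expectation at most `1`. -/
lemma lintegral_prod_le_one (hm : ∀ t, Measurable (ε t)) (hi : iIndepFun ε P)
    (hd : ∀ t, IdentDistrib (ε t) (ε 0) P P)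
    (g : ℕ → (ℕ → ℝ) × ℝ → ℝ≥0∞) (hg : ∀ l, Measurable (g l))
    (hg1 : ∀ l x, ∫⁻ y, g l (x, y) ∂(P.map (ε 0)) ≤ 1) (n : ℕ) :
    ∫⁻ ω, ∏ l ∈ Finset.Icc 1 n, g l (pastOf (fun j => ε j ω) ((l : ℤ) - 1), ε l ω) ∂P ≤ 1 := by
  induction n with
  | zero => simp
  | succ n ih =>
    -- The first `n` factors, read off the past at time `n`: its coordinate `k` is `ε_{n-k}`, so the
    -- past at `l - 1` starts at coordinate `n + 1 - l` and `ε_l` is coordinate `n - l`.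
    set ζ : (ℕ → ℝ) → ℝ≥0∞ := fun x => ∏ l ∈ Finset.Icc 1 n,
      g l (fun k => x (k + (n + 1 - l)), x (n - l)) with hζ
    have hζm : Measurable ζ := by
      refine Finset.measurable_fun_prod _ fun l _ => (hg l).comp ?_
      exact (measurable_pi_lambda _ fun k => measurable_pi_apply _).prodMk (measurable_pi_apply _)
    have hζe : ∀ ω, ζ (pastOf (fun j => ε j ω) (((n + 1 : ℕ) : ℤ) - 1)) =
        ∏ l ∈ Finset.Icc 1 n, g l (pastOf (fun j => ε j ω) ((l : ℤ) - 1), ε l ω) := by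
      intro ω
      refine Finset.prod_congr rfl fun l hl => ?_
      rw [Finset.mem_Icc] at hl
      congr 2
      · funext k
        simp only [pastOf]
        congr 1
        push_cast [Nat.cast_sub (show l ≤ n + 1 by omega)]; ring_nf
      · simp only [pastOf]
        congr 1
        push_cast [Nat.cast_sub hl.2]; ring
    rw [← Finset.insert_Icc_right_eq_Icc_add_one (by omega)]
    simp_rw [Finset.prod_insert (show n + 1 ∉ Finset.Icc 1 n by simp)]
    simp_rw [← hζe]
    have hmap := (indepFun_iff_map_prod_eq_prod_map_map
      (measurable_pastOf_noise hm _).aemeasurable (hm _).aemeasurable).1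
      (indepFun_pastOf_noise hm hi ((n + 1 : ℕ) : ℤ))
    rw [(hd ((n + 1 : ℕ) : ℤ)).map_eq] at hmap
    have hF : Measurable (fun p : (ℕ → ℝ) × ℝ => g (n + 1) p * ζ p.1) :=
      (hg _).mul (hζm.comp measurable_fst)
    have : ∫⁻ ω, g (n + 1) (pastOf (fun j => ε j ω) (((n + 1 : ℕ) : ℤ) - 1), ε ((n + 1 : ℕ) : ℤ) ω) *
        ζ (pastOf (fun j => ε j ω) (((n + 1 : ℕ) : ℤ) - 1)) ∂P =
        ∫⁻ x, ∫⁻ y, g (n + 1) (x, y) * ζ x ∂(P.map (ε 0))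
          ∂(P.map fun ω => pastOf (fun j => ε j ω) (((n + 1 : ℕ) : ℤ) - 1)) := by
      rw [← lintegral_prod _ hF.aemeasurable, ← hmap,
        lintegral_map hF ((measurable_pastOf_noise hm _).prodMk (hm _))]
    rw [this]
    -- The last noise is independent of everything else and is integrated out first, which removes
    -- the last factor.
    calc _ ≤ ∫⁻ x, ζ x ∂(P.map fun ω => pastOf (fun j => ε j ω) (((n + 1 : ℕ) : ℤ) - 1)) := by
          refine lintegral_mono fun x => ?_
          rw [lintegral_mul_const (f := fun y => g (n + 1) (x, y)) _
            ((hg _).comp measurable_prodMk_left)]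
          exact (mul_le_mul_left (hg1 _ _) _).trans (one_mul _).le
      _ = ∫⁻ ω, ∏ l ∈ Finset.Icc 1 n, g l (pastOf (fun j => ε j ω) ((l : ℤ) - 1), ε l ω) ∂P := by
          rw [lintegral_map hζm (measurable_pastOf_noise hm _)]
          simp_rw [hζe]
      _ ≤ 1 := ih

end Causal

/-! ### Law of large numbers for causal functions of the noise -/

section LLN

variable {Ω : Type*} [MeasurableSpace Ω] {P : Measure Ω} [IsProbabilityMeasure P]
  {ε : ℤ → Ω → ℝ}

/-- The filtration on `ℝ^ℕ` generated by the coordinates. -/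
noncomputable def coordFiltration : Filtration ℕ (inferInstance : MeasurableSpace (ℕ → ℝ)) :=
  Filtration.natural (fun (j : ℕ) (x : ℕ → ℝ) => x j)
    (fun j => (measurable_pi_apply j).stronglyMeasurable)

/-- Needed for Lévy's upward theorem: conditioning on more and more coordinates recovers an
integrable function. -/
lemma iSup_coordFiltration :
    ⨆ k, coordFiltration k = (inferInstance : MeasurableSpace (ℕ → ℝ)) := by
  refine le_antisymm (iSup_le fun k => coordFiltration.le k) ?_
  change (⨆ a : ℕ, MeasurableSpace.comap (fun x : ℕ → ℝ => x a) _) ≤ _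
  refine iSup_le fun j => le_iSup_of_le j ?_
  exact le_iSup₂_of_le (f := fun i (_ : i ≤ j) => MeasurableSpace.comap (fun x : ℕ → ℝ => x i) _)
    j le_rfl le_rfl

/-- At time `t`, a function of the coordinates `0, …, k` uses only the noises at the times `t - k,
…, t`; under the hypothesis on `i` and `j` these two windows are disjoint. -/
lemma indepFun_comp_pastOf (hm : ∀ t, Measurable (ε t)) (hi : iIndepFun ε P) {k : ℕ}
    {g : (ℕ → ℝ) → ℝ} (hg : Measurable[coordFiltration k] g) {i j : ℤ} (hij : i + k < j) :
    IndepFun (fun ω => g (pastOf (fun l => ε l ω) i)) (fun ω => g (pastOf (fun l => ε l ω) j)) P := by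
  have key : ∀ t : ℤ, MeasurableSpace.comap (fun ω => g (pastOf (fun l => ε l ω) t)) inferInstance ≤
      ⨆ l ∈ Set.Icc (t - k) t, MeasurableSpace.comap (ε l) inferInstance := by
    intro t
    have h1 : (fun ω => g (pastOf (fun l => ε l ω) t)) = g ∘ fun ω => pastOf (fun l => ε l ω) t := rfl
    rw [h1, ← MeasurableSpace.comap_comp]
    refine (MeasurableSpace.comap_mono hg.comap_le).trans ?_
    change MeasurableSpace.comap _ (⨆ a ≤ k, MeasurableSpace.comap (fun x : ℕ → ℝ => x a) _) ≤ _
    simp only [MeasurableSpace.comap_iSup, MeasurableSpace.comap_comp]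
    refine iSup₂_le fun a ha => ?_
    refine le_iSup₂_of_le (t - (a : ℤ)) ?_ le_rfl
    simp only [Set.mem_Icc]; omega
  have hdis : Disjoint (Set.Icc (i - k) i) (Set.Icc (j - k) j) := by
    rw [Set.disjoint_left]; intro x h1 h2
    simp only [Set.mem_Icc] at h1 h2; omega
  have := indep_iSup_of_disjoint (fun i => (hm i).comap_le) hi hdis
  rw [IndepFun_iff_Indep]
  exact indep_of_indep_of_le_left (indep_of_indep_of_le_right this (key j)) (key i)

/-- The variance of `|f|` is nonnegative. -/
lemma abs_integral_le_sqrt {f : Ω → ℝ} (hf : MemLp f 2 P) :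
    ∫ ω, |f ω| ∂P ≤ √(∫ ω, f ω ^ 2 ∂P) := by
  refine Real.le_sqrt_of_sq_le ?_
  have h := variance_nonneg (fun ω => |f ω|) P
  rw [variance_eq_sub (X := fun ω => |f ω|) hf.abs] at h
  simp only [Pi.pow_apply, sq_abs] at h
  linarith

/-- Centred terms more than `k` apart are independent, so at most `(2k + 1) n` covariances survive,
each at most `(2C)²`. The mean square of the average is thus of order `1/n`. -/
lemma tendsto_average_of_bounded (hm : ∀ t, Measurable (ε t)) (hi : iIndepFun ε P)
    (hd : ∀ t, IdentDistrib (ε t) (ε 0) P P) {k : ℕ} {g : (ℕ → ℝ) → ℝ}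
    (hg : Measurable[coordFiltration k] g) {C : ℝ} (hC : 0 ≤ C)
    (hb : ∀ᵐ x ∂(Measure.infinitePi fun _ : ℕ => P.map (ε 0)), |g x| ≤ C) :
    Tendsto (fun n : ℕ => ∫ ω, |(n : ℝ)⁻¹ * ∑ i ∈ Finset.Icc 1 n,
      g (pastOf (fun l => ε l ω) ((i : ℤ) - 1)) -
        ∫ x, g x ∂(Measure.infinitePi fun _ : ℕ => P.map (ε 0))| ∂P) atTop (𝓝 0) := by
  set ν := Measure.infinitePi fun _ : ℕ => P.map (ε 0) with hν
  have hlaw := map_pastOf_noise (P := P) hm hi hd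
  have hg' : Measurable g := hg.mono (coordFiltration.le k) le_rfl
  have hξ := measurable_pastOf_noise hm
  set m := ∫ x, g x ∂ν with hmdef
  have : IsProbabilityMeasure ν := by
    rw [hν, ← hlaw 0]; exact Measure.isProbabilityMeasure_map (hξ 0).aemeasurable
  have hmC : |m| ≤ C := by
    have := norm_integral_le_of_norm_le_const (μ := ν) (f := g) (C := C) hb
    simpa using this
  set Y : ℕ → Ω → ℝ := fun i ω => g (pastOf (fun l => ε l ω) ((i : ℤ) - 1)) - m with hY
  have hYm : ∀ i, Measurable (Y i) := fun i => (hg'.comp (hξ _)).sub_const _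
  have hYb : ∀ i, ∀ᵐ ω ∂P, |Y i ω| ≤ 2 * C := by
    intro i
    have h1 : ∀ᵐ x ∂(P.map fun ω => pastOf (fun l => ε l ω) ((i : ℤ) - 1)), |g x| ≤ C := by
      rw [hlaw]; exact hb
    filter_upwards [ae_of_ae_map (hξ _).aemeasurable h1] with ω h
    calc |Y i ω| ≤ _ := abs_sub _ _
      _ ≤ 2 * C := by linarith
  have hYL : ∀ i, MemLp (Y i) 2 P := fun i =>
    MemLp.of_bound (hYm i).aestronglyMeasurable (2 * C) (hYb i)
  have hYint : ∀ i, ∫ ω, Y i ω ∂P = 0 := by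
    intro i
    have h2 : ∫ ω, g (pastOf (fun l => ε l ω) ((i : ℤ) - 1)) ∂P = m := by
      rw [hmdef, hν, ← hlaw ((i : ℤ) - 1), integral_map (hξ _).aemeasurable hg'.aestronglyMeasurable]
    have hint : Integrable (fun ω => g (pastOf (fun l => ε l ω) ((i : ℤ) - 1))) P := by
      have := ((hYL i).integrable (by norm_num)).add (integrable_const m)
      refine this.congr (Eventually.of_forall fun ω => ?_)
      simp [hY]
    rw [hY]; simp only
    rw [integral_sub hint (integrable_const _), h2]; simp
  have hcov : ∀ i j, ∫ ω, Y i ω * Y j ω ∂P ≤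
      if (i ≤ j + k ∧ j ≤ i + k) then (2 * C) ^ 2 else 0 := by
    intro i j
    split_ifs with h
    · refine (le_abs_self _).trans ?_
      have := norm_integral_le_of_norm_le_const (μ := P) (f := fun ω => Y i ω * Y j ω)
        (C := (2 * C) ^ 2) (by
          filter_upwards [hYb i, hYb j] with ω h1 h2
          rw [norm_mul, sq]
          exact mul_le_mul h1 h2 (norm_nonneg _) (by positivity))
      simpa using this
    · have h0 : ∀ a b : ℕ, a + k < b → ∫ ω, Y a ω * Y b ω ∂P = 0 := by
        intro a b hab
        have hind := indepFun_comp_pastOf hm hi hg (i := (a : ℤ) - 1) (j := (b : ℤ) - 1) (by omega)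
        have hind2 : IndepFun (Y a) (Y b) P :=
          hind.comp (φ := fun x => x - m) (ψ := fun x => x - m)
            (measurable_id.sub_const _) (measurable_id.sub_const _)
        rw [hind2.integral_fun_mul_eq_mul_integral (hYm a).aestronglyMeasurable
          (hYm b).aestronglyMeasurable, hYint, zero_mul]
      rw [not_and_or, not_le, not_le] at h
      rcases h with h | h
      · refine le_of_eq ?_
        rw [← h0 j i h]; exact integral_congr_ae (Eventually.of_forall fun ω => mul_comm _ _)
      · exact (h0 i j h).le
  have hS : ∀ n : ℕ, ∫ ω, (∑ i ∈ Finset.Icc 1 n, Y i ω) ^ 2 ∂P ≤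
      n * ((2 * k + 1) * (2 * C) ^ 2) := by
    intro n
    have h1 : ∀ ω, (∑ i ∈ Finset.Icc 1 n, Y i ω) ^ 2 =
        ∑ i ∈ Finset.Icc 1 n, ∑ j ∈ Finset.Icc 1 n, Y i ω * Y j ω := by
      intro ω; rw [sq, Finset.sum_mul_sum]
    simp_rw [h1]
    have hprod : ∀ i j, Integrable (fun ω => Y i ω * Y j ω) P := fun i j =>
      (hYL i).integrable_mul (hYL j)
    rw [integral_finsetSum _ fun i _ => integrable_finsetSum _ fun j _ => hprod i j]
    simp_rw [integral_finsetSum _ fun j _ => hprod _ j]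
    have h2 : ∀ i ∈ Finset.Icc 1 n, ∑ j ∈ Finset.Icc 1 n, ∫ ω, Y i ω * Y j ω ∂P ≤
        (2 * k + 1) * (2 * C) ^ 2 := by
      intro i _
      refine (Finset.sum_le_sum fun j _ => hcov i j).trans ?_
      rw [← Finset.sum_filter, Finset.sum_const, nsmul_eq_mul]
      refine mul_le_mul_of_nonneg_right ?_ (by positivity)
      -- The truncated subtraction can only shorten the window, so `2k + 1` remains an upper bound
      -- for its size.
      have hsub : (Finset.Icc 1 n).filter (fun j => i ≤ j + k ∧ j ≤ i + k) ⊆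
          Finset.Icc (i - k) (i + k) := by
        intro j hj
        simp only [Finset.mem_filter, Finset.mem_Icc] at hj ⊢; omega
      have := Finset.card_le_card hsub
      rw [Nat.card_Icc] at this
      have h3 : ((Finset.Icc 1 n).filter (fun j => i ≤ j + k ∧ j ≤ i + k)).card ≤ 2 * k + 1 := by
        omega
      exact_mod_cast h3
    refine (Finset.sum_le_sum h2).trans ?_
    rw [Finset.sum_const, nsmul_eq_mul]; simp
  have hrew : ∀ n : ℕ, 1 ≤ n → ∀ ω, (n : ℝ)⁻¹ * ∑ i ∈ Finset.Icc 1 n,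
      g (pastOf (fun l => ε l ω) ((i : ℤ) - 1)) - m = (n : ℝ)⁻¹ * ∑ i ∈ Finset.Icc 1 n, Y i ω := by
    intro n hn ω
    have : (n : ℝ) ≠ 0 := by positivity
    simp only [hY, Finset.sum_sub_distrib, Finset.sum_const, Nat.card_Icc, nsmul_eq_mul]
    simp; field_simp
  have hub : ∀ᶠ n : ℕ in atTop, ∫ ω, |(n : ℝ)⁻¹ * ∑ i ∈ Finset.Icc 1 n,
      g (pastOf (fun l => ε l ω) ((i : ℤ) - 1)) - m| ∂P ≤
      √((n : ℝ)⁻¹ * ((2 * k + 1) * (2 * C) ^ 2)) := by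
    filter_upwards [eventually_ge_atTop 1] with n hn
    simp_rw [hrew n hn]
    refine (abs_integral_le_sqrt
      ((memLp_finsetSum (Finset.Icc 1 n) fun i _ => hYL i).const_mul _)).trans ?_
    refine Real.sqrt_le_sqrt ?_
    simp_rw [mul_pow]
    rw [integral_const_mul]
    have hn0 : (0 : ℝ) < n := by positivity
    calc ((n : ℝ)⁻¹) ^ 2 * ∫ ω, (∑ i ∈ Finset.Icc 1 n, Y i ω) ^ 2 ∂P
        ≤ ((n : ℝ)⁻¹) ^ 2 * (n * ((2 * k + 1) * (2 * C) ^ 2)) := by gcongr; exact hS n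
      _ = _ := by field_simp
  refine squeeze_zero' (Eventually.of_forall fun n => integral_nonneg fun ω => abs_nonneg _) hub ?_
  have : Tendsto (fun n : ℕ => (n : ℝ)⁻¹ * ((2 * k + 1) * (2 * C) ^ 2)) atTop (𝓝 0) := by
    simpa using tendsto_inv_atTop_nhds_zero_nat (𝕜 := ℝ).mul_const ((2 * k + 1) * (2 * C) ^ 2)
  have h2 := (Real.continuous_sqrt.tendsto 0).comp this
  rwa [Real.sqrt_zero] at h2

/-- Truncating the values at a level `N` costs `δ/2` by dominated convergence; conditioning on the
first coordinates costs another `δ/2` by martingale convergence in mean, and preserves the bound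
`N`. -/
lemma exists_bounded_approx {ν : Measure (ℕ → ℝ)} [IsProbabilityMeasure ν] {g : (ℕ → ℝ) → ℝ}
    (hgm : Measurable g) (hg : Integrable g ν) {δ : ℝ} (hδ : 0 < δ) :
    ∃ (k : ℕ) (C : ℝ) (g' : (ℕ → ℝ) → ℝ), 0 ≤ C ∧ Measurable[coordFiltration k] g' ∧
      (∀ᵐ x ∂ν, |g' x| ≤ C) ∧ ∫ x, |g x - g' x| ∂ν ≤ δ := by
  set gN : ℕ → (ℕ → ℝ) → ℝ := fun N => {x | |g x| ≤ N}.indicator g with hgN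
  have hset : ∀ N : ℕ, MeasurableSet {x | |g x| ≤ N} := fun N =>
    measurableSet_le hgm.abs measurable_const
  have h1 : Tendsto (fun N => ∫ x, |g x - gN N x| ∂ν) atTop (𝓝 0) := by
    have : Tendsto (fun N => ∫ x, |g x - gN N x| ∂ν) atTop (𝓝 (∫ x, (0 : ℝ) ∂ν)) := by
      refine tendsto_integral_of_dominated_convergence (fun x => |g x|) (fun N => ?_) hg.abs
        (fun N => Eventually.of_forall fun x => ?_) (Eventually.of_forall fun x => ?_)
      · exact (hgm.sub (hgm.indicator (hset N))).abs.aestronglyMeasurable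
      · by_cases hx : |g x| ≤ N <;> simp [hgN, hx]
      · refine tendsto_const_nhds.congr' ?_
        filter_upwards [eventually_ge_atTop ⌈|g x|⌉₊] with N hN
        have : |g x| ≤ N := (Nat.le_ceil _).trans (by exact_mod_cast hN)
        simp [hgN, this]
    simpa using this
  obtain ⟨N, hN⟩ := (h1.eventually_lt_const (half_pos hδ)).exists
  have hgNm : Measurable (gN N) := hgm.indicator (hset N)
  have hgNb : ∀ x, |gN N x| ≤ N := by
    intro x
    by_cases hx : |g x| ≤ N <;> simp [hgN, hx]
  have hgNi : Integrable (gN N) ν := hg.indicator (hset N)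
  have h2 := hgNi.tendsto_eLpNorm_condExp (ℱ := coordFiltration)
    (by rw [iSup_coordFiltration]; exact hgNm.stronglyMeasurable)
  obtain ⟨k, hk⟩ := (h2.eventually_lt_const
    (ENNReal.ofReal_pos.2 (half_pos hδ))).exists
  refine ⟨k, N, ν[gN N | coordFiltration k], Nat.cast_nonneg _,
    stronglyMeasurable_condExp.measurable, ?_, ?_⟩
  · have := ae_bdd_abs_condExp_of_ae_bdd_abs (μ := ν) (m := coordFiltration k) (R := (N : ℝ)) (f := gN N)
      (Eventually.of_forall fun x => hgNb x)
    exact this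
  · have hci : Integrable (ν[gN N | coordFiltration k]) ν := integrable_condExp
    have h3 : ∫ x, |gN N x - (ν[gN N | coordFiltration k]) x| ∂ν ≤ δ / 2 := by
      rw [eLpNorm_one_eq_lintegral_enorm, ← ofReal_integral_norm_eq_lintegral_enorm
        (hci.sub hgNi)] at hk
      have := (ENNReal.ofReal_lt_ofReal_iff (half_pos hδ)).1 hk
      refine le_trans (le_of_eq ?_) this.le
      refine integral_congr_ae (Eventually.of_forall fun x => ?_)
      simp [abs_sub_comm]
    calc ∫ x, |g x - (ν[gN N | coordFiltration k]) x| ∂ν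
        ≤ ∫ x, (|g x - gN N x| + |gN N x - (ν[gN N | coordFiltration k]) x|) ∂ν :=
          integral_mono (hg.sub hci).abs ((hg.sub hgNi).abs.add (hgNi.sub hci).abs)
            fun x => abs_sub_le _ _ _
      _ = _ := integral_add (hg.sub hgNi).abs (hgNi.sub hci).abs
      _ ≤ δ := by linarith

/-- The law of large numbers in mean for causal functions of an i.i.d. sequence. -/
lemma tendsto_average (hm : ∀ t, Measurable (ε t)) (hi : iIndepFun ε P)
    (hd : ∀ t, IdentDistrib (ε t) (ε 0) P P) {g : (ℕ → ℝ) → ℝ} (hgm : Measurable g)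
    (hg : Integrable g (Measure.infinitePi fun _ : ℕ => P.map (ε 0))) :
    Tendsto (fun n : ℕ => ∫ ω, |(n : ℝ)⁻¹ * ∑ i ∈ Finset.Icc 1 n,
      g (pastOf (fun l => ε l ω) ((i : ℤ) - 1)) -
        ∫ x, g x ∂(Measure.infinitePi fun _ : ℕ => P.map (ε 0))| ∂P) atTop (𝓝 0) := by
  set ν := Measure.infinitePi fun _ : ℕ => P.map (ε 0) with hν
  have hlaw := map_pastOf_noise (P := P) hm hi hd
  have hξ := measurable_pastOf_noise hm
  have : IsProbabilityMeasure ν := by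
    rw [hν, ← hlaw 0]; exact Measure.isProbabilityMeasure_map (hξ 0).aemeasurable
  rw [Metric.tendsto_atTop]
  intro δ hδ
  -- The approximation error occurs twice, in the average and in the limit, and the average of `g'`
  -- adds a third term: three quarters of `δ` in all.
  obtain ⟨k, C, g', hC, hg'm, hg'b, hgg⟩ := exists_bounded_approx (ν := ν) hgm hg
    (show 0 < δ / 4 by positivity)
  have hg'm' : Measurable g' := hg'm.mono (coordFiltration.le k) le_rfl
  have hg'i : Integrable g' ν := Integrable.of_bound hg'm'.aestronglyMeasurable C hg'b
  have hlim := tendsto_average_of_bounded hm hi hd hg'm hC hg'b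
  rw [← hν] at hlim
  obtain ⟨n₀, hn₀⟩ := eventually_atTop.1 (hlim.eventually_lt_const (show 0 < δ / 4 by positivity))
  refine ⟨max n₀ 1, fun n hn => ?_⟩
  have hn0 : (0 : ℝ) < n := by
    have : 1 ≤ n := (le_max_right _ _).trans hn
    positivity
  rw [Real.dist_0_eq_abs, abs_of_nonneg (integral_nonneg fun ω => abs_nonneg _)]
  have hcomp : ∀ {u : (ℕ → ℝ) → ℝ}, Measurable u → Integrable u ν → ∀ i : ℕ,
      Integrable (fun ω => u (pastOf (fun l => ε l ω) ((i : ℤ) - 1))) P := by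
    intro u hu1 hu2 i
    rw [hν, ← hlaw ((i : ℤ) - 1)] at hu2
    exact hu2.comp_measurable (hξ _)
  have hcomp2 : ∀ {u : (ℕ → ℝ) → ℝ}, Measurable u → ∀ i : ℕ,
      ∫ ω, u (pastOf (fun l => ε l ω) ((i : ℤ) - 1)) ∂P = ∫ x, u x ∂ν := by
    intro u hu1 i
    rw [hν, ← hlaw ((i : ℤ) - 1), integral_map (hξ _).aemeasurable hu1.aestronglyMeasurable]
  set D : (ℕ → ℝ) → ℝ := fun x => |g x - g' x| with hD
  have hDm : Measurable D := (hgm.sub hg'm').abs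
  have hDi : Integrable D ν := (hg.sub hg'i).abs
  have hsumi : Integrable (fun ω => (n : ℝ)⁻¹ * ∑ i ∈ Finset.Icc 1 n,
      D (pastOf (fun l => ε l ω) ((i : ℤ) - 1))) P :=
    (integrable_finsetSum _ fun i _ => hcomp hDm hDi i).const_mul _
  have havg' : Integrable (fun ω => |(n : ℝ)⁻¹ * ∑ i ∈ Finset.Icc 1 n,
      g' (pastOf (fun l => ε l ω) ((i : ℤ) - 1)) - ∫ x, g' x ∂ν|) P :=
    (((integrable_finsetSum _ fun i _ => hcomp hg'm' hg'i i).const_mul _).sub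
      (integrable_const _)).abs
  have havg : Integrable (fun ω => |(n : ℝ)⁻¹ * ∑ i ∈ Finset.Icc 1 n,
      g (pastOf (fun l => ε l ω) ((i : ℤ) - 1)) - ∫ x, g x ∂ν|) P :=
    (((integrable_finsetSum _ fun i _ => hcomp hgm hg i).const_mul _).sub
      (integrable_const _)).abs
  have hpt : ∀ ω, |(n : ℝ)⁻¹ * ∑ i ∈ Finset.Icc 1 n,
      g (pastOf (fun l => ε l ω) ((i : ℤ) - 1)) - ∫ x, g x ∂ν| ≤
      ((n : ℝ)⁻¹ * ∑ i ∈ Finset.Icc 1 n, D (pastOf (fun l => ε l ω) ((i : ℤ) - 1)) +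
      |(n : ℝ)⁻¹ * ∑ i ∈ Finset.Icc 1 n,
      g' (pastOf (fun l => ε l ω) ((i : ℤ) - 1)) - ∫ x, g' x ∂ν|) + ∫ x, D x ∂ν := by
    intro ω
    have e1 : |(n : ℝ)⁻¹ * ∑ i ∈ Finset.Icc 1 n, g (pastOf (fun l => ε l ω) ((i : ℤ) - 1)) -
        (n : ℝ)⁻¹ * ∑ i ∈ Finset.Icc 1 n, g' (pastOf (fun l => ε l ω) ((i : ℤ) - 1))| ≤
        (n : ℝ)⁻¹ * ∑ i ∈ Finset.Icc 1 n, D (pastOf (fun l => ε l ω) ((i : ℤ) - 1)) := by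
      rw [← mul_sub, ← Finset.sum_sub_distrib, abs_mul, abs_of_pos (inv_pos.2 hn0)]
      gcongr
      exact Finset.abs_sum_le_sum_abs _ _
    have e2 : |∫ x, g' x ∂ν - ∫ x, g x ∂ν| ≤ ∫ x, D x ∂ν := by
      rw [abs_sub_comm, ← integral_sub hg hg'i]
      exact abs_integral_le_integral_abs
    have e3 := abs_sub_le ((n : ℝ)⁻¹ * ∑ i ∈ Finset.Icc 1 n, g (pastOf (fun l => ε l ω) ((i : ℤ) - 1)))
      ((n : ℝ)⁻¹ * ∑ i ∈ Finset.Icc 1 n, g' (pastOf (fun l => ε l ω) ((i : ℤ) - 1))) (∫ x, g x ∂ν)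
    have e4 := abs_sub_le ((n : ℝ)⁻¹ * ∑ i ∈ Finset.Icc 1 n, g' (pastOf (fun l => ε l ω) ((i : ℤ) - 1)))
      (∫ x, g' x ∂ν) (∫ x, g x ∂ν)
    linarith
  have hDsum : ∫ ω, (n : ℝ)⁻¹ * ∑ i ∈ Finset.Icc 1 n, D (pastOf (fun l => ε l ω) ((i : ℤ) - 1)) ∂P =
      ∫ x, D x ∂ν := by
    rw [integral_const_mul, integral_finsetSum _ fun i _ => hcomp hDm hDi i]
    simp_rw [hcomp2 hDm]
    simp; field_simp
  calc _ ≤ ∫ ω, ((n : ℝ)⁻¹ * ∑ i ∈ Finset.Icc 1 n, D (pastOf (fun l => ε l ω) ((i : ℤ) - 1)) +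
      |(n : ℝ)⁻¹ * ∑ i ∈ Finset.Icc 1 n,
      g' (pastOf (fun l => ε l ω) ((i : ℤ) - 1)) - ∫ x, g' x ∂ν|) + ∫ x, D x ∂ν ∂P :=
        integral_mono havg ((hsumi.add havg').add (integrable_const _)) hpt
    _ = (∫ x, D x ∂ν + ∫ ω, |(n : ℝ)⁻¹ * ∑ i ∈ Finset.Icc 1 n,
      g' (pastOf (fun l => ε l ω) ((i : ℤ) - 1)) - ∫ x, g' x ∂ν| ∂P) + ∫ x, D x ∂ν := by
        have h1 := integral_add (hsumi.add havg') (integrable_const (∫ x, D x ∂ν))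
        have h2 := integral_add hsumi havg'
        simp only [Pi.add_apply] at h1
        rw [h1, h2, hDsum]
        simp
    _ < δ := by
        have := hn₀ n ((le_max_left _ _).trans hn)
        linarith

end LLN

/-! ### First-order expansions of a smooth density -/

/-- `f` is differentiable, `f` and `f'` are bounded by `F` and `F`-Lipschitz. -/
structure SmoothBdd (f : ℝ → ℝ) (F : ℝ) : Prop where
  one_le : 1 ≤ F
  diff : Differentiable ℝ f
  bdd : ∀ x, |f x| ≤ F
  bdd_deriv : ∀ x, |deriv f x| ≤ F
  lip_deriv : ∀ x y, |deriv f x - deriv f y| ≤ F * |x - y|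

namespace SmoothBdd

variable {f : ℝ → ℝ} {F : ℝ}

lemma lip (hf : SmoothBdd f F) (x y : ℝ) : |f x - f y| ≤ F * |x - y| := by
  have := Convex.norm_image_sub_le_of_norm_deriv_le (f := f) (s := Set.univ) (C := F)
    (fun x _ => hf.diff x) (fun x _ => hf.bdd_deriv x) convex_univ (Set.mem_univ y) (Set.mem_univ x)
  simpa using this

lemma continuous_deriv (hf : SmoothBdd f F) : Continuous (deriv f) := by
  have : LipschitzWith F.toNNReal (deriv f) := LipschitzWith.of_dist_le_mul fun x y => by
    rw [Real.dist_eq, Real.dist_eq, Real.coe_toNNReal _ (by linarith [hf.one_le])]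
    exact hf.lip_deriv x y
  exact this.continuous

/-- Mean value inequality for `z ↦ f z - f'(x) z` on the ball of radius `|δ|`, where its derivative
is at most `F |δ|`. -/
lemma taylor (hf : SmoothBdd f F) (x δ : ℝ) :
    |f (x + δ) - f x - deriv f x * δ| ≤ F * δ ^ 2 := by
  have h := Convex.norm_image_sub_le_of_norm_deriv_le
    (f := fun z => f z - deriv f x * z) (s := Metric.closedBall x |δ|) (C := F * |δ|)
    (x := x) (y := x + δ)
    (fun z _ => ((hf.diff z).sub ((differentiableAt_id).const_mul _)))
    (fun z hz => by
      have h1 : deriv (fun z => f z - deriv f x * z) z = deriv f z - deriv f x := by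
        have := ((hf.diff z).hasDerivAt.sub ((hasDerivAt_id z).const_mul (deriv f x))).deriv
        exact (this.trans (by simp))
      rw [h1, Real.norm_eq_abs]
      refine (hf.lip_deriv z x).trans ?_
      have : |z - x| ≤ |δ| := by simpa [Real.dist_eq] using hz
      have := hf.one_le
      gcongr)
    (convex_closedBall _ _) (by simp) (by simp)
  have e : f (x + δ) - deriv f x * (x + δ) - (f x - deriv f x * x) =
      f (x + δ) - f x - deriv f x * δ := by ring
  rw [e] at h
  simp only [Real.norm_eq_abs, add_sub_cancel_left] at h
  calc _ ≤ F * |δ| * |δ| := h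
    _ = F * δ ^ 2 := by rw [mul_assoc, ← sq, sq_abs]

/-- The two parts of the increment are treated differently. In the application `r` is bounded by `ρ`
times the square of an envelope that has only two moments, so `r²` may fail to be integrable; the
minimum with `|r|` keeps the error integrable and still negligible. The larger of `|p|` and `|r|`
dominates the sum. -/
lemma taylor_min (hf : SmoothBdd f F) (x p r : ℝ) :
    |f (x + (p + r)) - f x - deriv f x * (p + r)| ≤ 4 * F * p ^ 2 + 4 * F * min (r ^ 2) |r| := by
  have h1 := hf.taylor x (p + r)
  have h2 : |f (x + (p + r)) - f x - deriv f x * (p + r)| ≤ 2 * F * |p + r| := by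
    have a := hf.lip (x + (p + r)) x
    rw [add_sub_cancel_left] at a
    have b : |deriv f x * (p + r)| ≤ F * |p + r| := by
      rw [abs_mul]; gcongr; exact hf.bdd_deriv x
    calc _ ≤ |f (x + (p + r)) - f x| + |deriv f x * (p + r)| := abs_sub _ _
      _ ≤ _ := by linarith
  have hF := hf.one_le
  rcases le_total |r| |p| with h | h
  · have h3 : (p + r) ^ 2 ≤ 4 * p ^ 2 := by
      rw [← sq_abs (p + r), ← sq_abs p]
      nlinarith [abs_add_le p r, abs_nonneg p, abs_nonneg r, abs_nonneg (p + r)]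
    have h4 : 0 ≤ min (r ^ 2) |r| := le_min (sq_nonneg _) (abs_nonneg _)
    have h5 : F * (p + r) ^ 2 ≤ F * (4 * p ^ 2) := by gcongr
    have h6 : 0 ≤ 4 * F * min (r ^ 2) |r| := by positivity
    linarith
  · have h3 : (p + r) ^ 2 ≤ 4 * r ^ 2 := by
      rw [← sq_abs (p + r), ← sq_abs r]
      nlinarith [abs_add_le p r, abs_nonneg p, abs_nonneg r, abs_nonneg (p + r)]
    have h4 : |p + r| ≤ 2 * |r| := by linarith [abs_add_le p r]
    have h5 : |f (x + (p + r)) - f x - deriv f x * (p + r)| ≤ 4 * F * min (r ^ 2) |r| := by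
      rcases min_choice (r ^ 2) |r| with h6 | h6
      · rw [h6]; nlinarith
      · rw [h6]; nlinarith
    have : 0 ≤ 4 * F * p ^ 2 := by positivity
    linarith

set_option maxHeartbeats 1000000 in
/-- First-order expansion of `w s f(s (y - t) + e)` around `w₀ f(y₀)`. -/
lemma expansion (hf : SmoothBdd f F) {K w w₀ dw y y₀ dy s ds e de t τ ρ Li Lj Ri Rj : ℝ}
    (hK : 1 ≤ K) (hFK : F ≤ K) (hρ : 0 ≤ ρ) (ht : |t| ≤ τ) (hτ : τ ≤ 1) (hLi : 1 ≤ Li)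
    (hLj : 1 ≤ Lj) (hRi : 0 ≤ Ri) (hRj : 0 ≤ Rj)
    (hw : |w| ≤ K) (hw0 : |w₀| ≤ K) (hww : |w - w₀| ≤ K * ρ * Li) (hrw : |w - w₀ - dw| ≤ ρ * Ri)
    (hdw : |dw| ≤ K * ρ * Li) (hy : |y| ≤ K * Li) (hyy : |y - y₀| ≤ K * ρ * Li ^ 2)
    (hry : |y - y₀ - dy| ≤ K * ρ * Ri) (hs : |s - 1| ≤ ρ * Lj) (he : |e| ≤ ρ * Lj)
    (hrs : |s - 1 - ds| ≤ ρ * Rj) (hre : |e - de| ≤ ρ * Rj) (hds : |ds| ≤ ρ * Lj) :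
    |w * (s * f (s * (y - t) + e)) - w₀ * f (y₀ - t) -
      (dw * f y₀ + w₀ * deriv f y₀ * dy + w₀ * (f y₀ + y₀ * deriv f y₀) * ds +
        w₀ * deriv f y₀ * de)| ≤
      60 * K ^ 4 * (ρ * (Ri + Rj * Li + (ρ + τ) * (Li ^ 2 * Lj ^ 2) +
        min (ρ * Li ^ 4) (Li ^ 2))) := by
  have hτ0 : 0 ≤ τ := (abs_nonneg _).trans ht
  set u := s * (y - t) + e with hu
  -- The argument of `f` moves from `y₀ - t` by `p + r`: the part `p` is due to `s` and `e`, the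
  -- part `r` to `y`.
  set p := (s - 1) * (y - t) + e with hp
  set r := y - y₀ with hr
  set m := min (ρ * Li ^ 4) (Li ^ 2) with hm
  have hm0 : 0 ≤ m := le_min (by positivity) (by positivity)
  have hup : u = (y₀ - t) + (p + r) := by rw [hu, hp, hr]; ring
  have hF0 : 0 ≤ F := by linarith [hf.one_le]
  have hfb : ∀ x, |f x| ≤ K := fun x => (hf.bdd x).trans hFK
  have hfb' : ∀ x, |deriv f x| ≤ K := fun x => (hf.bdd_deriv x).trans hFK
  have hfl : ∀ x z, |f x - f z| ≤ K * |x - z| := fun x z => (hf.lip x z).trans (by gcongr)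
  have hfl' : ∀ x z, |deriv f x - deriv f z| ≤ K * |x - z| :=
    fun x z => (hf.lip_deriv x z).trans (by gcongr)
  have hK0 : 0 ≤ K := by linarith
  set P := Li ^ 2 * Lj ^ 2 with hP
  have hLi2 : Li ≤ Li ^ 2 := by nlinarith
  have hLj2 : Lj ≤ Lj ^ 2 := by nlinarith
  have hLi21 : 1 ≤ Li ^ 2 := hLi.trans hLi2
  have hLj21 : 1 ≤ Lj ^ 2 := hLj.trans hLj2
  have hQ : Li ^ 2 * Lj ≤ P := by rw [hP]; gcongr
  have hLL : Li * Lj ≤ P := by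
    calc Li * Lj ≤ Li ^ 2 * Lj := by gcongr
      _ ≤ P := hQ
  have hLiP : Li ≤ P := by
    calc Li = Li * 1 := (mul_one _).symm
      _ ≤ Li * Lj := by gcongr
      _ ≤ P := hLL
  have hLjP : Lj ≤ P := by
    calc Lj = 1 * Lj := (one_mul _).symm
      _ ≤ Li * Lj := by gcongr
      _ ≤ P := hLL
  have hLi2P : Li ^ 2 ≤ P := by
    calc Li ^ 2 = Li ^ 2 * 1 := (mul_one _).symm
      _ ≤ Li ^ 2 * Lj := by gcongr
      _ ≤ P := hQ
  have hP0 : 0 ≤ P := by positivity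
  have hyt : |y - t| ≤ 2 * K * Li := by
    have h1 : (1 : ℝ) ≤ K * Li := one_le_mul_of_one_le_of_one_le hK hLi
    calc |y - t| ≤ |y| + |t| := abs_sub _ _
      _ ≤ K * Li + K * Li := by linarith only [hy, ht, hτ, h1]
      _ = _ := by ring
  have hKL1 : (1 : ℝ) ≤ K * Li := one_le_mul_of_one_le_of_one_le hK hLi
  have hpb : |p| ≤ 3 * K * ρ * (Li * Lj) := by
    have h1 : |(s - 1) * (y - t)| ≤ (ρ * Lj) * (2 * K * Li) := by rw [abs_mul]; gcongr
    have h2 : ρ * Lj * 1 ≤ ρ * Lj * (K * Li) := by gcongr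
    calc |p| ≤ |(s - 1) * (y - t)| + |e| := abs_add_le _ _
      _ ≤ (ρ * Lj) * (2 * K * Li) + ρ * Lj * (K * Li) := by linarith only [h1, h2, he]
      _ = _ := by ring
  have hpP : |p| ≤ 3 * K * ρ * P := hpb.trans (by gcongr)
  have hrb : |r| ≤ K * ρ * Li ^ 2 := hyy
  have hrP : |r| ≤ K * ρ * P := hrb.trans (by gcongr)
  have b1 : |(w - w₀ - dw) * f (y₀ - t)| ≤ K * (ρ * Ri) := by
    rw [abs_mul, mul_comm]; gcongr; exact hfb _
  have b2 : |dw * (f (y₀ - t) - f y₀)| ≤ K ^ 2 * (ρ * (τ * P)) := by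
    rw [abs_mul]
    have : |f (y₀ - t) - f y₀| ≤ K * τ := (hfl _ _).trans (by
      rw [show y₀ - t - y₀ = -t by ring, abs_neg]; gcongr)
    calc _ ≤ (K * ρ * Li) * (K * τ) := by gcongr
      _ ≤ (K * ρ * P) * (K * τ) := by gcongr
      _ = _ := by ring
  have b3 : |w * (s - 1 - ds) * f u| ≤ K ^ 2 * (ρ * (Rj * Li)) := by
    rw [abs_mul, abs_mul]
    calc _ ≤ K * (ρ * Rj) * K := by gcongr; exact hfb _
      _ = K ^ 2 * (ρ * (Rj * 1)) := by ring
      _ ≤ _ := by gcongr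
  have b4 : |(w - w₀) * ds * f u| ≤ K ^ 2 * (ρ * (ρ * P)) := by
    rw [abs_mul, abs_mul]
    calc _ ≤ (K * ρ * Li) * (ρ * Lj) * K := by gcongr; exact hfb _
      _ = K ^ 2 * (ρ * (ρ * (Li * Lj))) := by ring
      _ ≤ _ := by gcongr
  have hu0 : |u - y₀| ≤ τ + 4 * K * ρ * (Li ^ 2 * Lj) := by
    have e1 : u - y₀ = -t + p + r := by rw [hup]; ring
    have h1 : 3 * K * ρ * (Li * Lj) ≤ 3 * K * ρ * (Li ^ 2 * Lj) := by gcongr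
    have h2 : K * ρ * Li ^ 2 * 1 ≤ K * ρ * Li ^ 2 * Lj := by gcongr
    calc |u - y₀| ≤ |-t| + |p| + |r| := by rw [e1]; exact abs_add_three _ _ _
      _ ≤ τ + 3 * K * ρ * (Li ^ 2 * Lj) + K * ρ * Li ^ 2 * Lj := by
        rw [abs_neg]; linarith only [ht, hpb, h1, hrb, h2]
      _ = _ := by ring
  have b5 : |w₀ * ds * (f u - f y₀)| ≤ K ^ 2 * (ρ * (τ * P)) + 4 * K ^ 3 * (ρ * (ρ * P)) := by
    rw [abs_mul, abs_mul]
    calc _ ≤ K * (ρ * Lj) * (K * (τ + 4 * K * ρ * (Li ^ 2 * Lj))) := by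
          gcongr; exact (hfl _ _).trans (by gcongr)
      _ = K ^ 2 * (ρ * (τ * Lj)) + 4 * K ^ 3 * (ρ * (ρ * P)) := by rw [hP]; ring
      _ ≤ _ := by gcongr
  -- The only place where `Li` would appear to the fourth power; the minimum defining `m` makes up
  -- for it.
  have hmr : min (r ^ 2) |r| ≤ K ^ 2 * (ρ * m) := by
    have hKK : K ≤ K ^ 2 := by nlinarith
    rw [hm, mul_min_of_nonneg _ _ hρ, mul_min_of_nonneg _ _ (by positivity)]
    refine min_le_min ?_ ?_
    · calc r ^ 2 = |r| ^ 2 := (sq_abs _).symm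
        _ ≤ (K * ρ * Li ^ 2) ^ 2 := by gcongr
        _ = _ := by ring
    · calc |r| ≤ K * ρ * Li ^ 2 := hrb
        _ ≤ K ^ 2 * ρ * Li ^ 2 := by gcongr
        _ = _ := by ring
  have b6 : |w * (f u - f (y₀ - t) - deriv f (y₀ - t) * (p + r))| ≤
      36 * K ^ 4 * (ρ * (ρ * P)) + 4 * K ^ 4 * (ρ * m) := by
    rw [abs_mul, hup]
    have h1 := hf.taylor_min (y₀ - t) p r
    have h2 : p ^ 2 ≤ 9 * K ^ 2 * (ρ * (ρ * P)) := by
      calc p ^ 2 = |p| ^ 2 := (sq_abs _).symm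
        _ ≤ (3 * K * ρ * (Li * Lj)) ^ 2 := by gcongr
        _ = _ := by rw [hP]; ring
    calc _ ≤ K * (4 * K * (9 * K ^ 2 * (ρ * (ρ * P))) + 4 * K * (K ^ 2 * (ρ * m))) := by
          refine mul_le_mul hw (h1.trans ?_) (abs_nonneg _) hK0
          have : 0 ≤ min (r ^ 2) |r| := le_min (sq_nonneg _) (abs_nonneg _)
          gcongr
      _ = _ := by ring
  have hpr : |p + r| ≤ 4 * K * ρ * P := by
    calc |p + r| ≤ |p| + |r| := abs_add_le _ _
      _ ≤ _ := by linarith only [hpP, hrP]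
  have b7 : |w * (deriv f (y₀ - t) - deriv f y₀) * (p + r)| ≤ 4 * K ^ 3 * (ρ * (τ * P)) := by
    rw [abs_mul, abs_mul]
    have : |deriv f (y₀ - t) - deriv f y₀| ≤ K * τ := (hfl' _ _).trans (by
      rw [show y₀ - t - y₀ = -t by ring, abs_neg]; gcongr)
    calc _ ≤ K * (K * τ) * (4 * K * ρ * P) := by gcongr
      _ = _ := by ring
  have b8 : |(w - w₀) * deriv f y₀ * p| ≤ 3 * K ^ 3 * (ρ * (ρ * P)) := by
    rw [abs_mul, abs_mul]
    calc _ ≤ (K * ρ * Li) * K * (3 * K * ρ * (Li * Lj)) := by gcongr; exact hfb' _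
      _ = 3 * K ^ 3 * (ρ * (ρ * (Li ^ 2 * Lj))) := by ring
      _ ≤ _ := by gcongr
  have b9 : |(w - w₀) * deriv f y₀ * r| ≤ 2 * K ^ 3 * (ρ * m) := by
    rw [abs_mul, abs_mul, hm, mul_min_of_nonneg _ _ hρ, mul_min_of_nonneg _ _ (by positivity)]
    have hLi3 : Li ^ 3 ≤ Li ^ 4 := pow_le_pow_right₀ hLi (by norm_num)
    refine le_min ?_ ?_
    · calc _ ≤ (K * ρ * Li) * K * (K * ρ * Li ^ 2) := by gcongr; exact hfb' _
        _ = K ^ 3 * (ρ * (ρ * Li ^ 3)) := by ring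
        _ ≤ K ^ 3 * (ρ * (ρ * Li ^ 4)) := by gcongr
        _ ≤ _ := by
          have : 0 ≤ K ^ 3 * (ρ * (ρ * Li ^ 4)) := by positivity
          linarith only [this]
    · have : |w - w₀| ≤ 2 * K := by
        calc |w - w₀| ≤ |w| + |w₀| := abs_sub _ _
          _ ≤ _ := by linarith only [hw, hw0]
      calc _ ≤ (2 * K) * K * (K * ρ * Li ^ 2) := by gcongr; exact hfb' _
        _ = _ := by ring
  have b10 : |w₀ * deriv f y₀ * ((s - 1 - ds) * (y - t) + ds * r - ds * t + (e - de) +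
      (r - dy))| ≤ K ^ 2 * (3 * K * (ρ * (Rj * Li)) + K * (ρ * (ρ * P)) + ρ * (τ * P) +
        K * (ρ * Ri)) := by
    rw [abs_mul, abs_mul]
    have h1 : |(s - 1 - ds) * (y - t)| ≤ (ρ * Rj) * (2 * K * Li) := by rw [abs_mul]; gcongr
    have h2 : |ds * r| ≤ (ρ * Lj) * (K * ρ * Li ^ 2) := by rw [abs_mul]; gcongr
    have h3 : |ds * t| ≤ (ρ * Lj) * τ := by rw [abs_mul]; gcongr
    have h4 : ρ * Rj * 1 ≤ ρ * Rj * (K * Li) := by gcongr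
    have h5 : (ρ * Lj) * (K * ρ * Li ^ 2) ≤ K * (ρ * (ρ * P)) := by
      calc _ = K * (ρ * (ρ * (Li ^ 2 * Lj))) := by ring
        _ ≤ _ := by gcongr
    have h6 : (ρ * Lj) * τ ≤ ρ * (τ * P) := by
      calc _ = ρ * (τ * Lj) := by ring
        _ ≤ _ := by gcongr
    have h7 : |(s - 1 - ds) * (y - t) + ds * r - ds * t + (e - de) + (r - dy)| ≤
        |(s - 1 - ds) * (y - t)| + |ds * r| + |ds * t| + |e - de| + |r - dy| := by
      refine (abs_add_le _ _).trans (add_le_add ((abs_add_le _ _).trans (add_le_add ?_ le_rfl)) le_rfl)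
      exact (abs_sub _ _).trans (add_le_add (abs_add_le _ _) le_rfl)
    have h8 : |w₀| * |deriv f y₀| ≤ K ^ 2 := by
      rw [sq]; exact mul_le_mul hw0 (hfb' _) (abs_nonneg _) hK0
    refine mul_le_mul h8 (h7.trans ?_) (abs_nonneg _) (by positivity)
    linarith only [h1, h2, h3, h4, h5, h6, hre, hry]
  -- Telescoping into the ten terms bounded by `b1` to `b10`: one factor at a time is replaced by
  -- its value at `θ₀` or by its linear part.
  have hid : w * (s * f u) - w₀ * f (y₀ - t) -
      (dw * f y₀ + w₀ * deriv f y₀ * dy + w₀ * (f y₀ + y₀ * deriv f y₀) * ds +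
        w₀ * deriv f y₀ * de) =
      (w - w₀ - dw) * f (y₀ - t) + dw * (f (y₀ - t) - f y₀) + w * (s - 1 - ds) * f u +
      (w - w₀) * ds * f u + w₀ * ds * (f u - f y₀) +
      w * (f u - f (y₀ - t) - deriv f (y₀ - t) * (p + r)) +
      w * (deriv f (y₀ - t) - deriv f y₀) * (p + r) + (w - w₀) * deriv f y₀ * p +
      (w - w₀) * deriv f y₀ * r +
      w₀ * deriv f y₀ * ((s - 1 - ds) * (y - t) + ds * r - ds * t + (e - de) + (r - dy)) := by
    rw [hp, hr]; ring
  rw [hid]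
  have k1 : K ≤ K ^ 4 := le_self_pow₀ hK (by norm_num)
  have k2 : K ^ 2 ≤ K ^ 4 := pow_le_pow_right₀ hK (by norm_num)
  have k3 : K ^ 3 ≤ K ^ 4 := pow_le_pow_right₀ hK (by norm_num)
  have A1 : 0 ≤ ρ * Ri := by positivity
  have A2 : 0 ≤ ρ * (Rj * Li) := by positivity
  have A3 : 0 ≤ ρ * (ρ * P) := by positivity
  have A4 : 0 ≤ ρ * (τ * P) := by positivity
  have A5 : 0 ≤ ρ * m := by positivity
  have T : ∀ {a b x z : ℝ}, |a| ≤ x → |b| ≤ z → |a + b| ≤ x + z :=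
    fun h1 h2 => (abs_add_le _ _).trans (add_le_add h1 h2)
  refine (T (T (T (T (T (T (T (T (T b1 b2) b3) b4) b5) b6) b7) b8) b9) b10).trans ?_
  have c : ∀ {a x : ℝ}, 0 ≤ x → a ≤ K ^ 4 → a * x ≤ K ^ 4 * x :=
    fun hx ha => mul_le_mul_of_nonneg_right ha hx
  have B1 := c A1 k1
  have B1' := c A1 k3
  have B2 := c A2 k2
  have B2' := c A2 k3
  have B3 := c A3 k2
  have B3' := c A3 k3
  have B4 := c A4 k2
  have B4' := c A4 k3
  have B5 := c A5 k3
  have B0 : ∀ {x : ℝ}, 0 ≤ x → 0 ≤ K ^ 4 * x := fun hx => mul_nonneg (by positivity) hx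
  have C1 := B0 A1
  have C2 := B0 A2
  have C3 := B0 A3
  have C4 := B0 A4
  have C5 := B0 A5
  have e1 : K ^ 2 * (3 * K * (ρ * (Rj * Li)) + K * (ρ * (ρ * P)) + ρ * (τ * P) + K * (ρ * Ri)) =
      3 * (K ^ 3 * (ρ * (Rj * Li))) + K ^ 3 * (ρ * (ρ * P)) + K ^ 2 * (ρ * (τ * P)) +
        K ^ 3 * (ρ * Ri) := by ring
  have e2 : 60 * K ^ 4 * (ρ * (Ri + Rj * Li + (ρ + τ) * P + m)) =
      60 * (K ^ 4 * (ρ * Ri)) + 60 * (K ^ 4 * (ρ * (Rj * Li))) + 60 * (K ^ 4 * (ρ * (ρ * P))) +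
      60 * (K ^ 4 * (ρ * (τ * P))) + 60 * (K ^ 4 * (ρ * m)) := by ring
  rw [e1, e2]
  linarith only [B1, B1', B2, B2', B3, B3', B4, B4', B5, C1, C2, C3, C4, C5]

end SmoothBdd

/-! ### Averages of functions of the past -/

namespace SeriesModel

variable {d : ℕ} {Ω : Type*} [MeasurableSpace Ω] {M : SeriesModel d Ω} {P : Measure Ω}
  [IsProbabilityMeasure P]

/-- The past `(X_{t-1}, X_{t-2}, …)`. -/
def pastX (M : SeriesModel d Ω) (t : ℤ) (ω : Ω) : ℕ → ℝ := pastOf (fun j => M.X j ω) (t - 1)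

/-- The past of the process as a function of the past of the noise. -/
def causalPast (M : SeriesModel d Ω) (x : ℕ → ℝ) : ℕ → ℝ := fun k => M.causal (fun l => x (k + l))

/-- The law of the past of the process. -/
noncomputable def pastLaw (M : SeriesModel d Ω) (P : Measure Ω) : Measure (ℕ → ℝ) :=
  P.map (M.pastX 0)

lemma measurable_pastX (hM : M.IsLocationScale P) (t : ℤ) : Measurable (M.pastX t) :=
  measurable_pi_lambda _ fun _ => hM.X_meas _

lemma measurable_causalPast (hM : M.IsLocationScale P) : Measurable M.causalPast :=
  measurable_pi_lambda _ fun _ => hM.causal_meas.comp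
    (measurable_pi_lambda _ fun _ => measurable_pi_apply _)

lemma pastX_ae_eq (hM : M.IsLocationScale P) (t : ℤ) :
    ∀ᵐ ω ∂P, M.pastX t ω = M.causalPast (pastOf (fun j => M.noise j ω) (t - 1)) := by
  filter_upwards [ae_all_iff.2 hM.X_causal] with ω hω
  funext k
  simp only [pastX, causalPast, pastOf, hω]
  congr 1
  funext l
  simp only [pastOf]; congr 1; push_cast; ring

lemma pastLaw_eq (hM : M.IsLocationScale P) : M.pastLaw P =
    (Measure.infinitePi fun _ : ℕ => P.map (M.noise 0)).map M.causalPast := by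
  rw [← map_pastOf_noise hM.noise_meas hM.noise_indep hM.noise_ident (0 - 1),
    Measure.map_map (measurable_causalPast hM) (measurable_pastOf_noise hM.noise_meas _)]
  exact Measure.map_congr (pastX_ae_eq hM 0)

lemma map_pastX (hM : M.IsLocationScale P) (t : ℤ) : P.map (M.pastX t) = M.pastLaw P := by
  rw [pastLaw_eq hM, ← map_pastOf_noise hM.noise_meas hM.noise_indep hM.noise_ident (t - 1),
    Measure.map_map (measurable_causalPast hM) (measurable_pastOf_noise hM.noise_meas _)]
  exact Measure.map_congr (pastX_ae_eq hM t)

lemma isProbabilityMeasure_pastLaw (hM : M.IsLocationScale P) :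
    IsProbabilityMeasure (M.pastLaw P) :=
  Measure.isProbabilityMeasure_map (measurable_pastX hM 0).aemeasurable

lemma indepFun_pastX_noise (hM : M.IsLocationScale P) (t : ℤ) :
    IndepFun (M.pastX t) (M.noise t) P := by
  have h := (indepFun_pastOf_noise hM.noise_meas hM.noise_indep t).comp
    (measurable_causalPast hM) measurable_id
  exact h.congr (EventuallyEq.symm (pastX_ae_eq hM t)) EventuallyEq.rfl

lemma lintegral_pastX (hM : M.IsLocationScale P) (t : ℤ) {u : (ℕ → ℝ) → ℝ≥0∞}
    (hu : Measurable u) : ∫⁻ ω, u (M.pastX t ω) ∂P = ∫⁻ x, u x ∂(M.pastLaw P) := by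
  rw [← map_pastX hM t, lintegral_map hu (measurable_pastX hM t)]

lemma integral_pastX (hM : M.IsLocationScale P) (t : ℤ) {u : (ℕ → ℝ) → ℝ}
    (hu : Measurable u) : ∫ ω, u (M.pastX t ω) ∂P = ∫ x, u x ∂(M.pastLaw P) := by
  rw [← map_pastX hM t, integral_map (measurable_pastX hM t).aemeasurable hu.aestronglyMeasurable]

lemma integrable_pastX (hM : M.IsLocationScale P) (t : ℤ) {u : (ℕ → ℝ) → ℝ}
    (hu : Integrable u (M.pastLaw P)) : Integrable (fun ω => u (M.pastX t ω)) P := by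
  rw [← map_pastX hM t] at hu
  exact hu.comp_measurable (measurable_pastX hM t)

lemma lintegral_prod_pastX_le_one (hM : M.IsLocationScale P)
    (g : (ℕ → ℝ) × ℝ → ℝ≥0∞) (hg : Measurable g)
    (hg1 : ∀ x, ∫⁻ y, g (x, y) ∂(P.map (M.noise 0)) ≤ 1) (n : ℕ) :
    ∫⁻ ω, ∏ l ∈ Finset.Icc 1 n, g (M.pastX l ω, M.noise l ω) ∂P ≤ 1 := by
  have h := lintegral_prod_le_one (P := P) hM.noise_meas hM.noise_indep hM.noise_ident
    (fun _ p => g (M.causalPast p.1, p.2))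
    (fun _ => hg.comp (((measurable_causalPast hM).comp measurable_fst).prodMk measurable_snd))
    (fun _ x => hg1 (M.causalPast x)) n
  refine le_trans (le_of_eq (lintegral_congr_ae ?_)) h
  filter_upwards [ae_all_iff.2 fun l : ℤ => pastX_ae_eq hM l] with ω hω
  exact Finset.prod_congr rfl fun l _ => by rw [hω]

/-- The average over `1 ≤ i ≤ n`. -/
noncomputable def avg (n : ℕ) (a : ℕ → ℝ) : ℝ := (n : ℝ)⁻¹ * ∑ i ∈ Finset.Icc 1 n, a i

lemma avg_mono {n : ℕ} {a b : ℕ → ℝ} (h : ∀ i ∈ Finset.Icc 1 n, a i ≤ b i) : avg n a ≤ avg n b :=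
  mul_le_mul_of_nonneg_left (Finset.sum_le_sum h) (by positivity)

lemma avg_add (n : ℕ) (a b : ℕ → ℝ) : avg n (fun i => a i + b i) = avg n a + avg n b := by
  simp only [avg, Finset.sum_add_distrib, mul_add]

lemma avg_sub (n : ℕ) (a b : ℕ → ℝ) : avg n (fun i => a i - b i) = avg n a - avg n b := by
  simp only [avg, Finset.sum_sub_distrib, mul_sub]

lemma avg_mul_left (n : ℕ) (c : ℝ) (a : ℕ → ℝ) : avg n (fun i => c * a i) = c * avg n a := by
  simp only [avg, ← Finset.mul_sum]; ring

lemma avg_mul_right (n : ℕ) (c : ℝ) (a : ℕ → ℝ) : avg n (fun i => a i * c) = avg n a * c := by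
  simp only [avg, ← Finset.sum_mul]; ring

lemma avg_const {n : ℕ} (hn : 1 ≤ n) (c : ℝ) : avg n (fun _ => c) = c := by
  have : (n : ℝ) ≠ 0 := by positivity
  simp [avg]; field_simp

lemma avg_nonneg {n : ℕ} {a : ℕ → ℝ} (h : ∀ i ∈ Finset.Icc 1 n, 0 ≤ a i) : 0 ≤ avg n a :=
  mul_nonneg (by positivity) (Finset.sum_nonneg h)

lemma abs_avg_le (n : ℕ) (a : ℕ → ℝ) : |avg n a| ≤ avg n (fun i => |a i|) := by
  rw [avg, avg, abs_mul, abs_of_nonneg (by positivity : (0 : ℝ) ≤ (n : ℝ)⁻¹)]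
  gcongr
  exact Finset.abs_sum_le_sum_abs _ _

lemma le_of_avg_le {n : ℕ} {a : ℕ → ℝ} {C : ℝ} (h0 : ∀ i ∈ Finset.Icc 1 n, 0 ≤ a i)
    (h : avg n a ≤ C) {i : ℕ} (hi : i ∈ Finset.Icc 1 n) : a i ≤ C * n := by
  have hn : (0 : ℝ) < n := by
    rw [Finset.mem_Icc] at hi
    have : 1 ≤ n := hi.1.trans hi.2
    positivity
  have h1 := Finset.single_le_sum h0 hi
  rw [avg, inv_mul_le_iff₀ hn] at h
  linarith

/-- Markov's inequality; the bound is uniform in `n`. -/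
lemma measure_avg_gt_le {a : ℕ → Ω → ℝ≥0∞} (ha : ∀ i, AEMeasurable (a i) P) {c : ℝ≥0∞}
    (hc : ∀ i, ∫⁻ ω, a i ω ∂P ≤ c) {n : ℕ} {t : ℝ} (ht : 0 < t) :
    P {ω | ¬ ((n : ℝ≥0∞)⁻¹ * ∑ i ∈ Finset.Icc 1 n, a i ω ≤ ENNReal.ofReal t)} ≤
      c / ENNReal.ofReal t := by
  rcases Nat.eq_zero_or_pos n with rfl | hn
  · simp
  have hm : AEMeasurable (fun ω => (n : ℝ≥0∞)⁻¹ * ∑ i ∈ Finset.Icc 1 n, a i ω) P :=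
    (Finset.aemeasurable_fun_sum _ fun i _ => ha i).const_mul _
  calc _ ≤ P {ω | ENNReal.ofReal t ≤ (n : ℝ≥0∞)⁻¹ * ∑ i ∈ Finset.Icc 1 n, a i ω} :=
        measure_mono fun ω hω => (not_le.1 hω).le
    _ ≤ (∫⁻ ω, (n : ℝ≥0∞)⁻¹ * ∑ i ∈ Finset.Icc 1 n, a i ω ∂P) / ENNReal.ofReal t :=
        meas_ge_le_lintegral_div hm (ENNReal.ofReal_pos.2 ht).ne' ENNReal.ofReal_ne_top
    _ ≤ c / ENNReal.ofReal t := by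
        gcongr
        rw [lintegral_const_mul'' _ (Finset.aemeasurable_fun_sum _ fun i _ => ha i),
          lintegral_finsetSum' _ fun i _ => ha i]
        calc (n : ℝ≥0∞)⁻¹ * ∑ i ∈ Finset.Icc 1 n, ∫⁻ ω, a i ω ∂P
            ≤ (n : ℝ≥0∞)⁻¹ * ∑ i ∈ Finset.Icc 1 n, c := by gcongr; exact hc _
          _ = c := by
            rw [Finset.sum_const, Nat.card_Icc, nsmul_eq_mul, ← mul_assoc, Nat.add_sub_cancel,
              ENNReal.inv_mul_cancel (by simpa using hn.ne') (ENNReal.natCast_ne_top n), one_mul]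

lemma measure_avg_real_gt_le {a : ℕ → Ω → ℝ} (ha : ∀ i, Measurable (a i)) (h0 : ∀ i ω, 0 ≤ a i ω)
    {c : ℝ≥0∞} (hc : ∀ i, ∫⁻ ω, ENNReal.ofReal (a i ω) ∂P ≤ c) {n : ℕ} (hn : 1 ≤ n)
    {t : ℝ} (ht : 0 < t) :
    P {ω | ¬ (avg n (fun i => a i ω) ≤ t)} ≤ c / ENNReal.ofReal t := by
  refine le_trans (measure_mono ?_) (measure_avg_gt_le (P := P) (n := n)
    (fun i => (ha i).ennreal_ofReal.aemeasurable) hc ht)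
  intro ω hω hcon
  refine hω ?_
  rw [← ENNReal.ofReal_le_ofReal_iff ht.le]
  refine le_trans (le_of_eq ?_) hcon
  rw [avg, ENNReal.ofReal_mul (by positivity), ENNReal.ofReal_sum_of_nonneg fun i _ => h0 i ω,
    ENNReal.ofReal_inv_of_pos (by positivity), ENNReal.ofReal_natCast]

/-- Averages of random variables with bounded expectations are bounded in probability. -/
lemma whp_avg_le {a : ℕ → Ω → ℝ} (ha : ∀ i, Measurable (a i)) (h0 : ∀ i ω, 0 ≤ a i ω)
    {c : ℝ≥0∞} (hcf : c ≠ ∞) (hc : ∀ i, ∫⁻ ω, ENNReal.ofReal (a i ω) ∂P ≤ c) {κ : ℝ≥0∞}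
    (hκ : κ ≠ 0) : ∃ C : ℝ, 1 ≤ C ∧ WHP P κ (fun n ω => avg n (fun i => a i ω) ≤ C) := by
  have ht : Tendsto (fun t : ℝ => c / ENNReal.ofReal t) atTop (𝓝 0) := by
    have h1 : Tendsto (fun t : ℝ => ENNReal.ofReal t) atTop (𝓝 ∞) :=
      ENNReal.tendsto_ofReal_atTop
    have := ENNReal.Tendsto.const_div h1 (Or.inr hcf)
    simpa using this
  obtain ⟨C, hC1, hC2⟩ := ((eventually_ge_atTop (1 : ℝ)).and
    (ht.eventually_le_const (pos_iff_ne_zero.2 hκ))).exists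
  refine ⟨C, hC1, ?_⟩
  filter_upwards [eventually_ge_atTop 1] with n hn
  exact (measure_avg_real_gt_le ha h0 hc hn (by linarith)).trans hC2

/-- Averages of random variables whose expectations tend to `0` are small in probability. -/
lemma whp_avg_small {a : ℕ → ℕ → Ω → ℝ} (ha : ∀ n i, Measurable (a n i))
    (h0 : ∀ n i ω, 0 ≤ a n i ω) {c : ℕ → ℝ≥0∞} (hcf : Tendsto c atTop (𝓝 0))
    (hc : ∀ n i, ∫⁻ ω, ENNReal.ofReal (a n i ω) ∂P ≤ c n) {κ : ℝ≥0∞} (hκ : κ ≠ 0) {τ : ℝ}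
    (hτ : 0 < τ) : WHP P κ (fun n ω => avg n (fun i => a n i ω) ≤ τ) := by
  have ht : Tendsto (fun n => c n / ENNReal.ofReal τ) atTop (𝓝 0) := by
    have := ENNReal.Tendsto.div_const hcf (b := ENNReal.ofReal τ)
      (Or.inr (ENNReal.ofReal_pos.2 hτ).ne')
    simpa using this
  refine WHP.of_le hκ ?_ ht
  filter_upwards [eventually_ge_atTop 1] with n hn
  exact measure_avg_real_gt_le (ha n) (h0 n) (hc n) hn hτ

lemma whp_avg_pastX_le (hM : M.IsLocationScale P) {u : (ℕ → ℝ) → ℝ} (hu : Measurable u)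
    (h0 : ∀ x, 0 ≤ u x) (hi : Integrable u (M.pastLaw P)) {κ : ℝ≥0∞} (hκ : κ ≠ 0) :
    ∃ C : ℝ, 1 ≤ C ∧ WHP P κ (fun n ω => avg n (fun i => u (M.pastX i ω)) ≤ C) :=
  whp_avg_le (a := fun i ω => u (M.pastX i ω)) (fun i => hu.comp (measurable_pastX hM _))
    (fun _ _ => h0 _) (c := ∫⁻ x, ENNReal.ofReal (u x) ∂(M.pastLaw P))
    (by rw [← ofReal_integral_eq_lintegral_ofReal hi (Eventually.of_forall h0)]
        exact ENNReal.ofReal_ne_top)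
    (fun i => (lintegral_pastX hM i hu.ennreal_ofReal).le) hκ

lemma whp_avg_pastX_small (hM : M.IsLocationScale P) {u : ℕ → (ℕ → ℝ) → ℝ}
    (hu : ∀ n, Measurable (u n)) (h0 : ∀ n x, 0 ≤ u n x)
    (hi : Tendsto (fun n => ∫⁻ x, ENNReal.ofReal (u n x) ∂(M.pastLaw P)) atTop (𝓝 0)) {κ : ℝ≥0∞}
    (hκ : κ ≠ 0) {τ : ℝ} (hτ : 0 < τ) :
    WHP P κ (fun n ω => avg n (fun i => u n (M.pastX i ω)) ≤ τ) :=
  whp_avg_small (a := fun n i ω => u n (M.pastX i ω)) (fun n _ => (hu n).comp (measurable_pastX hM _))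
    (fun _ _ _ => h0 _ _) hi (fun n i => (lintegral_pastX hM i (hu n).ennreal_ofReal).le) hκ hτ

lemma whp_of_tendsto_integral_abs {Y : ℕ → Ω → ℝ} (hY : ∀ n, Integrable (Y n) P)
    (h : Tendsto (fun n => ∫ ω, |Y n ω| ∂P) atTop (𝓝 0)) {κ : ℝ≥0∞} (hκ : κ ≠ 0) {τ : ℝ}
    (hτ : 0 < τ) : WHP P κ (fun n ω => |Y n ω| ≤ τ) := by
  have h2 : Tendsto (fun n : ℕ => ENNReal.ofReal (∫ ω, |Y n ω| ∂P) / ENNReal.ofReal τ)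
      atTop (𝓝 0) := by
    have h3 := (ENNReal.continuous_ofReal.tendsto 0).comp h
    rw [ENNReal.ofReal_zero] at h3
    have := ENNReal.Tendsto.div_const h3 (b := ENNReal.ofReal τ)
      (Or.inr (ENNReal.ofReal_pos.2 hτ).ne')
    simpa using this
  refine WHP.of_le hκ (Eventually.of_forall fun n => ?_) h2
  have h4 := meas_ge_le_lintegral_div (μ := P) (f := fun ω => ENNReal.ofReal |Y n ω|)
    (hY n).1.aemeasurable.abs.ennreal_ofReal (ENNReal.ofReal_pos.2 hτ).ne' ENNReal.ofReal_ne_top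
  rw [← ofReal_integral_eq_lintegral_ofReal (hY n).abs
    (Eventually.of_forall fun _ => abs_nonneg _)] at h4
  refine le_trans (measure_mono fun ω hω => ?_) h4
  exact ENNReal.ofReal_le_ofReal (not_le.1 hω).le

/-- The weak law of large numbers for functions of the past. -/
lemma whp_lln (hM : M.IsLocationScale P) {u : (ℕ → ℝ) → ℝ} (hu : Measurable u)
    (hi : Integrable u (M.pastLaw P)) {κ : ℝ≥0∞} (hκ : κ ≠ 0) {τ : ℝ} (hτ : 0 < τ) :
    WHP P κ (fun n ω => |avg n (fun i => u (M.pastX i ω)) - ∫ x, u x ∂(M.pastLaw P)| ≤ τ) := by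
  have hi' := hi
  rw [pastLaw_eq hM] at hi'
  have h := tendsto_average (P := P) hM.noise_meas hM.noise_indep hM.noise_ident
    (hu.comp (measurable_causalPast hM)) (hi'.comp_measurable (measurable_causalPast hM))
  have hint : ∫ x, u x ∂(M.pastLaw P) =
      ∫ x, (u ∘ M.causalPast) x ∂(Measure.infinitePi fun _ : ℕ => P.map (M.noise 0)) := by
    rw [pastLaw_eq hM, integral_map (measurable_causalPast hM).aemeasurable hu.aestronglyMeasurable]
    rfl
  rw [← hint] at h
  refine whp_of_tendsto_integral_abs (fun n => ?_) (h.congr fun n => ?_) hκ hτ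
  · have h1 : Integrable (fun ω => (n : ℝ)⁻¹ * ∑ i ∈ Finset.Icc 1 n, u (M.pastX i ω)) P :=
      (integrable_finsetSum (Finset.Icc 1 n)
        fun (i : ℕ) _ => integrable_pastX hM (i : ℤ) hi).const_mul _
    exact h1.sub (integrable_const _)
  · refine integral_congr_ae ?_
    filter_upwards [ae_all_iff.2 fun l : ℤ => pastX_ae_eq hM l] with ω hω
    simp only [avg, hω, Function.comp]

end SeriesModel

/-! ### Lipschitz envelopes over a dense sequence -/

section Envelope

variable {d : ℕ} {N : Set (Par d)} {D : ℕ → Par d} {g h : Par d → ℝ}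

/-- The supremum over a sequence of parameters of the Lipschitz quotients of `g`, relative to `h`. -/
noncomputable def lipSup (D : ℕ → Par d) (g h : Par d → ℝ) : ℝ≥0∞ :=
  ⨆ k, ⨆ l, ⨆ p, ENNReal.ofReal (|g (D k) - g (D l)| / (‖D k - D l‖ * h (D p)))

/-- The supremum over a sequence of parameters of the ratio of `g` to `h`. -/
noncomputable def ratioSup (D : ℕ → Par d) (g h : Par d → ℝ) : ℝ≥0∞ :=
  ⨆ k, ⨆ p, ENNReal.ofReal (|g (D k)| / h (D p))

/-- The sequence `D` is dense in `N`. -/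
structure DenseIn (N : Set (Par d)) (D : ℕ → Par d) : Prop where
  mem : ∀ k, D k ∈ N
  dense : ∀ θ ∈ N, ∀ U : Set (Par d), IsOpen U → θ ∈ U → ∃ k, D k ∈ U

lemma exists_denseIn (hN : N.Nonempty) : ∃ D, DenseIn N D := by
  have : Nonempty ↥N := hN.to_subtype
  refine ⟨fun k => TopologicalSpace.denseSeq ↥N k, fun k => Subtype.coe_prop _, ?_⟩
  intro θ hθ U hU hθU
  have hd := TopologicalSpace.denseRange_denseSeq ↥N
  obtain ⟨k, hk⟩ := hd.exists_mem_open (hU.preimage continuous_subtype_val) ⟨⟨θ, hθ⟩, hθU⟩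
  exact ⟨k, hk⟩

lemma DenseIn.exists_tendsto (hD : DenseIn N D) {θ : Par d} (hθ : θ ∈ N) :
    ∃ φ : ℕ → ℕ, Tendsto (fun j => D (φ j)) atTop (𝓝[N] θ) := by
  have : ∀ j : ℕ, ∃ k, D k ∈ Metric.ball θ (1 / ((j : ℝ) + 1)) := fun j =>
    hD.dense θ hθ _ Metric.isOpen_ball (Metric.mem_ball_self Nat.one_div_pos_of_nat)
  choose φ hφ using this
  refine ⟨φ, tendsto_nhdsWithin_iff.2 ⟨?_, Eventually.of_forall fun j => hD.mem _⟩⟩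
  rw [tendsto_iff_dist_tendsto_zero]
  exact squeeze_zero (fun _ => dist_nonneg) (fun j => (hφ j).le)
    tendsto_one_div_add_atTop_nhds_zero_nat

/-- A supremum over the whole neighbourhood need not be measurable, while one over a sequence is; by
continuity in the parameter nothing is lost. -/
lemma lip_of_lipSup (hD : DenseIn N D) (hg : ContinuousOn g N) (hh : ContinuousOn h N)
    (hpos : ∀ θ ∈ N, 0 < h θ) {a : ℝ} (ha : 0 ≤ a) (hs : lipSup D g h ≤ ENNReal.ofReal a)
    {θ θ' θ'' : Par d} (hθ : θ ∈ N) (hθ' : θ' ∈ N) (hθ'' : θ'' ∈ N) :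
    |g θ - g θ'| ≤ a * ‖θ - θ'‖ * h θ'' := by
  have key : ∀ k l p, |g (D k) - g (D l)| ≤ a * ‖D k - D l‖ * h (D p) := by
    intro k l p
    have h1 : ENNReal.ofReal (|g (D k) - g (D l)| / (‖D k - D l‖ * h (D p))) ≤ ENNReal.ofReal a :=
      (le_iSup_of_le k (le_iSup_of_le l (le_iSup
        (fun p => ENNReal.ofReal (|g (D k) - g (D l)| / (‖D k - D l‖ * h (D p)))) p))).trans hs
    rw [ENNReal.ofReal_le_ofReal_iff ha] at h1
    rcases eq_or_ne (D k) (D l) with h2 | h2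
    · simp [h2]
    · have h3 : 0 < ‖D k - D l‖ * h (D p) :=
        mul_pos (norm_pos_iff.2 (sub_ne_zero.2 h2)) (hpos _ (hD.mem _))
      rw [div_le_iff₀ h3] at h1
      linarith
  obtain ⟨φ, hφ⟩ := hD.exists_tendsto hθ
  obtain ⟨φ', hφ'⟩ := hD.exists_tendsto hθ'
  obtain ⟨φ'', hφ''⟩ := hD.exists_tendsto hθ''
  have t1 := (hg θ hθ).tendsto.comp hφ
  have t2 := (hg θ' hθ').tendsto.comp hφ'
  have t3 := (hh θ'' hθ'').tendsto.comp hφ''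
  have t4 := (tendsto_nhds_of_tendsto_nhdsWithin hφ).sub (tendsto_nhds_of_tendsto_nhdsWithin hφ')
  exact le_of_tendsto_of_tendsto' (t1.sub t2).abs ((t4.norm.const_mul a).mul t3)
    fun j => key _ _ _

lemma le_of_ratioSup (hD : DenseIn N D) (hg : ContinuousOn g N) (hh : ContinuousOn h N)
    (hpos : ∀ θ ∈ N, 0 < h θ) {a : ℝ} (ha : 0 ≤ a) (hs : ratioSup D g h ≤ ENNReal.ofReal a)
    {θ θ'' : Par d} (hθ : θ ∈ N) (hθ'' : θ'' ∈ N) : |g θ| ≤ a * h θ'' := by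
  have key : ∀ k p, |g (D k)| ≤ a * h (D p) := by
    intro k p
    have h1 : ENNReal.ofReal (|g (D k)| / h (D p)) ≤ ENNReal.ofReal a :=
      (le_iSup_of_le k (le_iSup (fun p => ENNReal.ofReal (|g (D k)| / h (D p))) p)).trans hs
    rw [ENNReal.ofReal_le_ofReal_iff ha, div_le_iff₀ (hpos _ (hD.mem _))] at h1
    exact h1
  obtain ⟨φ, hφ⟩ := hD.exists_tendsto hθ
  obtain ⟨φ'', hφ''⟩ := hD.exists_tendsto hθ''
  exact le_of_tendsto_of_tendsto' ((hg θ hθ).tendsto.comp hφ).abs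
    (((hh θ'' hθ'').tendsto.comp hφ'').const_mul a) fun j => key _ _

lemma ratioSup_le_supRatio (hD : DenseIn N D) (hpos : ∀ θ ∈ N, 0 < h θ) :
    ratioSup D g h ≤ supRatio N g h := by
  refine iSup_le fun k => iSup_le fun p => ?_
  have := le_iSup₂_of_le (f := fun θ (_ : θ ∈ N) => ⨆ θ' ∈ N, ENNReal.ofReal (‖g θ‖ / |h θ'|))
    (D k) (hD.mem k) (le_iSup₂_of_le (f := fun θ' (_ : θ' ∈ N) =>
      ENNReal.ofReal (‖g (D k)‖ / |h θ'|)) (D p) (hD.mem p) le_rfl)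
  rwa [abs_of_pos (hpos _ (hD.mem p)), Real.norm_eq_abs] at this

/-- Mean value inequality on the convex set `N`, with the derivatives over the larger set `Θ`. This
transfers the moments assumed on derivatives to Lipschitz constants. -/
lemma lipSup_le_supRatio {Θ : Set (Par d)} (hD : DenseIn N D) (hNΘ : N ⊆ Θ) (hN : Convex ℝ N)
    (hg : ∀ θ ∈ N, DifferentiableWithinAt ℝ g Θ θ) (hpos : ∀ θ ∈ N, 0 < h θ) :
    lipSup D g h ≤ supRatio N (D1 Θ g) h := by
  refine iSup_le fun k => iSup_le fun l => iSup_le fun p => ?_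
  set S := supRatio N (D1 Θ g) h with hS
  rcases eq_or_ne S ∞ with hinf | hfin
  · rw [hinf]; exact le_top
  have hp := hpos _ (hD.mem p)
  have hb : ∀ θ ∈ N, ‖fderivWithin ℝ g Θ θ‖ ≤ S.toReal * h (D p) := by
    intro θ hθ
    have h1 : ENNReal.ofReal (‖D1 Θ g θ‖ / |h (D p)|) ≤ S :=
      le_iSup₂_of_le (f := fun θ (_ : θ ∈ N) => ⨆ θ' ∈ N, ENNReal.ofReal (‖D1 Θ g θ‖ / |h θ'|))
        θ hθ (le_iSup₂_of_le (f := fun θ' (_ : θ' ∈ N) =>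
          ENNReal.ofReal (‖D1 Θ g θ‖ / |h θ'|)) (D p) (hD.mem p) le_rfl)
    rw [ENNReal.ofReal_le_iff_le_toReal hfin, abs_of_pos hp, div_le_iff₀ hp] at h1
    exact h1
  have hmvt := hN.norm_image_sub_le_of_norm_hasFDerivWithin_le
    (fun θ hθ => ((hg θ hθ).hasFDerivWithinAt.mono hNΘ)) hb (hD.mem l) (hD.mem k)
  rw [ENNReal.ofReal_le_iff_le_toReal hfin]
  rcases eq_or_ne (D k) (D l) with h2 | h2
  · simp [h2]
  · have h3 : 0 < ‖D k - D l‖ * h (D p) := mul_pos (norm_pos_iff.2 (sub_ne_zero.2 h2)) hp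
    rw [div_le_iff₀ h3]
    rw [Real.norm_eq_abs] at hmvt
    linarith

end Envelope

/-! ### Envelopes for the conditional mean and the volatility near `θ₀` -/

namespace SeriesModel

variable {d : ℕ} {Ω : Type*} [MeasurableSpace Ω] {M : SeriesModel d Ω} {P : Measure Ω}
  [IsProbabilityMeasure P] {r : ℝ}

lemma nhd_subset : M.nhd r ⊆ M.Θ := Set.inter_subset_left

lemma θ₀_mem_nhd (hM : M.IsLocationScale P) (hr : 0 < r) : M.θ₀ ∈ M.nhd r :=
  ⟨hM.θ₀_mem, Metric.mem_ball_self hr⟩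

lemma measurable_H (hM : M.IsLocationScale P) {θ : Par d} (hθ : θ ∈ M.Θ) : Measurable (M.H θ) :=
  hM.H_meas.comp (measurable_const.prodMk measurable_id : Measurable fun x : ℕ → ℝ =>
    ((⟨θ, hθ⟩ : M.Θ), x))

lemma measurable_G (hM : M.IsLocationScale P) {θ : Par d} (hθ : θ ∈ M.Θ) : Measurable (M.G θ) :=
  hM.G_meas.comp (measurable_const.prodMk measurable_id : Measurable fun x : ℕ → ℝ =>
    ((⟨θ, hθ⟩ : M.Θ), x))

/-- Regularity of `H(·; x)` and `G(·; x)` on the neighbourhood of `θ₀`, with envelopes `A`, `B`,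
`E` for the increments of `H`, of `G²`, and for `H`, relative to `G`, `G²` and `G`. -/
structure Regular (M : SeriesModel d Ω) (r γ : ℝ) (A B E : (ℕ → ℝ) → ℝ) (x : ℕ → ℝ) : Prop where
  lower : ∀ θ ∈ M.Θ, γ ≤ M.G θ x
  diffH : ∀ θ ∈ M.nhd r, DifferentiableWithinAt ℝ (fun θ => M.H θ x) M.Θ θ
  diffG : ∀ θ ∈ M.nhd r, DifferentiableWithinAt ℝ (fun θ => M.G θ x) M.Θ θ
  lipH : ∀ θ ∈ M.nhd r, ∀ θ' ∈ M.nhd r, ∀ θ'' ∈ M.nhd r,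
    |M.H θ x - M.H θ' x| ≤ A x * ‖θ - θ'‖ * M.G θ'' x
  lipG : ∀ θ ∈ M.nhd r, ∀ θ' ∈ M.nhd r, ∀ θ'' ∈ M.nhd r,
    |M.G θ x ^ 2 - M.G θ' x ^ 2| ≤ B x * ‖θ - θ'‖ * M.G θ'' x ^ 2
  boundH : ∀ θ ∈ M.nhd r, ∀ θ'' ∈ M.nhd r, |M.H θ x| ≤ E x * M.G θ'' x

/-- Measurable envelopes with the moments granted by the assumptions. -/
structure Envelopes (M : SeriesModel d Ω) (P : Measure Ω) (r γ : ℝ) (A B E : (ℕ → ℝ) → ℝ) :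
    Prop where
  γ_pos : 0 < γ
  measA : Measurable A
  measB : Measurable B
  measE : Measurable E
  A_nonneg : ∀ x, 0 ≤ A x
  B_nonneg : ∀ x, 0 ≤ B x
  E_nonneg : ∀ x, 0 ≤ E x
  intA : Integrable (fun x => A x ^ 3) (M.pastLaw P)
  intB : Integrable (fun x => B x ^ 3) (M.pastLaw P)
  intE : Integrable (fun x => E x ^ 2) (M.pastLaw P)
  regular : ∀ t, ∀ᵐ ω ∂P, M.Regular r γ A B E (M.pastX t ω)

/-- A finite moment makes `u` finite almost everywhere under the law of the past, which is the same
at all times; a bound assumed at time `0` therefore lets `u` be replaced by a real function at every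
`t`. -/
lemma exists_real_envelope (hM : M.IsLocationScale P) {u : (ℕ → ℝ) → ℝ≥0∞} (hu : Measurable u)
    {p : ℕ} {S : Ω → ℝ≥0∞} (hS : ExpFinite P (fun ω => S ω ^ (p + 1)))
    (hle : ∀ᵐ ω ∂P, u (M.pastX 0 ω) ≤ S ω) :
    Integrable (fun x => (u x).toReal ^ (p + 1)) (M.pastLaw P) ∧
      ∀ t, ∀ᵐ ω ∂P, u (M.pastX t ω) = ENNReal.ofReal (u (M.pastX t ω)).toReal := by
  have h1 : ∫⁻ x, u x ^ (p + 1) ∂(M.pastLaw P) < ∞ := by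
    rw [← lintegral_pastX hM 0 (hu.pow_const _)]
    refine lt_of_le_of_lt (lintegral_mono_ae ?_) hS.2
    filter_upwards [hle] with ω h
    gcongr
  have h2 : ∀ᵐ x ∂(M.pastLaw P), u x < ∞ := by
    filter_upwards [ae_lt_top (hu.pow_const _) h1.ne] with x hx
    by_contra hcon
    rw [not_lt, top_le_iff] at hcon
    simp [hcon] at hx
  constructor
  · have := integrable_toReal_of_lintegral_ne_top (hu.pow_const (p + 1)).aemeasurable h1.ne
    simpa [ENNReal.toReal_pow] using this
  · intro t
    rw [← map_pastX hM t] at h2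
    filter_upwards [ae_of_ae_map (measurable_pastX hM t).aemeasurable h2] with ω hω
    rw [ENNReal.ofReal_toReal hω.ne]

/-- The envelopes are suprema over a dense sequence, dominated by the ratios whose moments are
assumed: third moments for the increments of `H` and `G²`, but only second moments for `H` itself.
-/
lemma exists_envelopes (hM : M.IsLocationScale P) (hr : 0 < r) (h1 : M.A1 r) (h2 : M.A2 P r)
    (h3 : M.A3 P r) : ∃ γ A B E, M.Envelopes P r γ A B E := by
  obtain ⟨γ, s, a, κ, hγ, -, -, -, hlow, -⟩ := h2
  obtain ⟨D, hD⟩ := exists_denseIn (N := M.nhd r) ⟨_, θ₀_mem_nhd hM hr⟩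
  have hH : ∀ k, Measurable (M.H (D k)) := fun k => measurable_H hM (nhd_subset (hD.mem k))
  have hG : ∀ k, Measurable (M.G (D k)) := fun k => measurable_G hM (nhd_subset (hD.mem k))
  set uA : (ℕ → ℝ) → ℝ≥0∞ := fun x => lipSup D (fun θ => M.H θ x) (fun θ => M.G θ x) with huA
  set uB : (ℕ → ℝ) → ℝ≥0∞ :=
    fun x => lipSup D (fun θ => M.G θ x ^ 2) (fun θ => M.G θ x ^ 2) with huB
  set uE : (ℕ → ℝ) → ℝ≥0∞ := fun x => ratioSup D (fun θ => M.H θ x) (fun θ => M.G θ x) with huE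
  have mA : Measurable uA := by
    refine Measurable.iSup fun k => Measurable.iSup fun l => Measurable.iSup fun p => ?_
    exact (((hH k).sub (hH l)).abs.div ((hG p).const_mul _)).ennreal_ofReal
  have mB : Measurable uB := by
    refine Measurable.iSup fun k => Measurable.iSup fun l => Measurable.iSup fun p => ?_
    exact ((((hG k).pow_const 2).sub ((hG l).pow_const 2)).abs.div
      (((hG p).pow_const 2).const_mul _)).ennreal_ofReal
  have mE : Measurable uE := by
    refine Measurable.iSup fun k => Measurable.iSup fun p => ?_
    exact ((hH k).abs.div (hG p)).ennreal_ofReal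
  have hpos : ∀ t, ∀ᵐ ω ∂P, ∀ θ ∈ M.nhd r, 0 < M.G θ (M.pastX t ω) := by
    intro t
    filter_upwards [hlow t] with ω h θ hθ
    exact hγ.trans_le (h θ (nhd_subset hθ))
  have hA := exists_real_envelope hM mA (p := 2) (h3.mom_dm 0) (by
    filter_upwards [hpos 0, h3.diff_m 0] with ω p1 p2
    exact lipSup_le_supRatio hD nhd_subset h1.convex (fun θ hθ => (p2 θ hθ).1) p1)
  have hB := exists_real_envelope hM mB (p := 2) (h3.mom_dσ 0) (by
    filter_upwards [hpos 0, h3.diff_σ 0] with ω p1 p2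
    exact lipSup_le_supRatio hD nhd_subset h1.convex (fun θ hθ => ((p2 θ hθ).1.pow 2))
      fun θ hθ => pow_pos (p1 θ hθ) 2)
  have hE := exists_real_envelope hM mE (p := 1) (h3.mom_m 0) (by
    filter_upwards [hpos 0] with ω p1
    exact ratioSup_le_supRatio hD p1)
  refine ⟨γ, fun x => (uA x).toReal, fun x => (uB x).toReal, fun x => (uE x).toReal, hγ,
    mA.ennreal_toReal, mB.ennreal_toReal, mE.ennreal_toReal, fun x => ENNReal.toReal_nonneg,
    fun x => ENNReal.toReal_nonneg, fun x => ENNReal.toReal_nonneg, hA.1, hB.1, hE.1, ?_⟩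
  intro t
  filter_upwards [hlow t, hpos t, h3.diff_m t, h3.diff_σ t, hA.2 t, hB.2 t, hE.2 t] with
    ω q1 q2 q3 q4 q5 q6 q7
  have cH : ContinuousOn (fun θ => M.H θ (M.pastX t ω)) (M.nhd r) := fun θ hθ =>
    ((q3 θ hθ).1.continuousWithinAt).mono nhd_subset
  have cG : ContinuousOn (fun θ => M.G θ (M.pastX t ω)) (M.nhd r) := fun θ hθ =>
    ((q4 θ hθ).1.continuousWithinAt).mono nhd_subset
  exact {
    lower := q1
    diffH := fun θ hθ => (q3 θ hθ).1
    diffG := fun θ hθ => (q4 θ hθ).1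
    lipH := fun θ hθ θ' hθ' θ'' hθ'' =>
      lip_of_lipSup hD cH cG q2 ENNReal.toReal_nonneg q5.le hθ hθ' hθ''
    lipG := fun θ hθ θ' hθ' θ'' hθ'' =>
      lip_of_lipSup hD (cG.pow 2) (cG.pow 2) (fun θ hθ => pow_pos (q2 θ hθ) 2)
        ENNReal.toReal_nonneg q6.le hθ hθ' hθ''
    boundH := fun θ hθ θ'' hθ'' =>
      le_of_ratioSup hD cH cG q2 ENNReal.toReal_nonneg q7.le hθ hθ'' }

/-- The inverse volatility as a function of the parameter and of the past. -/
noncomputable def wF (M : SeriesModel d Ω) (θ : Par d) (x : ℕ → ℝ) : ℝ := 1 / M.G θ x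

/-- The ratio of the conditional mean to the volatility. -/
noncomputable def qF (M : SeriesModel d Ω) (θ : Par d) (x : ℕ → ℝ) : ℝ := M.H θ x / M.G θ x

/-- The volatility relative to its value at `θ₀`. -/
noncomputable def sF (M : SeriesModel d Ω) (θ : Par d) (x : ℕ → ℝ) : ℝ := M.G θ x / M.G M.θ₀ x

/-- The increment of the conditional mean from `θ₀`, relative to the volatility at `θ₀`. -/
noncomputable def eF (M : SeriesModel d Ω) (θ : Par d) (x : ℕ → ℝ) : ℝ :=
  (M.H θ x - M.H M.θ₀ x) / M.G M.θ₀ x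

namespace Regular

variable {γ : ℝ} {A B E : (ℕ → ℝ) → ℝ} {x : ℕ → ℝ} {θ θ' : Par d}

lemma G_pos (h : M.Regular r γ A B E x) (hγ : 0 < γ) (hθ : θ ∈ M.Θ) : 0 < M.G θ x :=
  hγ.trans_le (h.lower θ hθ)

lemma wF_pos (h : M.Regular r γ A B E x) (hγ : 0 < γ) (hθ : θ ∈ M.Θ) : 0 < M.wF θ x :=
  one_div_pos.2 (h.G_pos hγ hθ)

lemma wF_le (h : M.Regular r γ A B E x) (hγ : 0 < γ) (hθ : θ ∈ M.Θ) : M.wF θ x ≤ 1 / γ :=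
  one_div_le_one_div_of_le hγ (h.lower θ hθ)

lemma sF_pos (h : M.Regular r γ A B E x) (hγ : 0 < γ) (h0 : M.θ₀ ∈ M.Θ) (hθ : θ ∈ M.Θ) :
    0 < M.sF θ x := div_pos (h.G_pos hγ hθ) (h.G_pos hγ h0)

lemma sF_θ₀ (h : M.Regular r γ A B E x) (hγ : 0 < γ) (h0 : M.θ₀ ∈ M.Θ) : M.sF M.θ₀ x = 1 :=
  div_self (h.G_pos hγ h0).ne'

lemma eF_θ₀ : M.eF M.θ₀ x = 0 := by simp [eF]

/-- The assumptions control the increments of `G²`, not of `G`; this is the factorisation of a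
difference of squares. The factor `s + s'` on the left is bounded below wherever the lemma is used.
-/
lemma abs_sF_sub (h : M.Regular r γ A B E x) (hγ : 0 < γ) (h0 : M.θ₀ ∈ M.nhd r)
    (hθ : θ ∈ M.nhd r) (hθ' : θ' ∈ M.nhd r) :
    |M.sF θ x - M.sF θ' x| * (M.sF θ x + M.sF θ' x) ≤ B x * ‖θ - θ'‖ := by
  have g0 := h.G_pos hγ (nhd_subset h0)
  have s1 := h.sF_pos hγ (nhd_subset h0) (nhd_subset hθ)
  have s2 := h.sF_pos hγ (nhd_subset h0) (nhd_subset hθ')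
  have := h.lipG θ hθ θ' hθ' _ h0
  rw [← div_le_iff₀ (pow_pos g0 2)] at this
  refine le_trans (le_of_eq ?_) this
  rw [← abs_of_pos (add_pos s1 s2), ← abs_mul, ← abs_of_pos (pow_pos g0 2), ← abs_div]
  congr 1
  simp only [sF]; field_simp; ring

lemma abs_sF_sub_one (h : M.Regular r γ A B E x) (hγ : 0 < γ) (h0 : M.θ₀ ∈ M.nhd r)
    (hθ : θ ∈ M.nhd r) : |M.sF θ x - 1| ≤ B x * ‖θ - M.θ₀‖ := by
  have h1 := h.abs_sF_sub hγ h0 hθ h0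
  have s1 := h.sF_pos hγ (nhd_subset h0) (nhd_subset hθ)
  rw [h.sF_θ₀ hγ (nhd_subset h0)] at h1
  nlinarith [abs_nonneg (M.sF θ x - 1)]

lemma abs_eF_sub (h : M.Regular r γ A B E x) (hγ : 0 < γ) (h0 : M.θ₀ ∈ M.nhd r)
    (hθ : θ ∈ M.nhd r) (hθ' : θ' ∈ M.nhd r) : |M.eF θ x - M.eF θ' x| ≤ A x * ‖θ - θ'‖ := by
  have g0 := h.G_pos hγ (nhd_subset h0)
  have := h.lipH θ hθ θ' hθ' _ h0
  rw [← div_le_iff₀ g0] at this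
  refine le_trans (le_of_eq ?_) this
  rw [← abs_of_pos g0, ← abs_div]
  congr 1
  simp only [eF]; field_simp; ring

lemma abs_eF (h : M.Regular r γ A B E x) (hγ : 0 < γ) (h0 : M.θ₀ ∈ M.nhd r)
    (hθ : θ ∈ M.nhd r) : |M.eF θ x| ≤ A x * ‖θ - M.θ₀‖ := by
  simpa [eF_θ₀] using h.abs_eF_sub hγ h0 hθ h0

lemma abs_wF_sub (h : M.Regular r γ A B E x) (hγ : 0 < γ) (h0 : M.θ₀ ∈ M.nhd r)
    (hθ : θ ∈ M.nhd r) : |M.wF θ x - M.wF M.θ₀ x| ≤ 1 / γ * (B x * ‖θ - M.θ₀‖) := by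
  have g0 := h.G_pos hγ (nhd_subset h0)
  have g1 := h.G_pos hγ (nhd_subset hθ)
  have e1 : M.wF θ x - M.wF M.θ₀ x = - (M.wF θ x * (M.sF θ x - 1)) := by
    simp only [wF, sF]; field_simp; ring
  rw [e1, abs_neg, abs_mul, abs_of_pos (h.wF_pos hγ (nhd_subset hθ))]
  exact mul_le_mul (h.wF_le hγ (nhd_subset hθ)) (h.abs_sF_sub_one hγ h0 hθ) (abs_nonneg _)
    (one_div_pos.2 hγ).le

lemma abs_qF (h : M.Regular r γ A B E x) (hγ : 0 < γ) (hθ : θ ∈ M.nhd r) : |M.qF θ x| ≤ E x := by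
  have g1 := h.G_pos hγ (nhd_subset hθ)
  rw [qF, abs_div, abs_of_pos g1, div_le_iff₀ g1]
  exact h.boundH θ hθ θ hθ

/-- The increment of the quotient is `(H - H₀)/G - q₀ (G - G₀)/G`. The envelopes hold relative to
`G` at any point of the neighbourhood, so both denominators may be taken at `θ`. -/
lemma abs_qF_sub (h : M.Regular r γ A B E x) (hγ : 0 < γ) (h0 : M.θ₀ ∈ M.nhd r)
    (hθ : θ ∈ M.nhd r) (hE : 0 ≤ E x) :
    |M.qF θ x - M.qF M.θ₀ x| ≤ (A x + E x * B x) * ‖θ - M.θ₀‖ := by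
  have g0 := h.G_pos hγ (nhd_subset h0)
  have g1 := h.G_pos hγ (nhd_subset hθ)
  have e1 : M.qF θ x - M.qF M.θ₀ x =
      (M.H θ x - M.H M.θ₀ x) / M.G θ x - M.qF M.θ₀ x * ((M.G θ x - M.G M.θ₀ x) / M.G θ x) := by
    simp only [qF]; field_simp; ring
  have e2 : |(M.H θ x - M.H M.θ₀ x) / M.G θ x| ≤ A x * ‖θ - M.θ₀‖ := by
    rw [abs_div, abs_of_pos g1, div_le_iff₀ g1]; exact h.lipH θ hθ _ h0 θ hθ
  have e3 : |(M.G θ x - M.G M.θ₀ x) / M.G θ x| ≤ B x * ‖θ - M.θ₀‖ := by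
    have h1 := h.lipG θ hθ _ h0 θ hθ
    have h2 : M.G θ x ^ 2 - M.G M.θ₀ x ^ 2 =
      (M.G θ x - M.G M.θ₀ x) * (M.G θ x + M.G M.θ₀ x) := by ring
    rw [h2, abs_mul, abs_of_pos (add_pos g1 g0)] at h1
    rw [abs_div, abs_of_pos g1, div_le_iff₀ g1]
    have h3 : |M.G θ x - M.G M.θ₀ x| * M.G θ x ≤ B x * ‖θ - M.θ₀‖ * M.G θ x * M.G θ x := by
      nlinarith [mul_nonneg (abs_nonneg (M.G θ x - M.G M.θ₀ x)) g0.le]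
    exact le_of_mul_le_mul_right h3 g1
  rw [e1]
  calc _ ≤ |(M.H θ x - M.H M.θ₀ x) / M.G θ x| +
        |M.qF M.θ₀ x * ((M.G θ x - M.G M.θ₀ x) / M.G θ x)| := abs_sub _ _
    _ ≤ A x * ‖θ - M.θ₀‖ + E x * (B x * ‖θ - M.θ₀‖) := by
      rw [abs_mul]
      exact add_le_add e2 (mul_le_mul (h.abs_qF hγ h0) e3 (abs_nonneg _) hE)
    _ = _ := by ring

end Regular

end SeriesModel

/-! ### Differentiation at `θ₀` of functions of the parameter and of the past -/

namespace SeriesModel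

variable {d : ℕ} {Ω : Type*} [MeasurableSpace Ω] {M : SeriesModel d Ω} {P : Measure Ω}
  [IsProbabilityMeasure P] {r : ℝ}

lemma Par.sum_single (v : Par d) : v = ∑ k, v k • (EuclideanSpace.single k (1 : ℝ) : Par d) := by
  ext i
  simp [Finset.sum_apply, Pi.single_apply]

/-- `g` is a measurable function of the past, differentiable over `Θ` at `θ₀`, with an integrable
Lipschitz envelope. -/
structure SmoothFunctional (M : SeriesModel d Ω) (P : Measure Ω) (r : ℝ)
    (g : Par d → (ℕ → ℝ) → ℝ) (Λ : (ℕ → ℝ) → ℝ) : Prop where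
  meas : ∀ θ ∈ M.nhd r, Measurable (g θ)
  measΛ : Measurable Λ
  Λ_nonneg : ∀ x, 0 ≤ Λ x
  intΛ : Integrable Λ (M.pastLaw P)
  cont : ∀ t, ∀ᵐ ω ∂P, ContinuousOn (fun θ => g θ (M.pastX t ω)) (M.nhd r)
  diff : ∀ t, ∀ᵐ ω ∂P, DifferentiableWithinAt ℝ (fun θ => g θ (M.pastX t ω)) M.Θ M.θ₀
  lip : ∀ t, ∀ᵐ ω ∂P, ∀ θ ∈ M.nhd r,
    |g θ (M.pastX t ω) - g M.θ₀ (M.pastX t ω)| ≤ Λ (M.pastX t ω) * ‖θ - M.θ₀‖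

/-- The derivative at `θ₀` over `Θ`. -/
noncomputable def derivAt (M : SeriesModel d Ω) (g : Par d → (ℕ → ℝ) → ℝ) (t : ℤ) (ω : Ω) :
    Par d →L[ℝ] ℝ := fderivWithin ℝ (fun θ => g θ (M.pastX t ω)) M.Θ M.θ₀

namespace SmoothFunctional

variable {g : Par d → (ℕ → ℝ) → ℝ} {Λ : (ℕ → ℝ) → ℝ}

lemma segment_mem (h1 : M.A1 r) (h0 : M.θ₀ ∈ M.nhd r) {θ : Par d} (hθ : θ ∈ M.nhd r) (k : ℕ) :
    M.θ₀ + (1 / ((k : ℝ) + 1)) • (θ - M.θ₀) ∈ M.nhd r := by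
  have hk : (0 : ℝ) < 1 / ((k : ℝ) + 1) := Nat.one_div_pos_of_nat
  have hk1 : 1 / ((k : ℝ) + 1) ≤ 1 := by
    rw [div_le_one (by positivity)]; linarith [Nat.cast_nonneg (α := ℝ) k]
  exact h1.convex.add_smul_sub_mem h0 hθ ⟨hk.le, hk1⟩

/-- By convexity the segment from `θ₀` to `θ` stays in the neighbourhood, so the derivative over `Θ`
is a limit along a sequence of parameters, hence a measurable function of the past. -/
lemma tendsto_quotient (hg : SmoothFunctional M P r g Λ) (h1 : M.A1 r) (h0 : M.θ₀ ∈ M.nhd r)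
    (t : ℤ) : ∀ᵐ ω ∂P, ∀ θ ∈ M.nhd r,
    Tendsto (fun k : ℕ => ((k : ℝ) + 1) *
      (g (M.θ₀ + (1 / ((k : ℝ) + 1)) • (θ - M.θ₀)) (M.pastX t ω) - g M.θ₀ (M.pastX t ω)))
      atTop (𝓝 (M.derivAt g t ω (θ - M.θ₀))) := by
  filter_upwards [hg.diff t] with ω hω θ hθ
  have h := hω.hasFDerivWithinAt.lim (l := (atTop : Filter ℕ)) (c := fun k => (k : ℝ) + 1)
    (d := fun k => (1 / ((k : ℝ) + 1)) • (θ - M.θ₀)) (v := θ - M.θ₀)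
    (by
      have : Tendsto (fun k : ℕ => (1 / ((k : ℝ) + 1)) • (θ - M.θ₀)) atTop
          (𝓝 ((0 : ℝ) • (θ - M.θ₀))) := tendsto_one_div_add_atTop_nhds_zero_nat.smul_const _
      simpa using this)
    (Eventually.of_forall fun k => nhd_subset (segment_mem h1 h0 hθ k))
    (by
      refine tendsto_const_nhds.congr fun k => ?_
      rw [smul_smul, mul_one_div_cancel (by positivity), one_smul])
  simp only [smul_eq_mul] at h
  exact h

/-- Each difference quotient along the segment obeys the Lipschitz bound, and so does the limit. -/
lemma abs_derivAt_le (hg : SmoothFunctional M P r g Λ) (h1 : M.A1 r) (h0 : M.θ₀ ∈ M.nhd r)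
    (t : ℤ) : ∀ᵐ ω ∂P, ∀ θ ∈ M.nhd r, |M.derivAt g t ω (θ - M.θ₀)| ≤ Λ (M.pastX t ω) * ‖θ - M.θ₀‖ := by
  filter_upwards [hg.tendsto_quotient h1 h0 t, hg.lip t] with ω hω hl θ hθ
  refine le_of_tendsto' (hω θ hθ).abs fun k => ?_
  have hk : (0 : ℝ) < (k : ℝ) + 1 := by positivity
  rw [abs_mul, abs_of_pos hk]
  have := hl _ (segment_mem h1 h0 hθ k)
  rw [add_sub_cancel_left, norm_smul, Real.norm_eq_abs, abs_of_pos (one_div_pos.2 hk)] at this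
  calc _ ≤ ((k : ℝ) + 1) * (Λ (M.pastX t ω) * (1 / ((k : ℝ) + 1) * ‖θ - M.θ₀‖)) := by gcongr
    _ = _ := by field_simp

/-- Directional derivatives are integrable functions of the past. -/
lemma exists_direction (hM : M.IsLocationScale P) (hg : SmoothFunctional M P r g Λ)
    (h1 : M.A1 r) (h0 : M.θ₀ ∈ M.nhd r) (v : Par d) :
    ∃ u : (ℕ → ℝ) → ℝ, Measurable u ∧ Integrable u (M.pastLaw P) ∧
      ∀ t, ∀ᵐ ω ∂P, M.derivAt g t ω v = u (M.pastX t ω) := by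
  -- The directions with the required property form a subspace; it is everything as soon as it
  -- contains `θ - θ₀` for `θ` in a set with an interior point.
  set V : Submodule ℝ (Par d) :=
    { carrier := {v | ∃ u : (ℕ → ℝ) → ℝ, Measurable u ∧ Integrable u (M.pastLaw P) ∧
        ∀ t, ∀ᵐ ω ∂P, M.derivAt g t ω v = u (M.pastX t ω)}
      add_mem' := by
        rintro a b ⟨u, hu1, hu2, hu3⟩ ⟨w, hw1, hw2, hw3⟩
        refine ⟨fun x => u x + w x, hu1.add hw1, hu2.add hw2, fun t => ?_⟩
        filter_upwards [hu3 t, hw3 t] with ω p q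
        rw [map_add, p, q]
      zero_mem' := ⟨fun _ => 0, measurable_const, integrable_zero _ _ _,
        fun t => Eventually.of_forall fun ω => map_zero _⟩
      smul_mem' := by
        rintro c a ⟨u, hu1, hu2, hu3⟩
        refine ⟨fun x => c * u x, hu1.const_mul c, hu2.const_mul c, fun t => ?_⟩
        filter_upwards [hu3 t] with ω p
        rw [map_smul, p, smul_eq_mul] } with hV
  have hmem : ∀ θ ∈ M.nhd r, θ - M.θ₀ ∈ V := by
    intro θ hθ
    -- The upper limit is defined and measurable at every sequence, and agrees with the derivative
    -- wherever the quotients converge.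
    set u : (ℕ → ℝ) → ℝ := fun x => limsup (fun k : ℕ => ((k : ℝ) + 1) *
      (g (M.θ₀ + (1 / ((k : ℝ) + 1)) • (θ - M.θ₀)) x - g M.θ₀ x)) atTop with hu
    have hum : Measurable u := Measurable.limsup fun k =>
      ((hg.meas _ (segment_mem h1 h0 hθ k)).sub (hg.meas _ h0)).const_mul _
    have hue : ∀ t, ∀ᵐ ω ∂P, M.derivAt g t ω (θ - M.θ₀) = u (M.pastX t ω) := by
      intro t
      filter_upwards [hg.tendsto_quotient h1 h0 t] with ω hω
      exact (hω θ hθ).limsup_eq.symm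
    refine ⟨u, hum, ?_, hue⟩
    have hi : Integrable (fun ω => u (M.pastX 0 ω)) P := by
      refine Integrable.mono' ((integrable_pastX hM 0 hg.intΛ).mul_const ‖θ - M.θ₀‖)
        (hum.comp (measurable_pastX hM 0)).aestronglyMeasurable ?_
      filter_upwards [hue 0, hg.abs_derivAt_le h1 h0 0] with ω p q
      rw [← p]; exact q θ hθ
    exact (integrable_map_measure hum.aestronglyMeasurable (measurable_pastX hM 0).aemeasurable).2 hi
  have htop : V = ⊤ := by
    refine Submodule.eq_top_of_nonempty_interior' V ?_
    obtain ⟨y, hy⟩ := h1.nonempty_interior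
    refine ⟨y - M.θ₀, ?_⟩
    rw [mem_interior_iff_mem_nhds] at hy ⊢
    have hc : Tendsto (fun z : Par d => z + M.θ₀) (𝓝 (y - M.θ₀)) (𝓝 y) := by
      have : Tendsto (fun z : Par d => z + M.θ₀) (𝓝 (y - M.θ₀)) (𝓝 (y - M.θ₀ + M.θ₀)) :=
        (continuous_id.add continuous_const).tendsto _
      rwa [sub_add_cancel] at this
    filter_upwards [hc hy] with z hz
    have := hmem _ hz
    rwa [add_sub_cancel_right] at this
  have : v ∈ V := by rw [htop]; trivial
  exact this

/-- The partial derivatives at `θ₀` as functions of the past. -/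
lemma exists_partials (hM : M.IsLocationScale P) (hg : SmoothFunctional M P r g Λ)
    (h1 : M.A1 r) (h0 : M.θ₀ ∈ M.nhd r) :
    ∃ F : Fin d → (ℕ → ℝ) → ℝ, (∀ k, Measurable (F k)) ∧ (∀ k, Integrable (F k) (M.pastLaw P)) ∧
      ∀ t, ∀ᵐ ω ∂P, ∀ v, M.derivAt g t ω v = ∑ k, v k * F k (M.pastX t ω) := by
  have := fun k : Fin d => hg.exists_direction hM h1 h0 (EuclideanSpace.single k (1 : ℝ))
  choose F hF1 hF2 hF3 using this
  refine ⟨F, hF1, hF2, fun t => ?_⟩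
  filter_upwards [ae_all_iff.2 fun k => hF3 k t] with ω hω v
  conv_lhs => rw [Par.sum_single v]
  rw [map_sum]
  exact Finset.sum_congr rfl fun k _ => by rw [map_smul, hω, smul_eq_mul]

/-- The first-order remainder at `θ₀`, uniformly over shrinking balls, is small in mean. -/
lemma exists_remainder (hM : M.IsLocationScale P) (hg : SmoothFunctional M P r g Λ)
    (h1 : M.A1 r) (h0 : M.θ₀ ∈ M.nhd r) {F : Fin d → (ℕ → ℝ) → ℝ} (hF : ∀ k, Measurable (F k))
    (hF3 : ∀ t, ∀ᵐ ω ∂P, ∀ v, M.derivAt g t ω v = ∑ k, v k * F k (M.pastX t ω))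
    {ρ : ℕ → ℝ} (hρ : Tendsto ρ atTop (𝓝 0)) :
    ∃ R : ℕ → (ℕ → ℝ) → ℝ, (∀ n, Measurable (R n)) ∧ (∀ n x, 0 ≤ R n x) ∧
      Tendsto (fun n => ∫⁻ x, ENNReal.ofReal (R n x) ∂(M.pastLaw P)) atTop (𝓝 0) ∧
      (∀ n, Integrable (R n) (M.pastLaw P)) ∧
      ∀ t, ∀ᵐ ω ∂P, ∀ n, ∀ θ ∈ M.nhd r, ‖θ - M.θ₀‖ < ρ n →
        |g θ (M.pastX t ω) - g M.θ₀ (M.pastX t ω) - M.derivAt g t ω (θ - M.θ₀)| ≤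
          R n (M.pastX t ω) * ‖θ - M.θ₀‖ := by
  obtain ⟨D, hD⟩ := exists_denseIn (N := M.nhd r) ⟨_, h0⟩
  set rem : Par d → (ℕ → ℝ) → ℝ := fun θ x =>
    g θ x - g M.θ₀ x - ∑ k, (θ - M.θ₀) k * F k x with hrem
  have hremm : ∀ k, Measurable (rem (D k)) := fun k =>
    ((hg.meas _ (hD.mem k)).sub (hg.meas _ h0)).sub
      (Finset.measurable_fun_sum _ fun j _ => (hF j).const_mul _)
  -- The normalised remainder, maximised over the points of a dense sequence in the ball of radius
  -- `ρ n`. It is at most `2Λ` and tends to zero pointwise by differentiability, hence also in mean.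
  -- A point equal to `θ₀` contributes `0/0 = 0`.
  set S : ℕ → (ℕ → ℝ) → ℝ≥0∞ := fun n x => ⨆ k,
    if ‖D k - M.θ₀‖ < ρ n then ENNReal.ofReal (|rem (D k) x| / ‖D k - M.θ₀‖) else 0 with hS
  have hSm : ∀ n, Measurable (S n) := by
    intro n
    refine Measurable.iSup fun k => ?_
    split_ifs
    · exact ((hremm k).abs.div_const _).ennreal_ofReal
    · exact measurable_const
  have hSb : ∀ᵐ ω ∂P, ∀ n, S n (M.pastX 0 ω) ≤ ENNReal.ofReal (2 * Λ (M.pastX 0 ω)) := by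
    filter_upwards [hg.lip 0, hF3 0, hg.abs_derivAt_le h1 h0 0]
      with ω a b c n
    refine iSup_le fun k => ?_
    split_ifs
    · refine ENNReal.ofReal_le_ofReal ?_
      refine div_le_of_le_mul₀ (norm_nonneg _) (mul_nonneg zero_le_two (hg.Λ_nonneg _)) ?_
      have e := c _ (hD.mem k)
      rw [b] at e
      calc |rem (D k) (M.pastX 0 ω)| ≤ |g (D k) (M.pastX 0 ω) - g M.θ₀ (M.pastX 0 ω)| +
            |∑ j, (D k - M.θ₀) j * F j (M.pastX 0 ω)| := abs_sub _ _
        _ ≤ _ := by linarith [a _ (hD.mem k)]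
    · exact bot_le
  have hSt : ∀ᵐ ω ∂P, Tendsto (fun n => S n (M.pastX 0 ω)) atTop (𝓝 0) := by
    filter_upwards [hg.diff 0, hF3 0] with ω a b
    rw [ENNReal.tendsto_nhds_zero]
    intro c hc
    rcases eq_or_ne c ∞ with rfl | hc'
    · exact Eventually.of_forall fun _ => le_top
    have hcr : 0 < c.toReal := ENNReal.toReal_pos hc.ne' hc'
    have hlo := (hasFDerivWithinAt_iff_isLittleO.1 a.hasFDerivWithinAt).def hcr
    rw [eventually_nhdsWithin_iff] at hlo
    obtain ⟨δ, hδ, hball⟩ := Metric.eventually_nhds_iff.1 hlo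
    filter_upwards [hρ.eventually_lt_const hδ] with n hn
    refine iSup_le fun k => ?_
    split_ifs with hk
    · rw [ENNReal.ofReal_le_iff_le_toReal hc']
      refine div_le_of_le_mul₀ (norm_nonneg _) hcr.le ?_
      have := hball (y := D k) (by rw [dist_eq_norm]; exact hk.trans hn) (nhd_subset (hD.mem k))
      have e : M.derivAt g 0 ω (D k - M.θ₀) = _ := b (D k - M.θ₀)
      simp only [derivAt] at e
      rw [e] at this
      exact this
    · exact bot_le
  have hlim : Tendsto (fun n => ∫⁻ x, S n x ∂(M.pastLaw P)) atTop (𝓝 0) := by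
    have hfun : (fun n => ∫⁻ x, S n x ∂(M.pastLaw P)) = fun n => ∫⁻ ω, S n (M.pastX 0 ω) ∂P :=
      funext fun n => (lintegral_pastX hM 0 (hSm n)).symm
    rw [hfun]
    have := tendsto_lintegral_of_dominated_convergence (μ := P)
      (F := fun n ω => S n (M.pastX 0 ω)) (f := fun _ => 0)
      (fun ω => ENNReal.ofReal (2 * Λ (M.pastX 0 ω)))
      (fun n => (hSm n).comp (measurable_pastX hM 0))
      (fun n => by filter_upwards [hSb] with ω hω using hω n)
      (by
        have := (integrable_pastX hM 0 hg.intΛ).const_mul 2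
        rw [← ofReal_integral_eq_lintegral_ofReal this
          (Eventually.of_forall fun ω => mul_nonneg zero_le_two (hg.Λ_nonneg _))]
        exact ENNReal.ofReal_ne_top)
      hSt
    simpa using this
  have hfinI : ∀ n, ∫⁻ x, S n x ∂(M.pastLaw P) ≠ ∞ := by
    intro n
    rw [← lintegral_pastX hM 0 (hSm n)]
    refine ne_top_of_le_ne_top ?_ (lintegral_mono_ae (hSb.mono fun ω hω => hω n))
    have := (integrable_pastX hM 0 hg.intΛ).const_mul 2
    rw [← ofReal_integral_eq_lintegral_ofReal this
      (Eventually.of_forall fun ω => mul_nonneg zero_le_two (hg.Λ_nonneg _))]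
    exact ENNReal.ofReal_ne_top
  have hfin : ∀ t, ∀ᵐ ω ∂P, ∀ n, S n (M.pastX t ω) < ∞ := by
    intro t
    rw [ae_all_iff]
    intro n
    have := ae_lt_top (hSm n) (hfinI n)
    rw [← map_pastX hM t] at this
    exact ae_of_ae_map (measurable_pastX hM t).aemeasurable this
  refine ⟨fun n x => (S n x).toReal, fun n => (hSm n).ennreal_toReal,
    fun n x => ENNReal.toReal_nonneg, ?_,
    fun n => integrable_toReal_of_lintegral_ne_top (hSm n).aemeasurable (hfinI n), fun t => ?_⟩
  · refine tendsto_of_tendsto_of_tendsto_of_le_of_le tendsto_const_nhds hlim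
      (fun n => bot_le) fun n => lintegral_mono fun x => ENNReal.ofReal_toReal_le
  · filter_upwards [hfin t, hg.cont t, hF3 t] with ω a b c n θ hθ hθρ
    have key : ∀ k, ‖D k - M.θ₀‖ < ρ n → |g (D k) (M.pastX t ω) - g M.θ₀ (M.pastX t ω) -
        M.derivAt g t ω (D k - M.θ₀)| ≤ (S n (M.pastX t ω)).toReal * ‖D k - M.θ₀‖ := by
      intro k hk
      have h2 : ENNReal.ofReal (|rem (D k) (M.pastX t ω)| / ‖D k - M.θ₀‖) ≤ S n (M.pastX t ω) := by
        have := le_iSup (fun k => if ‖D k - M.θ₀‖ < ρ n then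
          ENNReal.ofReal (|rem (D k) (M.pastX t ω)| / ‖D k - M.θ₀‖) else 0) k
        rwa [if_pos hk] at this
      rw [ENNReal.ofReal_le_iff_le_toReal (a n).ne] at h2
      rcases eq_or_ne (D k) M.θ₀ with h3 | h3
      · simp [h3]
      · rw [div_le_iff₀ (norm_pos_iff.2 (sub_ne_zero.2 h3))] at h2
        rw [c]; exact h2
    -- The bound passes from the sequence to `θ` by continuity; the strict inequality `‖θ - θ₀‖ < ρ
    -- n` keeps the approximating points in the ball.
    obtain ⟨φ, hφ⟩ := hD.exists_tendsto hθ
    have hφ' := tendsto_nhds_of_tendsto_nhdsWithin hφ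
    have t1 := (b θ hθ).tendsto.comp hφ
    have t2 := hφ'.sub_const M.θ₀
    have t3 := ((M.derivAt g t ω).continuous.tendsto _).comp t2
    refine le_of_tendsto_of_tendsto ((t1.sub_const _).sub t3).abs (t2.norm.const_mul _) ?_
    filter_upwards [t2.norm.eventually_lt_const hθρ] with j hj
    exact key _ hj

end SmoothFunctional

end SeriesModel

/-! ### First-order behaviour of `w`, `q`, `s` and `e` -/

namespace SeriesModel

variable {d : ℕ} {Ω : Type*} [MeasurableSpace Ω] {M : SeriesModel d Ω} {P : Measure Ω}
  [IsProbabilityMeasure P] {r γ : ℝ} {A B E : (ℕ → ℝ) → ℝ}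

lemma differentiableWithinAt_div {a b : Par d → ℝ} {S : Set (Par d)} {z : Par d}
    (ha : DifferentiableWithinAt ℝ a S z) (hb : DifferentiableWithinAt ℝ b S z) (hz : b z ≠ 0) :
    DifferentiableWithinAt ℝ (fun x => a x / b x) S z := by
  simp_rw [div_eq_mul_inv]
  exact ha.mul (hb.inv hz)

lemma measurable_wF (hM : M.IsLocationScale P) {θ : Par d} (hθ : θ ∈ M.Θ) :
    Measurable (M.wF θ) := measurable_const.div (measurable_G hM hθ)

lemma measurable_qF (hM : M.IsLocationScale P) {θ : Par d} (hθ : θ ∈ M.Θ) :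
    Measurable (M.qF θ) := (measurable_H hM hθ).div (measurable_G hM hθ)

lemma measurable_sF (hM : M.IsLocationScale P) {θ : Par d} (hθ : θ ∈ M.Θ) :
    Measurable (M.sF θ) := (measurable_G hM hθ).div (measurable_G hM hM.θ₀_mem)

lemma measurable_eF (hM : M.IsLocationScale P) {θ : Par d} (hθ : θ ∈ M.Θ) :
    Measurable (M.eF θ) :=
  ((measurable_H hM hθ).sub (measurable_H hM hM.θ₀_mem)).div (measurable_G hM hM.θ₀_mem)

/-- The envelope of all the first-order quantities. -/
def env (A B E : (ℕ → ℝ) → ℝ) (x : ℕ → ℝ) : ℝ := 1 + A x + B x + E x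

namespace Envelopes

lemma one_le_env (h : M.Envelopes P r γ A B E) (x : ℕ → ℝ) : 1 ≤ env A B E x := by
  have := h.A_nonneg x; have := h.B_nonneg x; have := h.E_nonneg x
  simp only [env]; linarith

lemma A_le_env (h : M.Envelopes P r γ A B E) (x : ℕ → ℝ) : A x ≤ env A B E x := by
  have := h.A_nonneg x; have := h.B_nonneg x; have := h.E_nonneg x
  simp only [env]; linarith

lemma B_le_env (h : M.Envelopes P r γ A B E) (x : ℕ → ℝ) : B x ≤ env A B E x := by
  have := h.A_nonneg x; have := h.B_nonneg x; have := h.E_nonneg x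
  simp only [env]; linarith

lemma E_le_env (h : M.Envelopes P r γ A B E) (x : ℕ → ℝ) : E x ≤ env A B E x := by
  have := h.A_nonneg x; have := h.B_nonneg x; have := h.E_nonneg x
  simp only [env]; linarith

/-- The product `E B` comes from differentiating the quotient `q`; because of it, increments of `L`
are bounded by the square of the envelope. -/
lemma AEB_le_env (h : M.Envelopes P r γ A B E) (x : ℕ → ℝ) :
    A x + E x * B x ≤ env A B E x ^ 2 := by
  have := h.A_nonneg x; have := h.B_nonneg x; have := h.E_nonneg x
  simp only [env]
  nlinarith [mul_nonneg ‹0 ≤ A x› ‹0 ≤ B x›, mul_nonneg ‹0 ≤ A x› ‹0 ≤ E x›,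
    mul_nonneg ‹0 ≤ E x› ‹0 ≤ B x›, sq_nonneg (A x), sq_nonneg (B x), sq_nonneg (E x)]

lemma measurable_env (h : M.Envelopes P r γ A B E) : Measurable (env A B E) :=
  ((measurable_const.add h.measA).add h.measB).add h.measE

/-- Two moments are all that is available, `E` having no more. -/
lemma integrable_env_sq (hM : M.IsLocationScale P) (h : M.Envelopes P r γ A B E) :
    Integrable (fun x => env A B E x ^ 2) (M.pastLaw P) := by
  have := isProbabilityMeasure_pastLaw hM
  refine Integrable.mono' (g := fun x => 4 * (3 + A x ^ 3 + B x ^ 3 + E x ^ 2))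
    (((((integrable_const 3).add h.intA).add h.intB).add h.intE).const_mul 4)
    (h.measurable_env.pow_const 2).aestronglyMeasurable (Eventually.of_forall fun x => ?_)
  have a0 := h.A_nonneg x; have b0 := h.B_nonneg x; have e0 := h.E_nonneg x
  rw [Real.norm_eq_abs, abs_of_nonneg (sq_nonneg _), env]
  have hc : ∀ a : ℝ, 0 ≤ a → a ^ 2 ≤ 1 + a ^ 3 := fun a ha => by
    rcases le_total a 1 with h1 | h1
    · have : a ^ 2 ≤ 1 := pow_le_one₀ ha h1
      have : 0 ≤ a ^ 3 := pow_nonneg ha 3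
      linarith
    · have : a ^ 2 ≤ a ^ 3 := pow_le_pow_right₀ h1 (by norm_num)
      linarith
  have ha := hc _ a0
  have hb := hc _ b0
  have : (1 + A x + B x + E x) ^ 2 ≤ 4 * (1 + A x ^ 2 + B x ^ 2 + E x ^ 2) := by
    nlinarith [sq_nonneg (1 - A x), sq_nonneg (1 - B x), sq_nonneg (1 - E x),
      sq_nonneg (A x - B x), sq_nonneg (A x - E x), sq_nonneg (B x - E x)]
  linarith

lemma integrable_env (hM : M.IsLocationScale P) (h : M.Envelopes P r γ A B E) :
    Integrable (env A B E) (M.pastLaw P) := by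
  refine Integrable.mono' (h.integrable_env_sq hM) h.measurable_env.aestronglyMeasurable
    (Eventually.of_forall fun x => ?_)
  have := h.one_le_env x
  rw [Real.norm_eq_abs, abs_of_nonneg (by linarith)]
  nlinarith

lemma integrable_of_le_env (hM : M.IsLocationScale P) (h : M.Envelopes P r γ A B E)
    {u : (ℕ → ℝ) → ℝ} (hu : Measurable u) (h0 : ∀ x, 0 ≤ u x) (hle : ∀ x, u x ≤ env A B E x ^ 2) :
    Integrable u (M.pastLaw P) :=
  Integrable.mono' (h.integrable_env_sq hM) hu.aestronglyMeasurable
    (Eventually.of_forall fun x => by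
      rw [Real.norm_eq_abs, abs_of_nonneg (h0 x)]; exact hle x)

lemma le_env_sq (h : M.Envelopes P r γ A B E) (x : ℕ → ℝ) : env A B E x ≤ env A B E x ^ 2 := by
  have := h.one_le_env x; nlinarith

lemma smooth_wF (hM : M.IsLocationScale P) (h : M.Envelopes P r γ A B E) (hr : 0 < r) :
    SmoothFunctional M P r M.wF (fun x => 1 / γ * B x) where
  meas θ hθ := measurable_wF hM (nhd_subset hθ)
  measΛ := h.measB.const_mul _
  Λ_nonneg x := mul_nonneg (one_div_pos.2 h.γ_pos).le (h.B_nonneg x)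
  intΛ := (h.integrable_of_le_env hM h.measB h.B_nonneg
    fun x => (h.B_le_env x).trans (h.le_env_sq x)).const_mul _
  cont t := by
    filter_upwards [h.regular t] with ω hω θ hθ
    exact continuousWithinAt_const.div ((hω.diffG θ hθ).continuousWithinAt.mono nhd_subset)
      (hω.G_pos h.γ_pos (nhd_subset hθ)).ne'
  diff t := by
    filter_upwards [h.regular t] with ω hω
    exact differentiableWithinAt_div (differentiableWithinAt_const _) (hω.diffG _ (θ₀_mem_nhd hM hr))
      (hω.G_pos h.γ_pos hM.θ₀_mem).ne'
  lip t := by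
    filter_upwards [h.regular t] with ω hω θ hθ
    rw [mul_assoc]
    exact hω.abs_wF_sub h.γ_pos (θ₀_mem_nhd hM hr) hθ

lemma smooth_qF (hM : M.IsLocationScale P) (h : M.Envelopes P r γ A B E) (hr : 0 < r) :
    SmoothFunctional M P r M.qF (fun x => A x + E x * B x) where
  meas θ hθ := measurable_qF hM (nhd_subset hθ)
  measΛ := h.measA.add (h.measE.mul h.measB)
  Λ_nonneg x := add_nonneg (h.A_nonneg x) (mul_nonneg (h.E_nonneg x) (h.B_nonneg x))
  intΛ := h.integrable_of_le_env hM (h.measA.add (h.measE.mul h.measB))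
    (fun x => add_nonneg (h.A_nonneg x) (mul_nonneg (h.E_nonneg x) (h.B_nonneg x))) h.AEB_le_env
  cont t := by
    filter_upwards [h.regular t] with ω hω θ hθ
    exact ((hω.diffH θ hθ).continuousWithinAt.mono nhd_subset).div
      ((hω.diffG θ hθ).continuousWithinAt.mono nhd_subset)
      (hω.G_pos h.γ_pos (nhd_subset hθ)).ne'
  diff t := by
    filter_upwards [h.regular t] with ω hω
    exact differentiableWithinAt_div (hω.diffH _ (θ₀_mem_nhd hM hr)) (hω.diffG _ (θ₀_mem_nhd hM hr))
      (hω.G_pos h.γ_pos hM.θ₀_mem).ne'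
  lip t := by
    filter_upwards [h.regular t] with ω hω θ hθ
    exact hω.abs_qF_sub h.γ_pos (θ₀_mem_nhd hM hr) hθ (h.E_nonneg _)

lemma smooth_sF (hM : M.IsLocationScale P) (h : M.Envelopes P r γ A B E) (hr : 0 < r) :
    SmoothFunctional M P r M.sF B where
  meas θ hθ := measurable_sF hM (nhd_subset hθ)
  measΛ := h.measB
  Λ_nonneg := h.B_nonneg
  intΛ := h.integrable_of_le_env hM h.measB h.B_nonneg
    fun x => (h.B_le_env x).trans (h.le_env_sq x)
  cont t := by
    filter_upwards [h.regular t] with ω hω θ hθ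
    exact ((hω.diffG θ hθ).continuousWithinAt.mono nhd_subset).div_const _
  diff t := by
    filter_upwards [h.regular t] with ω hω
    exact differentiableWithinAt_div (hω.diffG _ (θ₀_mem_nhd hM hr)) (differentiableWithinAt_const _)
      (hω.G_pos h.γ_pos hM.θ₀_mem).ne'
  lip t := by
    filter_upwards [h.regular t] with ω hω θ hθ
    rw [hω.sF_θ₀ h.γ_pos hM.θ₀_mem]
    exact hω.abs_sF_sub_one h.γ_pos (θ₀_mem_nhd hM hr) hθ

lemma smooth_eF (hM : M.IsLocationScale P) (h : M.Envelopes P r γ A B E) (hr : 0 < r) :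
    SmoothFunctional M P r M.eF A where
  meas θ hθ := measurable_eF hM (nhd_subset hθ)
  measΛ := h.measA
  Λ_nonneg := h.A_nonneg
  intΛ := h.integrable_of_le_env hM h.measA h.A_nonneg
    fun x => (h.A_le_env x).trans (h.le_env_sq x)
  cont t := by
    filter_upwards [h.regular t] with ω hω θ hθ
    exact (((hω.diffH θ hθ).continuousWithinAt.mono nhd_subset).sub
      continuousWithinAt_const).div_const _
  diff t := by
    filter_upwards [h.regular t] with ω hω
    exact differentiableWithinAt_div
      ((hω.diffH _ (θ₀_mem_nhd hM hr)).sub (differentiableWithinAt_const _)) (differentiableWithinAt_const _) (hω.G_pos h.γ_pos hM.θ₀_mem).ne'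
  lip t := by
    filter_upwards [h.regular t] with ω hω θ hθ
    rw [Regular.eF_θ₀, sub_zero]
    exact hω.abs_eF h.γ_pos (θ₀_mem_nhd hM hr) hθ

end Envelopes

/-- The linear form with coefficients `F k x`. -/
def lin (F : Fin d → (ℕ → ℝ) → ℝ) (x : ℕ → ℝ) (v : Par d) : ℝ := ∑ k, v k * F k x

/-- The partial derivatives of `w`, `q`, `s`, `e` at `θ₀` as functions of the past. -/
structure Partials (M : SeriesModel d Ω) (P : Measure Ω) (r γ : ℝ) (A B E : (ℕ → ℝ) → ℝ)
    (Fw Fq Fs Fe : Fin d → (ℕ → ℝ) → ℝ) : Prop where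
  measw : ∀ k, Measurable (Fw k)
  measq : ∀ k, Measurable (Fq k)
  meass : ∀ k, Measurable (Fs k)
  mease : ∀ k, Measurable (Fe k)
  intw : ∀ k, Integrable (Fw k) (M.pastLaw P)
  intq : ∀ k, Integrable (Fq k) (M.pastLaw P)
  ints : ∀ k, Integrable (Fs k) (M.pastLaw P)
  inte : ∀ k, Integrable (Fe k) (M.pastLaw P)
  bound : ∀ t, ∀ᵐ ω ∂P, ∀ θ ∈ M.nhd r,
    |lin Fw (M.pastX t ω) (θ - M.θ₀)| ≤ 1 / γ * env A B E (M.pastX t ω) * ‖θ - M.θ₀‖ ∧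
    |lin Fq (M.pastX t ω) (θ - M.θ₀)| ≤ env A B E (M.pastX t ω) ^ 2 * ‖θ - M.θ₀‖ ∧
    |lin Fs (M.pastX t ω) (θ - M.θ₀)| ≤ env A B E (M.pastX t ω) * ‖θ - M.θ₀‖ ∧
    |lin Fe (M.pastX t ω) (θ - M.θ₀)| ≤ env A B E (M.pastX t ω) * ‖θ - M.θ₀‖
  remainder : ∀ ρ : ℕ → ℝ, Tendsto ρ atTop (𝓝 0) → ∃ R : ℕ → (ℕ → ℝ) → ℝ,
    (∀ n, Measurable (R n)) ∧ (∀ n x, 0 ≤ R n x) ∧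
    Tendsto (fun n => ∫⁻ x, ENNReal.ofReal (R n x) ∂(M.pastLaw P)) atTop (𝓝 0) ∧
    (∀ n, Integrable (R n) (M.pastLaw P)) ∧
    ∀ t, ∀ᵐ ω ∂P, ∀ n, ∀ θ ∈ M.nhd r, ‖θ - M.θ₀‖ < ρ n →
      |M.wF θ (M.pastX t ω) - M.wF M.θ₀ (M.pastX t ω) - lin Fw (M.pastX t ω) (θ - M.θ₀)| ≤
        R n (M.pastX t ω) * ‖θ - M.θ₀‖ ∧
      |M.qF θ (M.pastX t ω) - M.qF M.θ₀ (M.pastX t ω) - lin Fq (M.pastX t ω) (θ - M.θ₀)| ≤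
        R n (M.pastX t ω) * ‖θ - M.θ₀‖ ∧
      |M.sF θ (M.pastX t ω) - 1 - lin Fs (M.pastX t ω) (θ - M.θ₀)| ≤
        R n (M.pastX t ω) * ‖θ - M.θ₀‖ ∧
      |M.eF θ (M.pastX t ω) - lin Fe (M.pastX t ω) (θ - M.θ₀)| ≤
        R n (M.pastX t ω) * ‖θ - M.θ₀‖

lemma exists_partials (hM : M.IsLocationScale P) (h : M.Envelopes P r γ A B E) (hr : 0 < r)
    (h1 : M.A1 r) : ∃ Fw Fq Fs Fe, M.Partials P r γ A B E Fw Fq Fs Fe := by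
  have h0 := θ₀_mem_nhd hM hr
  have sw := h.smooth_wF hM hr
  have sq := h.smooth_qF hM hr
  have ss := h.smooth_sF hM hr
  have se := h.smooth_eF hM hr
  obtain ⟨Fw, w1, w2, w3⟩ := sw.exists_partials hM h1 h0
  obtain ⟨Fq, q1, q2, q3⟩ := sq.exists_partials hM h1 h0
  obtain ⟨Fs, s1, s2, s3⟩ := ss.exists_partials hM h1 h0
  obtain ⟨Fe, e1, e2, e3⟩ := se.exists_partials hM h1 h0
  refine ⟨Fw, Fq, Fs, Fe, w1, q1, s1, e1, w2, q2, s2, e2, fun t => ?_, fun ρ hρ => ?_⟩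
  · filter_upwards [sw.abs_derivAt_le h1 h0 t, sq.abs_derivAt_le h1 h0 t,
      ss.abs_derivAt_le h1 h0 t, se.abs_derivAt_le h1 h0 t, w3 t, q3 t, s3 t, e3 t] with ω
      bw bq bs be dw dq ds de θ hθ
    have hγ := one_div_pos.2 h.γ_pos
    refine ⟨?_, ?_, ?_, ?_⟩
    · have := bw θ hθ
      rw [dw] at this
      refine this.trans ?_
      gcongr; exact h.B_le_env _
    · have := bq θ hθ
      rw [dq] at this
      refine this.trans ?_
      gcongr; exact h.AEB_le_env _
    · have := bs θ hθ
      rw [ds] at this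
      refine this.trans ?_
      gcongr; exact h.B_le_env _
    · have := be θ hθ
      rw [de] at this
      refine this.trans ?_
      gcongr; exact h.A_le_env _
  · obtain ⟨Rw, w4, w5, w6, w7, w8⟩ := sw.exists_remainder hM h1 h0 w1 w3 hρ
    obtain ⟨Rq, q4, q5, q6, q7, q8⟩ := sq.exists_remainder hM h1 h0 q1 q3 hρ
    obtain ⟨Rs, s4, s5, s6, s7, s8⟩ := ss.exists_remainder hM h1 h0 s1 s3 hρ
    obtain ⟨Re, e4, e5, e6, e7, e8⟩ := se.exists_remainder hM h1 h0 e1 e3 hρ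
    refine ⟨fun n x => Rw n x + Rq n x + Rs n x + Re n x,
      fun n => (((w4 n).add (q4 n)).add (s4 n)).add (e4 n),
      fun n x => add_nonneg (add_nonneg (add_nonneg (w5 n x) (q5 n x)) (s5 n x)) (e5 n x), ?_,
      fun n => (((w7 n).add (q7 n)).add (s7 n)).add (e7 n), fun t => ?_⟩
    · have hsum : ∀ n, ∫⁻ x, ENNReal.ofReal (Rw n x + Rq n x + Rs n x + Re n x) ∂(M.pastLaw P) =
          ∫⁻ x, ENNReal.ofReal (Rw n x) ∂(M.pastLaw P) + ∫⁻ x, ENNReal.ofReal (Rq n x) ∂(M.pastLaw P) +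
          ∫⁻ x, ENNReal.ofReal (Rs n x) ∂(M.pastLaw P) +
          ∫⁻ x, ENNReal.ofReal (Re n x) ∂(M.pastLaw P) := by
        intro n
        rw [← lintegral_add_left (w4 n).ennreal_ofReal,
          ← lintegral_add_right _ (s4 n).ennreal_ofReal,
          ← lintegral_add_right _ (e4 n).ennreal_ofReal]
        refine lintegral_congr fun x => ?_
        have a1 := w5 n x; have a2 := q5 n x; have a3 := s5 n x; have a4 := e5 n x
        rw [ENNReal.ofReal_add (by positivity) a4, ENNReal.ofReal_add (by positivity) a3,
          ENNReal.ofReal_add a1 a2]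
      simp_rw [hsum]
      simpa using ((w6.add q6).add s6).add e6
    · filter_upwards [w8 t, q8 t, s8 t, e8 t, w3 t, q3 t, s3 t, e3 t, h.regular t] with ω
        bw bq bs be dw dq ds de hreg n θ hθ hθρ
      have a1 := w5 n (M.pastX t ω); have a2 := q5 n (M.pastX t ω)
      have a3 := s5 n (M.pastX t ω); have a4 := e5 n (M.pastX t ω)
      have cw := bw n θ hθ hθρ
      have cq := bq n θ hθ hθρ
      have cs := bs n θ hθ hθρ
      have ce := be n θ hθ hθρ
      rw [dw] at cw
      rw [dq] at cq
      rw [ds, hreg.sF_θ₀ h.γ_pos hM.θ₀_mem] at cs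
      rw [de, Regular.eF_θ₀, sub_zero] at ce
      refine ⟨cw.trans ?_, cq.trans ?_, cs.trans ?_, ce.trans ?_⟩ <;> gcongr <;> linarith

end SeriesModel

/-! ### Affine changes of variables -/

lemma lintegral_affine {h : ℝ → ℝ≥0∞} (hh : Measurable h) {s : ℝ} (hs : 0 < s) (e : ℝ) :
    ∫⁻ y, h y = ENNReal.ofReal s * ∫⁻ x, h (s * x + e) := by
  have h1 : ∫⁻ y, h y = ∫⁻ y, h (y + e) := (lintegral_add_right_eq_self h e).symm
  have h2 : Measurable fun y => h (y + e) := hh.comp (measurable_id.add_const e)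
  rw [h1]
  conv_lhs => rw [← Real.smul_map_volume_mul_left hs.ne']
  rw [lintegral_smul_measure, lintegral_map h2 (measurable_const_mul s), abs_of_pos hs, smul_eq_mul]

/-- The substitution `y = s (x - b z) + e`, carried out as a translation, a dilation by `s`, a
reflection through `x` and a dilation by `b`. -/
lemma integral_scaledKernel_affine (K f : ℝ → ℝ) {b s : ℝ} (hb : 0 < b) (hs : 0 < s) (e x : ℝ) :
    ∫ y, scaledKernel K b (x - (y - e) / s) * f y =
      ∫ z, K z * (s * f (s * (x - b * z) + e)) := by
  set φ : ℝ → ℝ := fun y => scaledKernel K b (x - (y - e) / s) * f y with hφ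
  have h1 : ∫ y, φ y = ∫ y, φ (y + e) := (integral_add_right_eq_self φ e).symm
  have h2 : ∫ u, φ (s * u + e) = s⁻¹ * ∫ y, φ (y + e) := by
    have := Measure.integral_comp_mul_left (fun y => φ (y + e)) s
    rwa [abs_of_pos (inv_pos.2 hs), smul_eq_mul] at this
  have h3 : ∫ u, φ (s * (x - u) + e) = ∫ u, φ (s * u + e) :=
    integral_sub_left_eq_self (fun u => φ (s * u + e)) volume x
  have h4 : ∫ z, φ (s * (x - b * z) + e) = b⁻¹ * ∫ u, φ (s * (x - u) + e) := by
    have := Measure.integral_comp_mul_left (fun u => φ (s * (x - u) + e)) b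
    rwa [abs_of_pos (inv_pos.2 hb), smul_eq_mul] at this
  have h5 : ∫ y, φ y = (s * b) * ∫ z, φ (s * (x - b * z) + e) := by
    rw [h4, h3, h2, ← h1]; field_simp
  rw [h5, ← integral_const_mul]
  refine integral_congr_ae (Eventually.of_forall fun z => ?_)
  simp only [hφ, scaledKernel]
  have e1 : (x - (s * (x - b * z) + e - e) / s) / b = z := by field_simp; ring
  rw [e1]; field_simp

/-! ### The density of the residuals -/

namespace SeriesModel

variable {d : ℕ} {Ω : Type*} [MeasurableSpace Ω] {M : SeriesModel d Ω} {P : Measure Ω}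
  [IsProbabilityMeasure P] {r γ : ℝ} {A B E : (ℕ → ℝ) → ℝ} {fε : ℝ → ℝ}

lemma A5.exists_smoothBdd (h : M.A5 P fε) : ∃ F, SmoothBdd fε F := by
  obtain ⟨C0, h0⟩ := h.bdd
  obtain ⟨C1, h1⟩ := h.bdd_deriv
  obtain ⟨C2, h2⟩ := h.bdd_deriv2
  have m0 : C0 ≤ max 1 (max C0 (max C1 C2)) := (le_max_left _ _).trans (le_max_right _ _)
  have m1 : C1 ≤ max 1 (max C0 (max C1 C2)) :=
    ((le_max_left _ _).trans (le_max_right _ _)).trans (le_max_right _ _)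
  have m2 : C2 ≤ max 1 (max C0 (max C1 C2)) :=
    ((le_max_right _ _).trans (le_max_right _ _)).trans (le_max_right _ _)
  refine ⟨max 1 (max C0 (max C1 C2)), le_max_left _ _, h.diff, fun x => (h0 x).trans m0,
    fun x => (h1 x).trans m1, fun x y => ?_⟩
  have := Convex.norm_image_sub_le_of_norm_deriv_le (f := deriv fε) (s := Set.univ) (C := C2)
    (fun x _ => h.diff_deriv x) (fun x _ => h2 x) convex_univ (Set.mem_univ y) (Set.mem_univ x)
  simp only [Real.norm_eq_abs] at this
  exact this.trans (by gcongr)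

lemma lintegral_noise (h : M.A5 P fε) {u : ℝ → ℝ≥0∞} (hu : Measurable u) :
    ∫⁻ y, u y ∂(P.map (M.noise 0)) = ∫⁻ y, u y * ENNReal.ofReal (fε y) := by
  rw [h.law, lintegral_withDensity_eq_lintegral_mul _ h.diff.continuous.measurable.ennreal_ofReal hu]
  exact lintegral_congr fun y => mul_comm _ _

lemma integral_noise (h : M.A5 P fε) (u : ℝ → ℝ) :
    ∫ y, u y ∂(P.map (M.noise 0)) = ∫ y, u y * fε y := by
  rw [h.law, integral_withDensity_eq_integral_toReal_smul
    h.diff.continuous.measurable.ennreal_ofReal (Eventually.of_forall fun _ => ENNReal.ofReal_lt_top)]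
  refine integral_congr_ae (Eventually.of_forall fun y => ?_)
  simp only [ENNReal.toReal_ofReal (h.nonneg y), smul_eq_mul, mul_comm]

/-- Independence of the past and of the present noise, and Tonelli: the noise may be integrated with
the past frozen. -/
lemma lintegral_pastX_noise (hM : M.IsLocationScale P) (t : ℤ) {u : (ℕ → ℝ) × ℝ → ℝ≥0∞}
    (hu : Measurable u) : ∫⁻ ω, u (M.pastX t ω, M.noise t ω) ∂P =
      ∫⁻ ω, ∫⁻ y, u (M.pastX t ω, y) ∂(P.map (M.noise 0)) ∂P := by
  have hmap := (indepFun_iff_map_prod_eq_prod_map_map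
    (measurable_pastX hM t).aemeasurable (hM.noise_meas t).aemeasurable).1
    (indepFun_pastX_noise hM t)
  rw [(hM.noise_ident t).map_eq] at hmap
  rw [← lintegral_map hu ((measurable_pastX hM t).prodMk (hM.noise_meas t)), hmap,
    lintegral_prod _ hu.aemeasurable, lintegral_map hu.lintegral_prod_right' (measurable_pastX hM t)]

/-- The model equation at `θ₀` substituted in the residual at `θ`. This reduces everything to the
noise and to two functions of its past, equal to `1` and `0` at `θ₀`. -/
lemma resid_ae_eq (hM : M.IsLocationScale P) (h : M.Envelopes P r γ A B E) (t : ℤ) :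
    ∀ᵐ ω ∂P, ∀ θ ∈ M.Θ, M.resid t θ ω =
      (M.noise t ω - M.eF θ (M.pastX t ω)) / M.sF θ (M.pastX t ω) := by
  filter_upwards [h.regular t, hM.X_eq t] with ω hω hX θ hθ
  have g0 := hω.G_pos h.γ_pos hM.θ₀_mem
  have g1 := hω.G_pos h.γ_pos hθ
  have e1 : M.m t M.θ₀ ω = M.H M.θ₀ (M.pastX t ω) := rfl
  have e2 : M.σ t M.θ₀ ω = M.G M.θ₀ (M.pastX t ω) := rfl
  have e3 : M.m t θ ω = M.H θ (M.pastX t ω) := rfl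
  have e4 : M.σ t θ ω = M.G θ (M.pastX t ω) := rfl
  rw [resid, hX, e1, e2, e3, e4, eF, sF]
  field_simp
  ring

/-- The density of the residual at `θ`, as a mixture of affine images of the noise density. -/
noncomputable def mixDensity (M : SeriesModel d Ω) (P : Measure Ω) (fε : ℝ → ℝ) (θ : Par d)
    (x : ℝ) : ℝ :=
  ∫ ω, M.sF θ (M.pastX 0 ω) * fε (M.sF θ (M.pastX 0 ω) * x + M.eF θ (M.pastX 0 ω)) ∂P

lemma integrable_sF (hM : M.IsLocationScale P) (h : M.Envelopes P r γ A B E) (hr : 0 < r)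
    {θ : Par d} (hθ : θ ∈ M.nhd r) : Integrable (fun ω => M.sF θ (M.pastX 0 ω)) P := by
  have hB := integrable_pastX hM 0 (h.smooth_sF hM hr).intΛ
  refine Integrable.mono' ((hB.mul_const ‖θ - M.θ₀‖).add (integrable_const 1))
    ((measurable_sF hM (nhd_subset hθ)).comp (measurable_pastX hM 0)).aestronglyMeasurable ?_
  filter_upwards [h.regular 0] with ω hω
  have h1 := hω.abs_sF_sub_one h.γ_pos (θ₀_mem_nhd hM hr) hθ
  simp only [Pi.add_apply]
  calc ‖M.sF θ (M.pastX 0 ω)‖ = |(M.sF θ (M.pastX 0 ω) - 1) + 1| := by rw [sub_add_cancel]; rfl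
    _ ≤ |M.sF θ (M.pastX 0 ω) - 1| + |(1 : ℝ)| := abs_add_le _ _
    _ ≤ _ := by rw [abs_one]; linarith

lemma measurable_mix (hM : M.IsLocationScale P) (h5 : M.A5 P fε) {θ : Par d} (hθ : θ ∈ M.Θ) :
    Measurable (fun p : (ℕ → ℝ) × ℝ => M.sF θ p.1 * fε (M.sF θ p.1 * p.2 + M.eF θ p.1)) := by
  have hs := (measurable_sF hM hθ).comp (measurable_fst : Measurable (Prod.fst : (ℕ → ℝ) × ℝ → _))
  have he := (measurable_eF hM hθ).comp (measurable_fst : Measurable (Prod.fst : (ℕ → ℝ) × ℝ → _))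
  exact hs.mul (h5.diff.continuous.measurable.comp ((hs.mul measurable_snd).add he))

lemma integrable_mix (hM : M.IsLocationScale P) (h : M.Envelopes P r γ A B E) (hr : 0 < r)
    (h5 : M.A5 P fε) {θ : Par d} (hθ : θ ∈ M.nhd r) (x : ℝ) :
    Integrable (fun ω => M.sF θ (M.pastX 0 ω) *
      fε (M.sF θ (M.pastX 0 ω) * x + M.eF θ (M.pastX 0 ω))) P := by
  obtain ⟨F, hF⟩ := h5.exists_smoothBdd
  refine Integrable.mul_bdd (c := F) (integrable_sF hM h hr hθ) ?_ (Eventually.of_forall fun ω => hF.bdd _)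
  have hs := (measurable_sF hM (nhd_subset hθ)).comp (measurable_pastX hM 0)
  have he := (measurable_eF hM (nhd_subset hθ)).comp (measurable_pastX hM 0)
  exact (h5.diff.continuous.measurable.comp ((hs.mul_const x).add he)).aestronglyMeasurable

/-- Given the past, the residual is an affine image of the noise, with density `x ↦ s f(s x + e)`;
Tonelli averages these densities over the past. Continuity is dominated convergence with the bound
`s F`. -/
lemma isContDensity_mix (hM : M.IsLocationScale P) (h : M.Envelopes P r γ A B E) (hr : 0 < r)
    (h5 : M.A5 P fε) {θ : Par d} (hθ : θ ∈ M.nhd r) :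
    IsContDensity (P.map (M.resid 0 θ)) (M.mixDensity P fε θ) := by
  obtain ⟨F, hF⟩ := h5.exists_smoothBdd
  have hsm := (measurable_sF hM (nhd_subset hθ)).comp (measurable_pastX hM 0)
  have hem := (measurable_eF hM (nhd_subset hθ)).comp (measurable_pastX hM 0)
  have hspos : ∀ᵐ ω ∂P, 0 < M.sF θ (M.pastX 0 ω) := by
    filter_upwards [h.regular 0] with ω hω
    exact hω.sF_pos h.γ_pos hM.θ₀_mem (nhd_subset hθ)
  refine ⟨?_, fun x => ?_, ?_⟩
  · refine continuous_of_dominated (bound := fun ω => M.sF θ (M.pastX 0 ω) * F)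
      (fun x => (integrable_mix hM h hr h5 hθ x).1) (fun x => ?_)
      ((integrable_sF hM h hr hθ).mul_const F) (Eventually.of_forall fun ω => ?_)
    · filter_upwards [hspos] with ω hω
      rw [norm_mul, Real.norm_of_nonneg hω.le]
      exact mul_le_mul_of_nonneg_left (hF.bdd _) hω.le
    · exact continuous_const.mul (h5.diff.continuous.comp
        ((continuous_const.mul continuous_id).add continuous_const))
  · refine integral_nonneg_of_ae ?_
    filter_upwards [hspos] with ω hω
    exact mul_nonneg hω.le (h5.nonneg _)
  · have hrm : AEMeasurable (M.resid 0 θ) P := by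
      refine AEMeasurable.congr (f := fun ω => (M.noise 0 ω - M.eF θ (M.pastX 0 ω)) /
        M.sF θ (M.pastX 0 ω)) (((hM.noise_meas 0).sub hem).div hsm).aemeasurable ?_
      filter_upwards [resid_ae_eq hM h 0] with ω hω
      exact (hω θ (nhd_subset hθ)).symm
    ext S hS
    have h1S : Measurable (S.indicator (1 : ℝ → ℝ≥0∞)) := measurable_one.indicator hS
    have e1 : P.map (M.resid 0 θ) S = ∫⁻ ω, S.indicator (1 : ℝ → ℝ≥0∞)
        ((M.noise 0 ω - M.eF θ (M.pastX 0 ω)) / M.sF θ (M.pastX 0 ω)) ∂P := by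
      rw [← lintegral_indicator_one hS, lintegral_map' h1S.aemeasurable hrm]
      refine lintegral_congr_ae ?_
      filter_upwards [resid_ae_eq hM h 0] with ω hω
      rw [hω θ (nhd_subset hθ)]
    have hu : Measurable (fun p : (ℕ → ℝ) × ℝ => S.indicator (1 : ℝ → ℝ≥0∞)
        ((p.2 - M.eF θ p.1) / M.sF θ p.1)) :=
      h1S.comp ((measurable_snd.sub ((measurable_eF hM (nhd_subset hθ)).comp measurable_fst)).div
        ((measurable_sF hM (nhd_subset hθ)).comp measurable_fst))
    have hmix := measurable_mix hM h5 (nhd_subset hθ)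
    rw [e1, lintegral_pastX_noise hM 0 hu, withDensity_apply _ hS]
    have e2 : ∀ᵐ ω ∂P, ∫⁻ y, S.indicator (1 : ℝ → ℝ≥0∞)
        ((y - M.eF θ (M.pastX 0 ω)) / M.sF θ (M.pastX 0 ω)) ∂(P.map (M.noise 0)) =
        ∫⁻ x, S.indicator (1 : ℝ → ℝ≥0∞) x * ENNReal.ofReal (M.sF θ (M.pastX 0 ω) *
          fε (M.sF θ (M.pastX 0 ω) * x + M.eF θ (M.pastX 0 ω))) := by
      filter_upwards [hspos] with ω hω
      set s := M.sF θ (M.pastX 0 ω)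
      set e := M.eF θ (M.pastX 0 ω)
      have m1 : Measurable fun y : ℝ => S.indicator (1 : ℝ → ℝ≥0∞) ((y - e) / s) :=
        h1S.comp ((measurable_id.sub_const e).div_const s)
      have m2 : Measurable fun y : ℝ => S.indicator (1 : ℝ → ℝ≥0∞) ((y - e) / s) *
          ENNReal.ofReal (fε y) := m1.mul (h5.diff.continuous.measurable.ennreal_ofReal)
      rw [lintegral_noise h5 m1, lintegral_affine m2 hω e, ← lintegral_const_mul]
      · refine lintegral_congr fun x => ?_
        have e3 : (s * x + e - e) / s = x := by field_simp; ring
        rw [e3, ENNReal.ofReal_mul hω.le]; ring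
      · exact m2.comp ((measurable_const_mul s).add_const e)
    rw [lintegral_congr_ae e2, lintegral_lintegral_swap]
    · rw [← lintegral_indicator hS]
      refine lintegral_congr fun x => ?_
      have m3 : Measurable fun ω => ENNReal.ofReal (M.sF θ (M.pastX 0 ω) *
          fε (M.sF θ (M.pastX 0 ω) * x + M.eF θ (M.pastX 0 ω))) :=
        (hmix.comp ((measurable_pastX hM 0).prodMk measurable_const)).ennreal_ofReal
      rw [lintegral_const_mul _ m3]
      by_cases hx : x ∈ S
      · simp only [Set.indicator_of_mem hx, Pi.one_apply, one_mul]
        rw [mixDensity, ofReal_integral_eq_lintegral_ofReal (integrable_mix hM h hr h5 hθ x)]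
        · filter_upwards [hspos] with ω hω
          exact mul_nonneg hω.le (h5.nonneg _)
      · simp [Set.indicator_of_notMem hx]
    · refine ((h1S.comp measurable_snd).mul ?_).aemeasurable
      exact (hmix.comp (((measurable_pastX hM 0).comp measurable_fst).prodMk
        measurable_snd)).ennreal_ofReal

/-- Two densities agree almost everywhere, and continuous functions that do so are equal. Hence the
density chosen in `contDensity` is the mixture. -/
lemma isContDensity_unique {μ : Measure ℝ} [IsFiniteMeasure μ] {f g : ℝ → ℝ}
    (hf : IsContDensity μ f) (hg : IsContDensity μ g) : f = g := by
  have h1 : (fun x => ENNReal.ofReal (f x)) =ᵐ[volume] fun x => ENNReal.ofReal (g x) := by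
    refine (withDensity_eq_iff_of_sigmaFinite hf.1.measurable.ennreal_ofReal.aemeasurable
      hg.1.measurable.ennreal_ofReal.aemeasurable).1 ?_
    rw [← hf.2.2, ← hg.2.2]
  refine (Continuous.ae_eq_iff_eq volume hf.1 hg.1).1 ?_
  filter_upwards [h1] with x hx
  exact (ENNReal.ofReal_eq_ofReal_iff (hf.2.1 x) (hg.2.1 x)).1 hx

lemma isContDensity_residDensity (hM : M.IsLocationScale P) (h : M.Envelopes P r γ A B E)
    (hr : 0 < r) (h5 : M.A5 P fε) {θ : Par d} (hθ : θ ∈ M.nhd r) :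
    IsContDensity (P.map (M.resid 0 θ)) (M.residDensity P θ) := by
  have hex : ∃ f, IsContDensity (P.map (M.resid 0 θ)) f := ⟨_, isContDensity_mix hM h hr h5 hθ⟩
  rw [residDensity, contDensity, dif_pos hex]
  exact hex.choose_spec

lemma residDensity_eq (hM : M.IsLocationScale P) (h : M.Envelopes P r γ A B E)
    (hr : 0 < r) (h5 : M.A5 P fε) {θ : Par d} (hθ : θ ∈ M.nhd r) :
    M.residDensity P θ = M.mixDensity P fε θ :=
  isContDensity_unique (isContDensity_residDensity hM h hr h5 hθ) (isContDensity_mix hM h hr h5 hθ)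

end SeriesModel

/-! ### Expansion of the integrand at a pair of pasts -/

namespace SeriesModel

variable {d : ℕ} {Ω : Type*} [MeasurableSpace Ω] {M : SeriesModel d Ω} {P : Measure Ω}
  [IsProbabilityMeasure P] {r γ : ℝ} {A B E : (ℕ → ℝ) → ℝ} {f : ℝ → ℝ} {F : ℝ}
  {Fw Fq Fs Fe : Fin d → (ℕ → ℝ) → ℝ} {ρ : ℕ → ℝ} {R : ℕ → (ℕ → ℝ) → ℝ}

/-- At the past `x`, the functionals `w`, `q`, `s`, `e` admit a first-order expansion at `θ₀`, with
linear terms controlled by the envelope and with remainders controlled by `R`. -/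
structure Expands (M : SeriesModel d Ω) (r γ : ℝ) (A B E : (ℕ → ℝ) → ℝ)
    (Fw Fq Fs Fe : Fin d → (ℕ → ℝ) → ℝ) (ρ : ℕ → ℝ) (R : ℕ → (ℕ → ℝ) → ℝ) (x : ℕ → ℝ) : Prop where
  reg : M.Regular r γ A B E x
  bound : ∀ θ ∈ M.nhd r,
    |lin Fw x (θ - M.θ₀)| ≤ 1 / γ * env A B E x * ‖θ - M.θ₀‖ ∧
    |lin Fq x (θ - M.θ₀)| ≤ env A B E x ^ 2 * ‖θ - M.θ₀‖ ∧
    |lin Fs x (θ - M.θ₀)| ≤ env A B E x * ‖θ - M.θ₀‖ ∧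
    |lin Fe x (θ - M.θ₀)| ≤ env A B E x * ‖θ - M.θ₀‖
  rem : ∀ n, ∀ θ ∈ M.nhd r, ‖θ - M.θ₀‖ < ρ n →
    |M.wF θ x - M.wF M.θ₀ x - lin Fw x (θ - M.θ₀)| ≤ R n x * ‖θ - M.θ₀‖ ∧
    |M.qF θ x - M.qF M.θ₀ x - lin Fq x (θ - M.θ₀)| ≤ R n x * ‖θ - M.θ₀‖ ∧
    |M.sF θ x - 1 - lin Fs x (θ - M.θ₀)| ≤ R n x * ‖θ - M.θ₀‖ ∧
    |M.eF θ x - lin Fe x (θ - M.θ₀)| ≤ R n x * ‖θ - M.θ₀‖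

/-- The ratio `L_v(θ)` as a function of the past. -/
noncomputable def LF (M : SeriesModel d Ω) (v : ℝ) (θ : Par d) (x : ℕ → ℝ) : ℝ :=
  v * M.wF θ x - M.qF θ x

/-- The coefficients of the expansion coming from `w` and `q`. -/
noncomputable def coefL (M : SeriesModel d Ω) (f : ℝ → ℝ) (Fw Fq : Fin d → (ℕ → ℝ) → ℝ) (v : ℝ)
    (k : Fin d) (x : ℕ → ℝ) : ℝ :=
  Fw k x * f (M.LF v M.θ₀ x) +
    M.wF M.θ₀ x * deriv f (M.LF v M.θ₀ x) * (v * Fw k x - Fq k x)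

/-- The coefficient of the expansion coming from `s`. -/
noncomputable def coefS (M : SeriesModel d Ω) (f : ℝ → ℝ) (v : ℝ) (x : ℕ → ℝ) : ℝ :=
  M.wF M.θ₀ x * (f (M.LF v M.θ₀ x) + M.LF v M.θ₀ x * deriv f (M.LF v M.θ₀ x))

/-- The coefficient of the expansion coming from `e`. -/
noncomputable def coefE (M : SeriesModel d Ω) (f : ℝ → ℝ) (v : ℝ) (x : ℕ → ℝ) : ℝ :=
  M.wF M.θ₀ x * deriv f (M.LF v M.θ₀ x)

lemma lin_coefL (v : ℝ) (x : ℕ → ℝ) (u : Par d) :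
    lin (M.coefL f Fw Fq v) x u = lin Fw x u * f (M.LF v M.θ₀ x) +
      M.wF M.θ₀ x * deriv f (M.LF v M.θ₀ x) * (v * lin Fw x u - lin Fq x u) := by
  simp only [lin, coefL, Finset.sum_mul, Finset.mul_sum, ← Finset.sum_sub_distrib,
    ← Finset.sum_add_distrib]
  exact Finset.sum_congr rfl fun k _ => by ring

/-- The truncated square envelope. -/
def minEnv (A B E : (ℕ → ℝ) → ℝ) (ρ : ℝ) (x : ℕ → ℝ) : ℝ :=
  min (ρ * env A B E x ^ 4) (env A B E x ^ 2)

/-- The constant of the expansion. -/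
noncomputable def expK (F γ V : ℝ) : ℝ := F + 1 / γ + V / γ + V + 1

lemma Regular.abs_wF_le (h : M.Regular r γ A B E x) (hγ : 0 < γ) {θ : Par d} (hθ : θ ∈ M.Θ) :
    |M.wF θ x| ≤ 1 / γ := by
  rw [abs_of_pos (h.wF_pos hγ hθ)]; exact h.wF_le hγ hθ

lemma Regular.abs_LF_le (h : M.Regular r γ A B E x) (hE : M.Envelopes P r γ A B E) {θ : Par d}
    (hθ : θ ∈ M.nhd r) {v V : ℝ} (hv : |v| ≤ V) :
    |M.LF v θ x| ≤ (V / γ + 1) * env A B E x := by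
  have h1 := h.abs_wF_le hE.γ_pos (nhd_subset hθ)
  have h2 := h.abs_qF hE.γ_pos hθ
  have h3 := hE.E_le_env x
  have h4 := hE.one_le_env x
  have hV : 0 ≤ V := (abs_nonneg v).trans hv
  have hγ := hE.γ_pos
  calc |M.LF v θ x| ≤ |v * M.wF θ x| + |M.qF θ x| := abs_sub _ _
    _ ≤ V * (1 / γ) + env A B E x := by
        rw [abs_mul]; gcongr; linarith
    _ ≤ V / γ * env A B E x + env A B E x := by
        have : V / γ * 1 ≤ V / γ * env A B E x := by gcongr
        rw [mul_one_div]; linarith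
    _ = _ := by ring

lemma Regular.abs_wF_sub_le (h : M.Regular r γ A B E x) (hE : M.Envelopes P r γ A B E)
    (h0 : M.θ₀ ∈ M.nhd r) {θ : Par d} (hθ : θ ∈ M.nhd r) :
    |M.wF θ x - M.wF M.θ₀ x| ≤ 1 / γ * (‖θ - M.θ₀‖ * env A B E x) := by
  have hγ := hE.γ_pos
  refine (h.abs_wF_sub hγ h0 hθ).trans ?_
  rw [mul_comm (B x)]
  gcongr
  exact hE.B_le_env x

lemma Regular.abs_LF_sub_le (h : M.Regular r γ A B E x) (hE : M.Envelopes P r γ A B E)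
    (h0 : M.θ₀ ∈ M.nhd r) {θ : Par d} (hθ : θ ∈ M.nhd r) {v V : ℝ} (hv : |v| ≤ V) :
    |M.LF v θ x - M.LF v M.θ₀ x| ≤ (V / γ + 1) * (‖θ - M.θ₀‖ * env A B E x ^ 2) := by
  have hγ := hE.γ_pos
  have h1 := h.abs_wF_sub_le hE h0 hθ
  have h2 := h.abs_qF_sub hγ h0 hθ (hE.E_nonneg x)
  have h3 := hE.AEB_le_env x
  have h4 := hE.le_env_sq x
  have h5 := hE.one_le_env x
  have hV : 0 ≤ V := (abs_nonneg v).trans hv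
  have e1 : M.LF v θ x - M.LF v M.θ₀ x =
      v * (M.wF θ x - M.wF M.θ₀ x) - (M.qF θ x - M.qF M.θ₀ x) := by simp only [LF]; ring
  rw [e1]
  calc _ ≤ |v| * |M.wF θ x - M.wF M.θ₀ x| + |M.qF θ x - M.qF M.θ₀ x| := by
        rw [← abs_mul]; exact abs_sub _ _
    _ ≤ V * (1 / γ * (‖θ - M.θ₀‖ * env A B E x ^ 2)) + env A B E x ^ 2 * ‖θ - M.θ₀‖ := by
        gcongr
        · refine h1.trans ?_; gcongr
        · refine h2.trans ?_; gcongr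
    _ = _ := by ring

lemma one_le_expK (hF : 1 ≤ F) (hγ : 0 < γ) {V : ℝ} (hV : 0 ≤ V) : 1 ≤ expK F γ V := by
  have : 0 ≤ 1 / γ := by positivity
  have : 0 ≤ V / γ := by positivity
  simp only [expK]; linarith

/-- The expansion with `w, L` taken at the past `x` and `s, e` at the past `x'`. The shift `t`
leaves room for the argument of the kernel. The bound is `‖θ - θ₀‖` times a combination of products
of functions of `x` and of `x'`, so it can be averaged or integrated over the two pasts separately.
-/
lemma Expands.pair (hE : M.Envelopes P r γ A B E) (hf : SmoothBdd f F) (h0 : M.θ₀ ∈ M.nhd r)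
    (hR : ∀ n x, 0 ≤ R n x) {x x' : ℕ → ℝ} (hx : M.Expands r γ A B E Fw Fq Fs Fe ρ R x)
    (hx' : M.Expands r γ A B E Fw Fq Fs Fe ρ R x') {v V t τ : ℝ} (hv : |v| ≤ V) (ht : |t| ≤ τ)
    (hτ : τ ≤ 1) {n : ℕ} {θ : Par d} (hθ : θ ∈ M.nhd r) (hn : ‖θ - M.θ₀‖ < ρ n) :
    |M.wF θ x * (M.sF θ x' * f (M.sF θ x' * (M.LF v θ x - t) + M.eF θ x')) -
      M.wF M.θ₀ x * f (M.LF v M.θ₀ x - t) - (lin (M.coefL f Fw Fq v) x (θ - M.θ₀) +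
        M.coefS f v x * lin Fs x' (θ - M.θ₀) + M.coefE f v x * lin Fe x' (θ - M.θ₀))| ≤
      60 * expK F γ V ^ 4 * (‖θ - M.θ₀‖ * (R n x + R n x' * env A B E x +
        (ρ n + τ) * (env A B E x ^ 2 * env A B E x' ^ 2) + minEnv A B E (ρ n) x)) := by
  have hγ := hE.γ_pos
  have hV : 0 ≤ V := (abs_nonneg v).trans hv
  have hF := hf.one_le
  have g1 : 0 ≤ 1 / γ := by positivity
  have g2 : 0 ≤ V / γ := by positivity
  have hK := one_le_expK hF hγ hV
  have kF : F ≤ expK F γ V := by simp only [expK]; linarith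
  have kγ : 1 / γ ≤ expK F γ V := by simp only [expK]; linarith
  have kL : V / γ + 1 ≤ expK F γ V := by simp only [expK]; linarith
  have kV : V + 1 ≤ expK F γ V := by simp only [expK]; linarith
  have hL := hE.one_le_env x
  have hL' := hE.one_le_env x'
  set δ := ‖θ - M.θ₀‖ with hδ
  have hδ0 : 0 ≤ δ := norm_nonneg _
  obtain ⟨b1, b2, -, -⟩ := hx.bound θ hθ
  obtain ⟨-, -, b3, b4⟩ := hx'.bound θ hθ
  obtain ⟨r1, r2, -, -⟩ := hx.rem n θ hθ hn
  obtain ⟨-, -, r3, r4⟩ := hx'.rem n θ hθ hn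
  have hRx := hR n x
  have hRx' := hR n x'
  have hτ0 : 0 ≤ τ := (abs_nonneg t).trans ht
  have main := hf.expansion (K := expK F γ V) (ρ := δ) (t := t) (τ := τ) (Li := env A B E x)
    (Lj := env A B E x') (Ri := R n x) (Rj := R n x') (w := M.wF θ x) (w₀ := M.wF M.θ₀ x)
    (dw := lin Fw x (θ - M.θ₀)) (y := M.LF v θ x) (y₀ := M.LF v M.θ₀ x)
    (dy := v * lin Fw x (θ - M.θ₀) - lin Fq x (θ - M.θ₀)) (s := M.sF θ x') (e := M.eF θ x')
    (ds := lin Fs x' (θ - M.θ₀)) (de := lin Fe x' (θ - M.θ₀))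
    hK kF hδ0 ht hτ hL hL' hRx hRx'
    ((hx.reg.abs_wF_le hγ (nhd_subset hθ)).trans kγ) ((hx.reg.abs_wF_le hγ (nhd_subset h0)).trans kγ)
    ((hx.reg.abs_wF_sub_le hE h0 hθ).trans (by rw [mul_assoc]; gcongr)) (by rw [mul_comm δ]; exact r1)
    (b1.trans (by rw [mul_assoc, mul_assoc, mul_comm (env A B E x)]; gcongr))
    ((hx.reg.abs_LF_le hE hθ hv).trans (by gcongr))
    ((hx.reg.abs_LF_sub_le hE h0 hθ hv).trans (by rw [mul_assoc]; gcongr))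
    (by
      have e1 : M.LF v θ x - M.LF v M.θ₀ x - (v * lin Fw x (θ - M.θ₀) - lin Fq x (θ - M.θ₀)) =
        v * (M.wF θ x - M.wF M.θ₀ x - lin Fw x (θ - M.θ₀)) -
          (M.qF θ x - M.qF M.θ₀ x - lin Fq x (θ - M.θ₀)) := by simp only [LF]; ring
      rw [e1]
      calc _ ≤ |v| * |M.wF θ x - M.wF M.θ₀ x - lin Fw x (θ - M.θ₀)| +
            |M.qF θ x - M.qF M.θ₀ x - lin Fq x (θ - M.θ₀)| := by
            rw [← abs_mul]; exact abs_sub _ _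
        _ ≤ V * (R n x * δ) + R n x * δ := by gcongr
        _ = (V + 1) * δ * R n x := by ring
        _ ≤ _ := by gcongr)
    ((hx'.reg.abs_sF_sub_one hγ h0 hθ).trans (by rw [mul_comm]; gcongr; exact hE.B_le_env x'))
    ((hx'.reg.abs_eF hγ h0 hθ).trans (by rw [mul_comm]; gcongr; exact hE.A_le_env x'))
    (by rw [mul_comm δ]; exact r3) (by rw [mul_comm δ]; exact r4)
    (by rw [mul_comm δ]; exact b3)
  rw [lin_coefL]
  have e2 : lin Fw x (θ - M.θ₀) * f (M.LF v M.θ₀ x) + M.wF M.θ₀ x * deriv f (M.LF v M.θ₀ x) *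
      (v * lin Fw x (θ - M.θ₀) - lin Fq x (θ - M.θ₀)) +
        M.coefS f v x * lin Fs x' (θ - M.θ₀) + M.coefE f v x * lin Fe x' (θ - M.θ₀) =
      lin Fw x (θ - M.θ₀) * f (M.LF v M.θ₀ x) + M.wF M.θ₀ x * deriv f (M.LF v M.θ₀ x) *
      (v * lin Fw x (θ - M.θ₀) - lin Fq x (θ - M.θ₀)) +
      M.wF M.θ₀ x * (f (M.LF v M.θ₀ x) + M.LF v M.θ₀ x * deriv f (M.LF v M.θ₀ x)) *
        lin Fs x' (θ - M.θ₀) + M.wF M.θ₀ x * deriv f (M.LF v M.θ₀ x) * lin Fe x' (θ - M.θ₀) := by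
    simp only [coefS, coefE]
  rw [e2]
  refine main.trans ?_
  rw [minEnv]
  gcongr

lemma Partials.expands (h : M.Envelopes P r γ A B E) (hp : M.Partials P r γ A B E Fw Fq Fs Fe)
    (hρ : Tendsto ρ atTop (𝓝 0)) : ∃ R : ℕ → (ℕ → ℝ) → ℝ,
    (∀ n, Measurable (R n)) ∧ (∀ n x, 0 ≤ R n x) ∧
    Tendsto (fun n => ∫⁻ x, ENNReal.ofReal (R n x) ∂(M.pastLaw P)) atTop (𝓝 0) ∧
    (∀ n, Integrable (R n) (M.pastLaw P)) ∧
    ∀ t, ∀ᵐ ω ∂P, M.Expands r γ A B E Fw Fq Fs Fe ρ R (M.pastX t ω) := by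
  obtain ⟨R, h1, h2, h3, h4, h5⟩ := hp.remainder ρ hρ
  refine ⟨R, h1, h2, h3, h4, fun t => ?_⟩
  filter_upwards [h.regular t, hp.bound t, h5 t] with ω a b c
  exact ⟨a, b, c⟩

lemma measurable_minEnv (h : M.Envelopes P r γ A B E) (c : ℝ) : Measurable (minEnv A B E c) :=
  ((h.measurable_env.pow_const 4).const_mul c).min (h.measurable_env.pow_const 2)

lemma minEnv_nonneg {c : ℝ} (hc : 0 ≤ c) (x : ℕ → ℝ) : 0 ≤ minEnv A B E c x :=
  le_min (by positivity) (by positivity)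

lemma integrable_minEnv (hM : M.IsLocationScale P) (h : M.Envelopes P r γ A B E) {c : ℝ}
    (hc : 0 ≤ c) : Integrable (minEnv A B E c) (M.pastLaw P) :=
  h.integrable_of_le_env hM (measurable_minEnv h c) (minEnv_nonneg hc) fun _ => min_le_right _ _

/-- The first argument of the minimum tends to zero pointwise and the second is an integrable bound;
no fourth moment is needed. -/
lemma tendsto_integral_minEnv (hM : M.IsLocationScale P) (h : M.Envelopes P r γ A B E)
    (hρ : Tendsto ρ atTop (𝓝 0)) (hρ0 : ∀ n, 0 ≤ ρ n) :
    Tendsto (fun n => ∫ x, minEnv A B E (ρ n) x ∂(M.pastLaw P)) atTop (𝓝 0) := by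
  have := tendsto_integral_of_dominated_convergence (μ := M.pastLaw P)
    (F := fun n x => minEnv A B E (ρ n) x) (f := fun _ => 0) (fun x => env A B E x ^ 2)
    (fun n => (measurable_minEnv h _).aestronglyMeasurable) (h.integrable_env_sq hM)
    (fun n => Eventually.of_forall fun x => by
      rw [Real.norm_eq_abs, abs_of_nonneg (minEnv_nonneg (hρ0 n) x)]; exact min_le_right _ _)
    (Eventually.of_forall fun x => by
      have h1 : Tendsto (fun n => ρ n * env A B E x ^ 4) atTop (𝓝 0) := by
        simpa using hρ.mul_const (env A B E x ^ 4)
      exact squeeze_zero (fun n => minEnv_nonneg (hρ0 n) x) (fun n => min_le_left _ _) h1)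
  simpa using this

end SeriesModel

/-- The linear form on the parameter space with given coefficients. -/
noncomputable def coordForm {d : ℕ} (c : Fin d → ℝ) : Par d →L[ℝ] ℝ :=
  ∑ k, c k • (EuclideanSpace.proj k : Par d →L[ℝ] ℝ)

lemma coordForm_apply {d : ℕ} (c : Fin d → ℝ) (u : Par d) : coordForm c u = ∑ k, u k * c k := by
  simp only [coordForm, FunLike.coe_sum, Finset.sum_apply, FunLike.coe_smul, Pi.smul_apply,
    smul_eq_mul, mul_comm]
  rfl

/-! ### The coefficients of the expansion as functions of `v` -/

namespace SeriesModel

variable {d : ℕ} {Ω : Type*} [MeasurableSpace Ω] {M : SeriesModel d Ω} {P : Measure Ω}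
  [IsProbabilityMeasure P] {r γ : ℝ} {A B E : (ℕ → ℝ) → ℝ} {f : ℝ → ℝ} {F : ℝ}
  {Fw Fq Fs Fe : Fin d → (ℕ → ℝ) → ℝ} {ρ : ℕ → ℝ} {R : ℕ → (ℕ → ℝ) → ℝ} {v v' V : ℝ} {x : ℕ → ℝ}

lemma integrable_of_abs_pastX_le (hM : M.IsLocationScale P) {u g : (ℕ → ℝ) → ℝ} (hu : Measurable u)
    (hg : Integrable g (M.pastLaw P)) (h : ∀ᵐ ω ∂P, |u (M.pastX 0 ω)| ≤ g (M.pastX 0 ω)) :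
    Integrable u (M.pastLaw P) := by
  rw [pastLaw, integrable_map_measure hu.aestronglyMeasurable (measurable_pastX hM 0).aemeasurable]
  exact Integrable.mono' (integrable_pastX hM 0 hg)
    (hu.comp (measurable_pastX hM 0)).aestronglyMeasurable h

lemma measurable_LF (hM : M.IsLocationScale P) {θ : Par d} (hθ : θ ∈ M.Θ) (v : ℝ) :
    Measurable (M.LF v θ) := ((measurable_wF hM hθ).const_mul v).sub (measurable_qF hM hθ)

lemma measurable_coefL (hM : M.IsLocationScale P) (hf : SmoothBdd f F)
    (hw : ∀ k, Measurable (Fw k)) (hq : ∀ k, Measurable (Fq k)) (v : ℝ) (k : Fin d) :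
    Measurable (M.coefL f Fw Fq v k) := by
  have h1 := measurable_LF hM hM.θ₀_mem v
  exact ((hw k).mul (hf.diff.continuous.measurable.comp h1)).add
    (((measurable_wF hM hM.θ₀_mem).mul (hf.continuous_deriv.measurable.comp h1)).mul
      (((hw k).const_mul v).sub (hq k)))

lemma measurable_coefS (hM : M.IsLocationScale P) (hf : SmoothBdd f F) (v : ℝ) :
    Measurable (M.coefS f v) := by
  have h1 := measurable_LF hM hM.θ₀_mem v
  exact (measurable_wF hM hM.θ₀_mem).mul ((hf.diff.continuous.measurable.comp h1).add
    (h1.mul (hf.continuous_deriv.measurable.comp h1)))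

lemma measurable_coefE (hM : M.IsLocationScale P) (hf : SmoothBdd f F) (v : ℝ) :
    Measurable (M.coefE f v) :=
  (measurable_wF hM hM.θ₀_mem).mul
    (hf.continuous_deriv.measurable.comp (measurable_LF hM hM.θ₀_mem v))

namespace Regular

lemma abs_coefL_le (hx : M.Regular r γ A B E x) (hE : M.Envelopes P r γ A B E)
    (hf : SmoothBdd f F) (h0 : M.θ₀ ∈ M.nhd r) (hv : |v| ≤ V) (k : Fin d) :
    |M.coefL f Fw Fq v k x| ≤ F * |Fw k x| + 1 / γ * F * (V * |Fw k x| + |Fq k x|) := by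
  have hγ := hE.γ_pos
  have hw := hx.abs_wF_le hγ (nhd_subset h0)
  have hF := hf.one_le
  have hV : 0 ≤ V := (abs_nonneg v).trans hv
  refine (abs_add_le _ _).trans ?_
  rw [abs_mul, abs_mul, abs_mul, mul_comm F]
  gcongr
  · exact hf.bdd _
  · exact hf.bdd_deriv _
  · refine (abs_sub _ _).trans ?_
    rw [abs_mul]; gcongr

lemma abs_coefS_le (hx : M.Regular r γ A B E x) (hE : M.Envelopes P r γ A B E)
    (hf : SmoothBdd f F) (h0 : M.θ₀ ∈ M.nhd r) (hv : |v| ≤ V) :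
    |M.coefS f v x| ≤ 1 / γ * (F + (V / γ + 1) * env A B E x * F) := by
  have hγ := hE.γ_pos
  have hw := hx.abs_wF_le hγ (nhd_subset h0)
  have hL := hx.abs_LF_le hE h0 hv
  have hF := hf.one_le
  rw [coefS, abs_mul]
  gcongr
  refine (abs_add_le _ _).trans ?_
  rw [abs_mul]
  exact add_le_add (hf.bdd _) (mul_le_mul hL (hf.bdd_deriv _) (abs_nonneg _)
    ((abs_nonneg _).trans hL))

lemma abs_coefE_le (hx : M.Regular r γ A B E x) (hE : M.Envelopes P r γ A B E)
    (hf : SmoothBdd f F) (h0 : M.θ₀ ∈ M.nhd r) : |M.coefE f v x| ≤ 1 / γ * F := by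
  have hγ := hE.γ_pos
  have hw := hx.abs_wF_le hγ (nhd_subset h0)
  rw [coefE, abs_mul]
  gcongr
  exact hf.bdd_deriv _

/-- The difference is `(v - v') w`, and `w` is at most `1/γ`. The Lipschitz bounds in `v` for the
coefficients all come from here. -/
lemma abs_LF_sub_LF (hx : M.Regular r γ A B E x) (hE : M.Envelopes P r γ A B E)
    (h0 : M.θ₀ ∈ M.nhd r) : |M.LF v M.θ₀ x - M.LF v' M.θ₀ x| ≤ |v - v'| * (1 / γ) := by
  have e : M.LF v M.θ₀ x - M.LF v' M.θ₀ x = (v - v') * M.wF M.θ₀ x := by simp only [LF]; ring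
  rw [e, abs_mul]
  gcongr
  exact hx.abs_wF_le hE.γ_pos (nhd_subset h0)

lemma abs_coefE_sub (hx : M.Regular r γ A B E x) (hE : M.Envelopes P r γ A B E)
    (hf : SmoothBdd f F) (h0 : M.θ₀ ∈ M.nhd r) :
    |M.coefE f v x - M.coefE f v' x| ≤ |v - v'| * (1 / γ * F * (1 / γ)) := by
  have hγ := hE.γ_pos
  have hF := hf.one_le
  have hw := hx.abs_wF_le hγ (nhd_subset h0)
  rw [coefE, coefE, ← mul_sub, abs_mul]
  calc _ ≤ 1 / γ * (F * (|v - v'| * (1 / γ))) := by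
        gcongr
        refine (hf.lip_deriv _ _).trans ?_
        gcongr
        exact hx.abs_LF_sub_LF hE h0
    _ = _ := by ring

lemma abs_coefS_sub (hx : M.Regular r γ A B E x) (hE : M.Envelopes P r γ A B E)
    (hf : SmoothBdd f F) (h0 : M.θ₀ ∈ M.nhd r) (hv' : |v'| ≤ V) :
    |M.coefS f v x - M.coefS f v' x| ≤
      |v - v'| * (1 / γ * F * (1 / γ) * (2 + (V / γ + 1) * env A B E x)) := by
  have hγ := hE.γ_pos
  have hF := hf.one_le
  have hw := hx.abs_wF_le hγ (nhd_subset h0)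
  have hL := hx.abs_LF_le hE h0 hv'
  have hd := hx.abs_LF_sub_LF (v := v) (v' := v') hE h0
  set y := M.LF v M.θ₀ x
  set y' := M.LF v' M.θ₀ x
  have e : f y + y * deriv f y - (f y' + y' * deriv f y') =
      (f y - f y') + (y - y') * deriv f y + y' * (deriv f y - deriv f y') := by ring
  have h1 : |(f y - f y') + (y - y') * deriv f y + y' * (deriv f y - deriv f y')| ≤
      F * |y - y'| + |y - y'| * F + (V / γ + 1) * env A B E x * (F * |y - y'|) := by
    refine (abs_add_le _ _).trans (add_le_add ((abs_add_le _ _).trans (add_le_add (hf.lip _ _) ?_)) ?_)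
    · rw [abs_mul]; gcongr; exact hf.bdd_deriv _
    · rw [abs_mul]
      exact mul_le_mul hL (hf.lip_deriv _ _) (abs_nonneg _) ((abs_nonneg _).trans hL)
  have hL0 : 0 ≤ (V / γ + 1) * env A B E x := (abs_nonneg _).trans hL
  rw [coefS, coefS, ← mul_sub, abs_mul, e]
  calc _ ≤ 1 / γ * (F * |y - y'| + |y - y'| * F + (V / γ + 1) * env A B E x * (F * |y - y'|)) := by
        gcongr
    _ = 1 / γ * (|y - y'| * (F * (2 + (V / γ + 1) * env A B E x))) := by ring
    _ ≤ 1 / γ * (|v - v'| * (1 / γ) * (F * (2 + (V / γ + 1) * env A B E x))) := by gcongr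
    _ = _ := by ring

lemma abs_coefL_sub (hx : M.Regular r γ A B E x) (hE : M.Envelopes P r γ A B E)
    (hf : SmoothBdd f F) (h0 : M.θ₀ ∈ M.nhd r) (hv : |v| ≤ V) (k : Fin d) :
    |M.coefL f Fw Fq v k x - M.coefL f Fw Fq v' k x| ≤
      |v - v'| * (F * (1 / γ) * |Fw k x| +
        1 / γ * (F * (1 / γ) * (V * |Fw k x| + |Fq k x|) + F * |Fw k x|)) := by
  have hγ := hE.γ_pos
  have hF := hf.one_le
  have hV : 0 ≤ V := (abs_nonneg v).trans hv
  have hw := hx.abs_wF_le hγ (nhd_subset h0)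
  have hd := hx.abs_LF_sub_LF (v := v) (v' := v') hE h0
  set y := M.LF v M.θ₀ x with hy
  set y' := M.LF v' M.θ₀ x with hy'
  have e : M.coefL f Fw Fq v k x - M.coefL f Fw Fq v' k x = Fw k x * (f y - f y') +
      M.wF M.θ₀ x * ((deriv f y - deriv f y') * (v * Fw k x - Fq k x) +
        deriv f y' * ((v - v') * Fw k x)) := by
    simp only [coefL, ← hy, ← hy']; ring
  have h1 : |v * Fw k x - Fq k x| ≤ V * |Fw k x| + |Fq k x| := by
    refine (abs_sub _ _).trans ?_
    rw [abs_mul]; gcongr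
  rw [e]
  calc _ ≤ |Fw k x| * (F * |y - y'|) + 1 / γ * (F * |y - y'| * (V * |Fw k x| + |Fq k x|) +
          F * (|v - v'| * |Fw k x|)) := by
        refine (abs_add_le _ _).trans (add_le_add ?_ ?_)
        · rw [abs_mul]; gcongr; exact hf.lip _ _
        · rw [abs_mul]
          gcongr
          refine (abs_add_le _ _).trans (add_le_add ?_ ?_)
          · rw [abs_mul]; gcongr; exact hf.lip_deriv _ _
          · rw [abs_mul, abs_mul]; gcongr; exact hf.bdd_deriv _
    _ ≤ |Fw k x| * (F * (|v - v'| * (1 / γ))) + 1 / γ * (F * (|v - v'| * (1 / γ)) *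
          (V * |Fw k x| + |Fq k x|) + F * (|v - v'| * |Fw k x|)) := by gcongr
    _ = _ := by ring

end Regular

lemma integrable_coefL (hM : M.IsLocationScale P) (hE : M.Envelopes P r γ A B E)
    (hp : M.Partials P r γ A B E Fw Fq Fs Fe) (hf : SmoothBdd f F) (hr : 0 < r) (v : ℝ)
    (k : Fin d) : Integrable (M.coefL f Fw Fq v k) (M.pastLaw P) := by
  refine integrable_of_abs_pastX_le hM (measurable_coefL hM hf hp.measw hp.measq v k)
    (((hp.intw k).abs.const_mul F).add
      ((((hp.intw k).abs.const_mul |v|).add (hp.intq k).abs).const_mul (1 / γ * F))) ?_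
  filter_upwards [hE.regular 0] with ω hω
  exact hω.abs_coefL_le hE hf (θ₀_mem_nhd hM hr) le_rfl k

lemma integrable_coefS (hM : M.IsLocationScale P) (hE : M.Envelopes P r γ A B E)
    (hf : SmoothBdd f F) (hr : 0 < r) (v : ℝ) :
    Integrable (M.coefS f v) (M.pastLaw P) := by
  have := isProbabilityMeasure_pastLaw hM
  refine integrable_of_abs_pastX_le hM (measurable_coefS hM hf v)
    (((integrable_const F).add
      (((hE.integrable_env hM).const_mul (|v| / γ + 1)).mul_const F)).const_mul (1 / γ)) ?_
  filter_upwards [hE.regular 0] with ω hω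
  exact hω.abs_coefS_le hE hf (θ₀_mem_nhd hM hr) le_rfl

lemma integrable_coefE (hM : M.IsLocationScale P) (hE : M.Envelopes P r γ A B E)
    (hf : SmoothBdd f F) (hr : 0 < r) (v : ℝ) :
    Integrable (M.coefE f v) (M.pastLaw P) := by
  have := isProbabilityMeasure_pastLaw hM
  refine integrable_of_abs_pastX_le hM (measurable_coefE hM hf v)
    (integrable_const (1 / γ * F)) ?_
  filter_upwards [hE.regular 0] with ω hω
  exact hω.abs_coefE_le hE hf (θ₀_mem_nhd hM hr)

/-- The coefficients of the derivative of `θ ↦ h_θ(v)` at `θ₀`. -/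
noncomputable def slope (M : SeriesModel d Ω) (P : Measure Ω) (f : ℝ → ℝ)
    (Fw Fq Fs Fe : Fin d → (ℕ → ℝ) → ℝ) (v : ℝ) (k : Fin d) : ℝ :=
  ∫ x, M.coefL f Fw Fq v k x ∂(M.pastLaw P) +
    (∫ x, M.coefS f v x ∂(M.pastLaw P)) * ∫ x, Fs k x ∂(M.pastLaw P) +
    (∫ x, M.coefE f v x ∂(M.pastLaw P)) * ∫ x, Fe k x ∂(M.pastLaw P)

lemma integrable_lin {F : Fin d → (ℕ → ℝ) → ℝ} {Q : Measure (ℕ → ℝ)}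
    (hF : ∀ k, Integrable (F k) Q) (u : Par d) : Integrable (fun x => lin F x u) Q :=
  integrable_finsetSum _ fun k _ => (hF k).const_mul (u k)

lemma integral_lin {F : Fin d → (ℕ → ℝ) → ℝ} {Q : Measure (ℕ → ℝ)}
    (hF : ∀ k, Integrable (F k) Q) (u : Par d) :
    ∫ x, lin F x u ∂Q = ∑ k, u k * ∫ x, F k x ∂Q := by
  simp only [lin]
  rw [integral_finsetSum _ fun k _ => (hF k).const_mul (u k)]
  exact Finset.sum_congr rfl fun k _ => integral_const_mul _ _

/-- Regularity is known along almost every `ω` only, and the set of regular sequences need not be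
measurable. The property is therefore checked under `P.prod P`, and only the resulting inequality
`p` has to define a measurable set. -/
lemma ae_pastLaw_prod (hM : M.IsLocationScale P) {p : (ℕ → ℝ) × (ℕ → ℝ) → Prop}
    (hp : MeasurableSet {q | p q}) {p1 : (ℕ → ℝ) → Prop} (h1 : ∀ᵐ ω ∂P, p1 (M.pastX 0 ω))
    (h : ∀ x y, p1 x → p1 y → p (x, y)) :
    ∀ᵐ q ∂((M.pastLaw P).prod (M.pastLaw P)), p q := by
  have hm := measurable_pastX hM 0
  rw [pastLaw, Measure.map_prod_map _ _ hm hm,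
    ae_map_iff (hm.prodMap hm).aemeasurable hp]
  have a1 : ∀ᵐ q ∂(P.prod P), p1 (M.pastX 0 q.1) := Measure.quasiMeasurePreserving_fst.ae h1
  have a2 : ∀ᵐ q ∂(P.prod P), p1 (M.pastX 0 q.2) := Measure.quasiMeasurePreserving_snd.ae h1
  filter_upwards [a1, a2] with q b1 b2
  exact h _ _ b1 b2

end SeriesModel

/-! ### The derivative of `h` at `θ₀` -/

namespace SeriesModel

variable {d : ℕ} {Ω : Type*} [MeasurableSpace Ω] {M : SeriesModel d Ω} {P : Measure Ω}
  [IsProbabilityMeasure P] {r γ : ℝ} {A B E : (ℕ → ℝ) → ℝ} {f : ℝ → ℝ} {F : ℝ}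
  {Fw Fq Fs Fe : Fin d → (ℕ → ℝ) → ℝ} {ρ : ℕ → ℝ} {R : ℕ → (ℕ → ℝ) → ℝ} {v v' V : ℝ} {x : ℕ → ℝ}

/-- The kernel whose double expectation is `h_θ(v)`. -/
noncomputable def pairF (M : SeriesModel d Ω) (f : ℝ → ℝ) (v : ℝ) (θ : Par d)
    (p : (ℕ → ℝ) × (ℕ → ℝ)) : ℝ :=
  M.wF θ p.1 * (M.sF θ p.2 * f (M.sF θ p.2 * M.LF v θ p.1 + M.eF θ p.2))

lemma measurable_pairF (hM : M.IsLocationScale P) (hf : Continuous f) {θ : Par d} (hθ : θ ∈ M.Θ)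
    (v : ℝ) : Measurable (M.pairF f v θ) := by
  have hw := (measurable_wF hM hθ).comp (measurable_fst : Measurable (Prod.fst : _ × (ℕ → ℝ) → _))
  have hL := (measurable_LF hM hθ v).comp (measurable_fst : Measurable (Prod.fst : _ × (ℕ → ℝ) → _))
  have hs := (measurable_sF hM hθ).comp (measurable_snd : Measurable (Prod.snd : (ℕ → ℝ) × _ → _))
  have he := (measurable_eF hM hθ).comp (measurable_snd : Measurable (Prod.snd : (ℕ → ℝ) × _ → _))
  exact hw.mul (hs.mul (hf.measurable.comp ((hs.mul hL).add he)))

lemma integrable_pairF (hM : M.IsLocationScale P) (hE : M.Envelopes P r γ A B E)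
    (hf : SmoothBdd f F) (hr : 0 < r) {θ : Par d} (hθ : θ ∈ M.nhd r) (v : ℝ) :
    Integrable (M.pairF f v θ) ((M.pastLaw P).prod (M.pastLaw P)) := by
  have := isProbabilityMeasure_pastLaw hM
  have hγ := hE.γ_pos
  have hm := measurable_pairF hM hf.diff.continuous (nhd_subset hθ) v
  have hs : Integrable (M.sF θ) (M.pastLaw P) := by
    rw [pastLaw, integrable_map_measure (measurable_sF hM (nhd_subset hθ)).aestronglyMeasurable
      (measurable_pastX hM 0).aemeasurable]
    exact integrable_sF hM hE hr hθ
  refine Integrable.mono' (g := fun p => 1 / γ * F * |M.sF θ p.2|)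
    ((hs.abs.comp_snd _).const_mul _) hm.aestronglyMeasurable ?_
  have hms := (measurable_sF hM (nhd_subset hθ)).comp
    (measurable_snd : Measurable (Prod.snd : (ℕ → ℝ) × _ → _))
  refine ae_pastLaw_prod hM (p1 := M.Regular r γ A B E)
    (measurableSet_le hm.norm (hms.norm.const_mul _)) (hE.regular 0) fun x y hx _ => ?_
  have hw := hx.abs_wF_le hγ (nhd_subset hθ)
  simp only [pairF]
  rw [norm_mul, norm_mul, Real.norm_eq_abs, Real.norm_eq_abs, Real.norm_eq_abs]
  calc _ ≤ 1 / γ * (|M.sF θ y| * F) := by gcongr; exact hf.bdd _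
    _ = _ := by ring

/-- One past is averaged in the definition of `h`, and a second, independent one in the mixture
formula for the density of the residual. -/
lemma h_eq_integral_pairF (hM : M.IsLocationScale P) (hE : M.Envelopes P r γ A B E)
    (h5 : M.A5 P f) (hf : SmoothBdd f F) (hr : 0 < r) {θ : Par d} (hθ : θ ∈ M.nhd r) (v : ℝ) :
    M.h P θ v = ∫ p, M.pairF f v θ p ∂((M.pastLaw P).prod (M.pastLaw P)) := by
  have := isProbabilityMeasure_pastLaw hM
  have hm := measurable_pairF hM hf.diff.continuous (nhd_subset hθ) v
  rw [integral_prod _ (integrable_pairF hM hE hf hr hθ v), ← integral_pastX hM 0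
    hm.stronglyMeasurable.integral_prod_right'.measurable]
  refine integral_congr_ae (Eventually.of_forall fun ω => ?_)
  simp only
  rw [← integral_pastX hM 0 (u := fun y => M.pairF f v θ (M.pastX 0 ω, y))
    (hm.comp measurable_prodMk_left), residDensity_eq hM hE hr h5 hθ]
  simp only [pairF]
  rw [integral_const_mul, mixDensity]
  have e1 : M.L v 0 θ ω = M.LF v θ (M.pastX 0 ω) := by
    simp only [L, LF, wF, qF]
    rw [sub_div, mul_one_div]; rfl
  rw [e1]; rfl

/-- The first-order term of the expansion of `pairF`. -/
noncomputable def pairLin (M : SeriesModel d Ω) (f : ℝ → ℝ) (Fw Fq Fs Fe : Fin d → (ℕ → ℝ) → ℝ)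
    (v : ℝ) (u : Par d) (p : (ℕ → ℝ) × (ℕ → ℝ)) : ℝ :=
  lin (M.coefL f Fw Fq v) p.1 u + M.coefS f v p.1 * lin Fs p.2 u + M.coefE f v p.1 * lin Fe p.2 u

lemma integrable_pairLin (hM : M.IsLocationScale P) (hE : M.Envelopes P r γ A B E)
    (hp : M.Partials P r γ A B E Fw Fq Fs Fe) (hf : SmoothBdd f F) (hr : 0 < r) (v : ℝ) (u : Par d) :
    Integrable (M.pairLin f Fw Fq Fs Fe v u) ((M.pastLaw P).prod (M.pastLaw P)) := by
  have := isProbabilityMeasure_pastLaw hM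
  exact (((integrable_lin (integrable_coefL hM hE hp hf hr v) u).comp_fst _).add
    ((integrable_coefS hM hE hf hr v).mul_prod (integrable_lin hp.ints u))).add
    ((integrable_coefE hM hE hf hr v).mul_prod (integrable_lin hp.inte u))

/-- Under the product measure each product of a coefficient and of a linear form integrates to the
product of the integrals: this is where `slope` comes from. -/
lemma integral_pairLin (hM : M.IsLocationScale P) (hE : M.Envelopes P r γ A B E)
    (hp : M.Partials P r γ A B E Fw Fq Fs Fe) (hf : SmoothBdd f F) (hr : 0 < r) (v : ℝ) (u : Par d) :
    ∫ p, M.pairLin f Fw Fq Fs Fe v u p ∂((M.pastLaw P).prod (M.pastLaw P)) =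
      coordForm (M.slope P f Fw Fq Fs Fe v) u := by
  have := isProbabilityMeasure_pastLaw hM
  have i1 := (integrable_lin (integrable_coefL hM hE hp hf hr v) u).comp_fst (M.pastLaw P)
  have i2 := (integrable_coefS hM hE hf hr v).mul_prod (integrable_lin hp.ints u)
  have i3 := (integrable_coefE hM hE hf hr v).mul_prod (integrable_lin hp.inte u)
  have e1 := integral_add (i1.add i2) i3
  have e2 := integral_add i1 i2
  simp only [Pi.add_apply] at e1
  simp only [pairLin]
  rw [e1, e2, integral_prod_mul (M.coefS f v) (fun y => lin Fs y u),
    integral_prod_mul (M.coefE f v) (fun y => lin Fe y u),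
    integral_fun_fst (fun x => lin (M.coefL f Fw Fq v) x u),
    integral_lin (integrable_coefL hM hE hp hf hr v), integral_lin hp.ints, integral_lin hp.inte,
    coordForm_apply, probReal_univ, one_smul, Finset.mul_sum, Finset.mul_sum, ← Finset.sum_add_distrib,
    ← Finset.sum_add_distrib]
  refine Finset.sum_congr rfl fun k _ => ?_
  rw [slope]; ring

/-- The size of the second-order term of the expansion of `h`. -/
noncomputable def errH (M : SeriesModel d Ω) (P : Measure Ω) (A B E : (ℕ → ℝ) → ℝ) (ρ : ℕ → ℝ)
    (R : ℕ → (ℕ → ℝ) → ℝ) (n : ℕ) : ℝ :=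
  ∫ x, R n x ∂(M.pastLaw P) + (∫ x, R n x ∂(M.pastLaw P)) * (∫ x, env A B E x ∂(M.pastLaw P)) +
    ρ n * ((∫ x, env A B E x ^ 2 ∂(M.pastLaw P)) * ∫ x, env A B E x ^ 2 ∂(M.pastLaw P)) +
    ∫ x, minEnv A B E (ρ n) x ∂(M.pastLaw P)

lemma tendsto_errH (hM : M.IsLocationScale P) (hE : M.Envelopes P r γ A B E)
    (hρ : Tendsto ρ atTop (𝓝 0)) (hρ0 : ∀ n, 0 ≤ ρ n)
    (hR : ∀ n x, 0 ≤ R n x) (hRi : ∀ n, Integrable (R n) (M.pastLaw P))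
    (hRt : Tendsto (fun n => ∫⁻ x, ENNReal.ofReal (R n x) ∂(M.pastLaw P)) atTop (𝓝 0)) :
    Tendsto (M.errH P A B E ρ R) atTop (𝓝 0) := by
  have h1 : Tendsto (fun n => ∫ x, R n x ∂(M.pastLaw P)) atTop (𝓝 0) := by
    have := (ENNReal.tendsto_toReal ENNReal.zero_ne_top).comp hRt
    simp only [ENNReal.toReal_zero] at this
    refine this.congr fun n => ?_
    rw [integral_eq_lintegral_of_nonneg_ae (Eventually.of_forall (hR n)) (hRi n).1]; rfl
  have h2 := tendsto_integral_minEnv hM hE hρ hρ0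
  have := ((h1.add (h1.mul_const (∫ x, env A B E x ∂(M.pastLaw P)))).add (hρ.mul_const
    ((∫ x, env A B E x ^ 2 ∂(M.pastLaw P)) * ∫ x, env A B E x ^ 2 ∂(M.pastLaw P)))).add h2
  simp only [zero_mul, add_zero] at this
  exact this

/-- The bound of `Expands.pair` without shift, `t = τ = 0`, integrated over two independent pasts.
-/
lemma abs_h_sub_le (hM : M.IsLocationScale P) (hE : M.Envelopes P r γ A B E)
    (hp : M.Partials P r γ A B E Fw Fq Fs Fe) (h5 : M.A5 P f) (hf : SmoothBdd f F) (hr : 0 < r)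
    (hρ0 : ∀ n, 0 ≤ ρ n) (hR : ∀ n x, 0 ≤ R n x) (hRm : ∀ n, Measurable (R n))
    (hRi : ∀ n, Integrable (R n) (M.pastLaw P))
    (hX : ∀ᵐ ω ∂P, M.Expands r γ A B E Fw Fq Fs Fe ρ R (M.pastX 0 ω))
    {n : ℕ} {θ : Par d} (hθ : θ ∈ M.nhd r) (hn : ‖θ - M.θ₀‖ < ρ n) (v : ℝ) :
    |M.h P θ v - M.h P M.θ₀ v - coordForm (M.slope P f Fw Fq Fs Fe v) (θ - M.θ₀)| ≤
      60 * expK F γ |v| ^ 4 * (‖θ - M.θ₀‖ * M.errH P A B E ρ R n) := by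
  have := isProbabilityMeasure_pastLaw hM
  have h0 := θ₀_mem_nhd hM hr
  have i1 := integrable_pairF hM hE hf hr hθ v
  have i2 := integrable_pairF hM hE hf hr h0 v
  have i3 := integrable_pairLin hM hE hp hf hr v (θ - M.θ₀)
  set μ := (M.pastLaw P).prod (M.pastLaw P) with hμ
  set D := fun p => M.pairF f v θ p - M.pairF f v M.θ₀ p - M.pairLin f Fw Fq Fs Fe v (θ - M.θ₀) p
    with hD
  have eD : M.h P θ v - M.h P M.θ₀ v - coordForm (M.slope P f Fw Fq Fs Fe v) (θ - M.θ₀) =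
      ∫ p, D p ∂μ := by
    have e1 := integral_sub (i1.sub i2) i3
    have e2 := integral_sub i1 i2
    simp only [Pi.sub_apply] at e1
    rw [h_eq_integral_pairF hM hE h5 hf hr hθ, h_eq_integral_pairF hM hE h5 hf hr h0,
      ← integral_pairLin hM hE hp hf hr, hD, e1, e2]
  have mL : Measurable (M.pairLin f Fw Fq Fs Fe v (θ - M.θ₀)) := by
    have a1 : ∀ {G : Fin d → (ℕ → ℝ) → ℝ}, (∀ k, Measurable (G k)) →
        Measurable fun x => lin G x (θ - M.θ₀) := fun hG =>
      Finset.measurable_fun_sum _ fun k _ => (hG k).const_mul _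
    exact (((a1 (measurable_coefL hM hf hp.measw hp.measq v)).comp measurable_fst).add
      (((measurable_coefS hM hf v).comp measurable_fst).mul ((a1 hp.meass).comp measurable_snd))).add
      (((measurable_coefE hM hf v).comp measurable_fst).mul ((a1 hp.mease).comp measurable_snd))
  have mD : Measurable D := ((measurable_pairF hM hf.diff.continuous (nhd_subset hθ) v).sub
    (measurable_pairF hM hf.diff.continuous (nhd_subset h0) v)).sub mL
  have menv := hE.measurable_env
  have j1 : Integrable (fun p : (ℕ → ℝ) × (ℕ → ℝ) => R n p.1) μ := (hRi n).comp_fst _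
  have j2 : Integrable (fun p : (ℕ → ℝ) × (ℕ → ℝ) => env A B E p.1 * R n p.2) μ :=
    (hE.integrable_env hM).mul_prod (hRi n)
  have j3 : Integrable (fun p : (ℕ → ℝ) × (ℕ → ℝ) => env A B E p.1 ^ 2 * env A B E p.2 ^ 2) μ :=
    (hE.integrable_env_sq hM).mul_prod (hE.integrable_env_sq hM)
  have j4 : Integrable (fun p : (ℕ → ℝ) × (ℕ → ℝ) => minEnv A B E (ρ n) p.1) μ :=
    (integrable_minEnv hM hE (hρ0 n)).comp_fst _
  have j5 := ((((j1.add j2).add (j3.const_mul (ρ n))).add j4).const_mul ‖θ - M.θ₀‖).const_mul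
    (60 * expK F γ |v| ^ 4)
  have hae : ∀ᵐ p ∂μ, ‖D p‖ ≤ 60 * expK F γ |v| ^ 4 * (‖θ - M.θ₀‖ * (R n p.1 +
      env A B E p.1 * R n p.2 + ρ n * (env A B E p.1 ^ 2 * env A B E p.2 ^ 2) +
        minEnv A B E (ρ n) p.1)) := by
    refine ae_pastLaw_prod hM (p1 := M.Expands r γ A B E Fw Fq Fs Fe ρ R)
      (measurableSet_le mD.norm ?_) hX fun x y hx hy => ?_
    · exact ((((((hRm n).comp measurable_fst).add ((menv.comp measurable_fst).mul
        ((hRm n).comp measurable_snd))).add ((((menv.comp measurable_fst).pow_const 2).mul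
          ((menv.comp measurable_snd).pow_const 2)).const_mul (ρ n))).add
          ((measurable_minEnv hE (ρ n)).comp measurable_fst)).const_mul _).const_mul _
    · have hxy := hx.pair hE hf h0 hR hy (v := v) (t := 0) (τ := 0) le_rfl (by simp) zero_le_one hθ hn
      have s0 := hy.reg.sF_θ₀ hE.γ_pos hM.θ₀_mem
      rw [Real.norm_eq_abs]
      simp only [sub_zero, add_zero] at hxy
      simp only [hD, pairF, pairLin, s0, Regular.eF_θ₀, one_mul, add_zero]
      rw [mul_comm (env A B E x)]
      exact hxy
  rw [eD, ← Real.norm_eq_abs]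
  refine (norm_integral_le_integral_norm _).trans ((integral_mono_ae ?_ j5 hae).trans (le_of_eq ?_))
  · exact ((i1.sub i2).sub i3).norm
  · have e1 := integral_add ((j1.add j2).add (j3.const_mul (ρ n))) j4
    have e2 := integral_add (j1.add j2) (j3.const_mul (ρ n))
    have e3 := integral_add j1 j2
    simp only [Pi.add_apply] at e1 e2
    simp only [Pi.add_apply]
    rw [integral_const_mul, integral_const_mul, e1, e2, e3, integral_const_mul,
      integral_prod_mul (env A B E) (R n),
      integral_prod_mul (fun x => env A B E x ^ 2) (fun x => env A B E x ^ 2),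
      integral_fun_fst (R n), integral_fun_fst (minEnv A B E (ρ n)), probReal_univ, one_smul,
      one_smul, errH]
    ring

theorem hasFDerivWithinAt_h (hM : M.IsLocationScale P) (hE : M.Envelopes P r γ A B E)
    (hp : M.Partials P r γ A B E Fw Fq Fs Fe) (h5 : M.A5 P f) (hf : SmoothBdd f F) (hr : 0 < r)
    (v : ℝ) : HasFDerivWithinAt (fun θ => M.h P θ v) (coordForm (M.slope P f Fw Fq Fs Fe v))
      M.Θ M.θ₀ := by
  have hρ : Tendsto (fun n : ℕ => 1 / ((n : ℝ) + 1)) atTop (𝓝 0) :=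
    tendsto_one_div_add_atTop_nhds_zero_nat
  have hρ0 : ∀ n : ℕ, (0 : ℝ) ≤ 1 / ((n : ℝ) + 1) := fun n => by positivity
  obtain ⟨R, h1, h2, h3, h4, h6⟩ := hp.expands hE hρ
  have ht := (tendsto_errH hM hE hρ hρ0 h2 h4 h3).const_mul (60 * expK F γ |v| ^ 4)
  rw [mul_zero] at ht
  refine HasFDerivWithinAt.of_isLittleO (Asymptotics.isLittleO_iff.2 fun c hc => ?_)
  -- Here `n` is no sample size: it indexes the radius `1/(n + 1)` of a ball on which the relative
  -- error is at most `c`.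
  obtain ⟨n, hn⟩ := (ht.eventually_le_const hc).exists
  have hpos : 0 < min r (1 / ((n : ℝ) + 1)) := lt_min hr (by positivity)
  filter_upwards [self_mem_nhdsWithin,
    mem_nhdsWithin_of_mem_nhds (Metric.ball_mem_nhds M.θ₀ hpos)] with θ hθ hb
  rw [Metric.mem_ball, lt_min_iff] at hb
  have := abs_h_sub_le hM hE hp h5 hf hr hρ0 h2 h1 h4 (h6 0)
    (θ := θ) ⟨hθ, Metric.mem_ball.2 hb.1⟩ (n := n) (by rw [← dist_eq_norm]; exact hb.2) v
  rw [Real.norm_eq_abs]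
  refine this.trans ?_
  calc _ = 60 * expK F γ |v| ^ 4 * M.errH P A B E (fun n : ℕ => 1 / ((n : ℝ) + 1)) R n *
        ‖θ - M.θ₀‖ := by ring
    _ ≤ _ := by gcongr

lemma uniqueDiffWithinAt_θ₀ (hM : M.IsLocationScale P) (hr : 0 < r) (h1 : M.A1 r) :
    UniqueDiffWithinAt ℝ M.Θ M.θ₀ :=
  (uniqueDiffWithinAt_convex h1.convex h1.nonempty_interior
    (subset_closure (θ₀_mem_nhd hM hr))).mono fun _ h => h.1

end SeriesModel

/-! ### Events of probability tending to one, and integration against the kernel -/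

/-- The events `p n` have probability tending to one (in the sense of outer measure). -/
def Likely {Ω : Type*} [MeasurableSpace Ω] (P : Measure Ω) (p : ℕ → Ω → Prop) : Prop :=
  ∀ κ : ℝ≥0∞, κ ≠ 0 → WHP P κ p

namespace Likely

variable {Ω : Type*} [MeasurableSpace Ω] {P : Measure Ω} {p q : ℕ → Ω → Prop}

lemma and (hp : Likely P p) (hq : Likely P q) : Likely P (fun n ω => p n ω ∧ q n ω) := fun κ hκ => by
  have h2 : κ / 2 ≠ 0 := by simp [hκ]
  have := (hp _ h2).and (hq _ h2)
  rwa [ENNReal.add_halves] at this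

lemma mono (hp : Likely P p) (h : ∀ᶠ n in atTop, ∀ᵐ ω ∂P, p n ω → q n ω) : Likely P q :=
  fun κ hκ => (hp κ hκ).mono h

lemma forall_finset {ι : Type*} {p : ι → ℕ → Ω → Prop} (s : Finset ι)
    (h : ∀ i ∈ s, Likely P (p i)) : Likely P (fun n ω => ∀ i ∈ s, p i n ω) :=
  fun _ hκ => WHP.forall_finset s hκ h

/-- A tightness argument: for each `κ` some bound `c` holds up to probability `κ/2`, and for that
fixed `c` the conclusion fails with probability at most `κ/2` eventually. -/
lemma of_whp_imp {C : ℝ → ℕ → Ω → Prop} (h1 : ∀ κ : ℝ≥0∞, κ ≠ 0 → ∃ c, WHP P κ (C c))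
    (h2 : ∀ c, Likely P (fun n ω => C c n ω → q n ω)) : Likely P q := fun κ hκ => by
  have h3 : κ / 2 ≠ 0 := by simp [hκ]
  obtain ⟨c, hc⟩ := h1 _ h3
  have := hc.and (h2 c _ h3)
  rw [ENNReal.add_halves] at this
  exact this.mono_of_forall fun n ω h => h.2 h.1

end Likely

namespace IsKernel

variable {K : ℝ → ℝ}

lemma hasCompactSupport (hK : IsKernel K) : HasCompactSupport K :=
  HasCompactSupport.of_support_subset_isCompact (isCompact_Icc (a := -1) (b := 1)) fun x hx => by
    by_contra hcon
    refine hx (hK.support x ?_)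
    rw [Set.mem_Icc, ← abs_le] at hcon
    exact not_le.1 hcon

lemma integrable_mul (hK : IsKernel K) {g : ℝ → ℝ} (hg : Continuous g) :
    Integrable (fun z => K z * g z) :=
  (hK.contDiff.continuous.mul hg).integrable_of_hasCompactSupport hK.hasCompactSupport.mul_right

lemma integrable (hK : IsKernel K) : Integrable K := by
  simpa using hK.integrable_mul continuous_const (g := fun _ => (1 : ℝ))

/-- The integral is a weighted mean of the values of `g` on `[-1, 1]`. -/
lemma abs_integral_sub_le (hK : IsKernel K) {g : ℝ → ℝ} (hg : Continuous g) {c β : ℝ}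
    (h : ∀ z, |z| ≤ 1 → |g z - c| ≤ β) : |(∫ z, K z * g z) - c| ≤ β := by
  have e1 : (∫ z, K z * g z) - c = ∫ z, K z * (g z - c) := by
    have i1 := hK.integrable_mul hg
    have i2 := hK.integrable.mul_const c
    have := integral_sub i1 i2
    rw [integral_mul_const, hK.integral_eq_one, one_mul] at this
    rw [← this]
    exact integral_congr_ae (Eventually.of_forall fun z => by simp only; ring)
  rw [e1]
  have i3 := hK.integrable_mul (hg.sub continuous_const) (g := fun z => g z - c)
  refine (norm_integral_le_integral_norm (fun z => K z * (g z - c))).trans ?_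
  refine (integral_mono i3.norm (hK.integrable.mul_const β) fun z => ?_).trans ?_
  · simp only [norm_mul, Real.norm_eq_abs, abs_of_nonneg (hK.nonneg z)]
    rcases le_or_gt |z| 1 with hz | hz
    · exact mul_le_mul_of_nonneg_left (h z hz) (hK.nonneg z)
    · simp [hK.support z hz]
  · rw [integral_mul_const, hK.integral_eq_one, one_mul]

end IsKernel

/-! ### Uniform law of large numbers for the slope -/

namespace SeriesModel

variable {d : ℕ} {Ω : Type*} [MeasurableSpace Ω] {M : SeriesModel d Ω} {P : Measure Ω}
  [IsProbabilityMeasure P] {r γ : ℝ} {A B E : (ℕ → ℝ) → ℝ} {f : ℝ → ℝ} {F : ℝ}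
  {Fw Fq Fs Fe : Fin d → (ℕ → ℝ) → ℝ} {ρ : ℕ → ℝ} {R : ℕ → (ℕ → ℝ) → ℝ} {v v' V α β : ℝ}
  {x : ℕ → ℝ}

lemma likely_lln (hM : M.IsLocationScale P) {u : (ℕ → ℝ) → ℝ} (hu : Measurable u)
    (hi : Integrable u (M.pastLaw P)) {τ : ℝ} (hτ : 0 < τ) :
    Likely P (fun n ω => |avg n (fun i => u (M.pastX i ω)) - ∫ x, u x ∂(M.pastLaw P)| ≤ τ) :=
  fun _ hκ => whp_lln hM hu hi hκ hτ

/-- The law of large numbers on a finite net of `[α, β]`, extended by the Lipschitz envelope, whose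
averages are bounded in probability. -/
lemma likely_lln_uniform (hM : M.IsLocationScale P) {u : ℝ → (ℕ → ℝ) → ℝ} {Λ : (ℕ → ℝ) → ℝ}
    (hu : ∀ v, Measurable (u v)) (hi : ∀ v, Integrable (u v) (M.pastLaw P)) (hΛ : Measurable Λ)
    (hΛ0 : ∀ x, 0 ≤ Λ x) (hΛi : Integrable Λ (M.pastLaw P))
    (hlip : ∀ t : ℤ, ∀ᵐ ω ∂P, ∀ v ∈ Set.Icc α β, ∀ v' ∈ Set.Icc α β,
      |u v (M.pastX t ω) - u v' (M.pastX t ω)| ≤ |v - v'| * Λ (M.pastX t ω))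
    {τ : ℝ} (hτ : 0 < τ) :
    Likely P (fun n ω => ∀ v ∈ Set.Icc α β,
      |avg n (fun i => u v (M.pastX i ω)) - ∫ x, u v x ∂(M.pastLaw P)| ≤ τ) := by
  refine Likely.of_whp_imp (C := fun c n ω => avg n (fun i => Λ (M.pastX i ω)) ≤ c)
    (fun κ hκ => ?_) fun c => ?_
  · obtain ⟨C, -, hC⟩ := whp_avg_pastX_le hM hΛ hΛ0 hΛi hκ
    exact ⟨C, hC⟩
  set I := ∫ x, Λ x ∂(M.pastLaw P) with hI
  have hI0 : 0 ≤ I := integral_nonneg hΛ0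
  have hden : 0 < |c| + I + 1 := by positivity
  -- Mesh chosen so that `e (|c| + I) ≤ τ/2`, which covers the oscillation of the average and that
  -- of its limit.
  set e := τ / 2 / (|c| + I + 1) with he
  have he0 : 0 < e := by positivity
  obtain ⟨t, hts, htf, hcov⟩ := (isCompact_Icc (a := α) (b := β)).finite_cover_balls he0
  have hnet := Likely.forall_finset htf.toFinset (p := fun v n ω =>
    |avg n (fun i => u v (M.pastX i ω)) - ∫ x, u v x ∂(M.pastLaw P)| ≤ τ / 2)
    fun v _ => likely_lln hM (hu v) (hi v) (half_pos hτ)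
  refine hnet.mono (Eventually.of_forall fun n => ?_)
  filter_upwards [ae_all_iff.2 hlip] with ω hω hN hc v hv
  obtain ⟨v', hv't, hvv⟩ : ∃ v' ∈ t, v ∈ Metric.ball v' e := by simpa using hcov hv
  have hv' := hts hv't
  have h1 := hN v' (htf.mem_toFinset.2 hv't)
  rw [Metric.mem_ball, Real.dist_eq] at hvv
  have h2 : |avg n (fun i => u v (M.pastX i ω)) - avg n (fun i => u v' (M.pastX i ω))| ≤
      e * |c| := by
    rw [← avg_sub]
    refine (abs_avg_le _ _).trans ((avg_mono (b := fun i => |v - v'| * Λ (M.pastX i ω))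
      fun i _ => hω i v hv v' hv').trans ?_)
    rw [avg_mul_left]
    have : 0 ≤ avg n (fun i => Λ (M.pastX i ω)) := avg_nonneg fun _ _ => hΛ0 _
    exact mul_le_mul hvv.le (hc.trans (le_abs_self c)) this he0.le
  have h3 : |∫ x, u v x ∂(M.pastLaw P) - ∫ x, u v' x ∂(M.pastLaw P)| ≤ e * I := by
    rw [← integral_sub (hi v) (hi v'),
      ← integral_pastX hM 0 (u := fun x => u v x - u v' x) ((hu v).sub (hu v'))]
    refine (norm_integral_le_integral_norm (fun ω => u v (M.pastX 0 ω) - u v' (M.pastX 0 ω))).trans ?_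
    refine (integral_mono_ae (((integrable_pastX hM 0 (hi v)).sub
      (integrable_pastX hM 0 (hi v'))).norm) ((integrable_pastX hM 0 hΛi).const_mul |v - v'|) ?_).trans ?_
    · filter_upwards [hlip 0] with ω' hω'
      exact hω' v hv v' hv'
    · rw [integral_const_mul, integral_pastX hM 0 hΛ]
      gcongr
  have h4 : e * |c| + e * I ≤ τ / 2 := by
    rw [← mul_add, he, div_mul_eq_mul_div, div_le_iff₀ hden]
    have := half_pos hτ
    nlinarith
  have e1 : avg n (fun i => u v (M.pastX i ω)) - ∫ x, u v x ∂(M.pastLaw P) =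
      (avg n (fun i => u v (M.pastX i ω)) - avg n (fun i => u v' (M.pastX i ω))) +
      (avg n (fun i => u v' (M.pastX i ω)) - ∫ x, u v' x ∂(M.pastLaw P)) -
      (∫ x, u v x ∂(M.pastLaw P) - ∫ x, u v' x ∂(M.pastLaw P)) := by ring
  rw [e1]
  refine (abs_sub _ _).trans ((add_le_add (abs_add_le _ _) le_rfl).trans ?_)
  linarith

/-- The empirical version of `slope`. -/
noncomputable def empSlope (M : SeriesModel d Ω) (f : ℝ → ℝ) (Fw Fq Fs Fe : Fin d → (ℕ → ℝ) → ℝ)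
    (n : ℕ) (v : ℝ) (ω : Ω) (k : Fin d) : ℝ :=
  avg n (fun i => M.coefL f Fw Fq v k (M.pastX i ω)) +
    avg n (fun i => M.coefS f v (M.pastX i ω)) * avg n (fun i => Fs k (M.pastX i ω)) +
    avg n (fun i => M.coefE f v (M.pastX i ω)) * avg n (fun i => Fe k (M.pastX i ω))

lemma abs_mul_sub_mul_le {a a' c c' τ S : ℝ} (ha : |a - a'| ≤ τ) (hc : |c - c'| ≤ τ) (ha' : |a'| ≤ S)
    (hc' : |c'| ≤ S) (hτ : τ ≤ 1) : |a * c - a' * c'| ≤ τ * (2 * S + 1) := by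
  have e : a * c - a' * c' = (a - a') * c' + (a - a') * (c - c') + a' * (c - c') := by ring
  have hτ0 : 0 ≤ τ := (abs_nonneg _).trans ha
  rw [e]
  calc _ ≤ |a - a'| * |c'| + |a - a'| * |c - c'| + |a'| * |c - c'| := by
        rw [← abs_mul, ← abs_mul, ← abs_mul]
        exact (abs_add_le _ _).trans (add_le_add (abs_add_le _ _) le_rfl)
    _ ≤ τ * S + τ * τ + S * τ := by gcongr; exact (abs_nonneg _).trans ha'
    _ ≤ _ := by nlinarith

lemma likely_empSlope (hM : M.IsLocationScale P) (hE : M.Envelopes P r γ A B E)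
    (hp : M.Partials P r γ A B E Fw Fq Fs Fe) (hf : SmoothBdd f F) (hr : 0 < r) {τ : ℝ}
    (hτ : 0 < τ) (α β : ℝ) :
    Likely P (fun n ω => ∀ k, ∀ v ∈ Set.Icc α β,
      |M.empSlope f Fw Fq Fs Fe n v ω k - M.slope P f Fw Fq Fs Fe v k| ≤ τ) := by
  have := isProbabilityMeasure_pastLaw hM
  have h0 := θ₀_mem_nhd hM hr
  have hγ := hE.γ_pos
  have hF := hf.one_le
  set V := max |α| |β| with hV
  have hV0 : 0 ≤ V := (abs_nonneg α).trans (le_max_left _ _)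
  have hvV : ∀ v ∈ Set.Icc α β, |v| ≤ V := fun v hv => abs_le_max_abs_abs hv.1 hv.2
  have main : ∀ k, Likely P (fun n ω => ∀ v ∈ Set.Icc α β,
      |M.empSlope f Fw Fq Fs Fe n v ω k - M.slope P f Fw Fq Fs Fe v k| ≤ τ) := by
    intro k
    set IS := ∫ x, 1 / γ * (F + (V / γ + 1) * env A B E x * F) ∂(M.pastLaw P)
    set S := |IS| + 1 / γ * F + |∫ x, Fs k x ∂(M.pastLaw P)| + |∫ x, Fe k x ∂(M.pastLaw P)| with hS
    have hg : 0 ≤ 1 / γ * F := by positivity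
    have hS0 : 0 ≤ S := by positivity
    -- One simple average errs by `τ'` and each of the two products by `τ' (2S + 1)`, whence `τ' (4S
    -- + 3)` in total.
    set τ' := min 1 (τ / (4 * S + 3)) with hτ'
    have hτ'0 : 0 < τ' := lt_min one_pos (by positivity)
    have hτ'1 : τ' ≤ 1 := min_le_left _ _
    have hτ'2 : τ' * (4 * S + 3) ≤ τ := by
      rw [← le_div_iff₀ (by positivity)]; exact min_le_right _ _
    have aw := (hp.intw k).abs
    have aq := (hp.intq k).abs
    have mw := (hp.measw k).abs
    have mq := (hp.measq k).abs
    have l1 := likely_lln_uniform (α := α) (β := β) hM (u := fun v => M.coefL f Fw Fq v k)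
      (fun v => measurable_coefL hM hf hp.measw hp.measq v k)
      (fun v => integrable_coefL hM hE hp hf hr v k)
      (Λ := fun x => F * (1 / γ) * |Fw k x| + 1 / γ * (F * (1 / γ) * (V * |Fw k x| + |Fq k x|) +
        F * |Fw k x|))
      ((mw.const_mul _).add (((((mw.const_mul _).add mq).const_mul _).add
        (mw.const_mul _)).const_mul _)) (fun x => by positivity)
      ((aw.const_mul _).add (((((aw.const_mul _).add aq).const_mul _).add
        (aw.const_mul _)).const_mul _))
      (fun t => by
        filter_upwards [hE.regular t] with ω hω v hv v' hv'
        exact hω.abs_coefL_sub hE hf h0 (hvV v hv) k) hτ'0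
    have l2 := likely_lln_uniform (α := α) (β := β) hM (u := fun v => M.coefS f v)
      (fun v => measurable_coefS hM hf v) (fun v => integrable_coefS hM hE hf hr v)
      (Λ := fun x => 1 / γ * F * (1 / γ) * (2 + (V / γ + 1) * env A B E x))
      (((hE.measurable_env.const_mul _).const_add _).const_mul _)
      (fun x => by have := hE.one_le_env x; positivity)
      (((integrable_const _).add ((hE.integrable_env hM).const_mul _)).const_mul _)
      (fun t => by
        filter_upwards [hE.regular t] with ω hω v hv v' hv'
        exact hω.abs_coefS_sub hE hf h0 (hvV v' hv')) hτ'0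
    have l3 := likely_lln_uniform (α := α) (β := β) hM (u := fun v => M.coefE f v)
      (fun v => measurable_coefE hM hf v) (fun v => integrable_coefE hM hE hf hr v)
      (Λ := fun x => 1 / γ * F * (1 / γ)) measurable_const (fun x => by positivity)
      (integrable_const _)
      (fun t => by
        filter_upwards [hE.regular t] with ω hω v hv v' hv'
        exact hω.abs_coefE_sub hE hf h0) hτ'0
    have l4 := likely_lln hM (hp.meass k) (hp.ints k) hτ'0
    have l5 := likely_lln hM (hp.mease k) (hp.inte k) hτ'0
    refine ((((l1.and l2).and l3).and l4).and l5).mono (Eventually.of_forall fun n =>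
      Eventually.of_forall fun ω hω v hv => ?_)
    obtain ⟨⟨⟨⟨a1, a2⟩, a3⟩, a4⟩, a5⟩ := hω
    have b1 := a1 v hv
    have b2 := a2 v hv
    have b3 := a3 v hv
    have cS : |∫ x, M.coefS f v x ∂(M.pastLaw P)| ≤ S := by
      refine le_trans ?_ (show |IS| ≤ S by
        have := abs_nonneg (∫ x, Fs k x ∂(M.pastLaw P))
        have := abs_nonneg (∫ x, Fe k x ∂(M.pastLaw P)); simp only [hS]; linarith)
      refine le_trans ?_ (le_abs_self IS)
      rw [← integral_pastX hM 0 (measurable_coefS hM hf v)]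
      have hi : Integrable (fun x => 1 / γ * (F + (V / γ + 1) * env A B E x * F)) (M.pastLaw P) :=
        ((integrable_const F).add (((hE.integrable_env hM).const_mul (V / γ + 1)).mul_const F)).const_mul
          (1 / γ)
      have hm : Measurable (fun x => 1 / γ * (F + (V / γ + 1) * env A B E x * F)) :=
        (((hE.measurable_env.const_mul _).mul_const F).const_add F).const_mul _
      refine (norm_integral_le_integral_norm (fun ω => M.coefS f v (M.pastX 0 ω))).trans ?_
      rw [show IS = _ from (integral_pastX hM 0 hm).symm]
      refine integral_mono_ae (integrable_pastX hM 0 (integrable_coefS hM hE hf hr v)).norm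
        (integrable_pastX hM 0 hi) ?_
      filter_upwards [hE.regular 0] with ω' hω'
      exact hω'.abs_coefS_le hE hf h0 (hvV v hv)
    have cE : |∫ x, M.coefE f v x ∂(M.pastLaw P)| ≤ S := by
      refine le_trans ?_ (show 1 / γ * F ≤ S by
        have := abs_nonneg (∫ x, Fs k x ∂(M.pastLaw P)); have := abs_nonneg IS
        have := abs_nonneg (∫ x, Fe k x ∂(M.pastLaw P)); simp only [hS]; linarith)
      rw [← integral_pastX hM 0 (measurable_coefE hM hf v)]
      refine (norm_integral_le_integral_norm (fun ω => M.coefE f v (M.pastX 0 ω))).trans ?_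
      refine (integral_mono_ae (integrable_pastX hM 0 (integrable_coefE hM hE hf hr v)).norm
        (integrable_const (1 / γ * F)) ?_).trans (by simp)
      filter_upwards [hE.regular 0] with ω' hω'
      exact hω'.abs_coefE_le hE hf h0
    have cFs : |∫ x, Fs k x ∂(M.pastLaw P)| ≤ S := by
      have := abs_nonneg IS; have := abs_nonneg (∫ x, Fe k x ∂(M.pastLaw P))
      simp only [hS]; linarith
    have cFe : |∫ x, Fe k x ∂(M.pastLaw P)| ≤ S := by
      have := abs_nonneg IS; have := abs_nonneg (∫ x, Fs k x ∂(M.pastLaw P))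
      simp only [hS]; linarith
    have d1 := abs_mul_sub_mul_le b2 a4 cS cFs hτ'1
    have d2 := abs_mul_sub_mul_le b3 a5 cE cFe hτ'1
    have e1 : ∀ a a' c c' g g' : ℝ, a + c + g - (a' + c' + g') = (a - a') + (c - c') + (g - g') :=
      fun _ _ _ _ _ _ => by ring
    rw [empSlope, slope, e1]
    refine (abs_add_le _ _).trans ((add_le_add ((abs_add_le _ _).trans (add_le_add b1 d1)) d2).trans ?_)
    linarith
  exact (Likely.forall_finset Finset.univ (fun k _ => main k)).mono
    (Eventually.of_forall fun n => Eventually.of_forall fun ω h k => h k (Finset.mem_univ k))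

end SeriesModel

/-! ### The compensator -/

/-- The mean of `w K_b(x - (ε - e) / s)` when `ε` has density `f`. -/
noncomputable def kernelMean (K f : ℝ → ℝ) (b w x s e : ℝ) : ℝ :=
  w * ∫ z, K z * (s * f (s * (x - b * z) + e))

namespace SeriesModel

variable {d : ℕ} {Ω : Type*} [MeasurableSpace Ω] {M : SeriesModel d Ω} {P : Measure Ω}
  [IsProbabilityMeasure P] {r γ : ℝ} {A B E : (ℕ → ℝ) → ℝ} {f : ℝ → ℝ} {F : ℝ}
  {Fw Fq Fs Fe : Fin d → (ℕ → ℝ) → ℝ} {ρ : ℕ → ℝ} {R : ℕ → (ℕ → ℝ) → ℝ} {v v' V α β : ℝ}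
  {x x' : ℕ → ℝ} {K : ℝ → ℝ} {b : ℕ → ℝ}

/-- The kernel means are averages over `z ∈ [-1, 1]` of the integrand shifted by `t = b z`, so `τ =
b` is allowed. The smoothing biases at `θ` and at `θ₀` cancel at leading order; what remains carries
the factor `‖θ - θ₀‖`, and no rate for `b` is needed here. -/
lemma Expands.pair_kernelMean (hE : M.Envelopes P r γ A B E) (hf : SmoothBdd f F)
    (hK : IsKernel K) (h0 : M.θ₀ ∈ M.nhd r)
    (hR : ∀ n x, 0 ≤ R n x) (hx : M.Expands r γ A B E Fw Fq Fs Fe ρ R x)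
    (hx' : M.Expands r γ A B E Fw Fq Fs Fe ρ R x') {b : ℝ} (hv : |v| ≤ V) (hb : 0 < b)
    (hb1 : b ≤ 1) {n : ℕ} {θ : Par d} (hθ : θ ∈ M.nhd r) (hn : ‖θ - M.θ₀‖ < ρ n) :
    |kernelMean K f b (M.wF θ x) (M.LF v θ x) (M.sF θ x') (M.eF θ x') -
      kernelMean K f b (M.wF M.θ₀ x) (M.LF v M.θ₀ x) 1 0 -
        M.pairLin f Fw Fq Fs Fe v (θ - M.θ₀) (x, x')| ≤
      60 * expK F γ V ^ 4 * (‖θ - M.θ₀‖ * (R n x + R n x' * env A B E x +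
        (ρ n + b) * (env A B E x ^ 2 * env A B E x' ^ 2) + minEnv A B E (ρ n) x)) := by
  have hc := hf.diff.continuous
  have e1 : kernelMean K f b (M.wF θ x) (M.LF v θ x) (M.sF θ x') (M.eF θ x') -
      kernelMean K f b (M.wF M.θ₀ x) (M.LF v M.θ₀ x) 1 0 =
      ∫ z, K z * (M.wF θ x * (M.sF θ x' * f (M.sF θ x' * (M.LF v θ x - b * z) + M.eF θ x')) -
        M.wF M.θ₀ x * f (M.LF v M.θ₀ x - b * z)) := by
    have c1 : Continuous fun z =>
      M.wF θ x * (M.sF θ x' * f (M.sF θ x' * (M.LF v θ x - b * z) + M.eF θ x')) := by fun_prop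
    have c2 : Continuous fun z => M.wF M.θ₀ x * f (M.LF v M.θ₀ x - b * z) := by fun_prop
    have := integral_sub (hK.integrable_mul c1) (hK.integrable_mul c2)
    simp only [mul_sub (K _)]
    rw [this, kernelMean, kernelMean, ← integral_const_mul, ← integral_const_mul]
    congr 1
    · exact integral_congr_ae (Eventually.of_forall fun z => by simp only; ring)
    · exact integral_congr_ae (Eventually.of_forall fun z => by simp only [one_mul, add_zero]; ring)
  rw [e1]
  refine hK.abs_integral_sub_le (by fun_prop) fun z hz => ?_
  have hbz : |b * z| ≤ b := by
    rw [abs_mul, abs_of_pos hb]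
    exact mul_le_of_le_one_right hb.le hz
  exact hx.pair hE hf h0 hR hx' hv hbz hb1 hθ hn

lemma avg_lin (n : ℕ) (G : Fin d → (ℕ → ℝ) → ℝ) (y : ℕ → ℕ → ℝ) (u : Par d) :
    avg n (fun i => lin G (y i) u) = ∑ k, u k * avg n (fun i => G k (y i)) := by
  simp only [avg, lin]
  rw [Finset.sum_comm, Finset.mul_sum]
  refine Finset.sum_congr rfl fun k _ => ?_
  rw [← Finset.mul_sum]; ring

/-- The linear term is a sum of products of a function of `i` and a function of `j`, so its double
average factorises. -/
lemma avg_pairLin (n : ℕ) (hn : 1 ≤ n) (v : ℝ) (u : Par d) (ω : Ω) :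
    avg n (fun i => avg n fun j => M.pairLin f Fw Fq Fs Fe v u (M.pastX i ω, M.pastX j ω)) =
      coordForm (M.empSlope f Fw Fq Fs Fe n v ω) u := by
  simp only [pairLin, avg_add]
  simp only [avg_mul_left, avg_mul_right, avg_const hn]
  rw [avg_lin n (M.coefL f Fw Fq v) (fun i => M.pastX i ω) u,
    avg_lin n Fs (fun i => M.pastX i ω) u, avg_lin n Fe (fun i => M.pastX i ω) u, coordForm_apply,
    Finset.mul_sum, Finset.mul_sum, ← Finset.sum_add_distrib, ← Finset.sum_add_distrib]
  refine Finset.sum_congr rfl fun k _ => ?_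
  rw [empSlope]; ring

/-- The conditional mean of the difference of the two kernel averages. -/
noncomputable def compensator (M : SeriesModel d Ω) (K f : ℝ → ℝ) (b : ℝ) (n : ℕ) (v : ℝ)
    (θ : Par d) (ω : Ω) : ℝ :=
  avg n fun i => avg n fun j =>
    kernelMean K f b (M.wF θ (M.pastX i ω)) (M.LF v θ (M.pastX i ω)) (M.sF θ (M.pastX j ω))
      (M.eF θ (M.pastX j ω)) -
    kernelMean K f b (M.wF M.θ₀ (M.pastX i ω)) (M.LF v M.θ₀ (M.pastX i ω)) 1 0

lemma abs_avg_avg_sub_le {n : ℕ} {a c g : ℕ → ℕ → ℝ}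
    (h : ∀ i ∈ Finset.Icc 1 n, ∀ j ∈ Finset.Icc 1 n, |a i j - c i j| ≤ g i j) :
    |avg n (fun i => avg n (a i)) - avg n (fun i => avg n (c i))| ≤
      avg n (fun i => avg n (g i)) := by
  rw [← avg_sub]
  refine (abs_avg_le _ _).trans (avg_mono fun i hi => ?_)
  rw [← avg_sub]
  exact (abs_avg_le _ _).trans (avg_mono fun j hj => h i hi j hj)

lemma abs_compensator_sub_le (hE : M.Envelopes P r γ A B E) (hf : SmoothBdd f F)
    (hK : IsKernel K) (h0 : M.θ₀ ∈ M.nhd r) (hR : ∀ n x, 0 ≤ R n x) {ω : Ω} {n : ℕ} (hn1 : 1 ≤ n)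
    (hX : ∀ t, M.Expands r γ A B E Fw Fq Fs Fe ρ R (M.pastX t ω))
    {b : ℝ} (hv : |v| ≤ V) (hb : 0 < b) (hb1 : b ≤ 1)
    {θ : Par d} (hθ : θ ∈ M.nhd r) (hn : ‖θ - M.θ₀‖ < ρ n) :
    |M.compensator K f b n v θ ω - coordForm (M.empSlope f Fw Fq Fs Fe n v ω) (θ - M.θ₀)| ≤
      60 * expK F γ V ^ 4 * (‖θ - M.θ₀‖ * (avg n (fun i => R n (M.pastX i ω)) +
        avg n (fun i => R n (M.pastX i ω)) * avg n (fun i => env A B E (M.pastX i ω)) +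
        (ρ n + b) * (avg n (fun i => env A B E (M.pastX i ω) ^ 2) *
          avg n (fun i => env A B E (M.pastX i ω) ^ 2)) +
        avg n (fun i => minEnv A B E (ρ n) (M.pastX i ω)))) := by
  rw [← avg_pairLin n hn1, compensator]
  refine (abs_avg_avg_sub_le fun i _ j _ => (hX i).pair_kernelMean hE hf hK h0 hR (hX j) hv hb hb1
    hθ hn).trans (le_of_eq ?_)
  simp only [avg_mul_left, avg_add, avg_mul_right, avg_const hn1]

lemma abs_coordForm_le {c : Fin d → ℝ} {τ : ℝ} (hc : ∀ k, |c k| ≤ τ) (u : Par d) :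
    |coordForm c u| ≤ d * τ * ‖u‖ := by
  rw [coordForm_apply]
  refine (Finset.abs_sum_le_sum_abs _ _).trans
    ((Finset.sum_le_sum (g := fun _ => τ * ‖u‖) fun k _ => ?_).trans (by simp [mul_assoc]))
  rw [abs_mul, mul_comm]
  have hk := hc k
  have h1 : |u k| ≤ ‖u‖ := PiLp.norm_apply_le u k
  exact mul_le_mul hk h1 (abs_nonneg _) ((abs_nonneg _).trans hk)

lemma coordForm_sub (c c' : Fin d → ℝ) (u : Par d) :
    coordForm c u - coordForm c' u = coordForm (fun k => c k - c' k) u := by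
  simp only [coordForm_apply, ← Finset.sum_sub_distrib, mul_sub]

/-- After multiplication by `√n`, the factor `‖θ - θ₀‖` becomes a bounded one. The averages
multiplying it tend to zero in probability, and `empSlope` approaches `slope` uniformly in `v`. -/
lemma likely_compensator (hM : M.IsLocationScale P) (hE : M.Envelopes P r γ A B E)
    (hp : M.Partials P r γ A B E Fw Fq Fs Fe) (hf : SmoothBdd f F) (hK : IsKernel K) (hr : 0 < r)
    (hb : ∀ n, 0 < b n) (hbt : Tendsto b atTop (𝓝 0)) {C₀ : ℝ} (hC₀ : 0 ≤ C₀) {τ : ℝ}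
    (hτ : 0 < τ) (α β : ℝ) :
    Likely P (fun n ω => ∀ θ ∈ M.nhd r, √(n : ℝ) * ‖θ - M.θ₀‖ ≤ C₀ → ∀ v ∈ Set.Icc α β,
      √(n : ℝ) * |M.compensator K f (b n) n v θ ω -
        coordForm (M.slope P f Fw Fq Fs Fe v) (θ - M.θ₀)| ≤ τ) := by
  have h0 := θ₀_mem_nhd hM hr
  set V := max |α| |β| with hV
  have hV0 : 0 ≤ V := (abs_nonneg α).trans (le_max_left _ _)
  have hvV : ∀ v ∈ Set.Icc α β, |v| ≤ V := fun v hv => abs_le_max_abs_abs hv.1 hv.2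
  -- The extra `1` turns `√n ‖θ - θ₀‖ ≤ C₀` into the strict inequality required of the radius.
  set ρ : ℕ → ℝ := fun n => (C₀ + 1) / √(n : ℝ) with hρdef
  have hsq : Tendsto (fun n : ℕ => √(n : ℝ)) atTop atTop :=
    Real.tendsto_sqrt_atTop.comp tendsto_natCast_atTop_atTop
  have hρ : Tendsto ρ atTop (𝓝 0) := hsq.const_div_atTop _
  have hρ0 : ∀ n, 0 ≤ ρ n := fun n => by positivity
  obtain ⟨R, h1, h2, h3, h4, h6⟩ := hp.expands hE hρ
  have hK1 := one_le_expK hf.one_le hE.γ_pos hV0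
  set D := 60 * expK F γ V ^ 4 * C₀ with hD
  have hD0 : 0 ≤ D := by positivity
  refine Likely.of_whp_imp
    (C := fun c n ω => avg n (fun i => env A B E (M.pastX i ω) ^ 2) ≤ c) (fun κ hκ => ?_) fun c => ?_
  · obtain ⟨C, -, hC⟩ := whp_avg_pastX_le hM (hE.measurable_env.pow_const 2) (fun x => sq_nonneg _)
      (hE.integrable_env_sq hM) hκ
    exact ⟨C, hC⟩
  set τ₁ := τ / 2 / (D * (3 + |c|) + 1) with hτ₁
  have hτ₁0 : 0 < τ₁ := by positivity
  have hτ₁D : D * (τ₁ * (3 + |c|)) ≤ τ / 2 := by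
    have : τ₁ * (D * (3 + |c|) + 1) = τ / 2 := div_mul_cancel₀ _ (by positivity)
    nlinarith
  have hd : (0 : ℝ) ≤ d := Nat.cast_nonneg d
  set τ₂ := τ / 2 / (d * C₀ + 1) with hτ₂
  have hτ₂0 : 0 < τ₂ := by positivity
  have hτ₂D : d * τ₂ * C₀ ≤ τ / 2 := by
    have : τ₂ * (d * C₀ + 1) = τ / 2 := div_mul_cancel₀ _ (by positivity)
    nlinarith
  have l1 : Likely P (fun n ω => avg n (fun i => R n (M.pastX i ω)) ≤ τ₁) := fun κ hκ =>
    whp_avg_pastX_small hM h1 h2 h3 hκ hτ₁0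
  have l2 : Likely P (fun n ω => avg n (fun i => minEnv A B E (ρ n) (M.pastX i ω)) ≤ τ₁) :=
    fun κ hκ => by
      refine whp_avg_pastX_small hM (fun n => measurable_minEnv hE (ρ n))
        (fun n => minEnv_nonneg (hρ0 n)) ?_ hκ hτ₁0
      have := (ENNReal.continuous_ofReal.tendsto 0).comp (tendsto_integral_minEnv hM hE hρ hρ0)
      rw [ENNReal.ofReal_zero] at this
      refine this.congr fun n => ?_
      exact ofReal_integral_eq_lintegral_ofReal (integrable_minEnv hM hE (hρ0 n))
        (Eventually.of_forall (minEnv_nonneg (hρ0 n)))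
  have l3 := likely_empSlope hM hE hp hf hr hτ₂0 α β
  have hρb : ∀ᶠ n in atTop, (ρ n + b n) * c ^ 2 ≤ τ₁ := by
    have : Tendsto (fun n => (ρ n + b n) * c ^ 2) atTop (𝓝 0) := by
      simpa using (hρ.add hbt).mul_const (c ^ 2)
    exact this.eventually_le_const hτ₁0
  refine ((l1.and l2).and l3).mono ?_
  filter_upwards [hρb, hbt.eventually_le_const one_pos, eventually_ge_atTop 1] with n hn2 hbn hn1
  filter_upwards [ae_all_iff.2 h6] with ω hX hω hc θ hθ hθC v hv
  obtain ⟨⟨a1, a2⟩, a3⟩ := hω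
  have hn0 : (0 : ℝ) < √(n : ℝ) := Real.sqrt_pos.2 (by exact_mod_cast hn1)
  set δ := ‖θ - M.θ₀‖
  have hδ0 : 0 ≤ δ := norm_nonneg _
  have hδ : δ < ρ n := by
    rw [hρdef]; simp only
    rw [lt_div_iff₀ hn0]; linarith
  have m1 := abs_compensator_sub_le hE hf hK h0 h2 hn1 hX (hvV v hv) (hb n) hbn hθ hδ
  have m2 := abs_coordForm_le (fun k => a3 k v hv) (θ - M.θ₀)
  rw [← coordForm_sub] at m2
  set aR := avg n (fun i => R n (M.pastX i ω))
  set aL := avg n (fun i => env A B E (M.pastX i ω))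
  set aL2 := avg n (fun i => env A B E (M.pastX i ω) ^ 2)
  set aM := avg n (fun i => minEnv A B E (ρ n) (M.pastX i ω))
  have aR0 : 0 ≤ aR := avg_nonneg fun _ _ => h2 _ _
  have aL0 : 0 ≤ aL := avg_nonneg fun i _ => zero_le_one.trans (hE.one_le_env _)
  have aL20 : 0 ≤ aL2 := avg_nonneg fun i _ => sq_nonneg _
  have hL : aL ≤ |c| := (avg_mono fun i _ => hE.le_env_sq _).trans (hc.trans (le_abs_self c))
  -- Four terms, bounded by `τ₁`, `τ₁ |c|`, `τ₁` and `τ₁`.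
  have hbr : aR + aR * aL + (ρ n + b n) * (aL2 * aL2) + aM ≤ τ₁ * (3 + |c|) := by
    have q1 : aR * aL ≤ τ₁ * |c| := mul_le_mul a1 hL aL0 hτ₁0.le
    have q2 : aL2 * aL2 ≤ c ^ 2 := by rw [sq]; exact mul_le_mul hc hc aL20 (aL20.trans hc)
    have q3 : (ρ n + b n) * (aL2 * aL2) ≤ τ₁ :=
      (mul_le_mul_of_nonneg_left q2 (add_nonneg (hρ0 n) (hb n).le)).trans hn2
    linarith
  have key : |M.compensator K f (b n) n v θ ω -
      coordForm (M.slope P f Fw Fq Fs Fe v) (θ - M.θ₀)| ≤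
      60 * expK F γ V ^ 4 * (δ * (τ₁ * (3 + |c|))) + d * τ₂ * δ := by
    refine (abs_sub_le _ (coordForm (M.empSlope f Fw Fq Fs Fe n v ω) (θ - M.θ₀)) _).trans
      (add_le_add (m1.trans ?_) m2)
    gcongr
  calc _ ≤ √(n : ℝ) * (60 * expK F γ V ^ 4 * (δ * (τ₁ * (3 + |c|))) + d * τ₂ * δ) := by gcongr
    _ = 60 * expK F γ V ^ 4 * (√(n : ℝ) * δ) * (τ₁ * (3 + |c|)) + d * τ₂ * (√(n : ℝ) * δ) := by ring
    _ ≤ 60 * expK F γ V ^ 4 * C₀ * (τ₁ * (3 + |c|)) + d * τ₂ * C₀ := by gcongr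
    _ ≤ τ := by rw [← hD]; linarith

end SeriesModel

/-! ### An exponential inequality -/

/-- Since `|l (φ - a)| ≤ 1`, the inequality `exp u ≤ 1 + u + u²` applies; the linear term has mean
zero, the quadratic one mean at most `l² V`, and `1 + l² V ≤ exp (l² V)`. -/
lemma lintegral_exp_centered_le_one {μ : Measure ℝ} [IsProbabilityMeasure μ] {φ : ℝ → ℝ}
    (hφ : Measurable φ) {c l V : ℝ} (hc : ∀ y, |φ y| ≤ c) (hl : 0 ≤ l) (hlc : l * (2 * c) ≤ 1)
    (hV : ∫ y, φ y ^ 2 ∂μ ≤ V) :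
    ∫⁻ y, ENNReal.ofReal (Real.exp (l * (φ y - ∫ y, φ y ∂μ) - l ^ 2 * V)) ∂μ ≤ 1 := by
  have hc0 : 0 ≤ c := (abs_nonneg _).trans (hc 0)
  have i1 : Integrable φ μ := Integrable.of_bound hφ.aestronglyMeasurable c (Eventually.of_forall hc)
  have i2 : Integrable (fun y => φ y ^ 2) μ :=
    Integrable.of_bound (hφ.pow_const 2).aestronglyMeasurable (c ^ 2) (Eventually.of_forall fun y => by
      rw [norm_pow]; exact pow_le_pow_left₀ (norm_nonneg _) (hc y) 2)
  set a := ∫ y, φ y ∂μ with ha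
  have hac : |a| ≤ c := by
    have := norm_integral_le_of_norm_le_const (μ := μ) (f := φ) (C := c)
      (Eventually.of_forall hc)
    simpa using this
  have i3 : Integrable (fun y => 1 + l * (φ y - a) + l ^ 2 * (φ y ^ 2 - 2 * a * φ y + a ^ 2)) μ :=
    (((integrable_const 1).add ((i1.sub (integrable_const a)).const_mul l))).add
      (((i2.sub (i1.const_mul (2 * a))).add (integrable_const _)).const_mul _)
  have hpt : ∀ y, Real.exp (l * (φ y - a)) ≤
      1 + l * (φ y - a) + l ^ 2 * (φ y ^ 2 - 2 * a * φ y + a ^ 2) := fun y => by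
    have h1 : |l * (φ y - a)| ≤ 1 := by
      rw [abs_mul, abs_of_nonneg hl]
      refine le_trans ?_ hlc
      gcongr
      exact (abs_sub _ _).trans (by linarith [hc y])
    have h2 := (abs_le.1 (Real.abs_exp_sub_one_sub_id_le h1)).2
    nlinarith
  have hint : ∫ y, (1 + l * (φ y - a) + l ^ 2 * (φ y ^ 2 - 2 * a * φ y + a ^ 2)) ∂μ ≤
      1 + l ^ 2 * V := by
    have e0 : ∀ y, 1 + l * (φ y - a) + l ^ 2 * (φ y ^ 2 - 2 * a * φ y + a ^ 2) =
        (1 - l * a + l ^ 2 * a ^ 2) + (l - 2 * a * l ^ 2) * φ y + l ^ 2 * φ y ^ 2 := fun y => by ring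
    simp only [e0]
    have j1 := integral_add ((integrable_const (μ := μ) (1 - l * a + l ^ 2 * a ^ 2)).add
      (i1.const_mul (l - 2 * a * l ^ 2))) (i2.const_mul (l ^ 2))
    have j2 := integral_add (integrable_const (μ := μ) (1 - l * a + l ^ 2 * a ^ 2))
      (i1.const_mul (l - 2 * a * l ^ 2))
    simp only [Pi.add_apply] at j1
    rw [j1, j2, integral_const_mul, integral_const_mul, integral_const, probReal_univ, one_smul, ← ha]
    have := mul_le_mul_of_nonneg_left hV (sq_nonneg l)
    nlinarith [sq_nonneg (l * a)]
  have e1 : ∀ y, ENNReal.ofReal (Real.exp (l * (φ y - a) - l ^ 2 * V)) ≤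
      ENNReal.ofReal (Real.exp (-(l ^ 2 * V)) *
        (1 + l * (φ y - a) + l ^ 2 * (φ y ^ 2 - 2 * a * φ y + a ^ 2))) := fun y => by
    refine ENNReal.ofReal_le_ofReal ?_
    rw [sub_eq_neg_add, Real.exp_add]
    exact mul_le_mul_of_nonneg_left (hpt y) (Real.exp_pos _).le
  refine (lintegral_mono e1).trans ?_
  rw [← ofReal_integral_eq_lintegral_ofReal (i3.const_mul _) (Eventually.of_forall fun y =>
    mul_nonneg (Real.exp_pos _).le ((Real.exp_pos _).le.trans (hpt y))), integral_const_mul,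
    ← ENNReal.ofReal_one]
  refine ENNReal.ofReal_le_ofReal ?_
  calc _ ≤ Real.exp (-(l ^ 2 * V)) * (1 + l ^ 2 * V) := by gcongr
    _ ≤ Real.exp (-(l ^ 2 * V)) * Real.exp (l ^ 2 * V) := by
        gcongr; rw [add_comm]; exact Real.add_one_le_exp _
    _ = 1 := by rw [← Real.exp_add]; simp

namespace SeriesModel

variable {d : ℕ} {Ω : Type*} [MeasurableSpace Ω] {M : SeriesModel d Ω} {P : Measure Ω}
  [IsProbabilityMeasure P]

/-- Chernoff's bound for the supermartingale with factors `exp (l (φ - mean) - l² V)`. The variance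
stays random: it is charged to the threshold of the event rather than bounded beforehand. -/
lemma measure_sum_gt_le (hM : M.IsLocationScale P) {φ : (ℕ → ℝ) × ℝ → ℝ} (hφ : Measurable φ)
    {S : Set (ℕ → ℝ)} (hS : MeasurableSet S) {V : (ℕ → ℝ) → ℝ} (hV : Measurable V) {c l : ℝ}
    (hc : ∀ x ∈ S, ∀ y, |φ (x, y)| ≤ c) (hl : 0 ≤ l) (hlc : l * (2 * c) ≤ 1)
    (hφV : ∀ x ∈ S, ∫ y, φ (x, y) ^ 2 ∂(P.map (M.noise 0)) ≤ V x) (n : ℕ) (a : ℝ) :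
    P {ω | (∀ j ∈ Finset.Icc 1 n, M.pastX j ω ∈ S) ∧
      l * ∑ j ∈ Finset.Icc 1 n, V (M.pastX j ω) + a <
      ∑ j ∈ Finset.Icc 1 n, (φ (M.pastX j ω, M.noise j ω) -
        ∫ y, φ (M.pastX j ω, y) ∂(P.map (M.noise 0)))} ≤ ENNReal.ofReal (Real.exp (-(l * a))) := by
  have : IsProbabilityMeasure (P.map (M.noise 0)) :=
    Measure.isProbabilityMeasure_map (hM.noise_meas 0).aemeasurable
  -- Off `S` the factor is set to zero. Its conditional mean is then at most `1` at every past, and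
  -- on the event considered no factor is affected.
  set g : (ℕ → ℝ) × ℝ → ℝ≥0∞ := (S ×ˢ Set.univ).indicator fun p =>
    ENNReal.ofReal (Real.exp (l * (φ p - ∫ y, φ (p.1, y) ∂(P.map (M.noise 0))) - l ^ 2 * V p.1))
    with hg
  have hφi : Measurable fun x => ∫ y, φ (x, y) ∂(P.map (M.noise 0)) :=
    hφ.stronglyMeasurable.integral_prod_right'.measurable
  have hgm : Measurable g := by
    refine Measurable.indicator ?_ (hS.prod MeasurableSet.univ)
    exact (Real.measurable_exp.comp (((hφ.sub (hφi.comp measurable_fst)).const_mul l).sub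
      ((hV.comp measurable_fst).const_mul (l ^ 2)))).ennreal_ofReal
  have hg1 : ∀ x, ∫⁻ y, g (x, y) ∂(P.map (M.noise 0)) ≤ 1 := fun x => by
    by_cases hx : x ∈ S
    · have : ∀ y, g (x, y) = ENNReal.ofReal (Real.exp (l * (φ (x, y) -
          ∫ y, φ (x, y) ∂(P.map (M.noise 0))) - l ^ 2 * V x)) := fun y =>
        Set.indicator_of_mem (show (x, y) ∈ S ×ˢ Set.univ from ⟨hx, Set.mem_univ _⟩) _
      simp_rw [this]
      exact lintegral_exp_centered_le_one (φ := fun y => φ (x, y)) (hφ.comp measurable_prodMk_left)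
        (hc x hx) hl hlc (hφV x hx)
    · have : ∀ y, g (x, y) = 0 := fun y => Set.indicator_of_notMem (fun h => hx h.1) _
      simp [this]
  have hle := lintegral_prod_pastX_le_one hM g hgm hg1 n
  have hGm : Measurable fun ω => ∏ j ∈ Finset.Icc 1 n, g (M.pastX j ω, M.noise j ω) :=
    Finset.measurable_fun_prod _ fun j _ =>
      hgm.comp ((measurable_pastX hM _).prodMk (hM.noise_meas _))
  have hne : ENNReal.ofReal (Real.exp (l * a)) ≠ 0 := (ENNReal.ofReal_pos.2 (Real.exp_pos _)).ne'
  calc _ ≤ P {ω | ENNReal.ofReal (Real.exp (l * a)) ≤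
        ∏ j ∈ Finset.Icc 1 n, g (M.pastX j ω, M.noise j ω)} := by
        refine measure_mono fun ω hω => ?_
        simp only [Set.mem_ofPred_eq] at hω ⊢
        obtain ⟨h1, h2⟩ := hω
        have e1 : ∀ j ∈ Finset.Icc 1 n, g (M.pastX j ω, M.noise j ω) =
            ENNReal.ofReal (Real.exp (l * (φ (M.pastX j ω, M.noise j ω) -
              ∫ y, φ (M.pastX j ω, y) ∂(P.map (M.noise 0))) - l ^ 2 * V (M.pastX j ω))) :=
          fun j hj => Set.indicator_of_mem (show _ ∈ S ×ˢ Set.univ from ⟨h1 j hj, Set.mem_univ _⟩) _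
        rw [Finset.prod_congr rfl e1, ← ENNReal.ofReal_prod_of_nonneg fun _ _ => (Real.exp_pos _).le,
          ← Real.exp_sum]
        refine ENNReal.ofReal_le_ofReal (Real.exp_le_exp.2 ?_)
        rw [Finset.sum_sub_distrib, ← Finset.mul_sum, ← Finset.mul_sum]
        nlinarith [mul_le_mul_of_nonneg_left h2.le hl]
    _ ≤ (∫⁻ ω, ∏ j ∈ Finset.Icc 1 n, g (M.pastX j ω, M.noise j ω) ∂P) /
          ENNReal.ofReal (Real.exp (l * a)) :=
        meas_ge_le_lintegral_div hGm.aemeasurable hne ENNReal.ofReal_ne_top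
    _ ≤ 1 / ENNReal.ofReal (Real.exp (l * a)) := by gcongr
    _ = _ := by
        rw [Real.exp_neg, ENNReal.ofReal_inv_of_pos (Real.exp_pos _), one_div]

lemma measure_abs_sum_gt_le (hM : M.IsLocationScale P) {φ : (ℕ → ℝ) × ℝ → ℝ} (hφ : Measurable φ)
    {S : Set (ℕ → ℝ)} (hS : MeasurableSet S) {V : (ℕ → ℝ) → ℝ} (hV : Measurable V) {c l : ℝ}
    (hc : ∀ x ∈ S, ∀ y, |φ (x, y)| ≤ c) (hl : 0 ≤ l) (hlc : l * (2 * c) ≤ 1)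
    (hφV : ∀ x ∈ S, ∫ y, φ (x, y) ^ 2 ∂(P.map (M.noise 0)) ≤ V x) (n : ℕ) (a : ℝ) :
    P {ω | (∀ j ∈ Finset.Icc 1 n, M.pastX j ω ∈ S) ∧
      l * ∑ j ∈ Finset.Icc 1 n, V (M.pastX j ω) + a <
      |∑ j ∈ Finset.Icc 1 n, (φ (M.pastX j ω, M.noise j ω) -
        ∫ y, φ (M.pastX j ω, y) ∂(P.map (M.noise 0)))|} ≤
      2 * ENNReal.ofReal (Real.exp (-(l * a))) := by
  have h1 := measure_sum_gt_le hM hφ hS hV hc hl hlc hφV n a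
  have h2 := measure_sum_gt_le hM (φ := fun p => - φ p) hφ.neg hS hV (c := c)
    (fun x hx y => by rw [abs_neg]; exact hc x hx y) hl hlc
    (fun x hx => by simpa only [neg_sq] using hφV x hx) n a
  rw [two_mul]
  refine (measure_mono ?_).trans ((measure_union_le _ _).trans (add_le_add h1 h2))
  intro ω hω
  simp only [Set.mem_union, Set.mem_ofPred_eq] at hω ⊢
  rcases le_total 0 (∑ j ∈ Finset.Icc 1 n, (φ (M.pastX j ω, M.noise j ω) -
        ∫ y, φ (M.pastX j ω, y) ∂(P.map (M.noise 0)))) with h | h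
  · left; rw [abs_of_nonneg h] at hω; exact hω
  · right; rw [abs_of_nonpos h] at hω
    refine ⟨hω.1, hω.2.trans_le (le_of_eq ?_)⟩
    simp only [integral_neg, ← Finset.sum_neg_distrib]
    exact Finset.sum_congr rfl fun _ _ => by ring

end SeriesModel

/-! ### Increments of the kernel -/

/-- `K` is a kernel bounded by `k` and `k`-Lipschitz. -/
structure LipKernel (K : ℝ → ℝ) (k : ℝ) : Prop extends IsKernel K where
  one_le : 1 ≤ k
  le : ∀ x, K x ≤ k
  lip : ∀ x y, |K x - K y| ≤ k * |x - y|

lemma IsKernel.exists_lipKernel {K : ℝ → ℝ} (hK : IsKernel K) : ∃ k, LipKernel K k := by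
  obtain ⟨C, hC⟩ := hK.contDiff.continuous.bounded_above_of_compact_support hK.hasCompactSupport
  obtain ⟨L, hL⟩ := hK.contDiff.lipschitzWith_of_hasCompactSupport hK.hasCompactSupport one_ne_zero
  refine ⟨max 1 (max C L), hK, le_max_left _ _, fun x => ?_, fun x y => ?_⟩
  · exact (le_abs_self _).trans ((hC x).trans ((le_max_left _ _).trans (le_max_right _ _)))
  · have := hL.dist_le_mul x y
    rw [Real.dist_eq, Real.dist_eq] at this
    refine this.trans ?_
    gcongr
    exact (le_max_right _ _).trans (le_max_right _ _)

namespace LipKernel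

variable {K : ℝ → ℝ} {k b : ℝ}

lemma scaled_nonneg (hK : LipKernel K k) (hb : 0 < b) (u : ℝ) : 0 ≤ scaledKernel K b u :=
  mul_nonneg (by positivity) (hK.nonneg _)

lemma scaled_le (hK : LipKernel K k) (hb : 0 < b) (u : ℝ) : scaledKernel K b u ≤ k / b := by
  rw [scaledKernel, one_div_mul_eq_div]
  gcongr
  exact hK.le _

lemma scaled_lip (hK : LipKernel K k) (hb : 0 < b) (u u' : ℝ) :
    |scaledKernel K b u - scaledKernel K b u'| ≤ k / b ^ 2 * |u - u'| := by
  rw [scaledKernel, scaledKernel, ← mul_sub, abs_mul, abs_of_pos (by positivity : 0 < 1 / b)]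
  calc _ ≤ 1 / b * (k * |u / b - u' / b|) := by gcongr; exact hK.lip _ _
    _ = _ := by
        rw [← sub_div, abs_div, abs_of_pos hb]; field_simp

lemma scaled_eq_zero (hK : LipKernel K k) (hb : 0 < b) {u : ℝ} (hu : b < |u|) :
    scaledKernel K b u = 0 := by
  rw [scaledKernel, hK.support, mul_zero]
  rwa [abs_div, abs_of_pos hb, one_lt_div hb]

lemma abs_mul_scaled_sub_le (hK : LipKernel K k) (hb : 0 < b) (hb1 : b ≤ 1) (w w' u u' : ℝ) :
    |w * scaledKernel K b u - w' * scaledKernel K b u'| ≤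
      k / b ^ 2 * (|w - w'| + |w'| * |u - u'|) := by
  have h1 : scaledKernel K b u ≤ k / b ^ 2 := (hK.scaled_le hb u).trans (by
    have := hK.one_le
    gcongr
    nlinarith)
  have h0 := hK.scaled_nonneg hb u
  have e : w * scaledKernel K b u - w' * scaledKernel K b u' =
      (w - w') * scaledKernel K b u + w' * (scaledKernel K b u - scaledKernel K b u') := by ring
  rw [e]
  refine (abs_add_le _ _).trans ?_
  rw [abs_mul, abs_mul, abs_of_nonneg h0]
  calc _ ≤ |w - w'| * (k / b ^ 2) + |w'| * (k / b ^ 2 * |u - u'|) := by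
        gcongr; exact hK.scaled_lip hb _ _
    _ = _ := by ring

end LipKernel

/-- The difference between a kernel at a perturbed residual and the kernel at the noise. -/
noncomputable def kernelIncr (K : ℝ → ℝ) (b w x s e w' x' y : ℝ) : ℝ :=
  w * scaledKernel K b (x - (y - e) / s) - w' * scaledKernel K b (x' - y)

namespace LipKernel

variable {K : ℝ → ℝ} {k b w x s e w' x' W : ℝ}

/-- Comparing `y` with `y' = (y - e)/s` costs `|s - 1|` times the size of `y` or `y'`, which is
unbounded in general. But if neither kernel vanishes identically there, one of them localises `y`
near `x'` or `y'` near `x`; and if both vanish there is nothing to bound. Hence the factor `2 + |x|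
+ |x'|`. -/
lemma abs_kernelIncr_le (hK : LipKernel K k) (hb : 0 < b) (hb1 : b ≤ 1) (hs : 1 / 2 ≤ s)
    (hw' : |w'| ≤ W) (y : ℝ) : |kernelIncr K b w x s e w' x' y| ≤
      k / b ^ 2 * ((1 + W) * (|w - w'| + |x - x'| + 2 * (2 + |x| + |x'|) * (|s - 1| + |e|))) := by
  have hs0 : 0 < s := by linarith
  have hk := hK.one_le
  have hW : 0 ≤ W := (abs_nonneg _).trans hw'
  set y' := (y - e) / s with hy'
  have ey : y = s * y' + e := by rw [hy']; field_simp; ring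
  have hx0 := abs_nonneg x
  have hx0' := abs_nonneg x'
  have hs1 := abs_nonneg (s - 1)
  have he1 := abs_nonneg e
  have hgen : |y - y'| ≤ 2 * (2 + |x| + |x'|) * (|s - 1| + |e|) →
      |kernelIncr K b w x s e w' x' y| ≤ k / b ^ 2 * ((1 + W) * (|w - w'| + |x - x'| +
        2 * (2 + |x| + |x'|) * (|s - 1| + |e|))) := by
    intro h
    refine (hK.abs_mul_scaled_sub_le hb hb1 w w' (x - y') (x' - y)).trans ?_
    have h2 : |x - y' - (x' - y)| ≤ |x - x'| + |y - y'| := by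
      have : x - y' - (x' - y) = (x - x') + (y - y') := by ring
      rw [this]; exact abs_add_le _ _
    gcongr
    have h3 : |w'| * |x - y' - (x' - y)| ≤ W * (|x - x'| + |y - y'|) := by gcongr
    have h4 := mul_le_mul_of_nonneg_left h hW
    have h5 := abs_nonneg (w - w')
    have h6 := abs_nonneg (x - x')
    have h7 := mul_nonneg hW h5
    have h8 : 0 ≤ 2 * (2 + |x| + |x'|) * (|s - 1| + |e|) := by positivity
    nlinarith only [h3, h4, h5, h6, h7, h8]
  by_cases h1 : b < |x - y'|
  · by_cases h2 : b < |x' - y|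
    · rw [kernelIncr, hK.scaled_eq_zero hb h1, hK.scaled_eq_zero hb h2]
      simp only [mul_zero, sub_zero, abs_zero]
      positivity
    · refine hgen ?_
      have hy : |y| ≤ |x'| + 1 := by
        have := abs_sub_abs_le_abs_sub y x'
        rw [abs_sub_comm] at this
        linarith [not_lt.1 h2]
      have e1 : y - y' = (y * (s - 1) + e) / s := by rw [hy']; field_simp; ring
      rw [e1, abs_div, abs_of_pos hs0, div_le_iff₀ hs0]
      have h3 : |y * (s - 1) + e| ≤ (|x'| + 1) * |s - 1| + |e| := by
        refine (abs_add_le _ _).trans ?_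
        rw [abs_mul]; gcongr
      have h4 : 0 ≤ (2 + |x| + |x'|) * (|s - 1| + |e|) := by positivity
      have h5 : (|x'| + 1) * |s - 1| + |e| ≤ (2 + |x| + |x'|) * (|s - 1| + |e|) := by nlinarith
      nlinarith
  · refine hgen ?_
    have hy : |y'| ≤ |x| + 1 := by
      have := abs_sub_abs_le_abs_sub y' x
      rw [abs_sub_comm] at this
      linarith [not_lt.1 h1]
    have e1 : y - y' = y' * (s - 1) + e := by rw [ey]; ring
    have h3 : |y' * (s - 1) + e| ≤ (|x| + 1) * |s - 1| + |e| := by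
      refine (abs_add_le _ _).trans ?_
      rw [abs_mul]; gcongr
    have h5 : (|x| + 1) * |s - 1| + |e| ≤ (2 + |x| + |x'|) * (|s - 1| + |e|) := by nlinarith
    have h4 : 0 ≤ (2 + |x| + |x'|) * (|s - 1| + |e|) := by positivity
    rw [e1]; linarith

lemma kernelIncr_eq_zero (hK : LipKernel K k) (hb : 0 < b) (hs : 1 / 2 ≤ s) (hs2 : s ≤ 2)
    {y : ℝ} (hy : y ∉ Set.Icc (s * x + e - 2 * b) (s * x + e + 2 * b) ∪ Set.Icc (x' - b) (x' + b)) :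
    kernelIncr K b w x s e w' x' y = 0 := by
  have hs0 : 0 < s := by linarith
  rw [Set.mem_union, not_or, Set.mem_Icc, Set.mem_Icc] at hy
  have h2 : b < |x' - y| := by
    by_contra hcon
    have := abs_le.1 (not_lt.1 hcon)
    exact hy.2 ⟨by linarith, by linarith⟩
  have h1 : b < |x - (y - e) / s| := by
    by_contra hcon
    have h3 := not_lt.1 hcon
    have h4 : |s * x + e - y| ≤ 2 * b := by
      have : s * x + e - y = s * (x - (y - e) / s) := by field_simp; ring
      rw [this, abs_mul, abs_of_pos hs0]
      exact mul_le_mul hs2 h3 (abs_nonneg _) (by norm_num)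
    have := abs_le.1 h4
    exact hy.1 ⟨by linarith, by linarith⟩
  rw [kernelIncr, hK.scaled_eq_zero hb h1, hK.scaled_eq_zero hb h2]
  simp

/-- The increment lives on two intervals of lengths `4b` and `2b`, hence on a set of probability at
most `6 F b`. The gain of a factor `b` over the square of the supremum is what makes the Bernstein
bound strong enough. -/
lemma integral_kernelIncr_sq_le (hK : LipKernel K k) (hb : 0 < b) (hs : 1 / 2 ≤ s)
    (hs2 : s ≤ 2) {μ : Measure ℝ} [IsProbabilityMeasure μ] {F : ℝ} (hF : 0 ≤ F)
    (hμ : ∀ p q, p ≤ q → μ (Set.Icc p q) ≤ ENNReal.ofReal (F * (q - p))) {c : ℝ}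
    (hc : ∀ y, |kernelIncr K b w x s e w' x' y| ≤ c) :
    ∫ y, kernelIncr K b w x s e w' x' y ^ 2 ∂μ ≤ c ^ 2 * (6 * F * b) := by
  set S := Set.Icc (s * x + e - 2 * b) (s * x + e + 2 * b) ∪ Set.Icc (x' - b) (x' + b) with hS
  have hSm : MeasurableSet S := measurableSet_Icc.union measurableSet_Icc
  have h1 : ∀ y, kernelIncr K b w x s e w' x' y ^ 2 ≤ S.indicator (fun _ => c ^ 2) y := fun y => by
    by_cases hy : y ∈ S
    · rw [Set.indicator_of_mem hy, ← sq_abs]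
      exact pow_le_pow_left₀ (abs_nonneg _) (hc y) 2
    · rw [Set.indicator_of_notMem hy, hK.kernelIncr_eq_zero hb hs hs2 hy]; simp
  have h2 : ∫ y, kernelIncr K b w x s e w' x' y ^ 2 ∂μ ≤ ∫ y, S.indicator (fun _ => c ^ 2) y ∂μ :=
    integral_mono_of_nonneg (Eventually.of_forall fun y => sq_nonneg _)
      ((integrable_const _).indicator hSm) (Eventually.of_forall h1)
  refine h2.trans ?_
  rw [integral_indicator_const _ hSm, smul_eq_mul, mul_comm]
  gcongr
  rw [measureReal_def]
  refine ENNReal.toReal_le_of_le_ofReal (by positivity) ((measure_union_le _ _).trans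
    ((add_le_add (hμ _ _ (by linarith)) (hμ _ _ (by linarith))).trans (le_of_eq ?_)))
  rw [← ENNReal.ofReal_add (by ring_nf; positivity) (by ring_nf; positivity)]
  congr 1; ring

end LipKernel

/-! ### Nets and bandwidths -/

/-- A set on which finitely many bounded real coordinates are given has a net of polynomial size. -/
lemma exists_coordinate_net {ι T : Type*} [Fintype ι] (S : Set T) (φ : T → ι → ℝ) {R : ℝ}
    (hR : ∀ p ∈ S, ∀ i, |φ p i| ≤ R) {m : ℕ} (hm : 0 < m) :
    ∃ t : Finset T, (∀ p ∈ t, p ∈ S) ∧ t.card ≤ (2 * ⌈R * m⌉₊ + 2) ^ Fintype.card ι ∧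
      ∀ p ∈ S, ∃ p' ∈ t, ∀ i, |φ p i - φ p' i| ≤ 1 / m := by
  classical
  have hm0 : (0 : ℝ) < m := by exact_mod_cast hm
  set N := ⌈R * m⌉₊ with hN
  -- The cell of `p` in the grid of mesh `1/m`. Each integer coordinate lies between `-N - 1` and
  -- `N`, which gives `2N + 2` values.
  set c : T → ι → ℤ := fun p i => ⌊φ p i * m⌋ with hc
  set Z : Finset (ι → ℤ) := Fintype.piFinset fun _ => Finset.Icc (-(N : ℤ) - 1) N with hZ
  have hcZ : ∀ p ∈ S, c p ∈ Z := fun p hp => by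
    rw [hZ, Fintype.mem_piFinset]
    intro i
    have h1 := abs_le.1 (hR p hp i)
    have h2 : R * m ≤ N := Nat.le_ceil _
    rw [Finset.mem_Icc]
    constructor
    · rw [hc, Int.le_floor]; push_cast; nlinarith
    · have h3 : (⌊φ p i * m⌋ : ℝ) ≤ N := (Int.floor_le _).trans (by nlinarith)
      exact_mod_cast h3
  -- Only the cells that meet `S` are kept, so that every cell has a representative in `S`.
  set Z' := Z.filter fun z => ∃ p ∈ S, c p = z with hZ'
  have hex : ∀ z : Z', ∃ p ∈ S, c p = z := fun z => (Finset.mem_filter.1 z.2).2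
  choose g hgS hgc using hex
  refine ⟨Finset.univ.image g, ?_, ?_, ?_⟩
  · intro p hp
    obtain ⟨z, -, rfl⟩ := Finset.mem_image.1 hp
    exact hgS z
  · refine Finset.card_image_le.trans ?_
    rw [Finset.card_univ, Fintype.card_coe]
    refine (Finset.card_filter_le _ _).trans (le_of_eq ?_)
    rw [hZ, Fintype.card_piFinset]
    simp only [Int.card_Icc, Finset.prod_const, Finset.card_univ]
    congr 1
    omega
  · intro p hp
    have hz : c p ∈ Z' := Finset.mem_filter.2 ⟨hcZ p hp, p, hp, rfl⟩
    refine ⟨g ⟨c p, hz⟩, Finset.mem_image_of_mem _ (Finset.mem_univ _), fun i => ?_⟩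
    have h1 : ⌊φ p i * m⌋ = ⌊φ (g ⟨c p, hz⟩) i * m⌋ := (congrFun (hgc ⟨c p, hz⟩) i).symm
    have h2 := Int.abs_sub_lt_one_of_floor_eq_floor h1
    rw [← sub_mul, abs_mul, abs_of_pos hm0] at h2
    rw [le_div_iff₀ hm0]
    exact h2.le

lemma norm_le_of_abs_apply_le {d : ℕ} {u : Par d} {c : ℝ} (h : ∀ k, |u k| ≤ c) : ‖u‖ ≤ d * c := by
  have h1 := (EuclideanSpace.basisFun (Fin d) ℝ).sum_repr u
  rw [← h1]
  refine (norm_sum_le _ _).trans ((Finset.sum_le_sum (g := fun _ => c) fun k _ => ?_).trans (by simp))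
  rw [norm_smul, OrthonormalBasis.norm_eq_one, mul_one]
  simpa using h k

/-- A bandwidth going to zero, but slower than `n ^ (-1 / 3)` by a power of `n`. -/
structure Bandwidth (b : ℕ → ℝ) (a : ℝ) : Prop where
  pos : ∀ n, 0 < b n
  tendsto : Tendsto b atTop (𝓝 0)
  rate_pos : 0 < a
  rate : ∀ᶠ n : ℕ in atTop, (n : ℝ) ^ a ≤ b n * (n : ℝ) ^ (1 / 3 : ℝ)

/-- From `n b^(3+δ) ≥ 1` follows `b ≥ n^(-1/(3+δ))`, so `b n^(1/3)` is at least `n` to the power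
`1/3 - 1/(3+δ) > 0`. The upper condition is used only for `b → 0`. -/
lemma exists_bandwidth {b : ℕ → ℝ} (hb : ∀ n, 0 < b n)
    (hb_low : ∃ δ ∈ Set.Ioo (0 : ℝ) 1, Tendsto (fun n : ℕ => (n : ℝ) * b n ^ (3 + δ)) atTop atTop)
    (hb_up : Tendsto (fun n : ℕ => (n : ℝ) * b n ^ 4) atTop (𝓝 0)) : ∃ a, Bandwidth b a := by
  obtain ⟨δ, ⟨hδ0, hδ1⟩, hδ⟩ := hb_low
  refine ⟨1 / 3 - 1 / (3 + δ), hb, ?_, ?_, ?_⟩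
  · have h1 : Tendsto (fun n : ℕ => b n ^ 4) atTop (𝓝 0) := by
      refine squeeze_zero' (Eventually.of_forall fun n => pow_nonneg (hb n).le 4) ?_ hb_up
      filter_upwards [eventually_ge_atTop 1] with n hn
      have : (1 : ℝ) ≤ n := by exact_mod_cast hn
      exact le_mul_of_one_le_left (pow_nonneg (hb n).le 4) this
    have h0 : Tendsto Real.sqrt (𝓝 0) (𝓝 0) := by simpa using Real.continuous_sqrt.tendsto 0
    refine (h0.comp (h0.comp h1)).congr fun n => ?_
    simp only [Function.comp]
    rw [show b n ^ 4 = (b n ^ 2) ^ 2 by ring, Real.sqrt_sq (sq_nonneg _), Real.sqrt_sq (hb n).le]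
  · rw [sub_pos]; exact one_div_lt_one_div_of_lt (by norm_num) (by linarith)
  · filter_upwards [hδ.eventually_ge_atTop 1, eventually_ge_atTop 1] with n hn hn1
    have hn0 : (0 : ℝ) < n := by exact_mod_cast hn1
    have h3 : (0 : ℝ) < 3 + δ := by linarith
    rw [sub_eq_neg_add, Real.rpow_add hn0]
    refine mul_le_mul_of_nonneg_right ?_ (by positivity)
    have h4 : (n : ℝ) ^ (-(1 : ℝ)) ≤ b n ^ (3 + δ) := by
      rw [Real.rpow_neg_one, inv_le_iff_one_le_mul₀ hn0, mul_comm]; exact hn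
    have h5 := Real.rpow_le_rpow (by positivity) h4 (one_div_pos.2 h3).le
    rw [← Real.rpow_mul hn0.le, ← Real.rpow_mul (hb n).le, mul_one_div_cancel h3.ne',
      Real.rpow_one, neg_one_mul] at h5
    exact h5

lemma tendsto_pow_mul_exp_neg_rpow {a c : ℝ} (ha : 0 < a) (hc : 0 < c) (m : ℕ) :
    Tendsto (fun n : ℕ => (n : ℝ) ^ m * Real.exp (-(c * (n : ℝ) ^ a))) atTop (𝓝 0) := by
  have h1 := tendsto_rpow_mul_exp_neg_mul_atTop_nhds_zero (m / a) c hc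
  have h2 : Tendsto (fun n : ℕ => (n : ℝ) ^ a) atTop atTop :=
    (tendsto_rpow_atTop ha).comp tendsto_natCast_atTop_atTop
  refine (h1.comp h2).congr fun n => ?_
  simp only [Function.comp]
  rw [← Real.rpow_mul (Nat.cast_nonneg n), mul_div_cancel₀ _ ha.ne', Real.rpow_natCast, neg_mul]

/-! ### Deviation inequality for one family of increments -/

namespace SeriesModel

variable {d : ℕ} {Ω : Type*} [MeasurableSpace Ω] {M : SeriesModel d Ω} {P : Measure Ω}
  [IsProbabilityMeasure P] {r γ : ℝ} {A B E : (ℕ → ℝ) → ℝ} {f : ℝ → ℝ} {F : ℝ}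
  {K : ℝ → ℝ} {k : ℝ}

lemma noise_Icc_le (h5 : M.A5 P f) (hf : SmoothBdd f F) {p q : ℝ} :
    P.map (M.noise 0) (Set.Icc p q) ≤ ENNReal.ofReal (F * (q - p)) := by
  have hF := hf.one_le
  rw [h5.law, withDensity_apply _ measurableSet_Icc]
  calc _ ≤ ∫⁻ _ in Set.Icc p q, ENNReal.ofReal F := by
        refine lintegral_mono fun y => ENNReal.ofReal_le_ofReal ((le_abs_self _).trans (hf.bdd y))
    _ = _ := by
        rw [lintegral_const, Measure.restrict_apply_univ, Real.volume_Icc,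
          ENNReal.ofReal_mul (by linarith)]

lemma measurable_scaledKernel (hK : IsKernel K) (b : ℝ) : Measurable (scaledKernel K b) :=
  (hK.contDiff.continuous.measurable.comp (measurable_id.div_const b)).const_mul (1 / b)

lemma integral_kernelIncr (h5 : M.A5 P f) [IsProbabilityMeasure (P.map (M.noise 0))]
    (hK : LipKernel K k) {b w x s e w' x' : ℝ} (hb : 0 < b) (hs : 0 < s) :
    ∫ y, kernelIncr K b w x s e w' x' y ∂(P.map (M.noise 0)) =
      kernelMean K f b w x s e - kernelMean K f b w' x' 1 0 := by
  have hm := measurable_scaledKernel hK.toIsKernel b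
  have hi : ∀ g : ℝ → ℝ, Measurable g →
      Integrable (fun y => scaledKernel K b (g y)) (P.map (M.noise 0)) := fun g hg =>
    Integrable.of_bound (hm.comp hg).aestronglyMeasurable (k / b) (Eventually.of_forall fun y => by
      rw [Real.norm_eq_abs, abs_of_nonneg (hK.scaled_nonneg hb _)]; exact hK.scaled_le hb _)
  have h1 : ∀ (x s e : ℝ), 0 < s → ∫ y, scaledKernel K b (x - (y - e) / s) ∂(P.map (M.noise 0)) =
      ∫ z, K z * (s * f (s * (x - b * z) + e)) := fun x s e hs => by
    rw [integral_noise h5, integral_scaledKernel_affine K f hb hs e x]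
  have h2 := h1 x' 1 0 one_pos
  simp only [sub_zero, div_one] at h2
  have e1 := integral_sub ((hi (fun y => x - (y - e) / s)
    (((measurable_id.sub_const e).div_const s).const_sub x)).const_mul w)
    ((hi (fun y => x' - y) (measurable_id.const_sub x')).const_mul w')
  simp only [kernelIncr]
  rw [e1, integral_const_mul, integral_const_mul, h1 x s e hs, h2]
  rfl

/-- The envelope of the perturbations of the residuals. -/
def envR (A B : (ℕ → ℝ) → ℝ) (x : ℕ → ℝ) : ℝ := 1 + A x + B x

/-- The parameters of an increment of the kernel. -/
structure KernelPar (d : ℕ) where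
  θ : Par d
  x : ℝ
  x' : ℝ
  w : ℝ
  w' : ℝ

/-- The increment of the kernel as a function of the past and of the noise. -/
noncomputable def incr (M : SeriesModel d Ω) (K : ℝ → ℝ) (b : ℝ) (p : KernelPar d)
    (z : (ℕ → ℝ) × ℝ) : ℝ :=
  kernelIncr K b p.w p.x (M.sF p.θ z.1) (M.eF p.θ z.1) p.w' p.x' z.2

/-- The conditional mean of the increment of the kernel given the past. -/
noncomputable def incrMean (M : SeriesModel d Ω) (K f : ℝ → ℝ) (b : ℝ) (p : KernelPar d)
    (y : ℕ → ℝ) : ℝ :=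
  kernelMean K f b p.w p.x (M.sF p.θ y) (M.eF p.θ y) - kernelMean K f b p.w' p.x' 1 0

/-- The size of the increment of the kernel. -/
noncomputable def KernelPar.size (n : ℕ) (p : KernelPar d) : ℝ :=
  |p.w - p.w'| + |p.x - p.x'| + (2 + |p.x| + |p.x'|) / √(n : ℝ)

/-- The pasts at which the perturbation of the residuals is under control. -/
def controlled (M : SeriesModel d Ω) (A B : (ℕ → ℝ) → ℝ) (C₀ T : ℝ) (n : ℕ) (θ : Par d) :
    Set (ℕ → ℝ) :=
  {y | (envR A B y ≤ T ∧ 1 / 2 ≤ M.sF θ y) ∧ M.sF θ y ≤ 2 ∧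
    |M.sF θ y - 1| + |M.eF θ y| ≤ 2 * C₀ * envR A B y / √(n : ℝ)}

lemma measurable_envR (hE : M.Envelopes P r γ A B E) : Measurable (envR A B) :=
  (measurable_const.add hE.measA).add hE.measB

lemma one_le_envR (hE : M.Envelopes P r γ A B E) (x : ℕ → ℝ) : 1 ≤ envR A B x := by
  have := hE.A_nonneg x; have := hE.B_nonneg x
  simp only [envR]; linarith

lemma measurableSet_controlled (hM : M.IsLocationScale P) (hE : M.Envelopes P r γ A B E)
    {C₀ T : ℝ} {n : ℕ} {θ : Par d} (hθ : θ ∈ M.Θ) :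
    MeasurableSet (M.controlled A B C₀ T n θ) := by
  have hs := measurable_sF hM hθ
  have he := measurable_eF hM hθ
  have hR := measurable_envR hE
  exact ((measurableSet_le hR measurable_const).inter (measurableSet_le measurable_const hs)).inter
    ((measurableSet_le hs measurable_const).inter (measurableSet_le
      ((hs.sub_const 1).norm.add he.norm) ((hR.const_mul _).div_const _)))

lemma measurable_incr (hM : M.IsLocationScale P) (hK : IsKernel K) {b : ℝ} {p : KernelPar d}
    (hθ : p.θ ∈ M.Θ) : Measurable (M.incr K b p) := by
  have hm := measurable_scaledKernel hK b
  have hs := (measurable_sF hM hθ).comp (measurable_fst : Measurable (Prod.fst : _ × ℝ → _))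
  have he := (measurable_eF hM hθ).comp (measurable_fst : Measurable (Prod.fst : _ × ℝ → _))
  exact ((hm.comp (((measurable_snd.sub he).div hs).const_sub p.x)).const_mul p.w).sub
    ((hm.comp (measurable_snd.const_sub p.x')).const_mul p.w')

lemma KernelPar.size_pos {n : ℕ} (hn : 1 ≤ n) (p : KernelPar d) : 0 < p.size n := by
  have : (0 : ℝ) < √(n : ℝ) := Real.sqrt_pos.2 (by exact_mod_cast hn)
  rw [size]; positivity

/-- On controlled pasts the increments are at most `H T N / b²`, with `N` the size of the parameter,
and their conditional variances are at most `(H envR N / b²)²` times `6 F b`. Bernstein's bound at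
the scale `τ N` has an exponent free of `N`, so one estimate serves all parameters, however small
the increments. The hypothesis `hτ` says that the variance term is dominated by the supremum term.
-/
lemma measure_incr_gt_le (hM : M.IsLocationScale P) (hE : M.Envelopes P r γ A B E)
    (h5 : M.A5 P f) (hf : SmoothBdd f F) (hK : LipKernel K k) {b C₀ T W C τ : ℝ} (hb : 0 < b)
    (hb1 : b ≤ 1) (hC₀ : 0 ≤ C₀) (hT : 0 < T) {n : ℕ} (hn : 1 ≤ n) {p : KernelPar d}
    (hp : p.θ ∈ M.Θ) (hw : |p.w'| ≤ W)
    (hτ : 6 * F * (k * (1 + W) * (1 + 4 * C₀)) * C ≤ τ * (b * T)) :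
    P {ω | (∀ j ∈ Finset.Icc 1 n, M.pastX j ω ∈ M.controlled A B C₀ T n p.θ) ∧
      avg n (fun j => envR A B (M.pastX j ω) ^ 2) ≤ C ∧
      τ * p.size n < |avg n (fun j => M.incr K b p (M.pastX j ω, M.noise j ω) -
        M.incrMean K f b p (M.pastX j ω))|} ≤
      2 * ENNReal.ofReal (Real.exp (-(τ * (n * b ^ 2) / (4 * (k * (1 + W) * (1 + 4 * C₀)) * T)))) := by
  have hprob : IsProbabilityMeasure (P.map (M.noise 0)) :=
    Measure.isProbabilityMeasure_map (hM.noise_meas 0).aemeasurable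
  have hW : 0 ≤ W := (abs_nonneg _).trans hw
  have hk := hK.one_le
  have hF := hf.one_le
  set H := k * (1 + W) * (1 + 4 * C₀) with hH
  have hH0 : 0 < H := by positivity
  have hN := p.size_pos hn
  set N := p.size n with hNdef
  have hn0 : (0 : ℝ) < n := by exact_mod_cast hn
  have hsq : (0 : ℝ) < √(n : ℝ) := Real.sqrt_pos.2 hn0
  have hbound : ∀ y ∈ M.controlled A B C₀ T n p.θ, ∀ z, |M.incr K b p (y, z)| ≤
      H / b ^ 2 * envR A B y * N := by
    rintro y ⟨⟨h1, h2⟩, h3, h4⟩ z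
    refine (hK.abs_kernelIncr_le hb hb1 h2 hw z).trans ?_
    have hR1 := one_le_envR hE y
    have hD : |p.w - p.w'| + |p.x - p.x'| + 2 * (2 + |p.x| + |p.x'|) *
        (|M.sF p.θ y - 1| + |M.eF p.θ y|) ≤ (1 + 4 * C₀) * envR A B y * N := by
      have h5 : 2 * (2 + |p.x| + |p.x'|) * (|M.sF p.θ y - 1| + |M.eF p.θ y|) ≤
          4 * C₀ * envR A B y * ((2 + |p.x| + |p.x'|) / √(n : ℝ)) := by
        calc _ ≤ 2 * (2 + |p.x| + |p.x'|) * (2 * C₀ * envR A B y / √(n : ℝ)) := by gcongr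
          _ = _ := by ring
      have h6 : 0 ≤ (2 + |p.x| + |p.x'|) / √(n : ℝ) := by positivity
      have h7 : 0 ≤ |p.w - p.w'| + |p.x - p.x'| := by positivity
      have h8 : 1 ≤ (1 + 4 * C₀) * envR A B y := by nlinarith
      rw [hNdef, KernelPar.size]
      nlinarith [mul_le_mul_of_nonneg_right h8 h7,
        mul_nonneg (zero_le_one.trans hR1) h6]
    calc _ ≤ k / b ^ 2 * ((1 + W) * ((1 + 4 * C₀) * envR A B y * N)) := by gcongr
      _ = _ := by rw [hH]; ring
  have hbound' : ∀ y ∈ M.controlled A B C₀ T n p.θ, ∀ z, |M.incr K b p (y, z)| ≤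
      H / b ^ 2 * T * N := fun y hy z => by
    refine (hbound y hy z).trans ?_
    have := hy.1.1
    gcongr
  -- The largest `l` with `l` times twice the supremum at most `1`.
  set l := b ^ 2 / (2 * H * T * N) with hl
  have hl0 : 0 < l := by positivity
  have hVm : Measurable fun y => (H / b ^ 2 * envR A B y * N) ^ 2 * (6 * F * b) :=
    ((((measurable_envR hE).const_mul _).mul_const _).pow_const 2).mul_const _
  have hlc : l * (2 * (H / b ^ 2 * T * N)) ≤ 1 := le_of_eq (by rw [hl]; field_simp)
  have hsqV : ∀ y ∈ M.controlled A B C₀ T n p.θ,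
      ∫ z, M.incr K b p (y, z) ^ 2 ∂(P.map (M.noise 0)) ≤
        (H / b ^ 2 * envR A B y * N) ^ 2 * (6 * F * b) := by
    intro y hy
    have hc := hbound y hy
    obtain ⟨⟨h1, h2⟩, h3, h4⟩ := hy
    have hF0 : 0 ≤ F := by linarith
    have hμ : ∀ p q : ℝ, p ≤ q → P.map (M.noise 0) (Set.Icc p q) ≤ ENNReal.ofReal (F * (q - p)) :=
      fun _ _ _ => noise_Icc_le h5 hf
    simp only [incr] at hc ⊢
    exact hK.integral_kernelIncr_sq_le hb h2 h3 hF0 hμ hc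
  -- Half of the deviation `τ N n` is spent on the variance term, and the other half is the
  -- parameter `a`.
  have main := measure_abs_sum_gt_le hM (measurable_incr hM hK.toIsKernel (b := b) hp)
    (measurableSet_controlled hM hE (C₀ := C₀) (T := T) (n := n) hp) hVm hbound' hl0.le hlc
    hsqV n (τ * N * n / 2)
  refine (measure_mono ?_).trans (main.trans (le_of_eq ?_))
  · intro ω hω
    simp only [Set.mem_ofPred_eq] at hω ⊢
    obtain ⟨h1, h2, h3⟩ := hω
    refine ⟨h1, ?_⟩
    have e1 : ∑ j ∈ Finset.Icc 1 n, (M.incr K b p (M.pastX j ω, M.noise j ω) -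
        ∫ y, M.incr K b p (M.pastX j ω, y) ∂(P.map (M.noise 0))) =
        n * avg n (fun j => M.incr K b p (M.pastX j ω, M.noise j ω) -
          M.incrMean K f b p (M.pastX j ω)) := by
      rw [avg, mul_inv_cancel_left₀ hn0.ne']
      refine Finset.sum_congr rfl fun j hj => ?_
      have hs : 0 < M.sF p.θ (M.pastX j ω) := by
        have := (h1 j hj).1.2
        linarith
      have := integral_kernelIncr (w := p.w) (x := p.x) (e := M.eF p.θ (M.pastX j ω)) (w' := p.w')
        (x' := p.x') h5 hK hb hs
      rw [incrMean, ← this]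
      rfl
    have e2 : ∑ j ∈ Finset.Icc 1 n, (H / b ^ 2 * envR A B (M.pastX j ω) * N) ^ 2 * (6 * F * b) =
        n * ((H / b ^ 2 * N) ^ 2 * (6 * F * b) * avg n (fun j => envR A B (M.pastX j ω) ^ 2)) := by
      rw [avg, Finset.mul_sum, Finset.mul_sum, Finset.mul_sum]
      refine Finset.sum_congr rfl fun j _ => ?_
      field_simp
    rw [e1, e2, abs_mul, abs_of_pos hn0]
    have e3 : l * (n * ((H / b ^ 2 * N) ^ 2 * (6 * F * b) *
        avg n (fun j => envR A B (M.pastX j ω) ^ 2))) ≤ τ * N * n / 2 := by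
      calc _ ≤ l * (n * ((H / b ^ 2 * N) ^ 2 * (6 * F * b) * C)) := by gcongr
        _ = 6 * F * H * C * (N * n / (2 * b * T)) := by rw [hl]; field_simp
        _ ≤ τ * (b * T) * (N * n / (2 * b * T)) := by gcongr
        _ = τ * N * n / 2 := by field_simp
    have := mul_lt_mul_of_pos_left h3 hn0
    linarith
  · congr 4
    rw [hl]; field_simp; ring

end SeriesModel

/-! ### Dependence of the increments on their parameters, and a net -/

lemma LipKernel.abs_kernelIncr_sub_le {K : ℝ → ℝ} {k b w x s e w' x' w₁ x₁ s₁ e₁ w₁' x₁' W : ℝ}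
    (hK : LipKernel K k) (hb : 0 < b) (hb1 : b ≤ 1) (hs : 1 / 2 ≤ s) (hs₁ : 1 / 2 ≤ s₁)
    (hw : |w₁| ≤ W) (hw' : |w₁'| ≤ W) (y : ℝ) :
    |kernelIncr K b w x s e w' x' y - kernelIncr K b w₁ x₁ s₁ e₁ w₁' x₁' y| ≤
      k / b ^ 2 * (|w - w₁| + W * (|x - x₁| + 4 * (|y| + |e|) * |s - s₁| + 2 * |e - e₁|) +
        |w' - w₁'| + W * |x' - x₁'|) := by
  have hk := hK.one_le
  have hs0 : 0 < s := by linarith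
  have hs10 : 0 < s₁ := by linarith
  have h1 := hK.abs_mul_scaled_sub_le hb hb1 w w₁ (x - (y - e) / s) (x₁ - (y - e₁) / s₁)
  have h2 := hK.abs_mul_scaled_sub_le hb hb1 w' w₁' (x' - y) (x₁' - y)
  have h3 : |(y - e) / s - (y - e₁) / s₁| ≤ 4 * (|y| + |e|) * |s - s₁| + 2 * |e - e₁| := by
    have e1 : (y - e) / s - (y - e₁) / s₁ = (y - e) * (s₁ - s) / (s * s₁) - (e - e₁) / s₁ := by
      field_simp; ring
    rw [e1]
    refine (abs_sub _ _).trans (add_le_add ?_ ?_)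
    · rw [abs_div, abs_mul, abs_of_pos (mul_pos hs0 hs10), div_le_iff₀ (mul_pos hs0 hs10),
        abs_sub_comm s₁]
      have h4 : 1 / 4 ≤ s * s₁ := by nlinarith
      have h5 : |y - e| ≤ |y| + |e| := abs_sub _ _
      calc _ ≤ (|y| + |e|) * |s - s₁| := by gcongr
        _ = 4 * (|y| + |e|) * |s - s₁| * (1 / 4) := by ring
        _ ≤ _ := by gcongr
    · rw [abs_div, abs_of_pos hs10, div_le_iff₀ hs10]
      nlinarith [abs_nonneg (e - e₁)]
  have h4 : |x - (y - e) / s - (x₁ - (y - e₁) / s₁)| ≤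
      |x - x₁| + (4 * (|y| + |e|) * |s - s₁| + 2 * |e - e₁|) := by
    have : x - (y - e) / s - (x₁ - (y - e₁) / s₁) =
        (x - x₁) - ((y - e) / s - (y - e₁) / s₁) := by ring
    rw [this]
    exact (abs_sub _ _).trans (add_le_add le_rfl h3)
  have h5 : |x' - y - (x₁' - y)| = |x' - x₁'| := by congr 1; ring
  have e2 : ∀ a c g h : ℝ, a - c - (g - h) = (a - g) - (c - h) := fun _ _ _ _ => by ring
  rw [kernelIncr, kernelIncr, e2]
  refine (abs_sub _ _).trans ((add_le_add h1 h2).trans ?_)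
  rw [← mul_add, h5]
  refine mul_le_mul_of_nonneg_left ?_ (by positivity)
  have h6 : |w₁| * |x - (y - e) / s - (x₁ - (y - e₁) / s₁)| ≤
      W * (|x - x₁| + (4 * (|y| + |e|) * |s - s₁| + 2 * |e - e₁|)) :=
    mul_le_mul hw h4 (abs_nonneg _) ((abs_nonneg _).trans hw)
  have h7 : |w₁'| * |x' - x₁'| ≤ W * |x' - x₁'| := mul_le_mul_of_nonneg_right hw' (abs_nonneg _)
  linarith only [h6, h7]

namespace SeriesModel

variable {d : ℕ} {Ω : Type*} [MeasurableSpace Ω] {M : SeriesModel d Ω} {P : Measure Ω}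
  [IsProbabilityMeasure P] {r γ : ℝ} {A B E : (ℕ → ℝ) → ℝ} {f : ℝ → ℝ} {F : ℝ}
  {K : ℝ → ℝ} {k C₀ T W : ℝ} {n : ℕ}

/-- The parameters of the increments that occur at sample size `n`. -/
def parSet (M : SeriesModel d Ω) (r C₀ W : ℝ) (n : ℕ) : Set (KernelPar d) :=
  {p | p.θ ∈ M.nhd r ∧ √(n : ℝ) * ‖p.θ - M.θ₀‖ ≤ C₀ ∧ |p.x| ≤ n ∧ |p.x'| ≤ n ∧ |p.w| ≤ W ∧ |p.w'| ≤ W}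

/-- The perturbations are at most `envR ‖θ - θ₀‖ ≤ T C₀ / √n ≤ 1/2`, so `s` stays within `[1/2, 2]`.
-/
lemma Regular.mem_controlled {x : ℕ → ℝ} (h : M.Regular r γ A B E x) (hE : M.Envelopes P r γ A B E)
    (h0 : M.θ₀ ∈ M.nhd r) (hn : 1 ≤ n) {θ : Par d} (hθ : θ ∈ M.nhd r)
    (hC : √(n : ℝ) * ‖θ - M.θ₀‖ ≤ C₀) (hT : envR A B x ≤ T) (hTn : T * C₀ ≤ 1 / 2 * √(n : ℝ)) :
    x ∈ M.controlled A B C₀ T n θ ∧ |M.eF θ x| ≤ 1 := by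
  have hs := h.abs_sF_sub_one hE.γ_pos h0 hθ
  have he := h.abs_eF hE.γ_pos h0 hθ
  have hA := hE.A_nonneg x
  have hB := hE.B_nonneg x
  have hsq : (0 : ℝ) < √(n : ℝ) := Real.sqrt_pos.2 (by exact_mod_cast hn)
  have hΔ : ‖θ - M.θ₀‖ ≤ C₀ / √(n : ℝ) := by rw [le_div_iff₀ hsq]; linarith
  have hC0 : 0 ≤ C₀ := le_trans (by positivity) hC
  have hR1 := one_le_envR hE x
  have hAR : A x ≤ envR A B x := by simp only [envR]; linarith
  have hBR : B x ≤ envR A B x := by simp only [envR]; linarith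
  have hR : ∀ c, 0 ≤ c → c ≤ envR A B x → c * ‖θ - M.θ₀‖ ≤ envR A B x * (C₀ / √(n : ℝ)) :=
    fun c hc hcR => by gcongr
  have hhalf : envR A B x * (C₀ / √(n : ℝ)) ≤ 1 / 2 := by
    rw [← mul_div_assoc, div_le_iff₀ hsq]
    exact (mul_le_mul_of_nonneg_right hT hC0).trans hTn
  have s1 := hs.trans (hR _ hB hBR)
  have s2 := he.trans (hR _ hA hAR)
  have s3 := abs_le.1 (s1.trans hhalf)
  refine ⟨⟨⟨hT, by linarith⟩, by linarith, (add_le_add s1 s2).trans (le_of_eq (by ring))⟩, by linarith⟩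

lemma abs_incr_sub_le (hE : M.Envelopes P r γ A B E) (hK : LipKernel K k) (h0 : M.θ₀ ∈ M.nhd r)
    {b : ℝ} (hb : 0 < b) (hb1 : b ≤ 1) {x : ℕ → ℝ} (h : M.Regular r γ A B E x)
    {p p₁ : KernelPar d} (hp : p ∈ M.parSet r C₀ W n) (hp₁ : p₁ ∈ M.parSet r C₀ W n)
    (hc : x ∈ M.controlled A B C₀ T n p.θ) (hc₁ : x ∈ M.controlled A B C₀ T n p₁.θ)
    (he : |M.eF p.θ x| ≤ 1) {μ : ℝ} (hμθ : ‖p.θ - p₁.θ‖ ≤ d * μ)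
    (hμ : |p.x - p₁.x| ≤ μ ∧ |p.x' - p₁.x'| ≤ μ ∧ |p.w - p₁.w| ≤ μ ∧ |p.w' - p₁.w'| ≤ μ) (z : ℝ) :
    |M.incr K b p (x, z) - M.incr K b p₁ (x, z)| ≤
      k / b ^ 2 * ((1 + W) * (8 * (d + 1)) * T * μ) * (1 + |z|) := by
  obtain ⟨⟨hT, h1⟩, h2, -⟩ := hc
  obtain ⟨⟨-, h1'⟩, h2', -⟩ := hc₁
  obtain ⟨μ1, μ2, μ3, μ4⟩ := hμ
  have hk := hK.one_le
  have hθ := hp.1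
  have hθ' := hp₁.1
  have hw := hp₁.2.2.2.2
  have hμ0 : 0 ≤ μ := (abs_nonneg _).trans μ1
  have hW : 0 ≤ W := (abs_nonneg _).trans hw.1
  have hA := hE.A_nonneg x
  have hB := hE.B_nonneg x
  have hR1 := one_le_envR hE x
  have hAR : A x ≤ T := by simp only [envR] at hT; linarith
  have hBR : B x ≤ T := by simp only [envR] at hT; linarith
  have hd : (0 : ℝ) ≤ d := Nat.cast_nonneg d
  have hT0 : 0 ≤ T := by linarith
  have ds : |M.sF p.θ x - M.sF p₁.θ x| ≤ T * (d * μ) := by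
    have a1 := h.abs_sF_sub hE.γ_pos h0 hθ hθ'
    have a2 : B x * ‖p.θ - p₁.θ‖ ≤ T * (d * μ) := by gcongr
    nlinarith [abs_nonneg (M.sF p.θ x - M.sF p₁.θ x)]
  have de : |M.eF p.θ x - M.eF p₁.θ x| ≤ T * (d * μ) :=
    (h.abs_eF_sub hE.γ_pos h0 hθ hθ').trans (by gcongr)
  refine (hK.abs_kernelIncr_sub_le hb hb1 h1 h1' hw.1 hw.2 z).trans ?_
  rw [mul_assoc (k / b ^ 2)]
  refine mul_le_mul_of_nonneg_left ?_ (by positivity)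
  have hz := abs_nonneg z
  have hT1 : 1 ≤ T := hR1.trans hT
  calc _ ≤ μ + W * (μ + 4 * (|z| + 1) * (T * (d * μ)) + 2 * (T * (d * μ))) + μ + W * μ := by gcongr
    _ ≤ μ * T + W * (μ * T + 4 * (|z| + 1) * (T * (d * μ)) + 2 * (T * (d * μ))) + μ * T +
        W * (μ * T) := by
        have : μ ≤ μ * T := le_mul_of_one_le_right hμ0 hT1
        gcongr
    _ = T * μ * (2 * (1 + W) + W * d * (4 * |z| + 6)) := by ring
    _ ≤ T * μ * ((1 + W) * (8 * (d + 1)) * (1 + |z|)) := by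
        refine mul_le_mul_of_nonneg_left ?_ (by positivity)
        have q1 : 0 ≤ W * d := by positivity
        have q2 : 0 ≤ W * |z| := by positivity
        have q3 : 0 ≤ d * |z| := by positivity
        have q4 : 0 ≤ W * d * |z| := by positivity
        nlinarith
    _ = _ := by ring

lemma integrable_abs_noise (hM : M.IsLocationScale P) :
    Integrable (fun y : ℝ => |y|) (P.map (M.noise 0)) := by
  have h1 : Integrable (M.noise 0) P := hM.noise_sq.integrable (by norm_num)
  exact (integrable_map_measure continuous_abs.measurable.aestronglyMeasurable
    (hM.noise_meas 0).aemeasurable).2 h1.abs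

lemma integrable_incr (hM : M.IsLocationScale P) (hK : LipKernel K k) {b : ℝ} (hb : 0 < b)
    {p : KernelPar d} (hθ : p.θ ∈ M.Θ) (x : ℕ → ℝ) :
    Integrable (fun z => M.incr K b p (x, z)) (P.map (M.noise 0)) := by
  have : IsProbabilityMeasure (P.map (M.noise 0)) :=
    Measure.isProbabilityMeasure_map (hM.noise_meas 0).aemeasurable
  refine Integrable.of_bound ((measurable_incr hM hK.toIsKernel hθ).comp
    measurable_prodMk_left).aestronglyMeasurable (|p.w| * (k / b) + |p.w'| * (k / b))
    (Eventually.of_forall fun z => ?_)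
  have hs : ∀ u, |scaledKernel K b u| ≤ k / b := fun u => by
    rw [abs_of_nonneg (hK.scaled_nonneg hb u)]; exact hK.scaled_le hb u
  refine (abs_sub _ _).trans ?_
  rw [abs_mul, abs_mul]
  gcongr <;> exact hs _

lemma abs_incrMean_sub_le (hM : M.IsLocationScale P) (h5 : M.A5 P f)
    (hK : LipKernel K k) {b : ℝ} (hb : 0 < b) {x : ℕ → ℝ}
    {p p₁ : KernelPar d} (hp : p.θ ∈ M.Θ) (hp₁ : p₁.θ ∈ M.Θ) (hs : 0 < M.sF p.θ x)
    (hs₁ : 0 < M.sF p₁.θ x) {c : ℝ}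
    (hc : ∀ z, |M.incr K b p (x, z) - M.incr K b p₁ (x, z)| ≤ c * (1 + |z|)) :
    |M.incrMean K f b p x - M.incrMean K f b p₁ x| ≤
      c * (1 + ∫ z, |z| ∂(P.map (M.noise 0))) := by
  have : IsProbabilityMeasure (P.map (M.noise 0)) :=
    Measure.isProbabilityMeasure_map (hM.noise_meas 0).aemeasurable
  have e1 : ∀ q : KernelPar d, 0 < M.sF q.θ x → M.incrMean K f b q x =
      ∫ z, M.incr K b q (x, z) ∂(P.map (M.noise 0)) := fun q hq => by
    simp only [incr]
    rw [integral_kernelIncr h5 hK hb hq, incrMean]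
  have i1 := integrable_incr hM hK hb hp x
  have i2 := integrable_incr hM hK hb hp₁ x
  have i3 := integrable_abs_noise hM
  rw [e1 p hs, e1 p₁ hs₁, ← integral_sub i1 i2]
  refine (norm_integral_le_integral_norm
    (fun z => M.incr K b p (x, z) - M.incr K b p₁ (x, z))).trans
    ((integral_mono (i1.sub i2).norm (((integrable_const 1).add i3).const_mul c) hc).trans ?_)
  have := integral_add (integrable_const (μ := P.map (M.noise 0)) (1 : ℝ)) i3
  rw [integral_const_mul]
  simp only [Pi.add_apply]
  rw [this, integral_const, probReal_univ, one_smul]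

lemma KernelPar.size_le {p p₁ : KernelPar d} (hn : 1 ≤ n) {μ : ℝ}
    (hμ : |p.x - p₁.x| ≤ μ ∧ |p.x' - p₁.x'| ≤ μ ∧ |p.w - p₁.w| ≤ μ ∧ |p.w' - p₁.w'| ≤ μ) :
    p₁.size n ≤ p.size n + 6 * μ := by
  obtain ⟨h1, h2, h3, h4⟩ := hμ
  have hsq : (1 : ℝ) ≤ √(n : ℝ) := Real.one_le_sqrt.2 (by exact_mod_cast hn)
  have a1 : |p₁.w - p₁.w'| ≤ |p.w - p.w'| + 2 * μ := by
    have : p₁.w - p₁.w' = (p.w - p.w') - (p.w - p₁.w) + (p.w' - p₁.w') := by ring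
    rw [this]
    exact (abs_add_le _ _).trans ((add_le_add (abs_sub _ _) le_rfl).trans (by linarith))
  have a2 : |p₁.x - p₁.x'| ≤ |p.x - p.x'| + 2 * μ := by
    have : p₁.x - p₁.x' = (p.x - p.x') - (p.x - p₁.x) + (p.x' - p₁.x') := by ring
    rw [this]
    exact (abs_add_le _ _).trans ((add_le_add (abs_sub _ _) le_rfl).trans (by linarith))
  have a3 : |p₁.x| ≤ |p.x| + μ := by
    have : p₁.x = p.x - (p.x - p₁.x) := by ring
    rw [this]; exact (abs_sub _ _).trans (by linarith)
  have a4 : |p₁.x'| ≤ |p.x'| + μ := by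
    have : p₁.x' = p.x' - (p.x' - p₁.x') := by ring
    rw [this]; exact (abs_sub _ _).trans (by linarith)
  have hμ0 : 0 ≤ μ := (abs_nonneg _).trans h1
  have a5 : (2 + |p₁.x| + |p₁.x'|) / √(n : ℝ) ≤ (2 + |p.x| + |p.x'|) / √(n : ℝ) + 2 * μ := by
    calc _ ≤ (2 + |p.x| + |p.x'| + 2 * μ) / √(n : ℝ) := by
          gcongr ?_ / _; linarith
      _ = (2 + |p.x| + |p.x'|) / √(n : ℝ) + 2 * μ / √(n : ℝ) := by ring
      _ ≤ _ := by gcongr; exact div_le_self (by linarith) hsq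
  simp only [size]; linarith

/-- There are `d + 4` real coordinates of size at most a multiple of `n`. The mesh `1/n⁴` makes the
crude Lipschitz bounds negligible, and the cardinality is still polynomial in `n`. -/
lemma exists_parSet_net (hC₀ : 0 ≤ C₀) (hW : 0 ≤ W) (hn : 1 ≤ n) :
    ∃ t : Finset (KernelPar d), (∀ p ∈ t, p ∈ M.parSet r C₀ W n) ∧
      (t.card : ℝ) ≤ ((2 * (1 + W + C₀) + 4) * (n : ℝ) ^ 5) ^ (d + 4) ∧
      ∀ p ∈ M.parSet r C₀ W n, ∃ p₁ ∈ t, ‖p.θ - p₁.θ‖ ≤ d * (1 / (n : ℝ) ^ 4) ∧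
        (|p.x - p₁.x| ≤ 1 / (n : ℝ) ^ 4 ∧ |p.x' - p₁.x'| ≤ 1 / (n : ℝ) ^ 4 ∧
          |p.w - p₁.w| ≤ 1 / (n : ℝ) ^ 4 ∧ |p.w' - p₁.w'| ≤ 1 / (n : ℝ) ^ 4) := by
  have hn1 : (1 : ℝ) ≤ n := by exact_mod_cast hn
  have hsq : (1 : ℝ) ≤ √(n : ℝ) := Real.one_le_sqrt.2 hn1
  set φ : KernelPar d → Fin d ⊕ Fin 4 → ℝ := fun p =>
    Sum.elim (fun k => (p.θ - M.θ₀) k) ![p.x, p.x', p.w, p.w'] with hφ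
  have hR : ∀ p ∈ M.parSet r C₀ W n, ∀ i, |φ p i| ≤ (1 + W + C₀) * n := by
    rintro p ⟨-, h2, h3, h4, h5, h6⟩ i
    have q1 : (n : ℝ) ≤ (1 + W + C₀) * n := le_mul_of_one_le_left (by linarith) (by linarith)
    have q2 : W ≤ (1 + W + C₀) * n := by nlinarith
    have q3 : C₀ ≤ (1 + W + C₀) * n := by nlinarith
    rcases i with k | i
    · have h7 : |(p.θ - M.θ₀) k| ≤ ‖p.θ - M.θ₀‖ := PiLp.norm_apply_le (p.θ - M.θ₀) k
      have h8 : ‖p.θ - M.θ₀‖ ≤ √(n : ℝ) * ‖p.θ - M.θ₀‖ := le_mul_of_one_le_left (norm_nonneg _) hsq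
      exact (h7.trans (h8.trans h2)).trans q3
    · fin_cases i
      · exact h3.trans q1
      · exact h4.trans q1
      · exact h5.trans q2
      · exact h6.trans q2
  obtain ⟨t, ht1, ht2, ht3⟩ := exists_coordinate_net (M.parSet r C₀ W n) φ hR
    (m := n ^ 4) (by positivity)
  refine ⟨t, ht1, ?_, fun p hp => ?_⟩
  · have hcard : Fintype.card (Fin d ⊕ Fin 4) = d + 4 := by simp
    rw [hcard] at ht2
    have h1 : ((2 * ⌈(1 + W + C₀) * n * ((n ^ 4 : ℕ) : ℝ)⌉₊ + 2 : ℕ) : ℝ) ≤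
        (2 * (1 + W + C₀) + 4) * (n : ℝ) ^ 5 := by
      have h2 := (Nat.ceil_lt_add_one (a := (1 + W + C₀) * n * ((n ^ 4 : ℕ) : ℝ)) (by positivity)).le
      have h3 : (1 : ℝ) ≤ (n : ℝ) ^ 5 := one_le_pow₀ hn1
      push_cast at h2 ⊢
      have h4 : (1 + W + C₀) * n * (n : ℝ) ^ 4 = (1 + W + C₀) * (n : ℝ) ^ 5 := by ring
      rw [h4] at h2 ⊢
      linarith
    calc (t.card : ℝ) ≤ (((2 * ⌈(1 + W + C₀) * n * ((n ^ 4 : ℕ) : ℝ)⌉₊ + 2) ^ (d + 4) : ℕ) : ℝ) := by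
          exact_mod_cast ht2
      _ = ((2 * ⌈(1 + W + C₀) * n * ((n ^ 4 : ℕ) : ℝ)⌉₊ + 2 : ℕ) : ℝ) ^ (d + 4) := by
          rw [Nat.cast_pow]
      _ ≤ _ := by gcongr
  · obtain ⟨p₁, hp₁, h⟩ := ht3 p hp
    rw [Nat.cast_pow] at h
    refine ⟨p₁, hp₁, norm_le_of_abs_apply_le fun k => ?_, h (Sum.inr 0), h (Sum.inr 1),
      h (Sum.inr 2), h (Sum.inr 3)⟩
    have := h (Sum.inl k)
    simp only [hφ, Sum.elim_inl] at this
    have e : (p.θ - M.θ₀) k - (p₁.θ - M.θ₀) k = (p.θ - p₁.θ) k := by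
      simp
    rwa [e] at this

end SeriesModel

/-! ### Uniform bound on the centred increments -/

lemma rpow_third_pow {n : ℕ} : ((n : ℝ) ^ (1 / 3 : ℝ)) ^ 3 = n := by
  rw [← Real.rpow_natCast, ← Real.rpow_mul (Nat.cast_nonneg n)]; norm_num

lemma one_le_rpow_third {n : ℕ} (hn : 1 ≤ n) : (1 : ℝ) ≤ (n : ℝ) ^ (1 / 3 : ℝ) :=
  Real.one_le_rpow (by exact_mod_cast hn) (by norm_num)

lemma tendsto_rpow_third_div_sqrt :
    Tendsto (fun n : ℕ => (n : ℝ) ^ (1 / 3 : ℝ) / √(n : ℝ)) atTop (𝓝 0) := by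
  have h1 : Tendsto (fun n : ℕ => (n : ℝ) ^ (-(1 / 6 : ℝ))) atTop (𝓝 0) :=
    (tendsto_rpow_neg_atTop (by norm_num)).comp tendsto_natCast_atTop_atTop
  refine h1.congr' ?_
  filter_upwards [eventually_ge_atTop 1] with n hn
  have hn0 : (0 : ℝ) < n := by exact_mod_cast hn
  rw [Real.sqrt_eq_rpow, ← Real.rpow_sub hn0]; norm_num

namespace SeriesModel

variable {d : ℕ} {Ω : Type*} [MeasurableSpace Ω] {M : SeriesModel d Ω} {P : Measure Ω}
  [IsProbabilityMeasure P] {r γ : ℝ} {A B E : (ℕ → ℝ) → ℝ} {f : ℝ → ℝ} {F : ℝ}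
  {K : ℝ → ℝ} {k C₀ T W : ℝ} {n : ℕ}

/-- The recentred average of the increments of the kernel. -/
noncomputable def incrAvg (M : SeriesModel d Ω) (K f : ℝ → ℝ) (b : ℝ) (n : ℕ) (p : KernelPar d)
    (ω : Ω) : ℝ :=
  avg n (fun j => M.incr K b p (M.pastX j ω, M.noise j ω) - M.incrMean K f b p (M.pastX j ω))

lemma abs_incrAvg_sub_le (hM : M.IsLocationScale P) (hE : M.Envelopes P r γ A B E)
    (h5 : M.A5 P f) (hK : LipKernel K k) (h0 : M.θ₀ ∈ M.nhd r) (hn : 1 ≤ n)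
    {b : ℝ} (hb : 0 < b) (hb1 : b ≤ 1) {ω : Ω} (h : ∀ j : ℤ, M.Regular r γ A B E (M.pastX j ω))
    {p p₁ : KernelPar d} (hp : p ∈ M.parSet r C₀ W n) (hp₁ : p₁ ∈ M.parSet r C₀ W n)
    (hT : ∀ j ∈ Finset.Icc 1 n, envR A B (M.pastX j ω) ≤ T) (hTn : T * C₀ ≤ 1 / 2 * √(n : ℝ))
    {C : ℝ} (hC : avg n (fun j => |M.noise j ω|) ≤ C)
    {μ : ℝ} (hμθ : ‖p.θ - p₁.θ‖ ≤ d * μ)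
    (hμ : |p.x - p₁.x| ≤ μ ∧ |p.x' - p₁.x'| ≤ μ ∧ |p.w - p₁.w| ≤ μ ∧ |p.w' - p₁.w'| ≤ μ) :
    |M.incrAvg K f b n p ω - M.incrAvg K f b n p₁ ω| ≤
      k / b ^ 2 * ((1 + W) * (8 * (d + 1)) * T * μ) *
        (2 + C + ∫ z, |z| ∂(P.map (M.noise 0))) := by
  set c := k / b ^ 2 * ((1 + W) * (8 * (d + 1)) * T * μ) with hc
  set I := ∫ z, |z| ∂(P.map (M.noise 0))
  have hk := hK.one_le
  have hW : 0 ≤ W := (abs_nonneg _).trans hp.2.2.2.2.1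
  have hμ0 : 0 ≤ μ := (abs_nonneg _).trans hμ.1
  have hT0 : 0 ≤ T :=
    (zero_le_one.trans (one_le_envR hE _)).trans (hT 1 (Finset.mem_Icc.2 ⟨le_rfl, hn⟩))
  have hc0 : 0 ≤ c := by positivity
  rw [incrAvg, incrAvg, ← avg_sub]
  refine (abs_avg_le _ _).trans ((avg_mono (b := fun j => c * (2 + I) + c * |M.noise j ω|)
    fun j hj => ?_).trans ?_)
  · have m1 := (h j).mem_controlled hE h0 hn hp.1 hp.2.1 (hT j hj) hTn
    have m2 := (h j).mem_controlled hE h0 hn hp₁.1 hp₁.2.1 (hT j hj) hTn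
    have q1 := abs_incr_sub_le hE hK h0 hb hb1 (h j) hp hp₁ m1.1 m2.1 m1.2 hμθ hμ
    have s1 : 0 < M.sF p.θ (M.pastX j ω) := by have := m1.1.1.2; linarith
    have s2 : 0 < M.sF p₁.θ (M.pastX j ω) := by have := m2.1.1.2; linarith
    have q2 := abs_incrMean_sub_le hM h5 hK hb (nhd_subset hp.1) (nhd_subset hp₁.1) s1 s2 q1
    have q3 := q1 (M.noise j ω)
    have e : ∀ a c g h : ℝ, a - c - (g - h) = (a - g) - (c - h) := fun _ _ _ _ => by ring
    rw [e]
    refine (abs_sub _ _).trans ((add_le_add q3 q2).trans (le_of_eq ?_))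
    ring
  · rw [avg_add, avg_const hn, avg_mul_left]
    have := mul_le_mul_of_nonneg_left hC hc0
    linarith

/-- A union bound over the net, with `T` of order `n^(1/3)`: polynomially many events, each of
probability at most `2 exp (-c n^(2a))`. Uniformity over all `x, w` is needed because the parameters
substituted later are computed from the sample itself. One `τ` is spent on the net and the other on
the distance to it. -/
lemma likely_incrAvg (hM : M.IsLocationScale P) (hE : M.Envelopes P r γ A B E)
    (h5 : M.A5 P f) (hf : SmoothBdd f F) (hK : LipKernel K k) (hr : 0 < r) {b : ℕ → ℝ} {a : ℝ}
    (hb : Bandwidth b a) {T₀ C τ : ℝ} (hC₀ : 0 ≤ C₀) (hW : 0 ≤ W) (hT₀ : 0 < T₀) (hC : 0 ≤ C)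
    (hτ : 0 < τ) :
    Likely P (fun n ω => (∀ j ∈ Finset.Icc 1 n,
        envR A B (M.pastX j ω) ≤ T₀ * (n : ℝ) ^ (1 / 3 : ℝ)) →
      avg n (fun j => envR A B (M.pastX j ω) ^ 2) ≤ C → avg n (fun j => |M.noise j ω|) ≤ C →
      ∀ p ∈ M.parSet r C₀ W n, |M.incrAvg K f (b n) n p ω| ≤ 2 * τ * p.size n) := by
  have h0 := θ₀_mem_nhd hM hr
  have hk := hK.one_le
  have hF := hf.one_le
  set H := k * (1 + W) * (1 + 4 * C₀) with hH
  have hH0 : 0 < H := by positivity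
  set I := ∫ z, |z| ∂(P.map (M.noise 0)) with hI
  have hI0 : 0 ≤ I := integral_nonneg fun z => abs_nonneg z
  set D := k * ((1 + W) * (8 * (d + 1)) * T₀) * (2 + C + I) with hD
  have hD0 : 0 ≤ D := by positivity
  set c := τ / (4 * H * T₀) with hc
  have hc0 : 0 < c := by positivity
  set G := (2 * (1 + W + C₀) + 4 : ℝ) with hG
  have hu : Tendsto (fun n : ℕ => ENNReal.ofReal (2 * G ^ (d + 4) * ((n : ℝ) ^ (5 * (d + 4)) *
      Real.exp (-(c * (n : ℝ) ^ (2 * a)))))) atTop (𝓝 0) := by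
    have := (tendsto_pow_mul_exp_neg_rpow (a := 2 * a) (by linarith [hb.rate_pos]) hc0
      (5 * (d + 4))).const_mul (2 * G ^ (d + 4))
    have h2 := (ENNReal.continuous_ofReal.tendsto _).comp this
    rw [mul_zero, ENNReal.ofReal_zero] at h2
    exact h2
  have hrate : Tendsto (fun n : ℕ => (n : ℝ) ^ a) atTop atTop :=
    (tendsto_rpow_atTop hb.rate_pos).comp tendsto_natCast_atTop_atTop
  have ev1 : ∀ᶠ n : ℕ in atTop, 6 * F * H * C / (τ * T₀) ≤ (n : ℝ) ^ a := hrate.eventually_ge_atTop _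
  have ev2 : ∀ᶠ n : ℕ in atTop, T₀ * C₀ * ((n : ℝ) ^ (1 / 3 : ℝ) / √(n : ℝ)) ≤ 1 / 2 := by
    have := tendsto_rpow_third_div_sqrt.const_mul (T₀ * C₀)
    rw [mul_zero] at this
    exact this.eventually_le_const (by norm_num)
  have ev3 : ∀ᶠ n : ℕ in atTop, (6 * τ + D) / (2 * τ) ≤ (n : ℝ) :=
    tendsto_natCast_atTop_atTop.eventually_ge_atTop _
  intro κ hκ
  refine WHP.of_le hκ ?_ hu
  filter_upwards [hb.rate, hb.tendsto.eventually_le_const one_pos, ev1, ev2, ev3,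
    eventually_ge_atTop 1] with n hrn hb1 hn1 hn2 hn3 hn
  have hn1' : (1 : ℝ) ≤ n := by exact_mod_cast hn
  have hn0 : (0 : ℝ) < n := by linarith
  have hsq : (0 : ℝ) < √(n : ℝ) := Real.sqrt_pos.2 hn0
  have hbn := hb.pos n
  set m := (n : ℝ) ^ (1 / 3 : ℝ) with hm
  have hm1 : 1 ≤ m := one_le_rpow_third hn
  have hm3 : m ^ 3 = n := rpow_third_pow
  have hmn : m ≤ n := by rw [← hm3]; exact le_self_pow₀ hm1 (by norm_num)
  have hna : 1 ≤ (n : ℝ) ^ a := Real.one_le_rpow hn1' hb.rate_pos.le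
  have hbm : 1 ≤ b n * m := hna.trans hrn
  have hTn : T₀ * m * C₀ ≤ 1 / 2 * √(n : ℝ) := by
    rw [← mul_div_assoc, div_le_iff₀ hsq] at hn2
    linarith
  have hτb : 6 * F * (k * (1 + W) * (1 + 4 * C₀)) * C ≤ τ * (b n * (T₀ * m)) := by
    rw [div_le_iff₀ (by positivity)] at hn1
    rw [← hH]
    refine hn1.trans ?_
    calc _ ≤ b n * m * (τ * T₀) := by gcongr
      _ = _ := by ring
  obtain ⟨t, ht1, ht2, ht3⟩ := exists_parSet_net (M := M) (r := r) hC₀ hW hn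
  set bad : KernelPar d → Set Ω := fun p =>
    {ω | (∀ j ∈ Finset.Icc 1 n, M.pastX j ω ∈ M.controlled A B C₀ (T₀ * m) n p.θ) ∧
      avg n (fun j => envR A B (M.pastX j ω) ^ 2) ≤ C ∧ τ * p.size n < |M.incrAvg K f (b n) n p ω|}
    with hbad
  have hbadle : ∀ p ∈ t, P (bad p) ≤ ENNReal.ofReal (2 * Real.exp (-(c * (n : ℝ) ^ (2 * a)))) := by
    intro p hp
    have hpS := ht1 p hp
    refine (measure_incr_gt_le hM hE h5 hf hK hbn hb1 hC₀ (by positivity) hn (nhd_subset hpS.1)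
      hpS.2.2.2.2.2 hτb).trans ?_
    rw [ENNReal.ofReal_mul (by norm_num), ENNReal.ofReal_ofNat]
    gcongr
    -- With `n = m³` the exponent is a multiple of `(b n m)²`, hence at least a multiple of
    -- `n^(2a)`: this is what the rate of the bandwidth is for.
    have e1 : τ * (n * b n ^ 2) / (4 * (k * (1 + W) * (1 + 4 * C₀)) * (T₀ * m)) =
        c * (b n * m) ^ 2 := by
      rw [hc, ← hH, ← hm3]; field_simp
    rw [e1, mul_comm 2 a, Real.rpow_mul hn0.le, Real.rpow_two]
    gcongr
  -- The loss in passing to the net is of order `1/n²` at most, whereas the size of a parameter is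
  -- at least `2/√n`, whatever the parameter.
  have hμle : 6 * τ * (1 / (n : ℝ) ^ 4) + k / b n ^ 2 * ((1 + W) * (8 * (d + 1)) * (T₀ * m) *
      (1 / (n : ℝ) ^ 4)) * (2 + C + I) ≤ τ * (2 / √(n : ℝ)) := by
    have hb2 : 1 / b n ^ 2 ≤ n := by
      rw [div_le_iff₀ (by positivity)]
      have : 1 ≤ (b n * m) ^ 2 := one_le_pow₀ hbm
      have h3 : m ^ 2 ≤ n := by rw [← hm3]; exact pow_le_pow_right₀ hm1 (by norm_num)
      calc 1 ≤ (b n * m) ^ 2 := this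
        _ = m ^ 2 * b n ^ 2 := by ring
        _ ≤ _ := by gcongr
    have hn4 : 1 / (n : ℝ) ^ 4 ≤ 1 / (n : ℝ) ^ 2 :=
      one_div_le_one_div_of_le (by positivity) (pow_le_pow_right₀ hn1' (by norm_num))
    have q1 : k / b n ^ 2 * ((1 + W) * (8 * (d + 1)) * (T₀ * m) * (1 / (n : ℝ) ^ 4)) * (2 + C + I) ≤
        D * (1 / (n : ℝ) ^ 2) := by
      calc _ = D * (1 / b n ^ 2 * m * (1 / (n : ℝ) ^ 4)) := by rw [hD]; ring
        _ ≤ D * (n * n * (1 / (n : ℝ) ^ 4)) := by gcongr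
        _ = _ := by field_simp
    have q2 : 1 / (n : ℝ) ≤ 1 / √(n : ℝ) := by
      refine one_div_le_one_div_of_le hsq ?_
      rw [Real.sqrt_le_left hn0.le]; nlinarith
    calc _ ≤ 6 * τ * (1 / (n : ℝ) ^ 2) + D * (1 / (n : ℝ) ^ 2) := by gcongr
      _ = (6 * τ + D) / n * (1 / n) := by field_simp
      _ ≤ 2 * τ * (1 / √(n : ℝ)) := by
          gcongr
          rw [div_le_iff₀ (by positivity)] at hn3 ⊢
          linarith
      _ = _ := by ring
  have hkey : ∀ᵐ ω ∂P, ¬ ((∀ j ∈ Finset.Icc 1 n, envR A B (M.pastX j ω) ≤ T₀ * m) →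
      avg n (fun j => envR A B (M.pastX j ω) ^ 2) ≤ C → avg n (fun j => |M.noise j ω|) ≤ C →
      ∀ p ∈ M.parSet r C₀ W n, |M.incrAvg K f (b n) n p ω| ≤ 2 * τ * p.size n) →
      ω ∈ ⋃ p ∈ t, bad p := by
    filter_upwards [ae_all_iff.2 hE.regular] with ω hω
    contrapose!
    intro hnot g1 g2 g3 p hp
    obtain ⟨p₁, hp₁t, d1, d2⟩ := ht3 p hp
    have hp₁ := ht1 p₁ hp₁t
    have e1 := abs_incrAvg_sub_le (f := f) hM hE h5 hK h0 hn hbn hb1 hω hp hp₁ g1 hTn g3 d1 d2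
    have e2 : |M.incrAvg K f (b n) n p₁ ω| ≤ τ * p₁.size n := by
      by_contra hcon
      refine hnot (Set.mem_biUnion hp₁t ⟨fun j hj => ?_, g2, not_le.1 hcon⟩)
      exact ((hω j).mem_controlled hE h0 hn hp₁.1 hp₁.2.1 (g1 j hj) hTn).1
    have e3 := KernelPar.size_le hn d2
    have e4 : 2 / √(n : ℝ) ≤ p.size n := by
      have : 2 / √(n : ℝ) ≤ (2 + |p.x| + |p.x'|) / √(n : ℝ) := by
        have := abs_nonneg p.x; have := abs_nonneg p.x'
        gcongr ?_ / _; linarith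
      have := abs_nonneg (p.w - p.w'); have := abs_nonneg (p.x - p.x')
      simp only [KernelPar.size]; linarith
    have e5 : |M.incrAvg K f (b n) n p ω| ≤ |M.incrAvg K f (b n) n p₁ ω| +
        |M.incrAvg K f (b n) n p ω - M.incrAvg K f (b n) n p₁ ω| := by
      have : M.incrAvg K f (b n) n p ω = M.incrAvg K f (b n) n p₁ ω +
        (M.incrAvg K f (b n) n p ω - M.incrAvg K f (b n) n p₁ ω) := by ring
      conv_lhs => rw [this]
      exact abs_add_le _ _
    have e6 := mul_le_mul_of_nonneg_left e3 hτ.le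
    have e7 := mul_le_mul_of_nonneg_left e4 hτ.le
    linarith
  calc _ ≤ P (⋃ p ∈ t, bad p) := measure_mono_ae hkey
    _ ≤ ∑ p ∈ t, P (bad p) := measure_biUnion_finset_le _ _
    _ ≤ ∑ _p ∈ t, ENNReal.ofReal (2 * Real.exp (-(c * (n : ℝ) ^ (2 * a)))) :=
        Finset.sum_le_sum hbadle
    _ = ENNReal.ofReal (t.card * (2 * Real.exp (-(c * (n : ℝ) ^ (2 * a))))) := by
        rw [Finset.sum_const, nsmul_eq_mul, ENNReal.ofReal_mul (Nat.cast_nonneg _),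
          ENNReal.ofReal_natCast]
    _ ≤ _ := by
        refine ENNReal.ofReal_le_ofReal ?_
        calc _ ≤ (G * (n : ℝ) ^ 5) ^ (d + 4) * (2 * Real.exp (-(c * (n : ℝ) ^ (2 * a)))) := by gcongr
          _ = _ := by rw [mul_pow, ← pow_mul]; ring

end SeriesModel

/-! ### The average at `θ` compared with the unfeasible estimator -/

namespace SeriesModel

variable {d : ℕ} {Ω : Type*} [MeasurableSpace Ω] {M : SeriesModel d Ω} {P : Measure Ω}
  [IsProbabilityMeasure P] {r γ : ℝ} {A B E : (ℕ → ℝ) → ℝ} {f : ℝ → ℝ} {F : ℝ}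
  {Fw Fq Fs Fe : Fin d → (ℕ → ℝ) → ℝ} {K : ℝ → ℝ} {k C₀ c V α β : ℝ} {n : ℕ} {ω : Ω}

/-- The kernel average at the parameter `θ`, computed from the whole past. -/
noncomputable def kernelAvg (M : SeriesModel d Ω) (K : ℝ → ℝ) (b : ℝ) (n : ℕ) (v : ℝ) (θ : Par d)
    (ω : Ω) : ℝ :=
  avg n fun i => avg n fun j => M.wF θ (M.pastX i ω) * scaledKernel K b (M.LF v θ (M.pastX i ω) -
    (M.noise j ω - M.eF θ (M.pastX j ω)) / M.sF θ (M.pastX j ω))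

/-- Bounds on the sample averages of the envelopes and of the noise. -/
def MomentBound (M : SeriesModel d Ω) (A B E : (ℕ → ℝ) → ℝ) (c : ℝ) (n : ℕ) (ω : Ω) : Prop :=
  avg n (fun i => env A B E (M.pastX i ω) ^ 2) ≤ c ∧ avg n (fun i => |M.noise i ω|) ≤ c ∧
    avg n (fun i => envR A B (M.pastX i ω) ^ 3) ≤ c

lemma integrable_envR_cube (hM : M.IsLocationScale P) (hE : M.Envelopes P r γ A B E) :
    Integrable (fun x => envR A B x ^ 3) (M.pastLaw P) := by
  have := isProbabilityMeasure_pastLaw hM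
  refine Integrable.mono' (g := fun x => 9 * (1 + A x ^ 3 + B x ^ 3))
    ((((integrable_const 1).add hE.intA).add hE.intB).const_mul 9)
    ((measurable_envR hE).pow_const 3).aestronglyMeasurable (Eventually.of_forall fun x => ?_)
  have a0 := hE.A_nonneg x; have b0 := hE.B_nonneg x
  have h0 := one_le_envR hE x
  rw [Real.norm_eq_abs, abs_of_nonneg (by positivity), envR]
  have h1 : ∀ p q : ℝ, 0 ≤ p → 0 ≤ q → (p + q) * (p - q) ^ 2 ≥ 0 := fun p q hp hq => by positivity
  have h2 := h1 1 (A x) zero_le_one a0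
  have h3 := h1 1 (B x) zero_le_one b0
  have h4 := h1 (A x) (B x) a0 b0
  have h5 : A x * B x ≤ (1 + A x ^ 3 + B x ^ 3) / 3 := by
    nlinarith [mul_nonneg (add_nonneg (add_nonneg zero_le_one a0) b0) (sq_nonneg (1 - A x)),
      mul_nonneg (add_nonneg (add_nonneg zero_le_one a0) b0) (sq_nonneg (1 - B x)),
      mul_nonneg (add_nonneg (add_nonneg zero_le_one a0) b0) (sq_nonneg (A x - B x))]
  nlinarith

lemma exists_momentBound (hM : M.IsLocationScale P) (hE : M.Envelopes P r γ A B E) {κ : ℝ≥0∞}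
    (hκ : κ ≠ 0) : ∃ c, WHP P κ (M.MomentBound A B E c) := by
  have h2 : κ / 2 ≠ 0 := by simp [hκ]
  have h4 : κ / 2 / 2 ≠ 0 := by simp [hκ]
  obtain ⟨c1, -, w1⟩ := whp_avg_pastX_le hM (hE.measurable_env.pow_const 2) (fun x => sq_nonneg _)
    (hE.integrable_env_sq hM) h2
  obtain ⟨c3, -, w3⟩ := whp_avg_pastX_le hM ((measurable_envR hE).pow_const 3)
    (fun x => pow_nonneg (zero_le_one.trans (one_le_envR hE x)) 3) (integrable_envR_cube hM hE) h4
  obtain ⟨c2, -, w2⟩ := whp_avg_le (P := P) (a := fun i ω => |M.noise i ω|)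
    (fun i => (hM.noise_meas _).abs) (fun _ _ => abs_nonneg _)
    (c := ENNReal.ofReal (∫ y, |y| ∂(P.map (M.noise 0)))) ENNReal.ofReal_ne_top (fun i => by
      rw [ofReal_integral_eq_lintegral_ofReal (integrable_abs_noise hM)
        (Eventually.of_forall fun _ => abs_nonneg _), ← (hM.noise_ident i).map_eq,
        lintegral_map (by fun_prop) (hM.noise_meas _)]) h4
  have := w1.and (w2.and w3)
  rw [ENNReal.add_halves, ENNReal.add_halves] at this
  refine ⟨max c1 (max c2 c3), this.mono_of_forall fun n ω h => ⟨h.1.trans (le_max_left _ _), ?_, ?_⟩⟩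
  · exact h.2.1.trans ((le_max_left _ _).trans (le_max_right _ _))
  · exact h.2.2.trans ((le_max_right _ _).trans (le_max_right _ _))

/-- A single cube is at most `n` times the average of the cubes. This is the source of the level
`n^(1/3)`, and the reason for an envelope without `E`, which has no third moment. -/
lemma MomentBound.envR_le (hE : M.Envelopes P r γ A B E) (h : M.MomentBound A B E c n ω) :
    ∀ j ∈ Finset.Icc 1 n, envR A B (M.pastX j ω) ≤ (|c| + 1) * (n : ℝ) ^ (1 / 3 : ℝ) := by
  intro j hj
  have h1 := le_of_avg_le (fun i _ => pow_nonneg (zero_le_one.trans (one_le_envR hE _)) 3) h.2.2 hj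
  have h2 : envR A B (M.pastX j ω) ^ 3 ≤ ((|c| + 1) * (n : ℝ) ^ (1 / 3 : ℝ)) ^ 3 := by
    rw [mul_pow, rpow_third_pow]
    refine h1.trans ?_
    gcongr
    have := abs_nonneg c
    nlinarith [le_abs_self c, mul_nonneg this this, pow_nonneg this 3]
  exact le_of_pow_le_pow_left₀ (by norm_num) (by positivity) h2

lemma MomentBound.envR_sq_le (hE : M.Envelopes P r γ A B E) (h : M.MomentBound A B E c n ω) :
    avg n (fun j => envR A B (M.pastX j ω) ^ 2) ≤ |c| := by
  refine (avg_mono fun i _ => ?_).trans (h.1.trans (le_abs_self c))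
  have := one_le_envR hE (M.pastX i ω)
  refine pow_le_pow_left₀ (by linarith) ?_ 2
  have := hE.E_nonneg (M.pastX i ω)
  simp only [envR, env]; linarith

lemma MomentBound.env_le (h : M.MomentBound A B E c n ω) :
    ∀ j ∈ Finset.Icc 1 n, env A B E (M.pastX j ω) ≤ √(|c| * n) := fun j hj => by
  refine Real.le_sqrt_of_sq_le ((le_of_avg_le (fun i _ => sq_nonneg _) h.1 hj).trans ?_)
  gcongr
  exact le_abs_self c

lemma fCheck_eq_avg (b v : ℝ) : M.fCheck K b n v ω =
    avg n fun i => avg n fun j => M.wF M.θ₀ (M.pastX i ω) *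
      scaledKernel K b (M.LF v M.θ₀ (M.pastX i ω) - M.noise j ω) := by
  have e1 : ∀ i : ℤ, M.L v i M.θ₀ ω = M.LF v M.θ₀ (M.pastX i ω) := fun i => by
    simp only [L, LF, wF, qF]
    rw [sub_div, mul_one_div]; rfl
  simp only [fCheck, e1, avg, ← Finset.mul_sum]
  rw [← mul_assoc]
  congr 1
  rw [sq, one_div, mul_inv]

/-- The parameter of the increment at the past `x`. -/
noncomputable def parAt (M : SeriesModel d Ω) (v : ℝ) (θ : Par d) (x : ℕ → ℝ) : KernelPar d where
  θ := θ
  x := M.LF v θ x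
  x' := M.LF v M.θ₀ x
  w := M.wF θ x
  w' := M.wF M.θ₀ x

/-- For each `i`, the sum over `j` is an average of increments with parameters frozen at the past of
`i`; adding and subtracting conditional means separates the drift from the noise. -/
lemma kernelAvg_sub_fCheck (f : ℝ → ℝ) (b v : ℝ) (θ : Par d) :
    M.kernelAvg K b n v θ ω - M.fCheck K b n v ω =
      M.compensator K f b n v θ ω + avg n fun i => M.incrAvg K f b n (M.parAt v θ (M.pastX i ω)) ω := by
  rw [fCheck_eq_avg, kernelAvg, compensator, ← avg_sub, ← avg_add]
  congr 1; funext i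
  rw [incrAvg, ← avg_sub, ← avg_add]
  congr 1; funext j
  simp only [incr, incrMean, parAt, kernelIncr]
  ring

/-- The parameters that occur have size `1/√n` times the square of the envelope, which has bounded
averages; a centred part below `τ` times the size is therefore `o(1/√n)` after averaging over `i`.
-/
lemma Regular.size_parAt_le {x : ℕ → ℝ} (hx : M.Regular r γ A B E x) (hE : M.Envelopes P r γ A B E)
    (h0 : M.θ₀ ∈ M.nhd r) (hn : 1 ≤ n) {θ : Par d} (hθ : θ ∈ M.nhd r)
    (hC : √(n : ℝ) * ‖θ - M.θ₀‖ ≤ C₀) {v : ℝ} (hv : |v| ≤ V) :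
    √(n : ℝ) * (M.parAt v θ x).size n ≤
      ((1 / γ + (V / γ + 1)) * C₀ + 2 + 2 * (V / γ + 1)) * env A B E x ^ 2 := by
  have hγ := hE.γ_pos
  have hV : 0 ≤ V := (abs_nonneg v).trans hv
  have hsq : (0 : ℝ) < √(n : ℝ) := Real.sqrt_pos.2 (by exact_mod_cast hn)
  have h1 := hx.abs_wF_sub_le hE h0 hθ
  have h2 := hx.abs_LF_sub_le hE h0 hθ hv
  have h3 := hx.abs_LF_le hE hθ hv
  have h4 := hx.abs_LF_le hE h0 hv
  have h5 := hE.one_le_env x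
  have h6 := hE.le_env_sq x
  have hC0 : 0 ≤ C₀ := le_trans (by positivity) hC
  set ℓ := env A B E x
  set δ := ‖θ - M.θ₀‖
  have hδ : 0 ≤ δ := norm_nonneg _
  have e : √(n : ℝ) * (M.parAt v θ x).size n = √(n : ℝ) * |M.wF θ x - M.wF M.θ₀ x| +
      √(n : ℝ) * |M.LF v θ x - M.LF v M.θ₀ x| + (2 + |M.LF v θ x| + |M.LF v M.θ₀ x|) := by
    simp only [KernelPar.size, parAt]
    field_simp
  rw [e]
  have a1 : √(n : ℝ) * |M.wF θ x - M.wF M.θ₀ x| ≤ 1 / γ * C₀ * ℓ ^ 2 := by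
    calc _ ≤ √(n : ℝ) * (1 / γ * (δ * ℓ)) := by gcongr
      _ = 1 / γ * (√(n : ℝ) * δ) * ℓ := by ring
      _ ≤ _ := by gcongr
  have a2 : √(n : ℝ) * |M.LF v θ x - M.LF v M.θ₀ x| ≤ (V / γ + 1) * C₀ * ℓ ^ 2 := by
    calc _ ≤ √(n : ℝ) * ((V / γ + 1) * (δ * ℓ ^ 2)) := by gcongr
      _ = (V / γ + 1) * (√(n : ℝ) * δ) * ℓ ^ 2 := by ring
      _ ≤ _ := by gcongr
  have a3 : (V / γ + 1) * ℓ ≤ (V / γ + 1) * ℓ ^ 2 := by gcongr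
  have a4 : 2 ≤ 2 * ℓ ^ 2 := by nlinarith
  linarith

/-- The compensator supplies the linear term; the centred part is at most `2 τ₁` times an average of
sizes, with `τ₁` arbitrarily small. -/
lemma likely_kernelAvg (hM : M.IsLocationScale P) (hE : M.Envelopes P r γ A B E)
    (hp : M.Partials P r γ A B E Fw Fq Fs Fe) (h5 : M.A5 P f) (hf : SmoothBdd f F)
    (hK : LipKernel K k) (hr : 0 < r) {b : ℕ → ℝ} {a : ℝ} (hb : Bandwidth b a) (hC₀ : 0 ≤ C₀) {τ : ℝ}
    (hτ : 0 < τ) (α β : ℝ) :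
    Likely P (fun n ω => ∀ θ ∈ M.nhd r, √(n : ℝ) * ‖θ - M.θ₀‖ ≤ C₀ → ∀ v ∈ Set.Icc α β,
      √(n : ℝ) * |M.kernelAvg K (b n) n v θ ω - M.fCheck K (b n) n v ω -
        coordForm (M.slope P f Fw Fq Fs Fe v) (θ - M.θ₀)| ≤ τ) := by
  have h0 := θ₀_mem_nhd hM hr
  have hγ := hE.γ_pos
  set V := max |α| |β| with hV
  have hV0 : 0 ≤ V := (abs_nonneg α).trans (le_max_left _ _)
  have hvV : ∀ v ∈ Set.Icc α β, |v| ≤ V := fun v hv => abs_le_max_abs_abs hv.1 hv.2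
  refine Likely.of_whp_imp (C := fun c => M.MomentBound A B E c)
    (fun κ hκ => exists_momentBound hM hE hκ) fun c => ?_
  set Q := ((1 / γ + (V / γ + 1)) * C₀ + 2 + 2 * (V / γ + 1)) * |c| with hQ
  have hQ0 : 0 ≤ Q := by positivity
  set τ₁ := τ / 2 / (2 * Q + 1) with hτ₁
  have hτ₁0 : 0 < τ₁ := by positivity
  have hτ₁Q : 2 * τ₁ * Q ≤ τ / 2 := by
    have : τ₁ * (2 * Q + 1) = τ / 2 := div_mul_cancel₀ _ (by positivity)
    nlinarith
  have l1 := likely_compensator hM hE hp hf hK.toIsKernel hr hb.pos hb.tendsto hC₀ (half_pos hτ) α β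
  have l2 := likely_incrAvg hM hE h5 hf hK hr hb (T₀ := |c| + 1) (C := |c|) hC₀
    (W := 1 / γ) (by positivity) (by positivity) (abs_nonneg c) hτ₁0
  have ev : ∀ᶠ n : ℕ in atTop, (V / γ + 1) * √|c| ≤ √(n : ℝ) :=
    (Real.tendsto_sqrt_atTop.comp tendsto_natCast_atTop_atTop).eventually_ge_atTop _
  refine (l1.and l2).mono ?_
  filter_upwards [eventually_ge_atTop 1, ev] with n hn hnV
  filter_upwards [ae_all_iff.2 hE.regular] with ω hω hab hc θ hθ hθC v hv
  obtain ⟨g1, g2⟩ := hab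
  have hn0 : (0 : ℝ) < n := by exact_mod_cast hn
  have hsq : (0 : ℝ) < √(n : ℝ) := Real.sqrt_pos.2 hn0
  have m1 := g1 θ hθ hθC v hv
  have m2 := g2 (hc.envR_le hE) (hc.envR_sq_le hE) (hc.2.1.trans (le_abs_self c))
  -- Second moments give an envelope of order `√n` at each sample time, so `L` is at most `n` once
  -- `n` is large, as membership in `parSet` demands.
  have hLn : ∀ θ' ∈ M.nhd r, ∀ i ∈ Finset.Icc 1 n, |M.LF v θ' (M.pastX i ω)| ≤ n := by
    intro θ' hθ' i hi
    refine ((hω i).abs_LF_le hE hθ' (hvV v hv)).trans ?_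
    calc _ ≤ (V / γ + 1) * √(|c| * n) := by gcongr; exact hc.env_le i hi
      _ = (V / γ + 1) * √|c| * √(n : ℝ) := by rw [Real.sqrt_mul (abs_nonneg c)]; ring
      _ ≤ √(n : ℝ) * √(n : ℝ) := by gcongr
      _ = n := Real.mul_self_sqrt hn0.le
  have m3 : √(n : ℝ) * |avg n fun i => M.incrAvg K f (b n) n (M.parAt v θ (M.pastX i ω)) ω| ≤
      τ / 2 := by
    calc _ ≤ √(n : ℝ) * avg n fun i => 2 * τ₁ * (M.parAt v θ (M.pastX i ω)).size n := by
          gcongr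
          refine (abs_avg_le _ _).trans (avg_mono fun i hi => m2 _ ?_)
          exact ⟨hθ, hθC, hLn θ hθ i hi, hLn _ h0 i hi, (hω i).abs_wF_le hγ (nhd_subset hθ),
            (hω i).abs_wF_le hγ (nhd_subset h0)⟩
      _ = 2 * τ₁ * avg n fun i => √(n : ℝ) * (M.parAt v θ (M.pastX i ω)).size n := by
          rw [avg_mul_left, avg_mul_left]; ring
      _ ≤ 2 * τ₁ * avg n fun i => ((1 / γ + (V / γ + 1)) * C₀ + 2 + 2 * (V / γ + 1)) *
            env A B E (M.pastX i ω) ^ 2 := by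
          gcongr
          exact avg_mono fun i _ => (hω i).size_parAt_le hE h0 hn hθ hθC (hvV v hv)
      _ ≤ 2 * τ₁ * Q := by
          rw [avg_mul_left, hQ]
          gcongr
          exact hc.1.trans (le_abs_self c)
      _ ≤ τ / 2 := hτ₁Q
  rw [kernelAvg_sub_fCheck f]
  have e : ∀ p q s : ℝ, p + q - s = (p - s) + q := fun _ _ _ => by ring
  rw [e]
  calc _ ≤ √(n : ℝ) * (|M.compensator K f (b n) n v θ ω -
          coordForm (M.slope P f Fw Fq Fs Fe v) (θ - M.θ₀)| +
          |avg n fun i => M.incrAvg K f (b n) n (M.parAt v θ (M.pastX i ω)) ω|) := by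
        gcongr; exact abs_add_le _ _
    _ ≤ τ := by rw [mul_add]; linarith

end SeriesModel

/-! ### The effect of the truncation -/

lemma abs_sub_le_of_abs_sq_sub {γ s s' t : ℝ} (hγ : 0 < γ) (hs : γ ≤ s) (hs' : γ ≤ s')
    (h : |s ^ 2 - s' ^ 2| ≤ t) : |s - s'| ≤ t / (2 * γ) := by
  rw [le_div_iff₀ (by positivity)]
  have e : |s ^ 2 - s' ^ 2| = |s - s'| * (s + s') := by
    rw [show s ^ 2 - s' ^ 2 = (s - s') * (s + s') by ring, abs_mul, abs_of_pos (by linarith : 0 < s + s')]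
  nlinarith [abs_nonneg (s - s')]

/-- The error of the scale is multiplied by the standardised value itself, whence the bound `D` on
the latter. -/
lemma abs_standardize_sub_le {γ s s' m m' t y D : ℝ} (hγ : 0 < γ) (hs : γ ≤ s) (hs' : γ ≤ s')
    (hm : |m - m'| ≤ t) (h : |s ^ 2 - s' ^ 2| ≤ t) (hD : |(y - m) / s| ≤ D) :
    |(y - m') / s' - (y - m) / s| ≤ t / γ + D * (t / (2 * γ ^ 2)) := by
  have h1 := abs_sub_le_of_abs_sq_sub hγ hs hs' h
  have hs0 : 0 < s := by linarith
  have hs0' : 0 < s' := by linarith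
  have ht : 0 ≤ t := (abs_nonneg _).trans hm
  have e : (y - m') / s' - (y - m) / s = (m - m') / s' + (y - m) / s * ((s - s') / s') := by
    field_simp; ring
  rw [e]
  refine (abs_add_le _ _).trans (add_le_add ?_ ?_)
  · rw [abs_div, abs_of_pos hs0']
    gcongr
  · rw [abs_mul]
    refine mul_le_mul hD ?_ (abs_nonneg _) ((abs_nonneg _).trans hD)
    rw [abs_div, abs_of_pos hs0']
    calc _ ≤ t / (2 * γ) / γ := by gcongr
      _ = _ := by field_simp

lemma LipKernel.abs_truncation_le {K : ℝ → ℝ} {k b γ s s' m m' σ σ' μ μ' t v y V D : ℝ}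
    (hK : LipKernel K k) (hb : 0 < b) (hb1 : b ≤ 1) (hγ : 0 < γ) (hs : γ ≤ s) (hs' : γ ≤ s')
    (hσ : γ ≤ σ) (hσ' : γ ≤ σ') (hm : |m - m'| ≤ t) (h : |s ^ 2 - s' ^ 2| ≤ t)
    (hμ : |μ - μ'| ≤ t) (h' : |σ ^ 2 - σ' ^ 2| ≤ t) (hv : |v| ≤ V) (hD : |m / s| ≤ D)
    (hD' : |(y - μ) / σ| ≤ D) :
    |1 / s' * scaledKernel K b ((v - m') / s' - (y - μ') / σ') -
      1 / s * scaledKernel K b ((v - m) / s - (y - μ) / σ)| ≤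
      k / b ^ 2 * (t * (1 / (2 * γ ^ 3) + 2 / γ ^ 2 + (V / γ + 2 * D) / (2 * γ ^ 3))) := by
  have hk := hK.one_le
  have hs0 : 0 < s := by linarith
  have hs0' : 0 < s' := by linarith
  have ht : 0 ≤ t := (abs_nonneg _).trans hm
  have hV : 0 ≤ V := (abs_nonneg _).trans hv
  have h1 := abs_sub_le_of_abs_sq_sub hγ hs hs' h
  have hw : |1 / s' - 1 / s| ≤ t / (2 * γ ^ 3) := by
    have e : 1 / s' - 1 / s = (s - s') / (s' * s) := by field_simp
    rw [e, abs_div, abs_of_pos (mul_pos hs0' hs0)]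
    calc _ ≤ t / (2 * γ) / (γ * γ) := by gcongr
      _ = _ := by field_simp
  have hvs : |(v - m) / s| ≤ V / γ + D := by
    rw [sub_div]
    refine (abs_sub _ _).trans (add_le_add ?_ hD)
    rw [abs_div, abs_of_pos hs0]
    gcongr
  have h2 := abs_standardize_sub_le hγ hs hs' hm h hvs
  have h3 := abs_standardize_sub_le hγ hσ hσ' hμ h' hD'
  have hws : |1 / s| ≤ 1 / γ := by
    rw [abs_of_pos (by positivity)]; exact one_div_le_one_div_of_le hγ hs
  refine (hK.abs_mul_scaled_sub_le hb hb1 _ _ _ _).trans ?_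
  refine mul_le_mul_of_nonneg_left ?_ (by positivity)
  have h4 : |(v - m') / s' - (y - μ') / σ' - ((v - m) / s - (y - μ) / σ)| ≤
      (t / γ + (V / γ + D) * (t / (2 * γ ^ 2))) + (t / γ + D * (t / (2 * γ ^ 2))) := by
    have e : (v - m') / s' - (y - μ') / σ' - ((v - m) / s - (y - μ) / σ) =
        ((v - m') / s' - (v - m) / s) - ((y - μ') / σ' - (y - μ) / σ) := by ring
    rw [e]
    exact (abs_sub _ _).trans (add_le_add h2 h3)
  calc _ ≤ t / (2 * γ ^ 3) + 1 / γ * ((t / γ + (V / γ + D) * (t / (2 * γ ^ 2))) +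
        (t / γ + D * (t / (2 * γ ^ 2)))) := by gcongr
    _ = _ := by field_simp; ring

/-- The number of initial times at which the truncation is not negligible. -/
noncomputable def burnIn (n : ℕ) : ℕ := ⌈(n : ℝ) ^ (1 / 12 : ℝ)⌉₊

/-- The bandwidth exceeds `n^(-1/3)`, so `√n b` is at least `n^(1/6)`, which dominates `n^(1/12)`.
-/
lemma tendsto_burnIn_div {b : ℕ → ℝ} {a : ℝ} (hb : Bandwidth b a) :
    Tendsto (fun n : ℕ => (burnIn n : ℝ) / (√(n : ℝ) * b n)) atTop (𝓝 0) := by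
  have h1 : Tendsto (fun n : ℕ => 2 * (n : ℝ) ^ (-(1 / 12 : ℝ))) atTop (𝓝 0) := by
    have := ((tendsto_rpow_neg_atTop (by norm_num : (0 : ℝ) < 1 / 12)).comp
      tendsto_natCast_atTop_atTop).const_mul 2
    rw [mul_zero] at this
    exact this
  refine squeeze_zero' (Eventually.of_forall fun n => ?_) ?_ h1
  · have := hb.pos n
    positivity
  filter_upwards [hb.rate, eventually_ge_atTop 1] with n hn hn1
  have hn1' : (1 : ℝ) ≤ n := by exact_mod_cast hn1
  have hn0 : (0 : ℝ) < n := by linarith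
  have hbm : 1 ≤ b n * (n : ℝ) ^ (1 / 3 : ℝ) := (Real.one_le_rpow hn1' hb.rate_pos.le).trans hn
  have h2 : (n : ℝ) ^ (1 / 6 : ℝ) ≤ √(n : ℝ) * b n := by
    have : √(n : ℝ) = (n : ℝ) ^ (1 / 6 : ℝ) * (n : ℝ) ^ (1 / 3 : ℝ) := by
      rw [Real.sqrt_eq_rpow, ← Real.rpow_add hn0]; norm_num
    rw [this, mul_assoc, mul_comm _ (b n)]
    exact le_mul_of_one_le_right (by positivity) hbm
  have h3 : (burnIn n : ℝ) ≤ 2 * (n : ℝ) ^ (1 / 12 : ℝ) := by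
    have := (Nat.ceil_lt_add_one (a := (n : ℝ) ^ (1 / 12 : ℝ)) (by positivity)).le
    have h4 : (1 : ℝ) ≤ (n : ℝ) ^ (1 / 12 : ℝ) := Real.one_le_rpow hn1' (by norm_num)
    rw [burnIn]; linarith
  calc _ ≤ 2 * (n : ℝ) ^ (1 / 12 : ℝ) / (n : ℝ) ^ (1 / 6 : ℝ) := by gcongr
    _ = _ := by rw [mul_div_assoc, ← Real.rpow_sub hn0]; norm_num

/-- The decay is exponential in a positive power of `n` and beats every polynomial. -/
lemma tendsto_burnIn_pow {a κ : ℝ} (ha : a ∈ Set.Ioo (0 : ℝ) 1) (m : ℕ) :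
    Tendsto (fun n : ℕ => κ * ((n : ℝ) ^ m * a ^ burnIn n)) atTop (𝓝 0) := by
  have hc : 0 < -Real.log a := by have := Real.log_neg ha.1 ha.2; linarith
  have h1 := tendsto_pow_mul_exp_neg_rpow (a := 1 / 12) (by norm_num) hc m
  have h2 : Tendsto (fun n : ℕ => (n : ℝ) ^ m * a ^ burnIn n) atTop (𝓝 0) := by
    refine squeeze_zero (fun n => mul_nonneg (by positivity) (pow_nonneg ha.1.le _)) (fun n => ?_) h1
    gcongr
    rw [← Real.exp_log (pow_pos ha.1 _), Real.log_pow]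
    refine Real.exp_le_exp.2 ?_
    have : (n : ℝ) ^ (1 / 12 : ℝ) ≤ burnIn n := Nat.le_ceil _
    nlinarith
  simpa using h2.const_mul κ

lemma le_of_supPow_lt {d : ℕ} {S : Set (Par d)} {s t : ℝ} (hs : 0 < s) (ht : 0 ≤ t) {g : Par d → ℝ}
    (h : supPow S s g < ENNReal.ofReal (t ^ s)) : ∀ θ ∈ S, |g θ| ≤ t := by
  intro θ hθ
  by_contra hcon
  refine absurd h (not_lt.2 ?_)
  refine le_trans ?_ (le_iSup₂_of_le θ hθ le_rfl)
  exact ENNReal.ofReal_le_ofReal (Real.rpow_le_rpow ht (not_le.1 hcon).le hs.le)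

namespace SeriesModel

variable {d : ℕ} {Ω : Type*} [MeasurableSpace Ω] {M : SeriesModel d Ω} {P : Measure Ω}
  [IsProbabilityMeasure P] {r γ γ' : ℝ} {A B E : (ℕ → ℝ) → ℝ} {K : ℝ → ℝ} {k C₀ c V α β : ℝ}
  {n : ℕ} {ω : Ω}

lemma avg_lt_le {n : ℕ} (ℓ : ℕ) : avg n (fun i => if i < ℓ then (1 : ℝ) else 0) ≤ ℓ / n := by
  rw [avg, div_eq_inv_mul]
  gcongr
  rw [← Finset.sum_filter, Finset.sum_const, nsmul_eq_mul, mul_one]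
  norm_cast
  refine (Finset.card_le_card (t := Finset.range ℓ) fun i hi => ?_).trans (by simp)
  rw [Finset.mem_filter] at hi
  exact Finset.mem_range.2 hi.2

/-- After the initial times, the truncation errors are smaller than `t`. -/
def TruncationBound (M : SeriesModel d Ω) (r t : ℝ) (n : ℕ) (ω : Ω) : Prop :=
  ∀ i ∈ Finset.Icc 1 n, burnIn n ≤ i → ∀ θ ∈ M.nhd r,
    |M.m i θ ω - M.mTr i θ ω| ≤ t ∧ |M.σ i θ ω ^ 2 - M.σTr i θ ω ^ 2| ≤ t

/-- Markov's inequality for the moments of order `s`, and a union bound over at most `n` times: the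
geometric decay at the end of the burn-in absorbs any power of `n`. -/
lemma likely_truncationBound {s a κ : ℝ} (hs : s ∈ Set.Ioo (0 : ℝ) 1) (ha : a ∈ Set.Ioo (0 : ℝ) 1)
    (hκ : 0 < κ) (h : ∀ i : ℕ, 1 ≤ i → ExpLE P (fun ω =>
      supPow (M.nhd r) s (fun θ => M.m i θ ω - M.mTr i θ ω) +
      supPow (M.nhd r) s (fun θ => M.σ i θ ω ^ 2 - M.σTr i θ ω ^ 2)) (ENNReal.ofReal (κ * a ^ i)))
    (m : ℕ) : Likely P (fun n ω => M.TruncationBound r (1 / (n : ℝ) ^ m) n ω) := by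
  have hu : Tendsto (fun n : ℕ => ENNReal.ofReal (κ * ((n : ℝ) ^ (m + 1) * a ^ burnIn n))) atTop
      (𝓝 0) := by
    have := (ENNReal.continuous_ofReal.tendsto _).comp (tendsto_burnIn_pow (κ := κ) ha (m + 1))
    rw [ENNReal.ofReal_zero] at this
    exact this
  intro κ' hκ'
  refine WHP.of_le hκ' ?_ hu
  filter_upwards [eventually_ge_atTop 1] with n hn
  have hn1 : (1 : ℝ) ≤ n := by exact_mod_cast hn
  have hn0 : (0 : ℝ) < n := by linarith
  set t := 1 / (n : ℝ) ^ m with ht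
  have ht0 : 0 < t := by positivity
  have ht1 : t ≤ 1 := by rw [ht, div_le_one (by positivity)]; exact one_le_pow₀ hn1
  -- As `t ≤ 1` and `s < 1`, the exponent `s` may be dropped, at the price of a larger power of `n`.
  have hts : t ≤ t ^ s := by
    conv_lhs => rw [← Real.rpow_one t]
    exact Real.rpow_le_rpow_of_exponent_ge ht0 ht1 hs.2.le
  set S := (Finset.Icc 1 n).filter fun i => burnIn n ≤ i with hS
  set bad : ℕ → Set Ω := fun i => {ω | ENNReal.ofReal (t ^ s) ≤
    supPow (M.nhd r) s (fun θ => M.m i θ ω - M.mTr i θ ω) +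
      supPow (M.nhd r) s (fun θ => M.σ i θ ω ^ 2 - M.σTr i θ ω ^ 2)} with hbad
  have hbadle : ∀ i ∈ S, P (bad i) ≤ ENNReal.ofReal (κ * ((n : ℝ) ^ m * a ^ burnIn n)) := by
    intro i hi
    rw [hS, Finset.mem_filter, Finset.mem_Icc] at hi
    obtain ⟨h1, h2⟩ := h i hi.1.1
    have hpos : ENNReal.ofReal (t ^ s) ≠ 0 := (ENNReal.ofReal_pos.2 (by positivity)).ne'
    refine (meas_ge_le_lintegral_div h1 hpos ENNReal.ofReal_ne_top).trans ?_
    refine (ENNReal.div_le_div_right h2 _).trans ?_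
    rw [← ENNReal.ofReal_div_of_pos (by positivity)]
    refine ENNReal.ofReal_le_ofReal ?_
    have hai : a ^ i ≤ a ^ burnIn n := pow_le_pow_of_le_one ha.1.le ha.2.le hi.2
    have hab : 0 ≤ a ^ burnIn n := pow_nonneg ha.1.le _
    calc κ * a ^ i / t ^ s ≤ κ * a ^ burnIn n / t := by gcongr
      _ = _ := by rw [ht]; field_simp
  calc P {ω | ¬ M.TruncationBound r t n ω} ≤ P (⋃ i ∈ S, bad i) := by
        refine measure_mono fun ω hω => ?_
        rw [Set.mem_ofPred_eq] at hω
        by_contra hcon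
        refine hω fun i hi hbi θ hθ => ?_
        have hi' : ω ∉ bad i := fun hmem => hcon (Set.mem_biUnion (Finset.mem_filter.2 ⟨hi, hbi⟩) hmem)
        rw [hbad] at hi'
        simp only [Set.mem_ofPred_eq, not_le] at hi'
        exact ⟨le_of_supPow_lt hs.1 ht0.le (lt_of_le_of_lt le_self_add hi') θ hθ,
          le_of_supPow_lt hs.1 ht0.le (lt_of_le_of_lt le_add_self hi') θ hθ⟩
    _ ≤ ∑ i ∈ S, P (bad i) := measure_biUnion_finset_le _ _
    _ ≤ ∑ _i ∈ S, ENNReal.ofReal (κ * ((n : ℝ) ^ m * a ^ burnIn n)) := Finset.sum_le_sum hbadle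
    _ = (S.card : ℝ≥0∞) * ENNReal.ofReal (κ * ((n : ℝ) ^ m * a ^ burnIn n)) := by
        rw [Finset.sum_const, nsmul_eq_mul]
    _ ≤ (n : ℝ≥0∞) * ENNReal.ofReal (κ * ((n : ℝ) ^ m * a ^ burnIn n)) := by
        gcongr
        exact (Finset.card_filter_le _ _).trans (by simp)
    _ = _ := by
        rw [← ENNReal.ofReal_natCast, ← ENNReal.ofReal_mul (Nat.cast_nonneg _)]
        congr 1; ring

lemma fHat_eq_avg (b v : ℝ) (θ : Par d) : M.fHat K b n θ v ω =
    avg n fun i => avg n fun j => 1 / M.σTr i θ ω *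
      scaledKernel K b (M.LTr v i θ ω - M.residTr j θ ω) := by
  simp only [fHat, avg, ← Finset.mul_sum]
  rw [← mul_assoc]
  congr 1
  rw [sq, one_div, mul_inv]

set_option maxHeartbeats 1000000 in
-- Pairs with an index in the burn-in are a fraction of at most `2 burnIn / n` of all pairs, and
-- each costs at most a multiple of `1/b`. For the other pairs the truncation errors are at most
-- `n^(-6)`, and crude polynomial Lipschitz bounds suffice.
lemma likely_fHat_sub_kernelAvg (hM : M.IsLocationScale P) (hE : M.Envelopes P r γ A B E)
    (hK : LipKernel K k) (hr : 0 < r) {b : ℕ → ℝ} {a : ℝ} (hb : Bandwidth b a)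
    (hγ' : 0 < γ') (hlow : ∀ i : ℕ, 1 ≤ i → ∀ᵐ ω ∂P, ∀ θ ∈ M.Θ, γ' ≤ M.σTr i θ ω)
    (htr : Likely P (fun n ω => M.TruncationBound r (1 / (n : ℝ) ^ 6) n ω)) {τ : ℝ}
    (hτ : 0 < τ) (α β : ℝ) :
    Likely P (fun n ω => ∀ θ ∈ M.nhd r, √(n : ℝ) * ‖θ - M.θ₀‖ ≤ C₀ → ∀ v ∈ Set.Icc α β,
      √(n : ℝ) * |M.fHat K (b n) n θ v ω - M.kernelAvg K (b n) n v θ ω| ≤ τ) := by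
  have h0 := θ₀_mem_nhd hM hr
  have hk := hK.one_le
  set V := max |α| |β| with hV
  have hV0 : 0 ≤ V := (abs_nonneg α).trans (le_max_left _ _)
  have hvV : ∀ v ∈ Set.Icc α β, |v| ≤ V := fun v hv => abs_le_max_abs_abs hv.1 hv.2
  set g := min γ γ' with hg
  have hg0 : 0 < g := lt_min hE.γ_pos hγ'
  refine Likely.of_whp_imp (C := fun c => M.MomentBound A B E c)
    (fun κ hκ => exists_momentBound hM hE hκ) fun c => ?_
  set Z := 1 / (2 * g ^ 3) + 2 / g ^ 2 + (V / g + 2 * (2 * (|c| + 1))) / (2 * g ^ 3) with hZ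
  have hZ0 : 0 ≤ Z := by positivity
  have ev1 : ∀ᶠ n : ℕ in atTop, 2 * k / g * (burnIn n / (√(n : ℝ) * b n)) ≤ τ / 2 := by
    have := (tendsto_burnIn_div hb).const_mul (2 * k / g)
    rw [mul_zero] at this
    exact this.eventually_le_const (half_pos hτ)
  have ev2 : ∀ᶠ n : ℕ in atTop, (|c| + 1) * C₀ * ((n : ℝ) ^ (1 / 3 : ℝ) / √(n : ℝ)) ≤ 1 / 2 := by
    have := tendsto_rpow_third_div_sqrt.const_mul ((|c| + 1) * C₀)
    rw [mul_zero] at this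
    exact this.eventually_le_const (by norm_num)
  have ev3 : ∀ᶠ n : ℕ in atTop, k * Z / (τ / 2) ≤ (n : ℝ) :=
    tendsto_natCast_atTop_atTop.eventually_ge_atTop _
  refine htr.mono ?_
  filter_upwards [hb.rate, hb.tendsto.eventually_le_const one_pos, ev1, ev2, ev3,
    eventually_ge_atTop 1] with n hrn hb1 hn1 hn2 hn3 hn
  have hlow' : ∀ᵐ ω ∂P, ∀ i : ℕ, 1 ≤ i → ∀ θ ∈ M.Θ, γ' ≤ M.σTr i θ ω :=
    ae_all_iff.2 fun i => by
      by_cases hi : 1 ≤ i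
      · filter_upwards [hlow i hi] with ω hω _ using hω
      · exact Eventually.of_forall fun ω h => absurd h hi
  filter_upwards [ae_all_iff.2 hE.regular, ae_all_iff.2 (resid_ae_eq hM hE), hlow'] with ω hω hres hl
    ht hc θ hθ hθC v hv
  have hθΘ := nhd_subset hθ
  have hn1' : (1 : ℝ) ≤ n := by exact_mod_cast hn
  have hn0 : (0 : ℝ) < n := by linarith
  have hsq : (0 : ℝ) < √(n : ℝ) := Real.sqrt_pos.2 hn0
  have hbn := hb.pos n
  set m := (n : ℝ) ^ (1 / 3 : ℝ) with hm
  have hm1 : 1 ≤ m := one_le_rpow_third hn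
  have hm3 : m ^ 3 = n := rpow_third_pow
  have hbm : 1 ≤ b n * m := (Real.one_le_rpow hn1' hb.rate_pos.le).trans hrn
  have hTn : (|c| + 1) * m * C₀ ≤ 1 / 2 * √(n : ℝ) := by
    rw [← mul_div_assoc, div_le_iff₀ hsq] at hn2
    linarith
  have hσ : ∀ i : ℤ, g ≤ M.σ i θ ω := fun i => (min_le_left _ _).trans ((hω i).lower θ hθΘ)
  have hσ' : ∀ i ∈ Finset.Icc 1 n, g ≤ M.σTr i θ ω := fun i hi =>
    (min_le_right _ _).trans (hl i (Finset.mem_Icc.1 hi).1 θ hθΘ)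
  -- A bound for `m/σ` and for the residuals at all sample times: a single term is at most `n` times
  -- the average, and dividing by `s ≥ 1/2` doubles it.
  set D := 2 * (|c| + 1) * (n : ℝ) with hD
  have hc0 := abs_nonneg c
  have hq : ∀ i ∈ Finset.Icc 1 n, |M.m i θ ω / M.σ i θ ω| ≤ D := by
    intro i hi
    have h1 : |M.m i θ ω / M.σ i θ ω| ≤ E (M.pastX i ω) := (hω i).abs_qF hE.γ_pos hθ
    have h2 := le_of_avg_le (fun i _ => sq_nonneg (env A B E (M.pastX i ω))) hc.1 hi
    have h3 := (hE.E_le_env (M.pastX i ω)).trans (hE.le_env_sq (M.pastX i ω))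
    refine h1.trans (h3.trans (h2.trans ?_))
    rw [hD]; gcongr; linarith [le_abs_self c]
  have hR : ∀ j ∈ Finset.Icc 1 n, |M.resid j θ ω| ≤ D := by
    intro j hj
    have h1 := le_of_avg_le (fun i _ => abs_nonneg (M.noise i ω)) hc.2.1 hj
    obtain ⟨⟨⟨-, h3⟩, -⟩, h4⟩ := (hω j).mem_controlled hE h0 hn hθ hθC (hc.envR_le hE j hj) hTn
    have hs0 : 0 < M.sF θ (M.pastX j ω) := by linarith
    rw [hres j θ hθΘ, abs_div, abs_of_pos hs0, div_le_iff₀ hs0]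
    have h5 : |M.noise j ω - M.eF θ (M.pastX j ω)| ≤ (|c| + 1) * n := by
      refine (abs_sub _ _).trans ?_
      nlinarith [le_abs_self c]
    have h6 : D * (1 / 2) ≤ D * M.sF θ (M.pastX j ω) := by gcongr
    have : D * (1 / 2) = (|c| + 1) * n := by rw [hD]; ring
    linarith
  have e1 : ∀ i : ℤ, M.LF v θ (M.pastX i ω) = (v - M.m i θ ω) / M.σ i θ ω := fun i => by
    simp only [LF, wF, qF]
    rw [sub_div, mul_one_div]; rfl
  have e2 : M.kernelAvg K (b n) n v θ ω = avg n fun i => avg n fun j => 1 / M.σ i θ ω *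
      scaledKernel K (b n) ((v - M.m i θ ω) / M.σ i θ ω - M.resid j θ ω) := by
    rw [kernelAvg]
    congr 1; funext i; congr 1; funext j
    rw [e1, hres j θ hθΘ]; rfl
  set t := 1 / (n : ℝ) ^ 6 with htdef
  set Y := k / b n ^ 2 * (t * (1 / (2 * g ^ 3) + 2 / g ^ 2 + (V / g + 2 * D) / (2 * g ^ 3))) with hY
  have hY0 : 0 ≤ Y := by positivity
  have hpair : ∀ i ∈ Finset.Icc 1 n, ∀ j ∈ Finset.Icc 1 n,
      |1 / M.σTr i θ ω * scaledKernel K (b n) (M.LTr v i θ ω - M.residTr j θ ω) -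
        1 / M.σ i θ ω * scaledKernel K (b n) ((v - M.m i θ ω) / M.σ i θ ω - M.resid j θ ω)| ≤
      k / (g * b n) * (if i < burnIn n then 1 else 0) +
        k / (g * b n) * (if j < burnIn n then 1 else 0) + Y := by
    intro i hi j hj
    have hcr : ∀ s u : ℝ, g ≤ s → 1 / s * scaledKernel K (b n) u ∈ Set.Icc 0 (k / (g * b n)) := by
      intro s u hs
      have hs0 : 0 < s := by linarith
      have := hK.scaled_nonneg hbn u
      refine ⟨by positivity, ?_⟩
      calc _ ≤ 1 / g * (k / b n) := by gcongr; exact hK.scaled_le hbn u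
        _ = _ := by field_simp
    have c1 := hcr _ (M.LTr v i θ ω - M.residTr j θ ω) (hσ' i hi)
    have c2 := hcr _ ((v - M.m i θ ω) / M.σ i θ ω - M.resid j θ ω) (hσ i)
    have hcrude : |1 / M.σTr i θ ω * scaledKernel K (b n) (M.LTr v i θ ω - M.residTr j θ ω) -
        1 / M.σ i θ ω * scaledKernel K (b n) ((v - M.m i θ ω) / M.σ i θ ω - M.resid j θ ω)| ≤
        k / (g * b n) := by
      rw [abs_le]; constructor <;> linarith [c1.1, c1.2, c2.1, c2.2]
    have hkg : 0 ≤ k / (g * b n) := by positivity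
    by_cases h1 : i < burnIn n
    · rw [if_pos h1, mul_one]
      have : 0 ≤ k / (g * b n) * (if j < burnIn n then 1 else 0) :=
        mul_nonneg hkg (by split_ifs <;> norm_num)
      linarith
    · by_cases h2 : j < burnIn n
      · rw [if_pos h2, if_neg h1, mul_one, mul_zero]
        linarith
      · rw [if_neg h1, if_neg h2, mul_zero, zero_add, zero_add]
        obtain ⟨t1, t2⟩ := ht i hi (not_lt.1 h1) θ hθ
        obtain ⟨t3, t4⟩ := ht j hj (not_lt.1 h2) θ hθ
        exact hK.abs_truncation_le hbn hb1 hg0 (hσ i) (hσ' i hi) (hσ j) (hσ' j hj) t1 t2 t3 t4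
          (hvV v hv) (hq i hi) (hR j hj)
  have hmain : |M.fHat K (b n) n θ v ω - M.kernelAvg K (b n) n v θ ω| ≤
      2 * (k / (g * b n) * (burnIn n / n)) + Y := by
    rw [fHat_eq_avg, e2]
    refine (abs_avg_avg_sub_le hpair).trans ?_
    simp only [avg_add, avg_mul_left, avg_const hn]
    have h1 := avg_lt_le (n := n) (burnIn n)
    have h2 : k / (g * b n) * avg n (fun i => if i < burnIn n then (1 : ℝ) else 0) ≤
      k / (g * b n) * (burnIn n / n) := by gcongr
    linarith
  -- Powers of `n`: `√n` gives one at most, `1/b²` one, and the bound `D` one, against six in `t`.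
  have hY1 : √(n : ℝ) * Y ≤ τ / 2 := by
    have hb2 : 1 / b n ^ 2 ≤ n := by
      rw [div_le_iff₀ (by positivity)]
      have : 1 ≤ (b n * m) ^ 2 := one_le_pow₀ hbm
      have h3 : m ^ 2 ≤ n := by rw [← hm3]; exact pow_le_pow_right₀ hm1 (by norm_num)
      calc 1 ≤ (b n * m) ^ 2 := this
        _ = m ^ 2 * b n ^ 2 := by ring
        _ ≤ _ := by gcongr
    have hZn : 1 / (2 * g ^ 3) + 2 / g ^ 2 + (V / g + 2 * D) / (2 * g ^ 3) ≤ Z * n := by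
      have e3 : Z * n = 1 / (2 * g ^ 3) * n + 2 / g ^ 2 * n + (V / g * n + 2 * D) / (2 * g ^ 3) := by
        rw [hZ, hD]; ring
      rw [e3]
      have q : ∀ y : ℝ, 0 ≤ y → y ≤ y * n := fun y hy => le_mul_of_one_le_right hy hn1'
      gcongr
      · exact q _ (by positivity)
      · exact q _ (by positivity)
      · exact q _ (by positivity)
    have hsn : √(n : ℝ) ≤ n := by rw [Real.sqrt_le_left hn0.le]; nlinarith
    calc √(n : ℝ) * Y = √(n : ℝ) * (k * (1 / b n ^ 2) * (t *
          (1 / (2 * g ^ 3) + 2 / g ^ 2 + (V / g + 2 * D) / (2 * g ^ 3)))) := by rw [hY]; ring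
      _ ≤ n * (k * n * (t * (Z * n))) := by gcongr
      _ = k * Z * (1 / (n : ℝ) ^ 3) := by rw [htdef]; field_simp
      _ ≤ k * Z * (1 / n) := by
          gcongr
          exact le_self_pow₀ hn1' (by norm_num)
      _ ≤ τ / 2 := by
          rw [div_le_iff₀ (by positivity)] at hn3
          rw [mul_one_div, div_le_iff₀ hn0]; linarith
  calc _ ≤ √(n : ℝ) * (2 * (k / (g * b n) * (burnIn n / n)) + Y) := by gcongr
    _ = 2 * k / g * (burnIn n / (√(n : ℝ) * b n)) + √(n : ℝ) * Y := by
        have : √(n : ℝ) * (2 * (k / (g * b n) * (burnIn n / n))) =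
            2 * k / g * (burnIn n / (√(n : ℝ) * b n)) := by
          have h2 : (n : ℝ) = √(n : ℝ) * √(n : ℝ) := (Real.mul_self_sqrt hn0.le).symm
          have h3 : (burnIn n : ℝ) / n = burnIn n / (√(n : ℝ) * √(n : ℝ)) := by rw [← h2]
          rw [h3]; field_simp
        rw [mul_add, this]
    _ ≤ τ := by linarith

end SeriesModel

/-! ### Conclusion -/

namespace SeriesModel

variable {d : ℕ} {Ω : Type*} [MeasurableSpace Ω] {M : SeriesModel d Ω} {P : Measure Ω}
  [IsProbabilityMeasure P] {r γ : ℝ} {A B E : (ℕ → ℝ) → ℝ} {K : ℝ → ℝ} {k F : ℝ} {f : ℝ → ℝ}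
  {Fw Fq Fs Fe : Fin d → (ℕ → ℝ) → ℝ}

/-- The expansion of the estimator, uniformly over the parameters at distance `O(1/√n)` of `θ₀`. -/
lemma likely_fHat (hM : M.IsLocationScale P) (hE : M.Envelopes P r γ A B E)
    (hp : M.Partials P r γ A B E Fw Fq Fs Fe) (h2 : M.A2 P r) (h5 : M.A5 P f) (hf : SmoothBdd f F)
    (hK : LipKernel K k) (hr : 0 < r) {b : ℕ → ℝ} {a : ℝ} (hb : Bandwidth b a) {C₀ : ℝ}
    (hC₀ : 0 ≤ C₀) {τ : ℝ} (hτ : 0 < τ) (α β : ℝ) :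
    Likely P (fun n ω => ∀ θ ∈ M.nhd r, √(n : ℝ) * ‖θ - M.θ₀‖ ≤ C₀ → ∀ v ∈ Set.Icc α β,
      √(n : ℝ) * |M.fHat K (b n) n θ v ω - M.fCheck K (b n) n v ω -
        coordForm (M.slope P f Fw Fq Fs Fe v) (θ - M.θ₀)| ≤ τ) := by
  obtain ⟨γ', s, a', κ, hγ', hs, ha, hκ, -, hlow, -, -, htr⟩ := h2
  have e1 := likely_kernelAvg hM hE hp h5 hf hK hr hb hC₀ (half_pos hτ) α β
  have e2 := likely_fHat_sub_kernelAvg (C₀ := C₀) hM hE hK hr hb hγ' hlow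
    (likely_truncationBound hs ha hκ htr 6) (half_pos hτ) α β
  refine (e1.and e2).mono (Eventually.of_forall fun n => Eventually.of_forall ?_)
  rintro ω ⟨h1, h2⟩ θ hθ hC v hv
  have t1 := h1 θ hθ hC v hv
  have t2 := h2 θ hθ hC v hv
  calc _ ≤ √(n : ℝ) * (|M.fHat K (b n) n θ v ω - M.kernelAvg K (b n) n v θ ω| +
          |M.kernelAvg K (b n) n v θ ω - M.fCheck K (b n) n v ω -
            coordForm (M.slope P f Fw Fq Fs Fe v) (θ - M.θ₀)|) := by
        gcongr
        refine le_trans (le_of_eq ?_) (abs_add_le _ _)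
        congr 1; ring
    _ ≤ τ := by rw [mul_add]; linarith

lemma A4.whp_le {θhat : ℕ → Ω → Par d} (h4 : M.A4 P θhat) {κ : ℝ≥0∞} (hκ : κ ≠ 0) :
    ∃ C, WHP P κ (fun n ω => √(n : ℝ) * ‖θhat n ω - M.θ₀‖ ≤ C) := by
  -- The minimum guards against `κ = ∞`, whose real value would be `0`.
  have hκ' : 0 < (min κ 1).toReal :=
    ENNReal.toReal_pos (by simp [hκ]) (ne_top_of_le_ne_top ENNReal.one_ne_top (min_le_right _ _))
  obtain ⟨C, hC⟩ := h4.rate _ hκ'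
  refine ⟨C, hC.mono fun n hn => ?_⟩
  rw [ENNReal.ofReal_toReal (ne_top_of_le_ne_top ENNReal.one_ne_top (min_le_right _ _))] at hn
  simp only [not_le]
  exact hn.trans (min_le_left _ _)

lemma A4.eventually_mem_nhd {θhat : ℕ → Ω → Par d} (h4 : M.A4 P θhat) (hr : 0 < r) (C : ℝ) :
    ∀ᶠ n : ℕ in atTop, ∀ ω, √(n : ℝ) * ‖θhat n ω - M.θ₀‖ ≤ C → θhat n ω ∈ M.nhd r := by
  have h : Tendsto (fun n : ℕ => √(n : ℝ)) atTop atTop :=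
    Real.tendsto_sqrt_atTop.comp tendsto_natCast_atTop_atTop
  filter_upwards [h.eventually_gt_atTop (C / r), eventually_ge_atTop 1] with n hn hn1 ω hω
  have hsq : (0 : ℝ) < √(n : ℝ) := Real.sqrt_pos.2 (by exact_mod_cast hn1)
  refine ⟨h4.mem n ω, ?_⟩
  rw [Metric.mem_ball, dist_eq_norm]
  rw [div_lt_iff₀ hr] at hn
  exact lt_of_mul_lt_mul_left (hω.trans_lt hn) hsq.le

end SeriesModel

lemma ofReal_mul_iSup_le {ι : Type*} {S : Set ι} {x η : ℝ} {g : ι → ℝ} (hx : 0 ≤ x)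
    (h : ∀ v ∈ S, x * |g v| ≤ η) :
    ENNReal.ofReal x * ⨆ v ∈ S, ENNReal.ofReal |g v| ≤ ENNReal.ofReal η := by
  simp only [ENNReal.mul_iSup]
  refine iSup₂_le fun v hv => ?_
  rw [← ENNReal.ofReal_mul hx]
  exact ENNReal.ofReal_le_ofReal (h v hv)

theorem theorem2 {d : ℕ} {Ω : Type*} [MeasurableSpace Ω] (P : Measure Ω) [IsProbabilityMeasure P]
    (M : SeriesModel d Ω) (hM : M.IsLocationScale P)
    (K : ℝ → ℝ) (hK : IsKernel K)
    (b : ℕ → ℝ) (hb : ∀ n, 0 < b n)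
    (hb_low : ∃ δ ∈ Set.Ioo (0 : ℝ) 1, Tendsto (fun n : ℕ => (n : ℝ) * b n ^ (3 + δ)) atTop atTop)
    (hb_up : Tendsto (fun n : ℕ => (n : ℝ) * b n ^ 4) atTop (𝓝 0))
    (r : ℝ) (hr : 0 < r) (h1 : M.A1 r) (h2 : M.A2 P r) (h3 : M.A3 P r)
    (θhat : ℕ → Ω → Par d) (h4 : M.A4 P θhat)
    (fε : ℝ → ℝ) (h5 : M.A5 P fε)
    (α β : ℝ) (hαβ : α ≤ β) (h6 : M.A6 P fε α β) :
    (∀ θ ∈ M.nhd r, IsContDensity (P.map (M.resid 0 θ)) (M.residDensity P θ)) ∧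
    (∀ v ∈ Set.Icc α β, DifferentiableWithinAt ℝ (fun θ => M.h P θ v) M.Θ M.θ₀) ∧
    (∀ η : ℝ, 0 < η →
      Tendsto (fun n : ℕ => P {ω | ENNReal.ofReal η <
        ENNReal.ofReal √(n : ℝ) * ⨆ v ∈ Set.Icc α β, ENNReal.ofReal
          |M.fHat K (b n) n (θhat n ω) v ω - M.fCheck K (b n) n v ω
            - fderivWithin ℝ (fun θ => M.h P θ v) M.Θ M.θ₀ (θhat n ω - M.θ₀)|})
        atTop (𝓝 0)) := by
  obtain ⟨γ, A, B, E, hE⟩ := SeriesModel.exists_envelopes hM hr h1 h2 h3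
  obtain ⟨Fw, Fq, Fs, Fe, hp⟩ := SeriesModel.exists_partials hM hE hr h1
  obtain ⟨F, hf⟩ := h5.exists_smoothBdd
  obtain ⟨k, hk⟩ := hK.exists_lipKernel
  obtain ⟨a, ha⟩ := exists_bandwidth hb hb_low hb_up
  have hd := fun v => SeriesModel.hasFDerivWithinAt_h hM hE hp h5 hf hr v
  refine ⟨fun θ hθ => SeriesModel.isContDensity_residDensity hM hE hr h5 hθ,
    fun v _ => (hd v).differentiableWithinAt, fun η hη => ?_⟩
  -- Near `θ₀` the set `Θ` is convex with nonempty interior, so derivatives over it are unique and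
  -- the one in the statement is the explicit form.
  simp only [fun v => (hd v).fderivWithin (SeriesModel.uniqueDiffWithinAt_θ₀ hM hr h1)]
  have hmain : Likely P (fun n ω => ∀ v ∈ Set.Icc α β, √(n : ℝ) *
      |M.fHat K (b n) n (θhat n ω) v ω - M.fCheck K (b n) n v ω -
        coordForm (M.slope P fε Fw Fq Fs Fe v) (θhat n ω - M.θ₀)| ≤ η) := by
    -- The expansion holds simultaneously for all `θ` with `√n ‖θ - θ₀‖ ≤ max C 0`, so `θhat` may be
    -- inserted for each `ω`, however it depends on the sample.
    refine Likely.of_whp_imp (fun κ hκ => h4.whp_le hκ) fun C => ?_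
    refine (SeriesModel.likely_fHat hM hE hp h2 h5 hf hk hr ha (le_max_right C 0) hη α β).mono ?_
    filter_upwards [h4.eventually_mem_nhd hr C] with n hn
    exact Eventually.of_forall fun ω hω hC => hω _ (hn ω hC) (hC.trans (le_max_left _ _))
  refine ENNReal.tendsto_nhds_zero.2 fun κ hκ => Eventually.mono (hmain κ hκ.ne') fun n hn => ?_
  refine (measure_mono fun ω hω hcon => ?_).trans hn
  exact absurd hω (not_lt.2 (ofReal_mul_iSup_le (Real.sqrt_nonneg _) hcon))
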